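/- **Problem.** Let $M\ge 1$ and dimensions $d_0=d_x,d_1,\dots,d_M$ be fixed. For $K$ agents with local functions $f^k:\mathbb R^{d_0}\times\mathbb R^{d_M}\to\mathbb R$ and $g_m^k:\mathbb R^{d_{m-1}}\times\mathbb R^{d_m}\to\mathbb R$ put $f=\frac1K\sum_k f^k$, $g_m=\frac1K\sum_k g_m^k$, $y_0^\star(x)=x$, $y_m^\star(x)=\arg\min_{y}g_m(y_{m-1}^\star(x),y)$, $F(x)=f(x,y_M^\star(x))$, $F^*=\min F$. Subscripts $1,2$ denote partial derivatives in the first and second argument, $\|\cdot\|$ the Euclidean or spectral norm, $\|\cdot\|_F$ the Frobenius norm. **Assumptions.** Let $C_f,L_f,\mu$ and, for $m=1,\dots,M$, $C_{g,m},L_{g,m},\tilde L_{g,m},\mu_{g,m},\kappa_{g,m}$ be positive constants with $\kappa_{g,m}\le\mu_{g,m}/L_{g,m}\le1$. (a) *Oracle.* Agent $k$ obtains, at any query point, independent samples of unbiased stochastic versions of $\nabla_1f^k,\nabla_2f^k$ (sample $\zeta^k$) and of $\nabla_2g_m^k,\nabla^2_{12}g_m^k,\nabla^2_{22}g_m^k$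 (sample $\xi_m^k$); samples of different queries, rounds, levels and agents are independent. (b) *Gossip.* $W=(w_{k,j})$ is a symmetric, nonnegative, doubly stochastic $K\times K$ matrix with $\|W-\frac1K\mathbf 1\mathbf 1^\top\|^2=\rho\in(0,1)$. (c) *Outer functions.* $F$ has a minimizer; $f^k$ is differentiable; $\nabla_1f^k,\nabla_2f^k$ are $L_f$-Lipschitz, i.e. change by at most $L_f(\|x-x'\|+\|y-y'\|)$; $\mathbb E\|\nabla_1f^k(x,y;\zeta^k)\|^2\le C_f^2$ and $\mathbb E\|\nabla_2f^k(x,y;\zeta^k)\|^2\le C_f^2$ for $(x,y)\in D_0\times D_M$. (d) *Inner functions.* $g_m(y',\cdot)$ is $\mu_{g,m}$-strongly convex for all $y'$; $g_m^k$ is $C^2$; in the same sense $\nabla_2g_m^k$ is $L_{g,m}$-Lipschitz, and $\nabla_{12}^2g_m^k,\nabla^2_{22}g_m^k$ are $\tilde L_{g,m}$-Lipschitz in $\|\cdot\|_F$; $\mathbb E\|\nabla_2g_m^k(y',y;\xi_m^k)\|^2\le C_{g,m}^2$ for $(y',y)\in D_{m-1}\times D_m$; for all $(y',y)$, $\mathbb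 E\|\nabla^2_{22}g_m^k(y',y;\xi_m^k)\|^2\le L_{g,m}^2$, $\mathbb E\|\nabla^2_{12}g_m^k(y',y;\xi_m^k)\|^2\le L_{g,m}^2$ and $\mathbb E\|\mathbf I-\frac1{L_{g,m}}\nabla^2_{22}g_m^k(y',y;\xi_m^k)\|^2\le(1-\kappa_{g,m})^2$. Here $D_m\subseteq\mathbb R^{d_m}$ ($0\le m\le M$) are convex sets with $y_m^\star(D_0)\subseteq D_m$ such that the iterates below almost surely satisfy $x_t^k\in D_0$ and $y_{m,t}^k\in D_m$ for all $k$ and all $t\le T$, for every horizon $T\ge2$ (for instance $D_m=\mathbb R^{d_m}$). (e) *$\mu$-PL.* $2\mu(F(x)-F^*)\le\|\nabla F(x)\|^2$ for all $x$. **Algorithm.** Given $T$, start from $x_0^k=0$, $y_{m,0}^k=0$, $s_0^k=0$, $h_0^k=0$, $u_{m,0}^k=0$, $q_{m,0}^k=0$, $v_{m,0,i}^k=\mu_{g,m}\mathbf I$, write $y_{0,t}^k=x_t^k$, and for $t=0,\dots,T-1$ and every agent $k$ and level $m$ set $$x_{t+1}^k=\sum_jw_{k,j}x_t^j-\alpha_t\bigl(s_t^k+(-1)^Mu_{1,t}^kq_{1,t}^k\cdots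 u_{M,t}^kq_{M,t}^kh_t^k\bigr),$$ $$s_{t+1}^k=(1-\beta_t)\sum_jw_{k,j}s_t^j+\beta_t\nabla_1f^k(x_t^k,y_{M,t}^k;\zeta_t^k),\qquad h_{t+1}^k=(1-\beta_t)\sum_jw_{k,j}h_t^j+\beta_t\nabla_2f^k(x_t^k,y_{M,t}^k;\zeta_t^k),$$ $$y_{m,t+1}^k=\sum_jw_{k,j}y_{m,t}^j-\gamma_t\nabla_2g_m^k(y_{m-1,t}^k,y_{m,t}^k;\xi_{m,t}^k),\qquad u_{m,t+1}^k=(1-\beta_t)\sum_jw_{k,j}u_{m,t}^j+\beta_t\nabla_{12}^2g_m^k(y_{m-1,t}^k,y_{m,t}^k;\xi_{m,t}^k),$$ $$v_{m,t+1,i}^k=(1-\beta_t)\sum_jw_{k,j}v_{m,t,i}^j+\beta_t\nabla_{22}^2g_m^k(y_{m-1,t}^k,y_{m,t}^k;\xi_{m,t,i}^k)\quad(1\le i\le b_m),$$ and $q_{m,t+1}^k=\frac1{L_{g,m}}Q_{b_m}$, where $Q_0=\mathbf I$ and $Q_i=\mathbf I+(\mathbf I-\frac1{L_{g,m}}v_{m,t+1,i}^k)Q_{i-1}$.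 The parameters are $\alpha_t=\frac2{\mu(C_1+t)}$, $\beta_t=\gamma_t=\frac{C_1}{C_1+t}$ and $b_m=b_m(T)=\Theta(\log T)$ in the sense that $3\log_{1/(1-\kappa_{g,m})}T\le b_m(T)\le B\log T$ for $T\ge2$ with a constant $B$ (the lower bound is $0$ if $\kappa_{g,m}=1$). Put $\bar x_T=\frac1K\sum_kx_T^k$. **Theorem.** For every sufficiently large $C_1$ (how large depends only on $M$, the dimensions, $B$ and the constants above) there are constants $A,A',A''>0$, depending only on the same quantities and on $C_1$ — in particular not on $K$, $\rho$, $W$, $T$ or $\varepsilon$ — such that for all problems as above and all $T\ge2$, $F(\bar x_T)$ is integrable and $$\mathbb E[F(\bar x_T)]-F^*\le\frac{A}{KT}+\frac{A\ln T}{T^2(1-\rho)^2}.$$ Moreover, for all $K$ and $\rho$ there is $\varepsilon_0\in(0,1)$, depending only on $K$, $\rho$ and the above constants, such that for $0<\varepsilon\le\varepsilon_0$: every $T\ge\frac{A'}{K\varepsilon}$ gives $\mathbb E[F(\bar x_T)]-F^*\le\varepsilon$, and for $T=\lceil\frac{A'}{K\varepsilon}\rceil$ each agent draws at most $\frac{A''}{K\varepsilon}\ln\frac1\varepsilon$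 samples. That is, the iteration and per-agent sample complexities are $O(\frac1{K\varepsilon})$ and $\tilde O(\frac1{K\varepsilon})$. -/

import Mathlib

open MeasureTheory ProbabilityTheory

noncomputable section

namespace DSMO

/-- Euclidean space `ℝⁿ`. -/
abbrev Vec (n : ℕ) := EuclideanSpace ℝ (Fin n)

/-- Frobenius norm of a linear map between Euclidean spaces. (The norm `‖A‖` of a continuous linear
map is the spectral norm.) -/
def frobNorm {n m : ℕ} (A : Vec n →L[ℝ] Vec m) : ℝ :=
  Real.sqrt (∑ i : Fin n, ‖A (EuclideanSpace.single i 1)‖ ^ 2)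

/-- A minimizer of `φ` (an arbitrary point when there is none). -/
def argmin {V : Type*} [Nonempty V] (φ : V → ℝ) : V :=
  Classical.epsilon fun y => ∀ z, φ y ≤ φ z

/-! ### The multilevel problem

There are `M` inner levels and `K` agents. The variables are `y₀ = x, y₁, …, y_M` with
`y_m ∈ ℝ^{d m}`, `m : Fin (M + 1)`. The inner objectives are indexed by `m : Fin M`: the objective
with index `m` has `y_{m.castSucc}` as parameter and `y_{m.succ}` as decision variable. -/

/-- The local objectives `f^k` and `g_m^k` of the agents. -/
structure Problem {M : ℕ} (d : Fin (M + 1) → ℕ) (K : ℕ) where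
  f : Fin K → Vec (d 0) → Vec (d (Fin.last M)) → ℝ
  g : (m : Fin M) → Fin K → Vec (d m.castSucc) → Vec (d m.succ) → ℝ

namespace Problem

variable {M : ℕ} {d : Fin (M + 1) → ℕ} {K : ℕ} (p : Problem d K)

/-- The averaged outer objective `f`. -/
def fAvg (x : Vec (d 0)) (y : Vec (d (Fin.last M))) : ℝ :=
  (1 / (K : ℝ)) * ∑ k, p.f k x y

/-- The averaged inner objective `g_m`. -/
def gAvg (m : Fin M) (y' : Vec (d m.castSucc)) (y : Vec (d m.succ)) : ℝ :=
  (1 / (K : ℝ)) * ∑ k, p.g m k y' y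

/-- The best responses: `y₀⋆(x) = x` and `y_m⋆(x) = argmin_y g_m (y_{m-1}⋆(x), y)`. -/
def yStar (m : Fin (M + 1)) (x : Vec (d 0)) : Vec (d m) :=
  Fin.induction (motive := fun m => Vec (d m)) x (fun m y' => argmin (p.gAvg m y')) m

/-- The objective `F(x) = f(x, y_M⋆(x))`. -/
def F (x : Vec (d 0)) : ℝ := p.fAvg x (p.yStar (Fin.last M) x)

/-- The optimal value `F^*` (a minimum whenever `F` has a minimizer). -/
def FStar : ℝ := ⨅ x, p.F x

/-- `∇₁ f^k`. -/
def gradf₁ (k : Fin K) (x : Vec (d 0)) (y : Vec (d (Fin.last M))) : Vec (d 0) :=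
  gradient (fun x' => p.f k x' y) x

/-- `∇₂ f^k`. -/
def gradf₂ (k : Fin K) (x : Vec (d 0)) (y : Vec (d (Fin.last M))) : Vec (d (Fin.last M)) :=
  gradient (fun y' => p.f k x y') y

/-- `∇₂ g_m^k`. -/
def gradg₂ (m : Fin M) (k : Fin K) (y' : Vec (d m.castSucc)) (y : Vec (d m.succ)) :
    Vec (d m.succ) :=
  gradient (fun z => p.g m k y' z) y

/-- `∇₁₂² g_m^k`, the `d_{m-1} × d_m` matrix of mixed second derivatives. -/
def hessg₁₂ (m : Fin M) (k : Fin K) (y' : Vec (d m.castSucc)) (y : Vec (d m.succ)) :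
    Vec (d m.succ) →L[ℝ] Vec (d m.castSucc) :=
  ContinuousLinearMap.adjoint (fderiv ℝ (fun z => p.gradg₂ m k z y) y')

/-- `∇₂₂² g_m^k`. -/
def hessg₂₂ (m : Fin M) (k : Fin K) (y' : Vec (d m.castSucc)) (y : Vec (d m.succ)) :
    Vec (d m.succ) →L[ℝ] Vec (d m.succ) :=
  fderiv ℝ (fun z => p.gradg₂ m k y' z) y

/-- The Polyak–Łojasiewicz condition with constant `μ`. -/
def PL (μ : ℝ) : Prop :=
  ∀ x, 2 * μ * (p.F x - p.FStar) ≤ ‖gradient p.F x‖ ^ 2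

end Problem

/-! ### The sampling oracle -/

/-- The data of the stochastic oracle: the laws of the local samples of the agents (for the outer
objective and for each inner level), and the stochastic first- and second-order information as
functions of the query point and of the sample. -/
structure Oracle {M : ℕ} (d : Fin (M + 1) → ℕ) (K : ℕ) (S : Type*) [MeasurableSpace S] where
  outerLaw : Fin K → Measure S
  innerLaw : Fin M → Fin K → Measure S
  gradf₁ : Fin K → Vec (d 0) → Vec (d (Fin.last M)) → S → Vec (d 0)
  gradf₂ : Fin K → Vec (d 0) → Vec (d (Fin.last M)) → S → Vec (d (Fin.last M))
  gradg₂ : (m : Fin M) → Fin K → Vec (d m.castSucc) → Vec (d m.succ) → S → Vec (d m.succ)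
  hessg₁₂ : (m : Fin M) → Fin K → Vec (d m.castSucc) → Vec (d m.succ) → S →
    (Vec (d m.succ) →L[ℝ] Vec (d m.castSucc))
  hessg₂₂ : (m : Fin M) → Fin K → Vec (d m.castSucc) → Vec (d m.succ) → S →
    (Vec (d m.succ) →L[ℝ] Vec (d m.succ))

/-- `X` is an integrable, unbiased estimator of `a` under the law `ν`. -/
def Unbiased {S V : Type*} [MeasurableSpace S] [NormedAddCommGroup V] [NormedSpace ℝ V]
    (ν : Measure S) (X : S → V) (a : V) : Prop :=
  Integrable X ν ∧ ∫ s, X s ∂ν = a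

/-- `𝔼 ‖X‖² ≤ C²` (in particular the second moment is finite). -/
def SecondMomentLE {S V : Type*} [MeasurableSpace S] [NormedAddCommGroup V]
    (ν : Measure S) (X : S → V) (C : ℝ) : Prop :=
  MemLp X 2 ν ∧ ∫ s, ‖X s‖ ^ 2 ∂ν ≤ C ^ 2

/-- The oracle is (jointly) measurable and unbiased. -/
structure Oracle.IsUnbiased {M : ℕ} {d : Fin (M + 1) → ℕ} {K : ℕ} {S : Type*} [MeasurableSpace S]
    (o : Oracle d K S) (p : Problem d K) : Prop where
  measurable_gradf₁ : ∀ k, Measurable fun z : Vec (d 0) × Vec (d (Fin.last M)) × S =>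
    o.gradf₁ k z.1 z.2.1 z.2.2
  measurable_gradf₂ : ∀ k, Measurable fun z : Vec (d 0) × Vec (d (Fin.last M)) × S =>
    o.gradf₂ k z.1 z.2.1 z.2.2
  measurable_gradg₂ : ∀ m k, Measurable fun z : Vec (d (Fin.castSucc m)) × Vec (d m.succ) × S =>
    o.gradg₂ m k z.1 z.2.1 z.2.2
  measurable_hessg₁₂ : ∀ m k, Measurable fun z : Vec (d (Fin.castSucc m)) × Vec (d m.succ) × S =>
    o.hessg₁₂ m k z.1 z.2.1 z.2.2
  measurable_hessg₂₂ : ∀ m k, Measurable fun z : Vec (d (Fin.castSucc m)) × Vec (d m.succ) × S =>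
    o.hessg₂₂ m k z.1 z.2.1 z.2.2
  gradf₁ : ∀ k x y, Unbiased (o.outerLaw k) (o.gradf₁ k x y) (p.gradf₁ k x y)
  gradf₂ : ∀ k x y, Unbiased (o.outerLaw k) (o.gradf₂ k x y) (p.gradf₂ k x y)
  gradg₂ : ∀ m k y' y, Unbiased (o.innerLaw m k) (o.gradg₂ m k y' y) (p.gradg₂ m k y' y)
  hessg₁₂ : ∀ m k y' y, Unbiased (o.innerLaw m k) (o.hessg₁₂ m k y' y) (p.hessg₁₂ m k y' y)
  hessg₂₂ : ∀ m k y' y, Unbiased (o.innerLaw m k) (o.hessg₂₂ m k y' y) (p.hessg₂₂ m k y' y)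

/-- The queries made by the algorithm: in round `t`, agent `k` draws one outer sample, one sample
per level `m` for the gradient and the mixed Hessian, and samples `i = 0, 1, …` per level `m` for
the Hessian in the decision variable. -/
inductive Query (M K : ℕ)
  | outer (t : ℕ) (k : Fin K)
  | inner (t : ℕ) (m : Fin M) (k : Fin K)
  | hess (t : ℕ) (m : Fin M) (k : Fin K) (i : ℕ)

/-- The answers to the queries are independent samples from the laws of the oracle. -/
structure IsSampling {M : ℕ} {d : Fin (M + 1) → ℕ} {K : ℕ} {S Ω : Type*} [MeasurableSpace S]
    [MeasurableSpace Ω] (o : Oracle d K S) (P : Measure Ω) (ξ : Query M K → Ω → S) : Prop where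
  measurable : ∀ q, Measurable (ξ q)
  indep : iIndepFun ξ P
  outer : ∀ t k, P.map (ξ (.outer t k)) = o.outerLaw k
  inner : ∀ t m k, P.map (ξ (.inner t m k)) = o.innerLaw m k
  hess : ∀ t m k i, P.map (ξ (.hess t m k i)) = o.innerLaw m k

/-! ### Assumptions -/

/-- The gossip matrix: symmetric, nonnegative, doubly stochastic, with
`‖W - (1/K) 1 1ᵀ‖₂² = ρ`. -/
structure IsGossip {K : ℕ} (W : Matrix (Fin K) (Fin K) ℝ) (ρ : ℝ) : Prop where
  symm : W.IsSymm
  nonneg : ∀ i j, 0 ≤ W i j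
  row_sum : ∀ i, ∑ j, W i j = 1
  col_sum : ∀ j, ∑ i, W i j = 1
  norm_sq : ‖Matrix.toEuclideanCLM (n := Fin K) (𝕜 := ℝ)
    (W - Matrix.of fun _ _ : Fin K => 1 / (K : ℝ))‖ ^ 2 = ρ

/-- The constants of the smoothness, boundedness and convexity assumptions; `Lt` stands for
`L̃_g`. -/
structure Constants (M : ℕ) where
  Cf : ℝ
  Lf : ℝ
  Cg : Fin M → ℝ
  Lg : Fin M → ℝ
  Lt : Fin M → ℝ
  μg : Fin M → ℝ
  κ : Fin M → ℝ
  Cf_pos : 0 < Cf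
  Lf_pos : 0 < Lf
  Cg_pos : ∀ m, 0 < Cg m
  Lg_pos : ∀ m, 0 < Lg m
  Lt_pos : ∀ m, 0 < Lt m
  μg_pos : ∀ m, 0 < μg m
  κ_pos : ∀ m, 0 < κ m
  κ_le : ∀ m, κ m ≤ μg m / Lg m
  μg_div_le : ∀ m, μg m / Lg m ≤ 1

/-- Assumptions on the outer functions. The second moments of the stochastic gradients are bounded
on `D₀ × D_M` (on the whole space when every `D m` is `Set.univ`). -/
structure OuterAssumption {M : ℕ} {d : Fin (M + 1) → ℕ} {K : ℕ} {S : Type*} [MeasurableSpace S]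
    (c : Constants M) (p : Problem d K) (o : Oracle d K S) (D : (m : Fin (M + 1)) → Set (Vec (d m))) :
    Prop where
  exists_min : ∃ x, ∀ x', p.F x ≤ p.F x'
  differentiable : ∀ k, Differentiable ℝ
    fun z : Vec (d 0) × Vec (d (Fin.last M)) => p.f k z.1 z.2
  lip_gradf₁ : ∀ k x x' y y',
    ‖p.gradf₁ k x y - p.gradf₁ k x' y'‖ ≤ c.Lf * (‖x - x'‖ + ‖y - y'‖)
  lip_gradf₂ : ∀ k x x' y y',
    ‖p.gradf₂ k x y - p.gradf₂ k x' y'‖ ≤ c.Lf * (‖x - x'‖ + ‖y - y'‖)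
  moment_gradf₁ : ∀ k, ∀ x ∈ D 0, ∀ y ∈ D (Fin.last M),
    SecondMomentLE (o.outerLaw k) (o.gradf₁ k x y) c.Cf
  moment_gradf₂ : ∀ k, ∀ x ∈ D 0, ∀ y ∈ D (Fin.last M),
    SecondMomentLE (o.outerLaw k) (o.gradf₂ k x y) c.Cf

/-- Assumptions on the inner functions. The second moments of the stochastic gradients are bounded
on `D_{m-1} × D_m` (on the whole space when every `D m` is `Set.univ`). -/
structure InnerAssumption {M : ℕ} {d : Fin (M + 1) → ℕ} {K : ℕ} {S : Type*} [MeasurableSpace S]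
    (c : Constants M) (p : Problem d K) (o : Oracle d K S) (D : (m : Fin (M + 1)) → Set (Vec (d m))) :
    Prop where
  strongConvex : ∀ m y', StrongConvexOn Set.univ (c.μg m) (p.gAvg m y')
  contDiff : ∀ m k, ContDiff ℝ 2
    fun z : Vec (d (Fin.castSucc m)) × Vec (d m.succ) => p.g m k z.1 z.2
  lip_gradg₂ : ∀ m k y' z' y z,
    ‖p.gradg₂ m k y' y - p.gradg₂ m k z' z‖ ≤ c.Lg m * (‖y' - z'‖ + ‖y - z‖)
  lip_hessg₁₂ : ∀ m k y' z' y z,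
    frobNorm (p.hessg₁₂ m k y' y - p.hessg₁₂ m k z' z) ≤ c.Lt m * (‖y' - z'‖ + ‖y - z‖)
  lip_hessg₂₂ : ∀ m k y' z' y z,
    frobNorm (p.hessg₂₂ m k y' y - p.hessg₂₂ m k z' z) ≤ c.Lt m * (‖y' - z'‖ + ‖y - z‖)
  moment_gradg₂ : ∀ m k, ∀ y' ∈ D (Fin.castSucc m), ∀ y ∈ D m.succ,
    SecondMomentLE (o.innerLaw m k) (o.gradg₂ m k y' y) (c.Cg m)
  moment_hessg₂₂ : ∀ m k y' y, SecondMomentLE (o.innerLaw m k) (o.hessg₂₂ m k y' y) (c.Lg m)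
  moment_hessg₁₂ : ∀ m k y' y, SecondMomentLE (o.innerLaw m k) (o.hessg₁₂ m k y' y) (c.Lg m)
  moment_contraction : ∀ m k y' y, SecondMomentLE (o.innerLaw m k)
    (fun s => ContinuousLinearMap.id ℝ (Vec (d m.succ)) - (1 / c.Lg m) • o.hessg₂₂ m k y' y s)
    (1 - c.κ m)

/-! ### The algorithm -/

/-- Parameters of the algorithm: step sizes `α`, `β`, `γ`, smoothness constants `L_{g,m}`,
the initialization constants `μ_{g,m}` and the Hessian sampling parameters `b_m`. -/
structure Params (M : ℕ) where
  α : ℕ → ℝ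
  β : ℕ → ℝ
  γ : ℕ → ℝ
  L : Fin M → ℝ
  μ₀ : Fin M → ℝ
  b : Fin M → ℕ

/-- The iterates of all agents in one round. Here `y 0` is the outer variable `x`, and `v m i` is the
`i`-th running estimate (counted from `0`) of the Hessian of level `m`. -/
structure State {M : ℕ} (d : Fin (M + 1) → ℕ) (K : ℕ) where
  y : (m : Fin (M + 1)) → Fin K → Vec (d m)
  s : Fin K → Vec (d 0)
  h : Fin K → Vec (d (Fin.last M))
  u : (m : Fin M) → Fin K → (Vec (d m.succ) →L[ℝ] Vec (d m.castSucc))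
  v : (m : Fin M) → ℕ → Fin K → (Vec (d m.succ) →L[ℝ] Vec (d m.succ))
  q : (m : Fin M) → Fin K → (Vec (d m.succ) →L[ℝ] Vec (d m.succ))

section Algorithm

variable {M : ℕ} {d : Fin (M + 1) → ℕ} {K : ℕ}

/-- The gossip average `∑_j w_{k,j} z_j` (agents that are not neighbours have weight `0`). -/
def mix {V : Type*} [AddCommGroup V] [Module ℝ V] (W : Matrix (Fin K) (Fin K) ℝ) (z : Fin K → V)
    (k : Fin K) : V := ∑ j, W k j • z j

/-- `Q_0 = I` and `Q_i = I + (I - v_i / L) Q_{i-1}`. -/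
def hessQ {n : ℕ} (L : ℝ) (v : ℕ → (Vec n →L[ℝ] Vec n)) : ℕ → (Vec n →L[ℝ] Vec n)
  | 0 => ContinuousLinearMap.id ℝ (Vec n)
  | i + 1 => ContinuousLinearMap.id ℝ (Vec n) +
      (ContinuousLinearMap.id ℝ (Vec n) - (1 / L) • v i) ∘L hessQ L v i

/-- The product `u₁ q₁ u₂ q₂ ⋯ u_M q_M` of agent `k`. -/
def State.chain (st : State d K) (k : Fin K) : Vec (d (Fin.last M)) →L[ℝ] Vec (d 0) :=
  Fin.induction (motive := fun m => Vec (d m) →L[ℝ] Vec (d 0))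
    (ContinuousLinearMap.id ℝ (Vec (d 0)))
    (fun m A => A ∘L st.u m k ∘L st.q m k) (Fin.last M)

/-- The estimate `s + (-1)^M u₁ q₁ ⋯ u_M q_M h` of the outer gradient by agent `k`. -/
def State.z (st : State d K) (k : Fin K) : Vec (d 0) :=
  st.s k + (-1 : ℝ) ^ M • st.chain k (st.h k)

/-- The initial iterates. -/
def initState (a : Params M) : State d K where
  y := fun _ _ => 0
  s := fun _ => 0
  h := fun _ => 0
  u := fun _ _ => 0
  v := fun m _ _ => a.μ₀ m • ContinuousLinearMap.id ℝ _
  q := fun _ _ => 0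

/-- The Hessian estimates `v_{m,t+1,i}`. -/
def nextV {S : Type*} [MeasurableSpace S] (a : Params M) (W : Matrix (Fin K) (Fin K) ℝ)
    (o : Oracle d K S) (ξ : Query M K → S) (t : ℕ) (st : State d K) (m : Fin M) (i : ℕ) (k : Fin K) :
    Vec (d m.succ) →L[ℝ] Vec (d m.succ) :=
  (1 - a.β t) • mix W (st.v m i) k +
    a.β t • o.hessg₂₂ m k (st.y m.castSucc k) (st.y m.succ k) (ξ (.hess t m k i))

/-- Round `t` of the algorithm, given the answers `ξ` to the queries. -/
def step {S : Type*} [MeasurableSpace S] (a : Params M) (W : Matrix (Fin K) (Fin K) ℝ)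
    (o : Oracle d K S) (ξ : Query M K → S) (t : ℕ) (st : State d K) : State d K where
  y := fun m => Fin.cases (motive := fun m => Fin K → Vec (d m))
    (fun k => mix W (st.y 0) k - a.α t • st.z k)
    (fun m k => mix W (st.y m.succ) k -
      a.γ t • o.gradg₂ m k (st.y m.castSucc k) (st.y m.succ k) (ξ (.inner t m k))) m
  s := fun k => (1 - a.β t) • mix W st.s k +
    a.β t • o.gradf₁ k (st.y 0 k) (st.y (Fin.last M) k) (ξ (.outer t k))
  h := fun k => (1 - a.β t) • mix W st.h k +
    a.β t • o.gradf₂ k (st.y 0 k) (st.y (Fin.last M) k) (ξ (.outer t k))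
  u := fun m k => (1 - a.β t) • mix W (st.u m) k +
    a.β t • o.hessg₁₂ m k (st.y m.castSucc k) (st.y m.succ k) (ξ (.inner t m k))
  v := fun m i k => nextV a W o ξ t st m i k
  q := fun m k => (1 / a.L m) • hessQ (a.L m) (fun i => nextV a W o ξ t st m i k) (a.b m)

/-- The iterates after `t` rounds. -/
def run {S : Type*} [MeasurableSpace S] (a : Params M) (W : Matrix (Fin K) (Fin K) ℝ)
    (o : Oracle d K S) (ξ : Query M K → S) : ℕ → State d K
  | 0 => initState a
  | t + 1 => step a W o ξ t (run a W o ξ t)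

/-- The average `x̄` of the outer variables of the agents. -/
def State.xBar (st : State d K) : Vec (d 0) := (1 / (K : ℝ)) • ∑ k, st.y 0 k

/-- The number of samples that one agent draws in `T` rounds: per round one outer sample and, for
each level `m`, one sample for the gradient and the mixed Hessian and `b_m` samples for the Hessian in
the decision variable (only the estimates `v m i` with `i < b_m` enter the iterates). -/
def samplesPerAgent (a : Params M) (T : ℕ) : ℕ := T * (1 + ∑ m, (1 + a.b m))

end Algorithm

/-- The diminishing step sizes `α_t = 2/(μ(C₁+t))`, `β_t = γ_t = C₁/(C₁+t)`. -/
def plParams {M : ℕ} (c : Constants M) (μ C₁ : ℝ) (b : Fin M → ℕ) : Params M where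
  α := fun t => 2 / (μ * (C₁ + t))
  β := fun t => C₁ / (C₁ + t)
  γ := fun t => C₁ / (C₁ + t)
  L := c.Lg
  μ₀ := c.μg
  b := b

/-- The sampling parameters `b T m` for horizon `T` are of order `log T`: at least
`3 log_{1/(1-κ_m)} T` (read as `0` if `κ_m = 1`) and at most `B log T`. -/
def LogSampling {M : ℕ} (c : Constants M) (B : ℝ) (b : ℕ → Fin M → ℕ) : Prop :=
  ∀ T : ℕ, 2 ≤ T → ∀ m, 3 * Real.logb (1 / (1 - c.κ m)) T ≤ b T m ∧ (b T m : ℝ) ≤ B * Real.log T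

/-- The sets `D m` are convex, contain the best responses to the points of `D 0`, and contain the
iterates of the runs of the algorithm. This holds trivially if every `D m` is `Set.univ`. -/
structure Confined {M : ℕ} {d : Fin (M + 1) → ℕ} {K : ℕ} {S Ω : Type*} [MeasurableSpace S]
    [MeasurableSpace Ω] (p : Problem d K) (o : Oracle d K S) (W : Matrix (Fin K) (Fin K) ℝ)
    (P : Measure Ω) (ξ : Query M K → Ω → S) (a : ℕ → Params M)
    (D : (m : Fin (M + 1)) → Set (Vec (d m))) : Prop where
  convex : ∀ m, Convex ℝ (D m)
  yStar_mem : ∀ m, ∀ x ∈ D 0, p.yStar m x ∈ D m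
  run_mem : ∀ T : ℕ, 2 ≤ T → ∀ t ≤ T, ∀ m k,
    ∀ᵐ ω ∂P, (run (a T) W o (fun q => ξ q ω) t).y m k ∈ D m

/-- Sanity check of the last remark. -/
theorem confined_univ {M : ℕ} {d : Fin (M + 1) → ℕ} {K : ℕ} {S Ω : Type*} [MeasurableSpace S]
    [MeasurableSpace Ω] (p : Problem d K) (o : Oracle d K S) (W : Matrix (Fin K) (Fin K) ℝ)
    (P : Measure Ω) (ξ : Query M K → Ω → S) (a : ℕ → Params M) :
    Confined p o W P ξ a (fun _ => Set.univ) :=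
  ⟨fun _ => convex_univ, fun _ _ _ => trivial, fun _ _ _ _ _ _ => Filter.univ_mem' fun _ => trivial⟩

end DSMO

end

open DSMO

noncomputable section

namespace DSMO

/-! ### Averages, deviations and gossip -/

section Gossip

variable {K : ℕ} {V : Type*} [NormedAddCommGroup V]

/-! Every estimate of the algorithm (`s`, `h`, `u`, `I - v / L`) is an exponential moving average
with gossip, hence linear in its observations. It is compared with the same recursion driven by the
conditional means of the observations (`drive`; `Sys.Chan.E` against `Sys.Chan.G`). The noiseless
version is almost surely bounded, because the means are, and its network average tracks the target
at the best responses. The difference is a weighted sum of martingale differences. As `W` is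
symmetric and doubly stochastic, the coefficients of a linear functional of the noises are
themselves mixed from round to round: their sum is kept and their deviation shrinks by `ρ`. So the
squared functional has mean at most a constant times `p_t (∑ a)² / K + q_t ∑ (a - avg a)²`, where
`p_t = O(1/t)` and `q_t = O(1/((1-ρ)t²))` (`labFun_step`). The first term is the source of the
factor `1/K`.

The delicate point is the product `u₁q₁⋯u_Mq_M h`, in which each `q` is a product over about `log T`
Hessian estimates. The factors have only second moments, and they are dependent through the common
iterates. Given the past, however, distinct channels use distinct samples, and one round bounds the
functionals of a channel by combinations of functionals of the same channel. Replacing the channels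
one at a time, `lintegral_prod_le_prod` shows that expectations of products obey the bounds that
independence would give. Since errors are always split so that the unbounded noisy factors multiply
errors of other channels and the noise of a channel multiplies a bounded noiseless vector, the error
of the product is of the order of a single noise (`Ctrl.apply`, `Ctrl.chainTo`). Contraction of the
factors `I - v / L` makes the constants independent of the number of Hessian samples
(`Ctrl.neumann`).

Deterministically, the best responses are Lipschitz and differentiable by implicit differentiation,
and `∇F` is the product formula at the best responses (`Regular.hasGradientAt_F`). The noiseless
direction therefore differs from `∇F` by the tracking errors, the deviation between agents and a
Neumann truncation error `O(1/T)`.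

The Lyapunov function adds the optimality gap, the tracking errors, and the errors `‖ȳ_m -
y_m⋆(x̄)‖²` with geometrically decreasing weights over the levels. The descent inequality and PL
contract the gap and leave a spare `-α/4 ‖z̄‖²`, which pays for the drift of all targets caused by
the motion of `x̄`. Strong convexity contracts the inner errors, and momentum contracts the tracking
errors. For large `C₁` this gives contraction by `1 - 2/(C₁+t) + O(1/t²)` (`Sys.ae_lyap_pred_le`,
`Sys.eb_lyap_succ`).

Multiplication by roughly `(C₁+t)²` turns this into a sum of perturbations (`weighted_rec_le`): the
averaged noise contributes `T/K`, and all network effects together contribute `log T/(1-ρ)²`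
(`Sys.sum_sq_mul_pert_le`). For the consensus error the latter order is obtained because only its
truncation at `1` matters (`Sys.Chan.ae_norm_avg_m_sub_sq_le`, `sum_min_etaSeq_le`). Division by
`T²` is the rate, and the complexities follow by choosing `ε` so small that the network term is
below half of it. -/

/-- The average over the agents. -/
def avg [NormedSpace ℝ V] (z : Fin K → V) : V := (1 / (K : ℝ)) • ∑ k, z k

/-- The mean square over the agents. -/
def msq (z : Fin K → V) : ℝ := (1 / (K : ℝ)) * ∑ k, ‖z k‖ ^ 2

/-- The mean square deviation from the average. -/
def dev [NormedSpace ℝ V] (z : Fin K → V) : ℝ := msq fun k => z k - avg z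

theorem msq_nonneg (z : Fin K → V) : 0 ≤ msq z := by unfold msq; positivity

theorem dev_nonneg [NormedSpace ℝ V] (z : Fin K → V) : 0 ≤ dev z := msq_nonneg _

theorem avg_add [NormedSpace ℝ V] (z z' : Fin K → V) :
    avg (fun k => z k + z' k) = avg z + avg z' := by
  simp [avg, Finset.sum_add_distrib]

theorem avg_sub [NormedSpace ℝ V] (z z' : Fin K → V) :
    avg (fun k => z k - z' k) = avg z - avg z' := by
  simp [avg, Finset.sum_sub_distrib, smul_sub]

theorem avg_smul [NormedSpace ℝ V] (c : ℝ) (z : Fin K → V) :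
    avg (fun k => c • z k) = c • avg z := by
  simp [avg, ← Finset.smul_sum, smul_comm c]

theorem avg_const [NormedSpace ℝ V] (hK : 0 < K) (v : V) : avg (fun _ : Fin K => v) = v := by
  have : (K : ℝ) ≠ 0 := by positivity
  simp [avg, ← Nat.cast_smul_eq_nsmul ℝ, smul_smul, this]

theorem avg_map [NormedSpace ℝ V] {V' : Type*} [NormedAddCommGroup V'] [NormedSpace ℝ V']
    (f : V →L[ℝ] V') (z : Fin K → V) : avg (fun k => f (z k)) = f (avg z) := by
  simp [avg, map_sum]

theorem sum_sub_avg [NormedSpace ℝ V] (z : Fin K → V) : ∑ k, (z k - avg z) = 0 := by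
  rcases Nat.eq_zero_or_pos K with h | h
  · subst h; simp
  · have : (K : ℝ) ≠ 0 := by positivity
    simp [avg, Finset.sum_sub_distrib, ← Nat.cast_smul_eq_nsmul ℝ, smul_smul, this]

theorem msq_le_of_forall {z : Fin K → V} {C : ℝ} (h : ∀ k, ‖z k‖ ≤ C) :
    msq z ≤ C ^ 2 := by
  rcases Nat.eq_zero_or_pos K with h0 | h0
  · subst h0; simp [msq]; positivity
  · have hK : (0 : ℝ) < K := by exact_mod_cast h0
    have : ∑ k, ‖z k‖ ^ 2 ≤ ∑ _k : Fin K, C ^ 2 :=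
      Finset.sum_le_sum fun k _ => pow_le_pow_left₀ (norm_nonneg _) (h k) 2
    unfold msq
    rw [one_div, inv_mul_le_iff₀ hK]
    simpa using this

theorem norm_avg_le [NormedSpace ℝ V] (z : Fin K → V) :
    ‖avg z‖ ≤ (1 / (K : ℝ)) * ∑ k, ‖z k‖ := by
  unfold avg
  rw [norm_smul, Real.norm_of_nonneg (by positivity)]
  gcongr
  exact norm_sum_le _ _

theorem norm_avg_sq_le [NormedSpace ℝ V] (z : Fin K → V) : ‖avg z‖ ^ 2 ≤ msq z := by
  refine (pow_le_pow_left₀ (norm_nonneg _) (norm_avg_le z) 2).trans ?_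
  unfold msq
  rcases Nat.eq_zero_or_pos K with h0 | h0
  · subst h0; simp
  · have hK : (0 : ℝ) < K := by exact_mod_cast h0
    have := sq_sum_le_card_mul_sum_sq (s := Finset.univ) (f := fun k : Fin K => ‖z k‖)
    simp only [Finset.card_univ, Fintype.card_fin] at this
    calc (1 / (K : ℝ) * ∑ k, ‖z k‖) ^ 2 = (1 / (K : ℝ)) ^ 2 * (∑ k, ‖z k‖) ^ 2 := by ring
      _ ≤ (1 / (K : ℝ)) ^ 2 * (K * ∑ k, ‖z k‖ ^ 2) := by gcongr
      _ = _ := by field_simp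

theorem norm_avg_le_of_forall [NormedSpace ℝ V] {z : Fin K → V} {C : ℝ} (hC : 0 ≤ C)
    (h : ∀ k, ‖z k‖ ≤ C) : ‖avg z‖ ≤ C := by
  have := (norm_avg_sq_le z).trans (msq_le_of_forall h)
  exact le_of_sq_le_sq this hC

/-- The average is an orthogonal projection, so the cross term vanishes by `sum_sub_avg`. This needs
an inner product; operators with the spectral norm are first transported to a Euclidean space. -/
theorem dev_le_msq [InnerProductSpace ℝ V] (z : Fin K → V) : dev z ≤ msq z := by
  unfold dev msq
  gcongr ?_ * ?_
  have h : ∀ k, ‖z k‖ ^ 2 = ‖z k - avg z‖ ^ 2 + 2 * inner ℝ (z k - avg z) (avg z)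
      + ‖avg z‖ ^ 2 := fun k => by
    rw [← norm_add_sq_real, sub_add_cancel]
  have h2 : ∑ k, ‖z k‖ ^ 2 = ∑ k, ‖z k - avg z‖ ^ 2 + K * ‖avg z‖ ^ 2 := by
    rw [Finset.sum_congr rfl fun k _ => h k, Finset.sum_add_distrib, Finset.sum_add_distrib,
      ← Finset.mul_sum, ← sum_inner, sum_sub_avg]
    simp
  rw [h2]
  have : (0 : ℝ) ≤ K * ‖avg z‖ ^ 2 := by positivity
  linarith

/-- Cauchy–Schwarz in Engel form. Keeping the weights free allows recursions on norms to be run on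
squares without losing a constant. -/
theorem msq_add_le {z z' : Fin K → V} {p q : ℝ} (hp : 0 < p) (hq : 0 < q) :
    msq (fun k => z k + z' k) ≤ (p + q) * (msq z / p + msq z' / q) := by
  have key : ∀ k, ‖z k + z' k‖ ^ 2 ≤ (p + q) * (‖z k‖ ^ 2 / p + ‖z' k‖ ^ 2 / q) := fun k => by
    refine (pow_le_pow_left₀ (norm_nonneg _) (norm_add_le _ _) 2).trans ?_
    have : (p + q) * (‖z k‖ ^ 2 / p + ‖z' k‖ ^ 2 / q) - (‖z k‖ + ‖z' k‖) ^ 2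
        = (q * ‖z k‖ - p * ‖z' k‖) ^ 2 / (p * q) := by
      field_simp; ring
    have h2 : 0 ≤ (q * ‖z k‖ - p * ‖z' k‖) ^ 2 / (p * q) := by positivity
    linarith
  unfold msq
  calc _ ≤ (1 / (K : ℝ)) * ∑ k, (p + q) * (‖z k‖ ^ 2 / p + ‖z' k‖ ^ 2 / q) := by
        gcongr with k; exact key k
    _ = _ := by
        rw [← Finset.mul_sum, Finset.sum_add_distrib, ← Finset.sum_div, ← Finset.sum_div]; ring

theorem msq_smul [NormedSpace ℝ V] (c : ℝ) (z : Fin K → V) :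
    msq (fun k => c • z k) = c ^ 2 * msq z := by
  simp only [msq, norm_smul, mul_pow, Real.norm_eq_abs, sq_abs, ← Finset.mul_sum]
  ring

variable {W : Matrix (Fin K) (Fin K) ℝ} {ρ : ℝ}

theorem IsGossip.card_pos (hW : IsGossip W ρ) (hρ : 0 < ρ) : 0 < K := by
  rcases Nat.eq_zero_or_pos K with h | h
  · subst h
    have := hW.norm_sq
    rw [Subsingleton.elim (Matrix.toEuclideanCLM (n := Fin 0) (𝕜 := ℝ) _) 0] at this
    simp at this
    linarith
  · exact h

theorem IsGossip.sum_mix [NormedSpace ℝ V] (hW : IsGossip W ρ) (z : Fin K → V) :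
    ∑ k, mix W z k = ∑ k, z k := by
  unfold mix
  rw [Finset.sum_comm]
  simp [← Finset.sum_smul, hW.col_sum]

theorem IsGossip.avg_mix [NormedSpace ℝ V] (hW : IsGossip W ρ) (z : Fin K → V) :
    avg (mix W z) = avg z := by
  simp [avg, hW.sum_mix]

theorem IsGossip.mix_const [NormedSpace ℝ V] (hW : IsGossip W ρ) (v : V) (k : Fin K) :
    mix W (fun _ => v) k = v := by
  simp [mix, ← Finset.sum_smul, hW.row_sum]

theorem mix_map [NormedSpace ℝ V] {V' : Type*} [NormedAddCommGroup V'] [NormedSpace ℝ V']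
    (f : V →L[ℝ] V') (z : Fin K → V) (k : Fin K) : mix W (fun j => f (z j)) k = f (mix W z k) := by
  simp [mix, map_sum]

theorem mix_sub [NormedSpace ℝ V] (z z' : Fin K → V) (k : Fin K) :
    mix W (fun j => z j - z' j) k = mix W z k - mix W z' k := by
  simp [mix, smul_sub, Finset.sum_sub_distrib]

/-- Symmetry of `W` moves the mixing from the vectors to the coefficients. This lets a noise
functional be followed backwards in time. -/
theorem IsGossip.sum_smul_mix [NormedSpace ℝ V] (hW : IsGossip W ρ) (a : Fin K → ℝ)
    (z : Fin K → V) : ∑ k, a k • mix W z k = ∑ k, mix W a k • z k := by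
  simp only [mix, Finset.smul_sum, Finset.sum_smul, smul_smul, smul_eq_mul]
  rw [Finset.sum_comm]
  refine Finset.sum_congr rfl fun j _ => Finset.sum_congr rfl fun k _ => ?_
  rw [hW.symm.apply, mul_comm]

theorem IsGossip.norm_mix_sq_le [NormedSpace ℝ V] (hW : IsGossip W ρ) (z : Fin K → V) (k : Fin K) :
    ‖mix W z k‖ ^ 2 ≤ ∑ j, W k j * ‖z j‖ ^ 2 := by
  have h1 : ‖mix W z k‖ ≤ ∑ j, W k j * ‖z j‖ := by
    refine (norm_sum_le _ _).trans (Finset.sum_le_sum fun j _ => ?_)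
    rw [norm_smul, Real.norm_of_nonneg (hW.nonneg k j)]
  refine (pow_le_pow_left₀ (norm_nonneg _) h1 2).trans ?_
  have h2 : ConvexOn ℝ Set.univ fun x : ℝ => x ^ 2 := even_two.convexOn_pow
  simpa using h2.map_sum_le (t := Finset.univ) (w := W k) (p := fun j => ‖z j‖)
    (fun j _ => hW.nonneg k j) (hW.row_sum k) (fun _ _ => trivial)

theorem IsGossip.norm_mix_le_of_forall [NormedSpace ℝ V] (hW : IsGossip W ρ) {z : Fin K → V}
    {C : ℝ} (h : ∀ k, ‖z k‖ ≤ C) (k : Fin K) : ‖mix W z k‖ ≤ C := by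
  refine (norm_sum_le _ _).trans ?_
  calc ∑ j, ‖W k j • z j‖ ≤ ∑ j, W k j * C := Finset.sum_le_sum fun j _ => by
        rw [norm_smul, Real.norm_of_nonneg (hW.nonneg k j)]
        exact mul_le_mul_of_nonneg_left (h j) (hW.nonneg k j)
    _ = C := by rw [← Finset.sum_mul, hW.row_sum, one_mul]

/-- On vectors with zero sum, `W` and `W - 11ᵀ/K` act alike, and `W` fixes constants; the spectral
bound is applied to the centred vector. -/
theorem IsGossip.sum_sq_mix_le (hW : IsGossip W ρ) (z : Fin K → ℝ) :
    ∑ k, (mix W z k - avg z) ^ 2 ≤ ρ * ∑ k, (z k - avg z) ^ 2 := by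
  set A := Matrix.toEuclideanCLM (n := Fin K) (𝕜 := ℝ)
    (W - Matrix.of fun _ _ : Fin K => 1 / (K : ℝ)) with hA
  set v : EuclideanSpace ℝ (Fin K) := WithLp.toLp 2 fun k => z k - avg z with hv
  have h1 : ∀ k, (A v) k = mix W z k - avg z := fun k => by
    rw [hA, hv, Matrix.toEuclideanCLM_toLp]
    simp only [Matrix.mulVec, dotProduct, Matrix.sub_apply, Matrix.of_apply, sub_mul]
    rw [Finset.sum_sub_distrib, ← Finset.mul_sum, sum_sub_avg]
    simp [mul_sub, Finset.sum_sub_distrib, ← Finset.sum_mul, hW.row_sum, mix]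
  have h2 : ‖A v‖ ^ 2 ≤ ρ * ‖v‖ ^ 2 := by
    rw [← hW.norm_sq, ← mul_pow]
    exact pow_le_pow_left₀ (norm_nonneg _) (A.le_opNorm v) 2
  simpa [EuclideanSpace.norm_sq_eq, h1] using h2.trans_eq (by simp [EuclideanSpace.norm_sq_eq, hv])

theorem IsGossip.dev_mix_le (hW : IsGossip W ρ) {n : ℕ} (z : Fin K → EuclideanSpace ℝ (Fin n)) :
    msq (fun k => mix W z k - avg z) ≤ ρ * dev z := by
  unfold dev msq
  rw [mul_left_comm]
  gcongr ?_ * ?_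
  simp only [EuclideanSpace.norm_sq_eq]
  rw [Finset.sum_comm, Finset.sum_comm (s := Finset.univ (α := Fin K)), Finset.mul_sum]
  refine Finset.sum_le_sum fun i _ => ?_
  have := hW.sum_sq_mix_le fun k => z k i
  simpa [mix, avg] using this

/-- Contraction of the deviation in one round of gossip with a perturbation. -/
theorem IsGossip.dev_step (hW : IsGossip W ρ) {n : ℕ} (z N : Fin K → EuclideanSpace ℝ (Fin n))
    (θ c : ℝ) {p q : ℝ} (hp : 0 < p) (hq : 0 < q) :
    dev (fun k => θ • mix W z k + c • N k) ≤
      (p + q) * (θ ^ 2 * ρ * dev z / p + c ^ 2 * msq N / q) := by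
  have h1 : avg (fun k => θ • mix W z k + c • N k) = θ • avg z + c • avg N := by
    rw [avg_add, avg_smul, avg_smul, hW.avg_mix]
  have h2 : dev (fun k => θ • mix W z k + c • N k) =
      msq (fun k => θ • (mix W z k - avg z) + c • (N k - avg N)) := by
    unfold dev
    rw [h1]
    congr 1; funext k
    simp only [smul_sub]; abel
  rw [h2]
  refine (msq_add_le hp hq).trans ?_
  rw [msq_smul, msq_smul]
  have h3 := mul_le_mul_of_nonneg_left (hW.dev_mix_le z) (sq_nonneg θ)
  have h4 := mul_le_mul_of_nonneg_left (dev_le_msq N) (sq_nonneg c)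
  have h5 : 0 < p + q := by positivity
  refine mul_le_mul_of_nonneg_left (add_le_add ?_ ?_) h5.le
  · exact div_le_div_of_nonneg_right (by linarith) hp.le
  · exact div_le_div_of_nonneg_right h4 hq.le

theorem dev_eq_zero_of_const [NormedSpace ℝ V] (v : V) : dev (fun _ : Fin K => v) = 0 := by
  rcases Nat.eq_zero_or_pos K with h | h
  · subst h; simp [dev, msq]
  · simp [dev, msq, avg_const h]

end Gossip

/-! ### Scalar recursions -/

section Sequences

variable {C₁ : ℝ}

/-- The profile `2C₁/(C₁+t)` is a supersolution: an average with weights of order `1/t` has variance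
of order `1/t`. -/
theorem variance_rec_le (hC : 2 ≤ C₁) {p : ℕ → ℝ} (h0 : p 0 ≤ 2)
    (hp : ∀ t, p (t + 1) ≤ (1 - C₁ / (C₁ + t)) ^ 2 * p t + (C₁ / (C₁ + t)) ^ 2) (t : ℕ) :
    p t ≤ 2 * C₁ / (C₁ + t) := by
  induction t with
  | zero =>
    have : C₁ ≠ 0 := by linarith
    simpa [this] using h0
  | succ t ih =>
    refine (hp t).trans ?_
    have ht : (0 : ℝ) ≤ t := Nat.cast_nonneg t
    obtain ⟨s, hs⟩ : ∃ s, s = C₁ + t := ⟨_, rfl⟩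
    have hs0 : 0 < s := by rw [hs]; linarith
    have hsC : C₁ ≤ s := by rw [hs]; linarith
    push_cast
    rw [← add_assoc]
    rw [← hs] at ih ⊢
    have e : (1 - C₁ / s) ^ 2 * (2 * C₁ / s) + (C₁ / s) ^ 2 =
        (2 * C₁ * (s - C₁) ^ 2 + C₁ ^ 2 * s) / s ^ 3 := by field_simp
    calc (1 - C₁ / s) ^ 2 * p t + (C₁ / s) ^ 2 ≤
          (1 - C₁ / s) ^ 2 * (2 * C₁ / s) + (C₁ / s) ^ 2 := by gcongr
      _ = _ := e
      _ ≤ 2 * C₁ / (s + 1) := by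
        rw [div_le_div_iff₀ (by positivity) (by positivity)]
        -- The claim after division by `C₁`, with `s = C₁ + t ≥ C₁ ≥ 2`.
        have : (2 * (s - C₁) ^ 2 + C₁ * s) * (s + 1) ≤ 2 * s ^ 3 := by
          nlinarith [mul_nonneg (sub_nonneg.2 hsC) hs0.le, mul_nonneg (sub_nonneg.2 hsC)
            (sub_nonneg.2 hC), mul_nonneg (mul_nonneg (sub_nonneg.2 hsC) hs0.le) (by linarith : 0 ≤ C₁),
            mul_nonneg (sq_nonneg s) (sub_nonneg.2 hC)]
        nlinarith

/-- The momentum factor `1 - β_t` alone already compensates for the decrease of `1/(C₁+t)` in one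
step, so the gap `1 - ρ` remains entirely available to absorb the forcing. The last two bounds shift
the forcing by one index at the cost of a factor `2`. -/
theorem sq_div_sq_le_aux (hC : 3 ≤ C₁) (t : ℕ) :
    (1 - C₁ / (C₁ + t)) / (C₁ + t) ≤ 1 / (C₁ + (t + 1 : ℕ)) ∧ 0 ≤ 1 - C₁ / (C₁ + t) ∧
    1 / (C₁ + t) ^ 2 ≤ 2 * (1 / (C₁ + (t + 1 : ℕ)) ^ 2) ∧
    1 / (C₁ + t) ≤ 2 * (1 / (C₁ + (t + 1 : ℕ))) := by
  have ht : (0 : ℝ) ≤ t := Nat.cast_nonneg t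
  have h0 : 0 < C₁ + t := by linarith
  push_cast
  have h1 : 1 - C₁ / (C₁ + t) = t / (C₁ + t) := by field_simp; ring
  rw [h1, div_div, div_le_div_iff₀ (by positivity) (by positivity), mul_one_div, mul_one_div,
    div_le_div_iff₀ (by positivity) (by positivity), div_le_div_iff₀ (by positivity) (by positivity)]
  refine ⟨by nlinarith, by positivity, by nlinarith, by linarith⟩

/-- The constant `X = 2C₁²/(1-ρ)` solves `ρX + 2C₁² = X`, the recursion left after
`sq_div_sq_le_aux`. -/
theorem consensus_variance_rec_le (hC : 3 ≤ C₁) {ρ : ℝ} (h0ρ : 0 ≤ ρ) (hρ : ρ < 1) {q : ℕ → ℝ}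
    (h0 : q 0 ≤ 0)
    (hq : ∀ t, q (t + 1) ≤ ρ * (1 - C₁ / (C₁ + t)) ^ 2 * q t + (C₁ / (C₁ + t)) ^ 2) (t : ℕ) :
    q t ≤ 2 * C₁ ^ 2 / (1 - ρ) * (1 / (C₁ + t) ^ 2) := by
  have hr : 0 < 1 - ρ := by linarith
  induction t with
  | zero => exact h0.trans (by positivity)
  | succ t ih =>
    refine (hq t).trans ?_
    obtain ⟨h1, h2, h3, -⟩ := sq_div_sq_le_aux hC t
    have ht : (0 : ℝ) < C₁ + t := by have := Nat.cast_nonneg (α := ℝ) t; linarith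
    have h4 : ((1 - C₁ / (C₁ + t)) / (C₁ + t)) ^ 2 ≤ (1 / (C₁ + (t + 1 : ℕ))) ^ 2 :=
      pow_le_pow_left₀ (by positivity) h1 2
    calc ρ * (1 - C₁ / (C₁ + t)) ^ 2 * q t + (C₁ / (C₁ + t)) ^ 2 ≤
          ρ * (1 - C₁ / (C₁ + t)) ^ 2 * (2 * C₁ ^ 2 / (1 - ρ) * (1 / (C₁ + t) ^ 2))
            + (C₁ / (C₁ + t)) ^ 2 := by gcongr
      _ = ρ * (2 * C₁ ^ 2 / (1 - ρ)) * ((1 - C₁ / (C₁ + t)) / (C₁ + t)) ^ 2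
            + C₁ ^ 2 * (1 / (C₁ + t) ^ 2) := by field_simp
      _ ≤ ρ * (2 * C₁ ^ 2 / (1 - ρ)) * (1 / (C₁ + (t + 1 : ℕ))) ^ 2
            + C₁ ^ 2 * (2 * (1 / (C₁ + (t + 1 : ℕ)) ^ 2)) := by gcongr
      _ = _ := by rw [div_pow, one_pow]; field_simp; ring

/-- The same fixed point on the level of norms: `X = 2C₁/(1-r)` solves `rX + 2C₁ = X`. -/
theorem consensus_mean_rec_step (hC : 3 ≤ C₁) {r : ℝ} (h0r : 0 ≤ r) (hr : r < 1) (t : ℕ) :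
    (1 - C₁ / (C₁ + t)) * r * (2 * C₁ / (1 - r) * (1 / (C₁ + t))) + C₁ / (C₁ + t) ≤
      2 * C₁ / (1 - r) * (1 / (C₁ + (t + 1 : ℕ))) := by
  have hr' : 0 < 1 - r := by linarith
  obtain ⟨h1, h2, -, h3⟩ := sq_div_sq_le_aux hC t
  calc (1 - C₁ / (C₁ + t)) * r * (2 * C₁ / (1 - r) * (1 / (C₁ + t))) + C₁ / (C₁ + t)
      = r * (2 * C₁ / (1 - r)) * ((1 - C₁ / (C₁ + t)) / (C₁ + t)) + C₁ * (1 / (C₁ + t)) := by ring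
    _ ≤ r * (2 * C₁ / (1 - r)) * (1 / (C₁ + (t + 1 : ℕ))) + C₁ * (2 * (1 / (C₁ + (t + 1 : ℕ)))) := by
        gcongr
    _ = _ := by field_simp; ring

theorem sum_inv_le_log (hC : 1 ≤ C₁) (T : ℕ) :
    ∑ t ∈ Finset.range T, 1 / (C₁ + t) ≤ 1 + Real.log T := by
  have := harmonic_le_one_add_log T
  refine le_trans ?_ this
  rw [harmonic]
  push_cast
  refine Finset.sum_le_sum fun t _ => ?_
  have ht : (0 : ℝ) ≤ t := Nat.cast_nonneg t
  rw [one_div]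
  exact inv_anti₀ (by positivity) (by linarith)

/-- The undamped consensus recursion `η_{t+1} = r η_t + β_t`, `η_0 = 1`. -/
def etaSeq (C₁ r : ℝ) : ℕ → ℝ
  | 0 => 1
  | t + 1 => r * etaSeq C₁ r t + C₁ / (C₁ + t)

/-- The sequence starts at `1` although the deviation starts at `0`, because `r η_t` later serves as
a positive Cauchy–Schwarz weight. -/
theorem etaSeq_pos (hC : 1 ≤ C₁) {r : ℝ} (h0r : 0 ≤ r) (t : ℕ) : 0 < etaSeq C₁ r t := by
  induction t with
  | zero => exact one_pos
  | succ t ih =>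
    have ht : (0 : ℝ) ≤ t := Nat.cast_nonneg t
    have : 0 < C₁ / (C₁ + t) := by positivity
    have := mul_nonneg h0r ih.le
    simp only [etaSeq]; linarith

/-- The part of `etaSeq` that comes from the steps before `t₀`. -/
def etaEarly (C₁ r : ℝ) (t₀ : ℕ) : ℕ → ℝ
  | 0 => 1
  | t + 1 => r * etaEarly C₁ r t₀ t + if t < t₀ then C₁ / (C₁ + t) else 0

theorem etaEarly_nonneg (hC : 1 ≤ C₁) {r : ℝ} (h0r : 0 ≤ r) (t₀ t : ℕ) :
    0 ≤ etaEarly C₁ r t₀ t := by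
  induction t with
  | zero => exact zero_le_one
  | succ t ih =>
    have ht : (0 : ℝ) ≤ t := Nat.cast_nonneg t
    have := mul_nonneg h0r ih
    simp only [etaEarly]; split_ifs <;> positivity

/-- Here no momentum damps the recursion, and `1/(C₁+t)` is a supersolution only once it varies
slowly compared with the rate `1 - r`, that is, after about `2/(1-r)` steps. The part forced after
`t₀` vanishes up to that time and then stays below the profile. -/
theorem etaSeq_sub_early_le (hC : 3 ≤ C₁) {r : ℝ} (h0r : 0 ≤ r) (hr : r < 1) {t₀ : ℕ}
    (ht₀ : 2 / (1 - r) ≤ t₀) (t : ℕ) :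
    etaSeq C₁ r t - etaEarly C₁ r t₀ t ≤ 2 * C₁ / (1 - r) * (1 / (C₁ + t)) ∧
      0 ≤ etaSeq C₁ r t - etaEarly C₁ r t₀ t ∧
      (t ≤ t₀ → etaSeq C₁ r t - etaEarly C₁ r t₀ t = 0) := by
  have hr' : 0 < 1 - r := by linarith
  induction t with
  | zero =>
    simp only [etaSeq, etaEarly, sub_self, le_refl, implies_true, and_true]
    simp only [Nat.cast_zero]; positivity
  | succ t ih =>
    obtain ⟨h1, h2, h3⟩ := ih
    have ht : (0 : ℝ) ≤ t := Nat.cast_nonneg t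
    simp only [etaSeq, etaEarly]
    by_cases htt : t < t₀
    · rw [if_pos htt, add_sub_add_right_eq_sub, ← mul_sub, h3 htt.le]
      simp only [mul_zero, le_refl, implies_true, and_true]
      positivity
    · rw [if_neg htt]
      refine ⟨?_, ?_, fun h => absurd h (by omega)⟩
      · have hle : (t₀ : ℝ) ≤ t := by exact_mod_cast not_lt.1 htt
        have hs : 2 / (1 - r) ≤ C₁ + t := by linarith
        rw [add_zero, add_sub_right_comm, ← mul_sub]
        push_cast
        obtain ⟨s, hs'⟩ : ∃ s, s = C₁ + t := ⟨_, rfl⟩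
        have hs0 : 0 < s := by rw [hs']; linarith
        rw [← add_assoc]
        rw [← hs'] at h1 hs ⊢
        calc _ ≤ r * (2 * C₁ / (1 - r) * (1 / s)) + C₁ / s := by gcongr
          _ ≤ _ := by
            rw [div_le_iff₀ hr'] at hs
            have e1 : r * (2 * C₁ / (1 - r) * (1 / s)) + C₁ / s =
              C₁ * (1 + r) / ((1 - r) * s) := by field_simp; ring
            have e2 : 2 * C₁ / (1 - r) * (1 / (s + 1)) = C₁ * 2 / ((1 - r) * (s + 1)) := by
              field_simp
            rw [e1, e2, div_le_div_iff₀ (by positivity) (by positivity)]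
            have : (1 + r) * (s + 1) ≤ 2 * s := by nlinarith
            have h5 : 0 ≤ C₁ * (1 - r) := by positivity
            nlinarith
      · have h6 : 0 ≤ C₁ / (C₁ + t) := by positivity
        have := mul_nonneg h0r h2
        linarith

/-- Both bounds come from summing the recursion, once with weight `C₁+t` and once with weight `1`.
With the first weight the forcing is at most `2C₁` per step and lasts for only `t₀` steps. -/
theorem sum_etaEarly_le (hC : 3 ≤ C₁) {r : ℝ} (h0r : 0 ≤ r) (hr : r < 1) (t₀ T : ℕ) :
    (1 - r) * ∑ t ∈ Finset.range T, (C₁ + t) * etaEarly C₁ r t₀ t ≤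
      C₁ + 2 * C₁ * t₀ + ∑ t ∈ Finset.range T, etaEarly C₁ r t₀ t ∧
    (1 - r) * ∑ t ∈ Finset.range T, etaEarly C₁ r t₀ t ≤
      1 + C₁ * ∑ t ∈ Finset.range T, 1 / (C₁ + t) := by
  have hn := etaEarly_nonneg (C₁ := C₁) (by linarith) h0r t₀
  have hind : ∀ t : ℕ, (0 : ℝ) ≤ (if t < t₀ then C₁ / (C₁ + t) else 0) ∧
      (if t < t₀ then C₁ / (C₁ + t) else 0) ≤ C₁ * (1 / (C₁ + t)) := fun t => by
    have ht : (0 : ℝ) ≤ t := Nat.cast_nonneg t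
    split_ifs
    · exact ⟨by positivity, by rw [mul_one_div]⟩
    · exact ⟨le_rfl, by positivity⟩
  constructor
  · have key : ∀ T, ∑ t ∈ Finset.range T, (C₁ + t) * etaEarly C₁ r t₀ t +
        (C₁ + T) * etaEarly C₁ r t₀ T =
        C₁ + r * ∑ t ∈ Finset.range T, (C₁ + t) * etaEarly C₁ r t₀ t
          + r * ∑ t ∈ Finset.range T, etaEarly C₁ r t₀ t
          + ∑ t ∈ Finset.range T, (C₁ + t + 1) * (if t < t₀ then C₁ / (C₁ + t) else 0) := by
      intro T
      induction T with
      | zero => simp [etaEarly]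
      | succ T ih =>
        simp only [Finset.sum_range_succ, etaEarly]
        push_cast
        linear_combination ih
    have h2 : ∀ T : ℕ, ∑ t ∈ Finset.range T, (C₁ + t + 1) * (if t < t₀ then C₁ / (C₁ + t) else 0)
        ≤ 2 * C₁ * (min T t₀ : ℕ) := by
      intro T
      induction T with
      | zero => simp
      | succ T ih =>
        rw [Finset.sum_range_succ]
        by_cases hT : T < t₀
        · rw [if_pos hT]
          have e1 : min (T + 1) t₀ = min T t₀ + 1 := by omega
          rw [e1]
          push_cast
          push_cast at ih
          have ht : (0 : ℝ) ≤ T := Nat.cast_nonneg T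
          have : (C₁ + T + 1) * (C₁ / (C₁ + T)) ≤ 2 * C₁ := by
            rw [mul_div_assoc', div_le_iff₀ (by positivity)]
            nlinarith
          linarith
        · rw [if_neg hT]
          have e1 : min (T + 1) t₀ = min T t₀ := by omega
          rw [e1]; simpa using ih
    have h3 : ((min T t₀ : ℕ) : ℝ) ≤ t₀ := by exact_mod_cast min_le_right _ _
    have h4 := key T
    have h5 := h2 T
    have h6 : 0 ≤ (C₁ + T) * etaEarly C₁ r t₀ T := by
      have := hn T
      have ht : (0 : ℝ) ≤ T := Nat.cast_nonneg T
      positivity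
    have h7 : 0 ≤ ∑ t ∈ Finset.range T, etaEarly C₁ r t₀ t := Finset.sum_nonneg fun t _ => hn t
    nlinarith
  · have key : ∀ T, ∑ t ∈ Finset.range T, etaEarly C₁ r t₀ t + etaEarly C₁ r t₀ T =
        1 + r * ∑ t ∈ Finset.range T, etaEarly C₁ r t₀ t
          + ∑ t ∈ Finset.range T, (if t < t₀ then C₁ / (C₁ + t) else 0) := by
      intro T
      induction T with
      | zero => simp [etaEarly]
      | succ T ih =>
        simp only [Finset.sum_range_succ, etaEarly]
        linear_combination ih
    have h4 := key T
    have h5 : ∑ t ∈ Finset.range T, (if t < t₀ then C₁ / (C₁ + t) else 0) ≤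
        C₁ * ∑ t ∈ Finset.range T, 1 / (C₁ + t) := by
      rw [Finset.mul_sum]
      exact Finset.sum_le_sum fun t _ => (hind t).2
    have := hn T
    linarith

/-- The truncation lets the early part enter linearly, so that the sums of `sum_etaEarly_le`
suffice; the late part enters through its square, of order `(1-r)⁻²(C₁+t)⁻²`. Each contributes `log
T/(1-r)²`. -/
theorem sum_min_etaSeq_le (hC : 3 ≤ C₁) {r : ℝ} (h0r : 0 ≤ r) (hr : r < 1) {T : ℕ} (hT : 2 ≤ T) :
    ∑ t ∈ Finset.range T, (C₁ + t) * min 1 (etaSeq C₁ r t ^ 2) ≤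
      100 * C₁ ^ 2 * (Real.log T / (1 - r) ^ 2) := by
  have hr' : 0 < 1 - r := by linarith
  set τ := 1 / (1 - r) with hτ
  have hτ1 : 1 ≤ τ := by rw [hτ, le_div_iff₀ hr']; linarith
  have hτr : τ * (1 - r) = 1 := by rw [hτ]; field_simp
  set t₀ := ⌈2 / (1 - r)⌉₊ with ht₀
  have h1 : 2 / (1 - r) ≤ t₀ := Nat.le_ceil _
  have h2 : (t₀ : ℝ) ≤ 3 * τ := by
    have := (Nat.ceil_lt_add_one (show 0 ≤ 2 / (1 - r) by positivity)).le
    have e : 2 / (1 - r) = 2 * τ := by rw [hτ]; ring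
    rw [e] at this
    rw [ht₀, e]
    linarith
  have hlog : 1 / 2 ≤ Real.log T := by
    have : Real.log 2 ≤ Real.log T := Real.log_le_log (by norm_num) (by exact_mod_cast hT)
    have := Real.log_two_gt_d9
    linarith
  have hpt : ∀ t ∈ Finset.range T, (C₁ + t) * min 1 (etaSeq C₁ r t ^ 2) ≤
      2 * ((C₁ + t) * etaEarly C₁ r t₀ t) + 8 * C₁ ^ 2 * τ ^ 2 * (1 / (C₁ + t)) := by
    intro t _
    have ht : (0 : ℝ) ≤ t := Nat.cast_nonneg t
    obtain ⟨ha, hb, -⟩ := etaSeq_sub_early_le hC h0r hr h1 t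
    set a := etaEarly C₁ r t₀ t
    set b := etaSeq C₁ r t - a with hbdef
    have ha0 : 0 ≤ a := etaEarly_nonneg (by linarith) h0r _ _
    have e : etaSeq C₁ r t = a + b := by rw [hbdef]; ring
    -- If `a ≥ 1`, use the bound `1`; otherwise `(a+b)² ≤ 2a² + 2b²` and `a² ≤ a`.
    have hmin : min 1 (etaSeq C₁ r t ^ 2) ≤ 2 * a + 2 * b ^ 2 := by
      by_cases h : 1 ≤ a
      · exact (min_le_left _ _).trans (by nlinarith)
      · refine (min_le_right _ _).trans ?_
        rw [e]
        nlinarith [sq_nonneg (a - b)]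
    have hb2 : b ^ 2 ≤ (2 * C₁ * τ * (1 / (C₁ + t))) ^ 2 := by
      refine pow_le_pow_left₀ hb (ha.trans (le_of_eq ?_)) 2
      rw [hτ]; ring
    have hp : 0 < C₁ + t := by linarith
    calc _ ≤ (C₁ + t) * (2 * a + 2 * (2 * C₁ * τ * (1 / (C₁ + t))) ^ 2) := by
          gcongr; linarith
      _ = _ := by field_simp; ring
  refine (Finset.sum_le_sum hpt).trans ?_
  rw [Finset.sum_add_distrib, ← Finset.mul_sum, ← Finset.mul_sum]
  obtain ⟨h3, h4⟩ := sum_etaEarly_le hC h0r hr t₀ T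
  have h5 := sum_inv_le_log (C₁ := C₁) (by linarith) T
  set A := ∑ t ∈ Finset.range T, (C₁ + t) * etaEarly C₁ r t₀ t
  set S := ∑ t ∈ Finset.range T, etaEarly C₁ r t₀ t
  set H := ∑ t ∈ Finset.range T, 1 / (C₁ + t)
  set l := Real.log T
  have hS : S ≤ τ * (1 + C₁ * H) := by
    calc S = τ * ((1 - r) * S) := by rw [← mul_assoc, hτr, one_mul]
      _ ≤ _ := by gcongr
  have hA : A ≤ τ * (C₁ + 2 * C₁ * t₀ + S) := by
    calc A = τ * ((1 - r) * A) := by rw [← mul_assoc, hτr, one_mul]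
      _ ≤ _ := by gcongr
  have hH : H ≤ 3 * l := by linarith
  have e1 : l / (1 - r) ^ 2 = l * τ ^ 2 := by rw [hτ]; field_simp
  rw [e1]
  have hτ2 : τ ≤ τ ^ 2 := by nlinarith
  have hS' : S ≤ τ * (C₁ * (5 * l)) := hS.trans (by gcongr; nlinarith)
  have hA' : A ≤ τ * (C₁ * τ * (19 * l)) := by
    refine hA.trans ?_
    gcongr
    have : C₁ + 2 * C₁ * t₀ ≤ C₁ * τ * 7 := by nlinarith
    have h7 : C₁ * τ * 7 ≤ C₁ * τ * (14 * l) := by gcongr; linarith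
    nlinarith
  have h8 : 8 * C₁ ^ 2 * τ ^ 2 * H ≤ 8 * C₁ ^ 2 * τ ^ 2 * (3 * l) := by gcongr
  have h9 : C₁ * (τ ^ 2 * l) ≤ C₁ ^ 2 * (τ ^ 2 * l) := by
    gcongr; nlinarith
  nlinarith

end Sequences

end DSMO

end

noncomputable section

namespace DSMO

open scoped ENNReal

/-! ### Fresh samples -/

section Fresh

variable {Ω S Q : Type*} [MeasurableSpace S]

/-- The `σ`-algebra generated by the answers to the queries in `s`. -/
@[reducible] def sigmaOf (ξ : Q → Ω → S) (s : Set Q) : MeasurableSpace Ω :=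
  ⨆ q ∈ s, MeasurableSpace.comap (ξ q) inferInstance

theorem sigmaOf_mono (ξ : Q → Ω → S) {s s' : Set Q} (h : s ⊆ s') : sigmaOf ξ s ≤ sigmaOf ξ s' :=
  biSup_mono h

theorem measurable_sigmaOf (ξ : Q → Ω → S) {s : Set Q} {q : Q} (hq : q ∈ s) :
    Measurable[sigmaOf ξ s] (ξ q) :=
  (comap_measurable (ξ q)).mono
    (le_iSup₂ (f := fun q (_ : q ∈ s) => MeasurableSpace.comap (ξ q) inferInstance) q hq) le_rfl

variable [MeasurableSpace Ω] {P : Measure Ω}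

theorem sigmaOf_le {ξ : Q → Ω → S} (hξ : ∀ q, Measurable (ξ q)) (s : Set Q) :
    sigmaOf ξ s ≤ ‹MeasurableSpace Ω› :=
  iSup₂_le fun q _ => (hξ q).comap_le

/-- Integration over a fresh sample. -/
theorem lintegral_fresh [IsProbabilityMeasure P] {ξ : Q → Ω → S} (hξ : ∀ q, Measurable (ξ q))
    (hind : iIndepFun ξ P) {s : Set Q} {q : Q} (hq : q ∉ s) {E : Type*} [MeasurableSpace E]
    {X : Ω → E} (hX : Measurable[sigmaOf ξ s] X) {φ : E × S → ℝ≥0∞} (hφ : Measurable φ) :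
    ∫⁻ ω, φ (X ω, ξ q ω) ∂P = ∫⁻ ω, ∫⁻ z, φ (X ω, z) ∂(P.map (ξ q)) ∂P := by
  have hX' : Measurable X := hX.mono (sigmaOf_le hξ s) le_rfl
  have h1 : Indep (sigmaOf ξ s) (MeasurableSpace.comap (ξ q) inferInstance) P := by
    have := indep_iSup_of_disjoint (m := fun q => MeasurableSpace.comap (ξ q) inferInstance)
      (fun q => (hξ q).comap_le) hind (S := s) (T := {q}) (by simpa using hq)
    simpa [sigmaOf] using this
  have h2 : IndepFun X (ξ q) P := by
    rw [IndepFun_iff_Indep]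
    exact indep_of_indep_of_le_left h1 hX.comap_le
  have : IsProbabilityMeasure (P.map (ξ q)) := Measure.isProbabilityMeasure_map (hξ q).aemeasurable
  have : IsProbabilityMeasure (P.map X) := Measure.isProbabilityMeasure_map hX'.aemeasurable
  have h3 := (indepFun_iff_map_prod_eq_prod_map_map hX'.aemeasurable (hξ q).aemeasurable).1 h2
  calc ∫⁻ ω, φ (X ω, ξ q ω) ∂P = ∫⁻ z, φ z ∂(P.map fun ω => (X ω, ξ q ω)) :=
        (lintegral_map hφ (hX'.prodMk (hξ q))).symm
    _ = ∫⁻ x, ∫⁻ z, φ (x, z) ∂(P.map (ξ q)) ∂(P.map X) := by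
        rw [h3, lintegral_prod _ hφ.aemeasurable]
    _ = _ := lintegral_map hφ.lintegral_prod_right' hX'

/-- The cross term with the fixed vector `b` vanishes by unbiasedness, and centring does not
increase the second moment. The linear map `f` carries operator-valued samples into a Hilbert space,
where this expansion makes sense. -/
theorem lintegral_norm_sq_centered_le {ν : Measure S} [IsProbabilityMeasure ν]
    {V : Type*} [NormedAddCommGroup V] [NormedSpace ℝ V] [CompleteSpace V] {n : ℕ}
    {X : S → V} {m : V} {C : ℝ} (h1 : Unbiased ν X m) (h2 : SecondMomentLE ν X C)
    (f : V →L[ℝ] EuclideanSpace ℝ (Fin n)) (b : EuclideanSpace ℝ (Fin n)) (c : ℝ) :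
    ∫⁻ s, ENNReal.ofReal (‖b + c • f (X s - m)‖ ^ 2) ∂ν ≤
      ENNReal.ofReal (‖b‖ ^ 2) + ENNReal.ofReal (c ^ 2 * (‖f‖ * C) ^ 2) := by
  obtain ⟨hi, hm⟩ := h1
  obtain ⟨hL, hC⟩ := h2
  have hfX : MemLp (fun s => f (X s)) 2 ν := f.comp_memLp' hL
  have hmem : MemLp (fun s => f (X s - m)) 2 ν := by
    have e : (fun s => f (X s - m)) = (fun s => f (X s)) - fun _ => f m := by
      funext s; simp
    rw [e]
    exact hfX.sub (memLp_const (f m))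
  have hint : Integrable (fun s => ‖f (X s - m)‖ ^ 2) ν := hmem.integrable_norm_pow (by norm_num)
  have hintX : Integrable (fun s => ‖X s‖ ^ 2) ν := hL.integrable_norm_pow (by norm_num)
  have hintfX : Integrable (fun s => ‖f (X s)‖ ^ 2) ν := hfX.integrable_norm_pow (by norm_num)
  have hin : Integrable (fun s => X s - m) ν := hi.sub (integrable_const m)
  have hz : ∫ s, f (X s - m) ∂ν = 0 := by
    rw [f.integral_comp_comm hin, integral_sub hi (integrable_const m), hm]
    simp
  have hinf : Integrable (fun s => f (X s - m)) ν := f.integrable_comp hin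
  have hii : Integrable (fun s => inner ℝ b (f (X s - m))) ν := hinf.const_inner b
  have e1 : ∀ s, ‖b + c • f (X s - m)‖ ^ 2 =
      ‖b‖ ^ 2 + 2 * c * inner ℝ b (f (X s - m)) + c ^ 2 * ‖f (X s - m)‖ ^ 2 := fun s => by
    rw [norm_add_sq_real, inner_smul_right, norm_smul, mul_pow, Real.norm_eq_abs, sq_abs]; ring
  have hI : Integrable (fun s => ‖b + c • f (X s - m)‖ ^ 2) ν := by
    simp_rw [e1]
    exact ((integrable_const _).add (hii.const_mul _)).add (hint.const_mul _)
  have hle : ∫ s, ‖f (X s - m)‖ ^ 2 ∂ν ≤ (‖f‖ * C) ^ 2 := by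
    have e2 : ∀ s, ‖f (X s - m)‖ ^ 2 = ‖f (X s)‖ ^ 2 - 2 * inner ℝ (f m) (f (X s - m))
        - ‖f m‖ ^ 2 := fun s => by
      have : f (X s) = f (X s - m) + f m := by simp
      rw [this, norm_add_sq_real, real_inner_comm]; ring
    calc ∫ s, ‖f (X s - m)‖ ^ 2 ∂ν = ∫ s, ‖f (X s)‖ ^ 2 ∂ν
          - 2 * ∫ s, inner ℝ (f m) (f (X s - m)) ∂ν - ‖f m‖ ^ 2 := by
          simp_rw [e2]
          rw [integral_sub, integral_sub hintfX ((hinf.const_inner _).const_mul _),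
            integral_const_mul]
          · simp
          · exact hintfX.sub ((hinf.const_inner _).const_mul _)
          · exact integrable_const _
      _ ≤ ∫ s, ‖f (X s)‖ ^ 2 ∂ν := by
          rw [integral_inner hinf, hz, inner_zero_right]
          nlinarith [sq_nonneg ‖f m‖]
      _ ≤ ∫ s, ‖f‖ ^ 2 * ‖X s‖ ^ 2 ∂ν := by
          refine integral_mono hintfX (hintX.const_mul _) fun s => ?_
          simp only
          rw [← mul_pow]
          exact pow_le_pow_left₀ (norm_nonneg _) (f.le_opNorm _) 2
      _ ≤ _ := by
          rw [integral_const_mul, mul_pow]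
          gcongr
  rw [← ofReal_integral_eq_lintegral_ofReal hI (Filter.Eventually.of_forall fun s => by positivity),
    ← ENNReal.ofReal_add (by positivity) (by positivity)]
  refine ENNReal.ofReal_le_ofReal ?_
  simp_rw [e1]
  have i1 := integral_add ((integrable_const (μ := ν) (‖b‖ ^ 2)).add (hii.const_mul (2 * c)))
    (hint.const_mul (c ^ 2))
  have i2 := integral_add (integrable_const (μ := ν) (‖b‖ ^ 2)) (hii.const_mul (2 * c))
  simp only [Pi.add_apply] at i1 i2
  rw [i1, i2, integral_const_mul, integral_const_mul, integral_inner hinf, hz, inner_zero_right]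
  simp only [integral_const, probReal_univ, smul_eq_mul, one_mul, mul_zero, add_zero]
  gcongr

/-- `N` is a noisy observation with mean `m` whose second moment, conditionally on the `σ`-algebra
`𝒢`, is at most `C²`. -/
structure IsFresh {V : Type*} [NormedAddCommGroup V] [NormedSpace ℝ V] (P : Measure Ω)
    (𝒢 : MeasurableSpace Ω) (N m : Ω → V) (C : ℝ) : Prop where
  moment : ∀ A : Ω → ℝ≥0∞, Measurable[𝒢] A →
    ∫⁻ ω, A ω * ENNReal.ofReal (‖N ω‖ ^ 2) ∂P ≤ ∫⁻ ω, A ω * ENNReal.ofReal (C ^ 2) ∂P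
  centered : ∀ (n : ℕ) (f : V →L[ℝ] EuclideanSpace ℝ (Fin n)) (A : Ω → ℝ≥0∞)
    (B : Ω → EuclideanSpace ℝ (Fin n)) (c : ℝ), Measurable[𝒢] A → Measurable[𝒢] B →
    ∫⁻ ω, A ω * ENNReal.ofReal (‖B ω + c • f (N ω - m ω)‖ ^ 2) ∂P ≤
      ∫⁻ ω, A ω * (ENNReal.ofReal (‖B ω‖ ^ 2) + ENNReal.ofReal (c ^ 2 * (‖f‖ * C) ^ 2)) ∂P

/-- The query point is known before the sample is drawn, so the sample can be integrated out first.
Unbiasedness is used at every point, to make `m` measurable, but the moment bound only along the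
actual queries, which is all that confinement of the iterates provides. -/
theorem isFresh_of_sampling [IsProbabilityMeasure P] {ξ : Q → Ω → S} (hξ : ∀ q, Measurable (ξ q))
    (hind : iIndepFun ξ P) {s : Set Q} {q : Q} (hq : q ∉ s) {E : Type*} [MeasurableSpace E]
    {V : Type*} [NormedAddCommGroup V] [NormedSpace ℝ V] [FiniteDimensional ℝ V]
    [MeasurableSpace V] [BorelSpace V]
    {X : Ω → E} (hX : Measurable[sigmaOf ξ s] X) {n : E → S → V}
    (hn : Measurable fun z : E × S => n z.1 z.2) {m : E → V} {C : ℝ}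
    (hmean : ∀ x, Unbiased (P.map (ξ q)) (n x) (m x))
    (hmom : ∀ᵐ ω ∂P, SecondMomentLE (P.map (ξ q)) (n (X ω)) C) :
    IsFresh P (sigmaOf ξ s) (fun ω => n (X ω) (ξ q ω)) (fun ω => m (X ω)) C := by
  have : IsProbabilityMeasure (P.map (ξ q)) := Measure.isProbabilityMeasure_map (hξ q).aemeasurable
  have : CompleteSpace V := FiniteDimensional.complete ℝ V
  have : ProperSpace V := FiniteDimensional.proper ℝ V
  have hm : Measurable m := by
    have h1 : StronglyMeasurable fun x => ∫ z, n x z ∂(P.map (ξ q)) :=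
      StronglyMeasurable.integral_prod_right' (f := fun z : E × S => n z.1 z.2) hn.stronglyMeasurable
    have h2 : (fun x => ∫ z, n x z ∂(P.map (ξ q))) = m := funext fun x => (hmean x).2
    rw [← h2]
    exact h1.measurable
  constructor
  · intro A hA
    have hφ : Measurable fun z : (ℝ≥0∞ × E) × S =>
        z.1.1 * ENNReal.ofReal (‖n z.1.2 z.2‖ ^ 2) :=
      measurable_fst.fst.mul
        (((hn.comp (measurable_fst.snd.prodMk measurable_snd)).norm.pow_const 2).ennreal_ofReal)
    have := lintegral_fresh hξ hind hq (hA.prodMk hX) hφ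
    simp only at this
    rw [this]
    refine lintegral_mono_ae (hmom.mono fun ω h => ?_)
    have hnx : Measurable (n (X ω)) := hn.comp measurable_prodMk_left
    rw [lintegral_const_mul _ (hnx.norm.pow_const 2).ennreal_ofReal]
    gcongr
    rw [← ofReal_integral_eq_lintegral_ofReal (h.1.integrable_norm_pow (by norm_num))
      (Filter.Eventually.of_forall fun s => by positivity)]
    exact ENNReal.ofReal_le_ofReal h.2
  · intro n' f A B c hA hB
    have hφ : Measurable fun z : (ℝ≥0∞ × EuclideanSpace ℝ (Fin n') × E) × S =>
        z.1.1 * ENNReal.ofReal (‖z.1.2.1 + c • f (n z.1.2.2 z.2 - m z.1.2.2)‖ ^ 2) := by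
      refine measurable_fst.fst.mul (Measurable.ennreal_ofReal (Measurable.pow_const ?_ 2))
      refine Measurable.norm (measurable_fst.snd.fst.add (Measurable.const_smul ?_ c))
      refine f.measurable.comp ((hn.comp (measurable_fst.snd.snd.prodMk measurable_snd)).sub ?_)
      exact hm.comp measurable_fst.snd.snd
    have := lintegral_fresh hξ hind hq (hA.prodMk (hB.prodMk hX)) hφ
    simp only at this
    rw [this]
    refine lintegral_mono_ae (hmom.mono fun ω h => ?_)
    have hnx : Measurable (n (X ω)) := hn.comp measurable_prodMk_left
    rw [lintegral_const_mul]
    · gcongr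
      exact lintegral_norm_sq_centered_le (hmean _) h f _ _
    · refine Measurable.ennreal_ofReal (Measurable.pow_const ?_ 2)
      exact Measurable.norm (measurable_const.add ((f.measurable.comp (hnx.sub measurable_const)).const_smul c))

/-- The agents are added one at a time: the noise of the others is known to `𝒢 k` and is absorbed
into `B`. Hence variances add, and coefficients of size `1/K` leave a total of `1/K`. -/
theorem IsFresh.lintegral_sum_le {V : Type*} [NormedAddCommGroup V] [NormedSpace ℝ V]
    [FiniteDimensional ℝ V] [MeasurableSpace V] [BorelSpace V] {K n : ℕ}
    {𝒢 : Fin K → MeasurableSpace Ω} {N m : Fin K → Ω → V} {C : ℝ}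
    (h : ∀ k, IsFresh P (𝒢 k) (N k) (m k) C)
    (hN : ∀ j k, j ≠ k → Measurable[𝒢 k] (N j)) (hm : ∀ j k, j ≠ k → Measurable[𝒢 k] (m j))
    (f : V →L[ℝ] EuclideanSpace ℝ (Fin n)) {A : Ω → ℝ≥0∞} {B : Ω → EuclideanSpace ℝ (Fin n)}
    (hA₀ : Measurable A) (hA : ∀ k, Measurable[𝒢 k] A) (hB : ∀ k, Measurable[𝒢 k] B)
    (a : Fin K → ℝ) :
    ∫⁻ ω, A ω * ENNReal.ofReal (‖B ω + ∑ k, a k • f (N k ω - m k ω)‖ ^ 2) ∂P ≤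
      ∫⁻ ω, A ω * (ENNReal.ofReal (‖B ω‖ ^ 2)
        + ENNReal.ofReal ((∑ k, a k ^ 2) * (‖f‖ * C) ^ 2)) ∂P := by
  have hp : ProperSpace V := FiniteDimensional.proper ℝ V
  have hadd : ∀ (x : Ω → ℝ≥0∞) (d : ℝ≥0∞), ∫⁻ ω, A ω * (x ω + d) ∂P =
      ∫⁻ ω, A ω * x ω ∂P + ∫⁻ ω, A ω * d ∂P := fun x d => by
    simp_rw [mul_add]
    exact lintegral_add_right _ (hA₀.mul_const d)
  have key : ∀ s : Finset (Fin K),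
      ∫⁻ ω, A ω * ENNReal.ofReal (‖B ω + ∑ k ∈ s, a k • f (N k ω - m k ω)‖ ^ 2) ∂P ≤
      ∫⁻ ω, A ω * (ENNReal.ofReal (‖B ω‖ ^ 2)
        + ENNReal.ofReal ((∑ k ∈ s, a k ^ 2) * (‖f‖ * C) ^ 2)) ∂P := by
    intro s
    induction s using Finset.induction_on with
    | empty => simp
    | insert k s hk ih =>
      have hmeas : Measurable[𝒢 k] fun ω => B ω + ∑ i ∈ s, a i • f (N i ω - m i ω) := by
        refine (hB k).add (Finset.measurable_sum _ fun i hi => Measurable.const_smul ?_ (a i))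
        have hij : i ≠ k := fun h => hk (h ▸ hi)
        exact f.measurable.comp ((hN i k hij).sub (hm i k hij))
      have e : ∀ ω, B ω + ∑ i ∈ insert k s, a i • f (N i ω - m i ω) =
          (B ω + ∑ i ∈ s, a i • f (N i ω - m i ω)) + a k • f (N k ω - m k ω) := fun ω => by
        rw [Finset.sum_insert hk]; abel
      simp_rw [e]
      refine ((h k).centered n f A _ (a k) (hA k) hmeas).trans ?_
      rw [hadd]
      refine (add_le_add_left ih _).trans_eq ?_
      rw [hadd, hadd, add_assoc, ← lintegral_add_right _ (hA₀.mul_const _), Finset.sum_insert hk,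
        add_mul (a k ^ 2), ENNReal.ofReal_add (by positivity) (mul_nonneg (Finset.sum_nonneg
          fun i _ => sq_nonneg (a i)) (sq_nonneg _))]
      simp_rw [mul_add]
      congr 1
      exact lintegral_congr fun ω => add_comm _ _
  exact key Finset.univ

end Fresh

end DSMO

end

noncomputable section

namespace DSMO

open scoped ENNReal

/-! ### Moments of products over independent channels -/

section Product

variable {Ω : Type*} [MeasurableSpace Ω] {P : Measure Ω}

/-- If the conditional expectation of every functional `Φ i (t+1) l` of channel `i`, given everything
but the fresh samples of the channel, is at most a combination of functionals `Φ i t l'` of the same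
channel, then expectations of products over the channels are bounded by products of bounds. -/
theorem lintegral_prod_le_prod [IsProbabilityMeasure P] {ι : Type*} [Fintype ι] [DecidableEq ι]
    {Λ : ι → Type*}
    {Φ : (i : ι) → ℕ → Λ i → Ω → ℝ≥0∞} {D : (i : ι) → ℕ → Λ i → ℝ≥0∞}
    (𝒢 : ι → ℕ → MeasurableSpace Ω) (h𝒢 : ∀ i t, 𝒢 i t ≤ ‹MeasurableSpace Ω›) {T : ℕ}
    (h0 : ∀ i l ω, Φ i 0 l ω ≤ D i 0 l)
    (hstep : ∀ i, ∀ t < T, ∀ l, ∃ (n : ℕ) (c : Fin n → ℝ≥0∞) (l' : Fin n → Λ i),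
      ∑ j, c j * D i t (l' j) ≤ D i (t + 1) l ∧
      ∀ A : Ω → ℝ≥0∞, Measurable[𝒢 i t] A →
        ∫⁻ ω, A ω * Φ i (t + 1) l ω ∂P ≤ ∫⁻ ω, A ω * ∑ j, c j * Φ i t (l' j) ω ∂P)
    (hm : ∀ i j, ∀ t < T, ∀ l, Measurable[𝒢 i t] (Φ j t l))
    (hm' : ∀ i j, i ≠ j → ∀ t < T, ∀ l, Measurable[𝒢 i t] (Φ j (t + 1) l)) :
    ∀ t ≤ T, ∀ l : (i : ι) → Λ i, ∫⁻ ω, ∏ i, Φ i t (l i) ω ∂P ≤ ∏ i, D i t (l i) := by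
  intro t
  induction t with
  | zero =>
    intro _ l
    calc ∫⁻ ω, ∏ i, Φ i 0 (l i) ω ∂P ≤ ∫⁻ _, ∏ i, D i 0 (l i) ∂P :=
          lintegral_mono fun ω => Finset.prod_le_prod' fun i _ => h0 i _ ω
      _ = _ := by simp
  | succ t ih =>
    intro ht l
    have ht' : t < T := ht
    choose n c l' hD hA using fun i => hstep i t ht' (l i)
    set Ψ : ι → Ω → ℝ≥0∞ := fun i ω => ∑ j, c i j * Φ i t (l' i j) ω with hΨ
    have hΨm : ∀ i j, Measurable[𝒢 i t] (Ψ j) := fun i j =>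
      Finset.measurable_sum _ fun a _ => (hm i j t ht' _).const_mul _
    -- A hybrid argument: the channels in `s` have already been pulled back to time `t`. All the
    -- other factors, at time `t` or `t + 1`, are measurable for `𝒢 k t`, so their product is an
    -- admissible weight for the step of channel `k`.
    have key : ∀ s : Finset ι, ∫⁻ ω, ∏ i, Φ i (t + 1) (l i) ω ∂P ≤
        ∫⁻ ω, (∏ i ∈ s, Ψ i ω) * ∏ i ∈ sᶜ, Φ i (t + 1) (l i) ω ∂P := by
      intro s
      induction s using Finset.induction_on with
      | empty => simp
      | insert k s hk ihs =>
        refine ihs.trans ?_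
        have e1 : ∀ ω, ∏ i ∈ sᶜ, Φ i (t + 1) (l i) ω =
            Φ k (t + 1) (l k) ω * ∏ i ∈ (insert k s)ᶜ, Φ i (t + 1) (l i) ω := fun ω => by
          rw [Finset.compl_insert, Finset.mul_prod_erase _ (fun i => Φ i (t + 1) (l i) ω)
            (Finset.mem_compl.2 hk)]
        have e2 : ∀ ω, (∏ i ∈ s, Ψ i ω) * ∏ i ∈ sᶜ, Φ i (t + 1) (l i) ω =
            ((∏ i ∈ s, Ψ i ω) * ∏ i ∈ (insert k s)ᶜ, Φ i (t + 1) (l i) ω)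
              * Φ k (t + 1) (l k) ω := fun ω => by rw [e1]; ring
        have e3 : ∀ ω, (∏ i ∈ insert k s, Ψ i ω) * ∏ i ∈ (insert k s)ᶜ, Φ i (t + 1) (l i) ω =
            ((∏ i ∈ s, Ψ i ω) * ∏ i ∈ (insert k s)ᶜ, Φ i (t + 1) (l i) ω) * Ψ k ω := fun ω => by
          rw [Finset.prod_insert hk]; ring
        simp_rw [e2, e3]
        refine hA k _ (Measurable.mul ?_ ?_)
        · exact Finset.measurable_prod _ fun i _ => hΨm k i
        · refine Finset.measurable_prod _ fun i hi => hm' k i ?_ t ht' _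
          rintro rfl
          simp at hi
    refine (key Finset.univ).trans ?_
    simp only [Finset.compl_univ, Finset.prod_empty, mul_one]
    -- Expanding the product of sums leaves monomials with one functional per channel at time `t`,
    -- to which the induction hypothesis applies; the bounds are then factored back.
    calc ∫⁻ ω, ∏ i, Ψ i ω ∂P
        = ∫⁻ ω, ∑ f ∈ Fintype.piFinset fun i => (Finset.univ : Finset (Fin (n i))),
            ∏ i, c i (f i) * Φ i t (l' i (f i)) ω ∂P := by
          simp_rw [hΨ, Finset.prod_univ_sum]
      _ = ∑ f ∈ Fintype.piFinset fun i => (Finset.univ : Finset (Fin (n i))),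
            ∫⁻ ω, ∏ i, c i (f i) * Φ i t (l' i (f i)) ω ∂P := by
          refine lintegral_finsetSum _ fun f _ => Finset.measurable_prod _ fun i _ => ?_
          exact ((hm i i t ht' _).const_mul _).mono (h𝒢 i t) le_rfl
      _ ≤ ∑ f ∈ Fintype.piFinset fun i => (Finset.univ : Finset (Fin (n i))),
            ∏ i, c i (f i) * D i t (l' i (f i)) := by
          refine Finset.sum_le_sum fun f _ => ?_
          simp_rw [Finset.prod_mul_distrib]
          rw [lintegral_const_mul _ (Finset.measurable_prod _ fun i _ =>
            (hm i i t ht' _).mono (h𝒢 i t) le_rfl)]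
          gcongr
          exact ih ht'.le _
      _ = ∏ i, ∑ j, c i j * D i t (l' i j) := by
          rw [Finset.prod_univ_sum]
      _ ≤ _ := Finset.prod_le_prod' fun i _ => hD i

end Product

/-! ### Momentum channels -/

/-- Labels of the functionals of a channel: the constant `1`, the squared norm of the estimate of
agent `k`, and the square of a linear combination of the accumulated noises of the agents. -/
inductive Lab (K : ℕ)
  | one
  | size (k : Fin K)
  | noise (a : Fin K → ℝ)

/-- The variance of the network average, relative to `1/K`. -/
def pSeq (C₁ : ℝ) : ℕ → ℝ
  | 0 => 0
  | t + 1 => (1 - C₁ / (C₁ + t)) ^ 2 * pSeq C₁ t + (C₁ / (C₁ + t)) ^ 2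

/-- The variance of the deviation from the network average. -/
def qSeq (C₁ ρ : ℝ) : ℕ → ℝ
  | 0 => 0
  | t + 1 => ρ * (1 - C₁ / (C₁ + t)) ^ 2 * qSeq C₁ ρ t + (C₁ / (C₁ + t)) ^ 2

theorem pSeq_nonneg (C₁ : ℝ) (t : ℕ) : 0 ≤ pSeq C₁ t := by
  induction t with
  | zero => exact le_rfl
  | succ t ih => simp only [pSeq]; positivity

theorem qSeq_nonneg (C₁ : ℝ) {ρ : ℝ} (hρ : 0 ≤ ρ) (t : ℕ) : 0 ≤ qSeq C₁ ρ t := by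
  induction t with
  | zero => exact le_rfl
  | succ t ih => simp only [qSeq]; positivity

section Channel

variable {Ω : Type*} {K : ℕ} {V : Type*} [NormedAddCommGroup V] [NormedSpace ℝ V]
  [FiniteDimensional ℝ V]

/-- The functional with a given label. -/
def labFun (X G : Fin K → Ω → V) : Lab K → Ω → ℝ
  | .one, _ => 1
  | .size k, ω => ‖X k ω‖ ^ 2
  | .noise a, ω => ‖∑ k, a k • toEuclidean (X k ω - G k ω)‖ ^ 2

/-- The bound for the functional with a given label. -/
def labBound (V : Type*) [NormedAddCommGroup V] [NormedSpace ℝ V] [FiniteDimensional ℝ V]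
    (C C₁ ρ : ℝ) (t : ℕ) : Lab K → ℝ
  | .one => 1
  | .size _ => C ^ 2
  | .noise a => (‖(toEuclidean : V ≃L[ℝ] _).toContinuousLinearMap‖ * C) ^ 2 *
      (pSeq C₁ t * ((∑ k, a k) ^ 2 / K) + qSeq C₁ ρ t * (∑ k, (a k - avg a) ^ 2))

theorem labFun_nonneg (X G : Fin K → Ω → V) (l : Lab K) (ω : Ω) : 0 ≤ labFun X G l ω := by
  cases l <;> simp only [labFun] <;> positivity

theorem labBound_nonneg {C C₁ ρ : ℝ} (hρ : 0 ≤ ρ) (t : ℕ) (l : Lab K) :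
    0 ≤ labBound V C C₁ ρ t l := by
  have := pSeq_nonneg C₁ t
  have := qSeq_nonneg C₁ hρ t
  cases l <;> simp only [labBound] <;> positivity

theorem measurable_labFun [m : MeasurableSpace Ω] [MeasurableSpace V] [BorelSpace V]
    {X G : Fin K → Ω → V} (hX : ∀ k, Measurable (X k)) (hG : ∀ k, Measurable (G k)) (l : Lab K) :
    Measurable (labFun X G l) := by
  have : ProperSpace V := FiniteDimensional.proper ℝ V
  cases l with
  | one => exact measurable_const
  | size k => exact (hX k).norm.pow_const 2
  | noise a =>
    refine (Measurable.norm (Finset.measurable_sum _ fun k _ => ?_)).pow_const 2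
    exact ((toEuclidean : V ≃L[ℝ] _).continuous.measurable.comp ((hX k).sub (hG k))).const_smul (a k)

/-- Pythagoras for the mean and the deviation. The fresh variance `∑ a²` splits into exactly the two
parts that `pSeq` and `qSeq` follow. -/
theorem sum_sq_eq_add_dev (a : Fin K → ℝ) :
    ∑ k, a k ^ 2 = (∑ k, a k) ^ 2 / K + ∑ k, (a k - avg a) ^ 2 := by
  rcases Nat.eq_zero_or_pos K with h | h
  · subst h; simp
  · have hK : (K : ℝ) ≠ 0 := by positivity
    have e : ∀ k, (a k - avg a) ^ 2 = a k ^ 2 - 2 * avg a * a k + avg a ^ 2 := fun k => by ring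
    have e2 : avg a = (∑ k, a k) / K := by simp [avg]; field_simp
    simp_rw [e]
    rw [Finset.sum_add_distrib, Finset.sum_sub_distrib, ← Finset.mul_sum, e2]
    simp
    field_simp
    ring

variable [MeasurableSpace V] [BorelSpace V]
  {W : Matrix (Fin K) (Fin K) ℝ} {ρ : ℝ}

/-- One round of a momentum channel. -/
theorem labFun_step {𝒢₀ : MeasurableSpace Ω} {𝒢 : Fin K → MeasurableSpace Ω}
    [mΩ : MeasurableSpace Ω] {P : Measure Ω} (hW : IsGossip W ρ) (h0ρ : 0 ≤ ρ) {C C₁ : ℝ} {t : ℕ}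
    (hC₁ : 0 < C₁)
    {X G X' G' N m : Fin K → Ω → V}
    (hX' : ∀ k ω, X' k ω = (1 - C₁ / (C₁ + t)) • mix W (fun j => X j ω) k + (C₁ / (C₁ + t)) • N k ω)
    (hG' : ∀ k ω, G' k ω = (1 - C₁ / (C₁ + t)) • mix W (fun j => G j ω) k + (C₁ / (C₁ + t)) • m k ω)
    (h𝒢₀ : 𝒢₀ ≤ mΩ) (h𝒢 : ∀ k, 𝒢₀ ≤ 𝒢 k)
    (h : ∀ k, IsFresh P (𝒢 k) (N k) (m k) C)
    (hN : ∀ j k, j ≠ k → Measurable[𝒢 k] (N j)) (hm : ∀ j k, j ≠ k → Measurable[𝒢 k] (m j))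
    (hX : ∀ k, Measurable[𝒢₀] (X k)) (hG : ∀ k, Measurable[𝒢₀] (G k)) (l : Lab K) :
    ∃ (n : ℕ) (c : Fin n → ℝ≥0∞) (l' : Fin n → Lab K),
      ∑ j, c j * ENNReal.ofReal (labBound V C C₁ ρ t (l' j)) ≤
        ENNReal.ofReal (labBound V C C₁ ρ (t + 1) l) ∧
      ∀ A : Ω → ℝ≥0∞, Measurable[𝒢₀] A →
        ∫⁻ ω, A ω * ENNReal.ofReal (labFun X' G' l ω) ∂P ≤
          ∫⁻ ω, A ω * ∑ j, c j * ENNReal.ofReal (labFun X G (l' j) ω) ∂P := by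
  have hp : ProperSpace V := FiniteDimensional.proper ℝ V
  have ht : (0 : ℝ) ≤ t := Nat.cast_nonneg t
  set β := C₁ / (C₁ + t) with hβ
  have hβ0 : 0 ≤ β := by positivity
  have hβ1 : 0 ≤ 1 - β := by
    rw [hβ, sub_nonneg, div_le_one (by positivity)]; linarith
  cases l with
  | one => exact ⟨1, fun _ => 1, fun _ => .one, by simp [labBound], fun A _ => by simp [labFun]⟩
  -- Convexity of the squared norm: the `K` sizes enter with weights `(1-β) W k j`, and the
  -- observation enters through its second moment, carried by the label `one`. The weights sum to
  -- `1`, so the bound `C²` reproduces itself.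
  | size k =>
    refine ⟨K + 1, Fin.cons (ENNReal.ofReal (β * C ^ 2)) fun j => ENNReal.ofReal ((1 - β) * W k j),
      Fin.cons .one fun j => .size j, ?_, fun A hA => ?_⟩
    · rw [Fin.sum_univ_succ]
      simp only [Fin.cons_zero, Fin.cons_succ, labBound, ENNReal.ofReal_one, mul_one]
      rw [← Finset.sum_mul, ← ENNReal.ofReal_sum_of_nonneg fun j _ => mul_nonneg hβ1 (hW.nonneg k j),
        ← Finset.mul_sum, hW.row_sum, ← ENNReal.ofReal_mul (by linarith),
        ← ENNReal.ofReal_add (by positivity) (by positivity)]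
      exact ENNReal.ofReal_le_ofReal (le_of_eq (by ring))
    · simp only [labFun]
      have hpt : ∀ ω, ENNReal.ofReal (‖X' k ω‖ ^ 2) ≤
          (∑ j, ENNReal.ofReal ((1 - β) * W k j) * ENNReal.ofReal (‖X j ω‖ ^ 2)) +
          ENNReal.ofReal β * ENNReal.ofReal (‖N k ω‖ ^ 2) := fun ω => by
        have e : ∀ j, ENNReal.ofReal ((1 - β) * W k j) * ENNReal.ofReal (‖X j ω‖ ^ 2) =
            ENNReal.ofReal ((1 - β) * (W k j * ‖X j ω‖ ^ 2)) := fun j => by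
          rw [← ENNReal.ofReal_mul (mul_nonneg hβ1 (hW.nonneg k j)), mul_assoc]
        have hnn : ∀ j, 0 ≤ W k j * ‖X j ω‖ ^ 2 := fun j => mul_nonneg (hW.nonneg k j) (sq_nonneg _)
        simp_rw [e]
        rw [← ENNReal.ofReal_sum_of_nonneg fun j _ => mul_nonneg hβ1 (hnn j),
          ← ENNReal.ofReal_mul hβ0, ← ENNReal.ofReal_add
            (Finset.sum_nonneg fun j _ => mul_nonneg hβ1 (hnn j)) (by positivity), ← Finset.mul_sum]
        refine ENNReal.ofReal_le_ofReal ?_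
        rw [hX']
        have h1 := hW.norm_mix_sq_le (fun j => X j ω) k
        have h2 : ‖(1 - β) • mix W (fun j => X j ω) k + β • N k ω‖ ≤
            (1 - β) * ‖mix W (fun j => X j ω) k‖ + β * ‖N k ω‖ := by
          refine (norm_add_le _ _).trans_eq ?_
          rw [norm_smul, norm_smul, Real.norm_of_nonneg hβ0, Real.norm_of_nonneg hβ1]
        refine (pow_le_pow_left₀ (norm_nonneg _) h2 2).trans ?_
        nlinarith [mul_nonneg (mul_nonneg hβ0 hβ1)
          (sq_nonneg (‖mix W (fun j => X j ω) k‖ - ‖N k ω‖)), mul_le_mul_of_nonneg_left h1 hβ1]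
      have hA' : Measurable A := hA.mono h𝒢₀ le_rfl
      calc ∫⁻ ω, A ω * ENNReal.ofReal (‖X' k ω‖ ^ 2) ∂P
          ≤ ∫⁻ ω, (A ω * (∑ j, ENNReal.ofReal ((1 - β) * W k j) * ENNReal.ofReal (‖X j ω‖ ^ 2)) +
            (A ω * ENNReal.ofReal β) * ENNReal.ofReal (‖N k ω‖ ^ 2)) ∂P := by
            refine lintegral_mono fun ω => ?_
            rw [mul_assoc, ← mul_add]
            gcongr
            exact hpt ω
        _ = ∫⁻ ω, A ω * (∑ j, ENNReal.ofReal ((1 - β) * W k j) * ENNReal.ofReal (‖X j ω‖ ^ 2)) ∂P +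
            ∫⁻ ω, (A ω * ENNReal.ofReal β) * ENNReal.ofReal (‖N k ω‖ ^ 2) ∂P := by
            refine lintegral_add_left (f := fun ω => A ω * ∑ j, _) (hA'.mul (Finset.measurable_sum _ fun j _ => ?_)) _
            exact (((hX j).mono h𝒢₀ le_rfl).norm.pow_const 2).ennreal_ofReal.const_mul _
        _ ≤ ∫⁻ ω, A ω * (∑ j, ENNReal.ofReal ((1 - β) * W k j) * ENNReal.ofReal (‖X j ω‖ ^ 2)) ∂P +
            ∫⁻ ω, (A ω * ENNReal.ofReal β) * ENNReal.ofReal (C ^ 2) ∂P := by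
            refine add_le_add_right ?_ _
            exact (h k).moment _ ((hA.mono (h𝒢 k) le_rfl).mul_const _)
        _ = _ := by
            rw [← lintegral_add_right (g := fun ω => A ω * ENNReal.ofReal β * ENNReal.ofReal (C ^ 2)) _
              ((hA'.mul_const _).mul_const _)]
            refine lintegral_congr fun ω => ?_
            rw [Fin.sum_univ_succ]
            simp only [Fin.cons_zero, Fin.cons_succ, ENNReal.ofReal_one, mul_one]
            rw [mul_assoc, ← ENNReal.ofReal_mul hβ0, ← mul_add, add_comm]
  -- The old noise is seen with coefficients `mix W a`, which have the same sum as `a` and a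
  -- deviation smaller by the factor `ρ`; the fresh noise adds `β² ∑ a²`. These are the recursions
  -- of `pSeq` and `qSeq`.
  | noise a =>
    set f := (toEuclidean : V ≃L[ℝ] _).toContinuousLinearMap with hf
    refine ⟨2, ![ENNReal.ofReal (β ^ 2 * ((∑ k, a k ^ 2) * (‖f‖ * C) ^ 2)),
      ENNReal.ofReal ((1 - β) ^ 2)], ![.one, .noise (mix W a)], ?_, fun A hA => ?_⟩
    · rw [Fin.sum_univ_two]
      simp only [Matrix.cons_val_zero, Matrix.cons_val_one, labBound, ENNReal.ofReal_one, mul_one]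
      have hp0 := pSeq_nonneg C₁ t
      have hq0 := qSeq_nonneg C₁ h0ρ t
      rw [← ENNReal.ofReal_mul (by positivity), ← ENNReal.ofReal_add (by positivity) (by positivity)]
      refine ENNReal.ofReal_le_ofReal ?_
      rw [hW.sum_mix, hW.avg_mix]
      have h1 := hW.sum_sq_mix_le a
      have h2 := sum_sq_eq_add_dev a
      simp only [pSeq, qSeq, ← hβ, ← hf]
      have h3 : qSeq C₁ ρ t * ∑ k, (mix W a k - avg a) ^ 2 ≤
        qSeq C₁ ρ t * (ρ * ∑ k, (a k - avg a) ^ 2) := by gcongr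
      rw [h2]
      have h4 := mul_le_mul_of_nonneg_left h3
        (mul_nonneg (sq_nonneg (1 - β)) (sq_nonneg (‖f‖ * C)))
      linarith
    · simp only [labFun]
      have e : ∀ ω, ∑ k, a k • toEuclidean (X' k ω - G' k ω) =
          (1 - β) • (∑ k, mix W a k • f (X k ω - G k ω)) +
            ∑ k, (a k * β) • f (N k ω - m k ω) := fun ω => by
        have : ∀ k, a k • toEuclidean (X' k ω - G' k ω) =
            (1 - β) • (a k • mix W (fun j => f (X j ω - G j ω)) k) +
              (a k * β) • f (N k ω - m k ω) := fun k => by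
          rw [hX', hG', mix_map, mix_sub]
          change a k • f _ = _
          rw [← map_smul, ← map_smul, ← map_smul, ← map_smul, ← map_add]
          congr 1
          module
        rw [Finset.sum_congr rfl fun k _ => this k, Finset.sum_add_distrib, ← Finset.smul_sum,
          hW.sum_smul_mix]
      have hB : Measurable[𝒢₀] fun ω => (1 - β) • (∑ k, mix W a k • f (X k ω - G k ω)) := by
        refine Measurable.const_smul (Finset.measurable_sum _ fun k _ => ?_) (1 - β)
        exact (f.measurable.comp ((hX k).sub (hG k))).const_smul (mix W a k)
      have := IsFresh.lintegral_sum_le h hN hm f (hA.mono h𝒢₀ le_rfl)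
        (fun k => hA.mono (h𝒢 k) le_rfl) (fun k => hB.mono (h𝒢 k) le_rfl) (fun k => a k * β)
      simp_rw [e]
      refine this.trans (lintegral_mono fun ω => ?_)
      rw [Fin.sum_univ_two]
      simp only [Matrix.cons_val_zero, Matrix.cons_val_one, ENNReal.ofReal_one, mul_one]
      refine mul_le_mul_right ?_ (A ω)
      rw [norm_smul, mul_pow, Real.norm_eq_abs, sq_abs, ENNReal.ofReal_mul (by positivity), add_comm]
      refine add_le_add_left (le_of_eq ?_) _
      congr 1
      simp_rw [mul_pow]
      rw [← Finset.sum_mul]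
      ring

end Channel

/-! ### Random variables bounded against products of the other channels -/

section Bdd

variable {Ω ι : Type*} [MeasurableSpace Ω] [Fintype ι] {K : ℕ}

/-- `Y ≥ 0` uses the channels in `I` only, and its expectation against a product of functionals of the
other channels is at most `d` times the product of their bounds. -/
def Bdd (P : Measure Ω) (Φ : ι → Lab K → Ω → ℝ) (D : ι → Lab K → ℝ) (I : Set ι) (Y : Ω → ℝ)
    (d : ℝ) : Prop :=
  ∃ Y' : Ω → ℝ, Measurable Y' ∧ (∀ ω, 0 ≤ Y' ω) ∧ (∀ᵐ ω ∂P, Y ω ≤ Y' ω) ∧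
    ∀ l : ι → Lab K, (∀ i ∈ I, l i = .one) →
      ∫⁻ ω, ENNReal.ofReal (Y' ω) * ∏ i, ENNReal.ofReal (Φ i (l i) ω) ∂P ≤
        ENNReal.ofReal d * ∏ i, ENNReal.ofReal (D i (l i))

variable {P : Measure Ω} {Φ : ι → Lab K → Ω → ℝ} {D : ι → Lab K → ℝ} {I J : Set ι}
  {Y Z : Ω → ℝ} {d e : ℝ}

theorem Bdd.mono_set (h : Bdd P Φ D I Y d) (hIJ : I ⊆ J) : Bdd P Φ D J Y d := by
  obtain ⟨Y', h1, h2, h3, h4⟩ := h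
  exact ⟨Y', h1, h2, h3, fun l hl => h4 l fun i hi => hl i (hIJ hi)⟩

theorem Bdd.mono (h : Bdd P Φ D I Y d) (hZ : ∀ᵐ ω ∂P, Z ω ≤ Y ω) (hd : d ≤ e) :
    Bdd P Φ D I Z e := by
  obtain ⟨Y', h1, h2, h3, h4⟩ := h
  exact ⟨Y', h1, h2, by filter_upwards [h3, hZ] with ω a b using b.trans a, fun l hl =>
    (h4 l hl).trans (by gcongr)⟩

theorem Bdd.add (hΦ : ∀ i l, Measurable (Φ i l)) (h : Bdd P Φ D I Y d) (h' : Bdd P Φ D I Z e)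
    (hd : 0 ≤ d) (he : 0 ≤ e) : Bdd P Φ D I (fun ω => Y ω + Z ω) (d + e) := by
  obtain ⟨Y', h1, h2, h3, h4⟩ := h
  obtain ⟨Z', k1, k2, k3, k4⟩ := h'
  refine ⟨fun ω => Y' ω + Z' ω, h1.add k1, fun ω => add_nonneg (h2 ω) (k2 ω), by
    filter_upwards [h3, k3] with ω a b using add_le_add a b, fun l hl => ?_⟩
  have hmeas : Measurable fun ω => ENNReal.ofReal (Y' ω) * ∏ i, ENNReal.ofReal (Φ i (l i) ω) :=
    h1.ennreal_ofReal.mul (Finset.measurable_prod _ fun i _ => (hΦ i (l i)).ennreal_ofReal)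
  simp_rw [ENNReal.ofReal_add (h2 _) (k2 _), add_mul]
  rw [lintegral_add_left hmeas, ENNReal.ofReal_add hd he, add_mul]
  exact add_le_add (h4 l hl) (k4 l hl)

theorem Bdd.const_mul (h : Bdd P Φ D I Y d) {c : ℝ} (hc : 0 ≤ c) :
    Bdd P Φ D I (fun ω => c * Y ω) (c * d) := by
  obtain ⟨Y', h1, h2, h3, h4⟩ := h
  refine ⟨fun ω => c * Y' ω, h1.const_mul c, fun ω => mul_nonneg hc (h2 ω), by
    filter_upwards [h3] with ω a using mul_le_mul_of_nonneg_left a hc, fun l hl => ?_⟩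
  simp_rw [ENNReal.ofReal_mul hc, mul_assoc]
  rw [lintegral_const_mul' _ _ ENNReal.ofReal_ne_top]
  exact mul_le_mul_right (h4 l hl) _

theorem Bdd.of_prod (h : ∀ l : ι → Lab K,
    ∫⁻ ω, ∏ i, ENNReal.ofReal (Φ i (l i) ω) ∂P ≤ ∏ i, ENNReal.ofReal (D i (l i))) :
    Bdd P Φ D I (fun _ => 1) 1 :=
  ⟨fun _ => 1, measurable_const, fun _ => zero_le_one, Filter.Eventually.of_forall fun _ => le_rfl,
    fun l _ => by simpa using h l⟩

theorem Bdd.const (h : Bdd P Φ D I (fun _ => 1) 1) {c : ℝ} (hc : 0 ≤ c) :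
    Bdd P Φ D I (fun _ => c) c := by
  simpa using h.const_mul hc

/-- Multiplication by a functional of a new channel. -/
theorem Bdd.mul_channel [DecidableEq ι] (hΦ : ∀ i l, Measurable (Φ i l))
    (hΦ0 : ∀ i l ω, 0 ≤ Φ i l ω) (hD0 : ∀ i l, 0 ≤ D i l)
    (h1Φ : ∀ i ω, Φ i .one ω = 1) (h1D : ∀ i, D i .one = 1)
    (h : Bdd P Φ D I Y d) {i : ι} (hi : i ∉ I) (l : Lab K) (hJ : insert i I ⊆ J) :
    Bdd P Φ D J (fun ω => Φ i l ω * Y ω) (D i l * d) := by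
  obtain ⟨Y', h1, h2, h3, h4⟩ := h
  refine ⟨fun ω => Φ i l ω * Y' ω, (hΦ i l).mul h1, fun ω => mul_nonneg (hΦ0 _ _ _) (h2 ω), by
    filter_upwards [h3] with ω a using mul_le_mul_of_nonneg_left a (hΦ0 _ _ _), fun L hL => ?_⟩
  have hLi : L i = .one := hL i (hJ (Set.mem_insert i I))
  -- Since channel `i` is unused by `Y`, its label is still free; the functional is placed there,
  -- where the test product had the trivial label.
  have := h4 (Function.update L i l) fun j hj => by
    have hji : j ≠ i := fun e => hi (e ▸ hj)
    rw [Function.update_of_ne hji]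
    exact hL j (hJ (Set.mem_insert_of_mem i hj))
  have e : ∀ ψ : ι → Lab K → ℝ≥0∞, ψ i .one = 1 →
      ∏ j, ψ j (Function.update L i l j) = ψ i l * ∏ j, ψ j (L j) := fun ψ hψ => by
    rw [← Finset.mul_prod_erase Finset.univ _ (Finset.mem_univ i),
      ← Finset.mul_prod_erase Finset.univ (fun j => ψ j (L j)) (Finset.mem_univ i), hLi, hψ, one_mul,
      Function.update_self]
    congr 1
    refine Finset.prod_congr rfl fun j hj => ?_
    rw [Function.update_of_ne (Finset.ne_of_mem_erase hj)]
  rw [e (fun i l => ENNReal.ofReal (D i l)) (by simp [h1D])] at this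
  calc _ = ∫⁻ ω, ENNReal.ofReal (Y' ω) *
        ∏ j, ENNReal.ofReal (Φ j (Function.update L i l j) ω) ∂P := by
        refine lintegral_congr fun ω => ?_
        rw [e (fun i l => ENNReal.ofReal (Φ i l ω)) (by simp [h1Φ]), ENNReal.ofReal_mul (hΦ0 _ _ _)]
        ring
    _ ≤ _ := this
    _ = _ := by rw [ENNReal.ofReal_mul (hD0 _ _)]; ring

end Bdd

end DSMO

end

noncomputable section

namespace DSMO

open scoped ENNReal

/-! ### Strongly convex functions -/

section StrongConvex

variable {n : ℕ} {φ : Vec n → ℝ} {μ : ℝ}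

/-- The convexity inequality on the segment from `y` to `z`, divided by `t`, is passed to the limit
`t → 0⁺`. -/
theorem strongConvexOn_add_inner_le (h : StrongConvexOn Set.univ μ φ) {g y : Vec n}
    (hg : HasGradientAt φ g y) (z : Vec n) :
    φ y + inner ℝ g (z - y) + μ / 2 * ‖z - y‖ ^ 2 ≤ φ z := by
  have hd : HasDerivAt (fun t : ℝ => φ (y + t • (z - y))) (inner ℝ g (z - y)) 0 := by
    have h1 : HasDerivAt (fun t : ℝ => y + t • (z - y)) (z - y) 0 := by
      simpa using ((hasDerivAt_id (0 : ℝ)).smul_const (z - y)).const_add y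
    have h2 : HasFDerivAt φ (InnerProductSpace.toDual ℝ _ g) (y + (0 : ℝ) • (z - y)) := by
      simpa using hg.hasFDerivAt
    have h3 := h2.comp_hasDerivAt (0 : ℝ) h1
    rw [InnerProductSpace.toDual_apply_apply] at h3
    exact h3
  have hs := hd.tendsto_slope_zero_right
  have hlim : Filter.Tendsto (fun t : ℝ => φ z - φ y - (1 - t) * (μ / 2 * ‖z - y‖ ^ 2))
      (nhdsWithin 0 (Set.Ioi 0)) (nhds (φ z - φ y - (1 - 0) * (μ / 2 * ‖z - y‖ ^ 2))) := by
    refine Filter.Tendsto.mono_left (Continuous.tendsto ?_ 0) nhdsWithin_le_nhds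
    fun_prop
  have hle := le_of_tendsto_of_tendsto hs hlim ?_
  · linarith
  · filter_upwards [Ioo_mem_nhdsGT (zero_lt_one (α := ℝ))] with t ht
    have h3 := h.2 (Set.mem_univ y) (Set.mem_univ z) (sub_nonneg.2 ht.2.le) ht.1.le (by ring)
    have e : (1 - t) • y + t • z = y + t • (z - y) := by module
    rw [e, norm_sub_rev] at h3
    simp only [zero_add, zero_smul, add_zero, smul_eq_mul] at h3 ⊢
    rw [inv_mul_le_iff₀ ht.1]
    linarith

theorem strongConvexOn_inner_sub_ge (h : StrongConvexOn Set.univ μ φ) {g g' y z : Vec n}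
    (hg : HasGradientAt φ g y) (hg' : HasGradientAt φ g' z) :
    μ * ‖y - z‖ ^ 2 ≤ inner ℝ (g - g') (y - z) := by
  have h1 := strongConvexOn_add_inner_le h hg z
  have h2 := strongConvexOn_add_inner_le h hg' y
  rw [norm_sub_rev] at h1
  have e : inner ℝ g (z - y) = - inner ℝ g (y - z) := by rw [← inner_neg_right, neg_sub]
  rw [inner_sub_left]
  linarith

/-- The quadratic minorant at `0` makes `φ` coercive. This is what makes `argmin` an actual
minimizer in the definition of the best responses. -/
theorem strongConvexOn_exists_forall_le (hμ : 0 < μ) (h : StrongConvexOn Set.univ μ φ)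
    (hφ : Differentiable ℝ φ) : ∃ y, ∀ z, φ y ≤ φ z := by
  refine hφ.continuous.exists_forall_le ?_
  have h1 : ∀ z, φ 0 - ‖gradient φ 0‖ * ‖z‖ + μ / 2 * ‖z‖ ^ 2 ≤ φ z := fun z => by
    have := strongConvexOn_add_inner_le h (hφ 0).hasGradientAt z
    simp only [sub_zero] at this
    have h2 := abs_le.1 (abs_real_inner_le_norm (gradient φ 0) z)
    linarith
  refine Filter.tendsto_atTop_mono h1 ?_
  have h3 : Filter.Tendsto (fun r : ℝ => φ 0 + r * (μ / 2 * r - ‖gradient φ 0‖)) Filter.atTop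
      Filter.atTop := by
    refine Filter.tendsto_atTop_add_const_left _ _ (Filter.tendsto_id.atTop_mul_atTop₀ ?_)
    exact Filter.tendsto_atTop_add_const_right _ _
      (Filter.tendsto_id.const_mul_atTop (by positivity))
  have h4 := h3.comp (tendsto_norm_cocompact_atTop (E := Vec n))
  refine h4.congr fun z => ?_
  simp only [Function.comp_apply]
  ring

theorem argmin_spec {V : Type*} [Nonempty V] {φ : V → ℝ} (h : ∃ y, ∀ z, φ y ≤ φ z) (z : V) :
    φ (argmin φ) ≤ φ z :=
  Classical.epsilon_spec h z

end StrongConvex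

/-! ### Derivatives of the inner objectives -/

section Derivatives

theorem eq_sum_inner_single {n : ℕ} (v : Vec n) :
    v = ∑ i, inner ℝ v (EuclideanSpace.single i (1 : ℝ)) • EuclideanSpace.single i (1 : ℝ) := by
  have := (EuclideanSpace.basisFun (Fin n) ℝ).sum_repr' v
  simp only [EuclideanSpace.basisFun_apply] at this
  conv_lhs => rw [← this]
  simp_rw [real_inner_comm]

/-- The coordinates of the partial gradient are the values of the full derivative on the vectors
`(0, e_i)`. -/
theorem contDiff_partial_gradient {a b : ℕ} {G : Vec a × Vec b → ℝ} (hG : ContDiff ℝ 2 G) :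
    ContDiff ℝ 1 fun z : Vec a × Vec b => gradient (fun y => G (z.1, y)) z.2 := by
  have hinner : ∀ (z : Vec a × Vec b) (w : Vec b),
      inner ℝ (gradient (fun y => G (z.1, y)) z.2) w = fderiv ℝ G z (0, w) := fun z w => by
    rw [gradient, InnerProductSpace.toDual_symm_apply]
    have h1 : HasFDerivAt (fun y => G (z.1, y)) ((fderiv ℝ G z).comp
        (ContinuousLinearMap.inr ℝ (Vec a) (Vec b))) z.2 :=
      ((hG.differentiable (by norm_num)) z).hasFDerivAt.comp z.2 (hasFDerivAt_prodMk_right z.1 z.2)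
    rw [h1.fderiv]
    rfl
  have e : (fun z : Vec a × Vec b => gradient (fun y => G (z.1, y)) z.2) = fun z =>
      ∑ i, (fderiv ℝ G z (0, EuclideanSpace.single i (1 : ℝ))) •
        EuclideanSpace.single i (1 : ℝ) := by
    funext z
    rw [eq_sum_inner_single (gradient (fun y => G (z.1, y)) z.2)]
    simp_rw [hinner]
  rw [e]
  refine ContDiff.sum fun i _ => ContDiff.fun_smul ?_ contDiff_const
  exact (hG.fderiv_right (by norm_num)).clm_apply contDiff_const

theorem fderiv_gradient_symmetric {n : ℕ} {φ : Vec n → ℝ} (hφ : ContDiff ℝ 2 φ) (y : Vec n) :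
    ContinuousLinearMap.adjoint (fderiv ℝ (gradient φ) y) = fderiv ℝ (gradient φ) y := by
  have hg : ContDiff ℝ 1 (gradient φ) := by
    -- A dummy zero-dimensional parameter reduces the gradient of one variable to the partial one.
    have := contDiff_partial_gradient (a := 0) (G := fun z : Vec 0 × Vec n => φ z.2)
      (hφ.comp contDiff_snd)
    exact this.comp (contDiff_const.prodMk contDiff_id : ContDiff ℝ 1 fun y : Vec n => ((0 : Vec 0), y))
  have hgd : DifferentiableAt ℝ (gradient φ) y := (hg.differentiable (by norm_num)) y
  have hsymm : IsSymmSndFDerivAt ℝ φ y := hφ.contDiffAt.isSymmSndFDerivAt (by simp)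
  have h2 : DifferentiableAt ℝ (fderiv ℝ φ) y :=
    ((hφ.fderiv_right (m := 1) (by norm_num)).differentiable (by norm_num)) y
  have key : ∀ v w, inner ℝ (fderiv ℝ (gradient φ) y v) w = fderiv ℝ (fderiv ℝ φ) y v w := by
    intro v w
    have h3 : HasFDerivAt (fun z => inner ℝ (gradient φ z) w)
        ((innerSL ℝ).flip w ∘L fderiv ℝ (gradient φ) y) y :=
      ((innerSL ℝ).flip w).hasFDerivAt.comp y hgd.hasFDerivAt
    have h4 : HasFDerivAt (fun z => fderiv ℝ φ z w)
        (((ContinuousLinearMap.apply ℝ ℝ) w) ∘L fderiv ℝ (fderiv ℝ φ) y) y :=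
      ((ContinuousLinearMap.apply ℝ ℝ) w).hasFDerivAt.comp y h2.hasFDerivAt
    have e : (fun z => inner ℝ (gradient φ z) w) = fun z => fderiv ℝ φ z w := by
      funext z
      rw [gradient, InnerProductSpace.toDual_symm_apply]
    rw [e] at h3
    have := congrArg (fun A => A v) (h3.unique h4)
    simp only [ContinuousLinearMap.comp_apply, ContinuousLinearMap.flip_apply, innerSL_apply_apply,
      ContinuousLinearMap.apply_apply] at this
    exact this
  symm
  rw [ContinuousLinearMap.eq_adjoint_iff]
  intro v w
  rw [key, hsymm v w, ← key, real_inner_comm]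

variable {M : ℕ} {d : Fin (M + 1) → ℕ} {K : ℕ} (p : Problem d K)

theorem Problem.hasFDerivAt_gradg₂ {m : Fin M} {k : Fin K}
    (h : ContDiff ℝ 2 fun z : Vec (d m.castSucc) × Vec (d m.succ) => p.g m k z.1 z.2)
    (z : Vec (d m.castSucc) × Vec (d m.succ)) :
    HasFDerivAt (fun z : Vec (d m.castSucc) × Vec (d m.succ) => p.gradg₂ m k z.1 z.2)
      ((ContinuousLinearMap.adjoint (p.hessg₁₂ m k z.1 z.2)) ∘L ContinuousLinearMap.fst ℝ _ _ +
        (p.hessg₂₂ m k z.1 z.2) ∘L ContinuousLinearMap.snd ℝ _ _) z := by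
  have h1 : ContDiff ℝ 1 fun z : Vec (d m.castSucc) × Vec (d m.succ) => p.gradg₂ m k z.1 z.2 :=
    contDiff_partial_gradient h
  have h2 := ((h1.differentiable (by norm_num)) z).hasFDerivAt
  have h3 := HasFDerivAt.comp (f := fun e => (e, z.2)) z.1 h2 (hasFDerivAt_prodMk_left z.1 z.2)
  have h4 := HasFDerivAt.comp (f := fun e => (z.1, e)) z.2 h2 (hasFDerivAt_prodMk_right z.1 z.2)
  have e1 : ContinuousLinearMap.adjoint (p.hessg₁₂ m k z.1 z.2) =
      fderiv ℝ (fun z : Vec (d m.castSucc) × Vec (d m.succ) => p.gradg₂ m k z.1 z.2) z ∘L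
        ContinuousLinearMap.inl ℝ (Vec (d m.castSucc)) (Vec (d m.succ)) := by
    unfold Problem.hessg₁₂
    rw [ContinuousLinearMap.adjoint_adjoint]
    exact h3.fderiv
  have e2 : p.hessg₂₂ m k z.1 z.2 =
      fderiv ℝ (fun z : Vec (d m.castSucc) × Vec (d m.succ) => p.gradg₂ m k z.1 z.2) z ∘L
        ContinuousLinearMap.inr ℝ (Vec (d m.castSucc)) (Vec (d m.succ)) := h4.fderiv
  rw [e1, e2]
  refine h2.congr_fderiv (ContinuousLinearMap.ext fun v => ?_)
  simp [← map_add]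

theorem Problem.adjoint_hessg₂₂ {m : Fin M} {k : Fin K}
    (h : ContDiff ℝ 2 fun z : Vec (d m.castSucc) × Vec (d m.succ) => p.g m k z.1 z.2)
    (y' : Vec (d m.castSucc)) (y : Vec (d m.succ)) :
    ContinuousLinearMap.adjoint (p.hessg₂₂ m k y' y) = p.hessg₂₂ m k y' y :=
  fderiv_gradient_symmetric (h.comp (contDiff_const.prodMk contDiff_id)) y

end Derivatives

/-- The derivative of an implicitly defined Lipschitz function. -/
theorem hasFDerivAt_of_implicit {E V₁ V₂ : Type*} [NormedAddCommGroup E] [NormedSpace ℝ E]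
    [NormedAddCommGroup V₁] [NormedSpace ℝ V₁] [NormedAddCommGroup V₂] [NormedSpace ℝ V₂]
    {G : V₁ × V₂ → V₂} {u : E → V₁} {y : E → V₂} {x : E} {A : V₁ →L[ℝ] V₂} {H q : V₂ →L[ℝ] V₂}
    {u' : E →L[ℝ] V₁} {C : ℝ}
    (hG : HasFDerivAt G (A ∘L ContinuousLinearMap.fst ℝ _ _ + H ∘L ContinuousLinearMap.snd ℝ _ _)
      (u x, y x))
    (hq : q ∘L H = ContinuousLinearMap.id ℝ _) (hu : HasFDerivAt u u' x)
    (hy : ∀ x', ‖y x' - y x‖ ≤ C * ‖x' - x‖) (hG0 : ∀ x', G (u x', y x') = 0) :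
    HasFDerivAt y (-(q ∘L A ∘L u')) x := by
  -- The Lipschitz bound for `y` is known beforehand, so remainders that are small in the increment
  -- of `(u, y)` are small in `x' - x`. Linearizing `G = 0` and applying `q` then isolates the
  -- increment of `y`.
  have hyO : (fun x' => y x' - y x) =O[nhds x] fun x' => x' - x :=
    Asymptotics.IsBigO.of_bound C (Filter.Eventually.of_forall hy)
  have hyc : Filter.Tendsto y (nhds x) (nhds (y x)) := by
    have h1 : Filter.Tendsto (fun x' => x' - x) (nhds x) (nhds 0) := by
      simpa using (Filter.tendsto_id (x := nhds x)).sub_const x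
    simpa using (hyO.trans_tendsto h1).add_const (y x)
  have hpair : (fun x' => (u x', y x') - (u x, y x)) =O[nhds x] fun x' => x' - x :=
    Asymptotics.IsBigO.prod_left hu.isBigO_sub hyO
  have h1 := (hG.isLittleO.comp_tendsto (hu.continuousAt.tendsto.prodMk_nhds hyc)).trans_isBigO hpair
  have h2 := (q.isBigO_comp _ (nhds x)).trans_isLittleO h1
  have h3 := ((q ∘L A).isBigO_comp _ (nhds x)).trans_isLittleO hu.isLittleO
  refine HasFDerivAt.of_isLittleO ?_
  have h4 := (h2.add h3).neg_left
  refine h4.congr_left fun x' => ?_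
  have e : ∀ v, q (H v) = v := fun v => congrArg (fun B => B v) hq
  simp only [Function.comp_apply, hG0, map_sub, add_apply,
    ContinuousLinearMap.comp_apply, ContinuousLinearMap.coe_fst', ContinuousLinearMap.coe_snd',
    neg_apply, map_add, e, map_zero]
  abel

end DSMO

end

noncomputable section

namespace DSMO

open scoped ENNReal

/-! ### Deterministic regularity of the problem -/

variable {M : ℕ} {d : Fin (M + 1) → ℕ} {K : ℕ}

/-- The deterministic consequences of the assumptions, with one constant `Λ ≥ 1` for all levels. -/
structure Regular (Λ : ℝ) (L : Fin M → ℝ) (p : Problem d K) (D : (m : Fin (M + 1)) → Set (Vec (d m))) :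
    Prop where
  one_le : 1 ≤ Λ
  L_pos : ∀ m, 0 < L m
  L_le : ∀ m, L m ≤ Λ
  inv_L_le : ∀ m, 1 / L m ≤ Λ
  card_pos : 0 < K
  exists_min : ∃ x, ∀ x', p.F x ≤ p.F x'
  differentiable : ∀ k, Differentiable ℝ
    fun z : Vec (d 0) × Vec (d (Fin.last M)) => p.f k z.1 z.2
  lip_gradf₁ : ∀ k x x' y y',
    ‖p.gradf₁ k x y - p.gradf₁ k x' y'‖ ≤ Λ * (‖x - x'‖ + ‖y - y'‖)
  lip_gradf₂ : ∀ k x x' y y',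
    ‖p.gradf₂ k x y - p.gradf₂ k x' y'‖ ≤ Λ * (‖x - x'‖ + ‖y - y'‖)
  norm_gradf₁ : ∀ k, ∀ x ∈ D 0, ∀ y ∈ D (Fin.last M), ‖p.gradf₁ k x y‖ ≤ Λ
  norm_gradf₂ : ∀ k, ∀ x ∈ D 0, ∀ y ∈ D (Fin.last M), ‖p.gradf₂ k x y‖ ≤ Λ
  strongConvex : ∀ m y', StrongConvexOn Set.univ Λ⁻¹ (p.gAvg m y')
  contDiff : ∀ m k, ContDiff ℝ 2
    fun z : Vec (d (Fin.castSucc m)) × Vec (d m.succ) => p.g m k z.1 z.2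
  lip_gradg₂ : ∀ m k y' z' y z,
    ‖p.gradg₂ m k y' y - p.gradg₂ m k z' z‖ ≤ Λ * (‖y' - z'‖ + ‖y - z‖)
  lip_hessg₁₂ : ∀ m k y' z' y z,
    ‖p.hessg₁₂ m k y' y - p.hessg₁₂ m k z' z‖ ≤ Λ * (‖y' - z'‖ + ‖y - z‖)
  lip_hessg₂₂ : ∀ m k y' z' y z,
    ‖p.hessg₂₂ m k y' y - p.hessg₂₂ m k z' z‖ ≤ Λ * (‖y' - z'‖ + ‖y - z‖)
  norm_hessg₁₂ : ∀ m k y' y, ‖p.hessg₁₂ m k y' y‖ ≤ Λ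
  norm_contraction : ∀ m k y' y,
    ‖ContinuousLinearMap.id ℝ (Vec (d m.succ)) - (1 / L m) • p.hessg₂₂ m k y' y‖ ≤ 1 - Λ⁻¹
  convex : ∀ m, Convex ℝ (D m)
  yStar_mem : ∀ m, ∀ x ∈ D 0, p.yStar m x ∈ D m

/-- The product `u₁ q₁ ⋯ u_m q_m`. -/
def chainTo (u : (m : Fin M) → Vec (d m.succ) →L[ℝ] Vec (d m.castSucc))
    (q : (m : Fin M) → Vec (d m.succ) →L[ℝ] Vec (d m.succ)) (m : Fin (M + 1)) :
    Vec (d m) →L[ℝ] Vec (d 0) :=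
  Fin.induction (motive := fun m => Vec (d m) →L[ℝ] Vec (d 0))
    (ContinuousLinearMap.id ℝ (Vec (d 0))) (fun m A => A ∘L u m ∘L q m) m

theorem chainTo_zero (u : (m : Fin M) → Vec (d m.succ) →L[ℝ] Vec (d m.castSucc))
    (q : (m : Fin M) → Vec (d m.succ) →L[ℝ] Vec (d m.succ)) :
    chainTo u q 0 = ContinuousLinearMap.id ℝ (Vec (d 0)) := rfl

theorem chainTo_succ (u : (m : Fin M) → Vec (d m.succ) →L[ℝ] Vec (d m.castSucc))
    (q : (m : Fin M) → Vec (d m.succ) →L[ℝ] Vec (d m.succ)) (m : Fin M) :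
    chainTo u q m.succ = chainTo u q m.castSucc ∘L u m ∘L q m := rfl

theorem norm_comp_sub_comp_le {E F G : Type*} [NormedAddCommGroup E] [NormedSpace ℝ E]
    [NormedAddCommGroup F] [NormedSpace ℝ F] [NormedAddCommGroup G] [NormedSpace ℝ G]
    (A A' : F →L[ℝ] G) (B B' : E →L[ℝ] F) :
    ‖A ∘L B - A' ∘L B'‖ ≤ ‖A - A'‖ * ‖B‖ + ‖A'‖ * ‖B - B'‖ := by
  have e : A ∘L B - A' ∘L B' = (A - A') ∘L B + A' ∘L (B - B') := by
    ext v; simp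
  rw [e]
  exact (norm_add_le _ _).trans (add_le_add (ContinuousLinearMap.opNorm_comp_le _ _)
    (ContinuousLinearMap.opNorm_comp_le _ _))

/-! ### Products of operators over the levels. -/

section Chain

variable {u u' : (m : Fin M) → Vec (d m.succ) →L[ℝ] Vec (d m.castSucc)}
  {q q' : (m : Fin M) → Vec (d m.succ) →L[ℝ] Vec (d m.succ)} {Λ : ℝ}

theorem norm_chainTo_le (hΛ : 1 ≤ Λ) (hu : ∀ m, ‖u m‖ ≤ Λ) (hq : ∀ m, ‖q m‖ ≤ Λ ^ 2)
    (m : Fin (M + 1)) : ‖chainTo u q m‖ ≤ Λ ^ (3 * (m : ℕ)) := by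
  induction m using Fin.induction with
  | zero => simpa [chainTo_zero] using ContinuousLinearMap.norm_id_le
  | succ m ih =>
    rw [chainTo_succ]
    calc _ ≤ ‖chainTo u q m.castSucc‖ * (‖u m‖ * ‖q m‖) :=
          (ContinuousLinearMap.opNorm_comp_le _ _).trans (mul_le_mul_of_nonneg_left
            (ContinuousLinearMap.opNorm_comp_le _ _) (norm_nonneg _))
      _ ≤ Λ ^ (3 * (m : ℕ)) * (Λ * Λ ^ 2) := by
          gcongr
          · exact ih
          · exact hu m
          · exact hq m
      _ = _ := by simp only [Fin.val_succ]; ring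

/-- The product telescopes: each of the two factors of a level is exchanged once, the remaining ones
being bounded. -/
theorem norm_chainTo_sub_le (hΛ : 1 ≤ Λ) (hu : ∀ m, ‖u m‖ ≤ Λ) (hq : ∀ m, ‖q m‖ ≤ Λ ^ 2)
    (hu' : ∀ m, ‖u' m‖ ≤ Λ) (hq' : ∀ m, ‖q' m‖ ≤ Λ ^ 2) {s : ℝ}
    (hsu : ∀ m, ‖u m - u' m‖ ≤ s) (hsq : ∀ m, ‖q m - q' m‖ ≤ s) (m : Fin (M + 1)) :
    ‖chainTo u q m - chainTo u' q' m‖ ≤ 2 * (m : ℕ) * Λ ^ (3 * (m : ℕ)) * s := by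
  induction m using Fin.induction with
  | zero => simp [chainTo_zero]
  | succ m ih =>
    have hs : 0 ≤ s := (norm_nonneg _).trans (hsu m)
    rw [chainTo_succ, chainTo_succ]
    have h1 : ‖u m ∘L q m‖ ≤ Λ * Λ ^ 2 :=
      (ContinuousLinearMap.opNorm_comp_le _ _).trans
        (mul_le_mul (hu m) (hq m) (norm_nonneg _) (by linarith))
    have h2 : ‖u m ∘L q m - u' m ∘L q' m‖ ≤ s * Λ ^ 2 + Λ * s :=
      (norm_comp_sub_comp_le _ _ _ _).trans (add_le_add
        (mul_le_mul (hsu m) (hq m) (norm_nonneg _) hs)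
        (mul_le_mul (hu' m) (hsq m) (norm_nonneg _) (by linarith)))
    have h3 := norm_chainTo_le hΛ hu' hq' m.castSucc
    simp only [Fin.val_castSucc] at h3 ih
    calc _ ≤ ‖chainTo u q m.castSucc - chainTo u' q' m.castSucc‖ * ‖u m ∘L q m‖ +
          ‖chainTo u' q' m.castSucc‖ * ‖u m ∘L q m - u' m ∘L q' m‖ := norm_comp_sub_comp_le _ _ _ _
      _ ≤ 2 * (m : ℕ) * Λ ^ (3 * (m : ℕ)) * s * (Λ * Λ ^ 2) +
          Λ ^ (3 * (m : ℕ)) * (s * Λ ^ 2 + Λ * s) := by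
          gcongr
      _ ≤ 2 * (m : ℕ) * Λ ^ (3 * (m : ℕ)) * s * (Λ * Λ ^ 2) +
          Λ ^ (3 * (m : ℕ)) * (s * Λ ^ 3 + Λ ^ 3 * s) := by
          gcongr
          · norm_num
          · exact le_self_pow₀ hΛ (by norm_num)
      _ = _ := by simp only [Fin.val_succ]; push_cast; ring

end Chain

/-! ### Inverse Hessians and truncated Neumann series. -/

section Inverse

variable {n : ℕ} {Λ L : ℝ}

theorem isUnit_of_norm_contraction (hΛ : 1 ≤ Λ) {H : Vec n →L[ℝ] Vec n}
    (h : ‖ContinuousLinearMap.id ℝ (Vec n) - (1 / L) • H‖ ≤ 1 - Λ⁻¹) : IsUnit H := by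
  have hΛ0 : 0 < Λ⁻¹ := by positivity
  have h1 : IsUnit ((1 / L) • H) := by
    have := isUnit_one_sub_of_norm_lt_one (R := Vec n →L[ℝ] Vec n) (h.trans_lt (by linarith))
    convert this using 1
    change (1 / L) • H = ContinuousLinearMap.id ℝ (Vec n) - (ContinuousLinearMap.id ℝ (Vec n) - (1 / L) • H)
    abel
  obtain ⟨v, hv⟩ := h1
  refine isUnit_iff_exists.2 ⟨(1 / L) • (↑v⁻¹ : Vec n →L[ℝ] Vec n), ?_, ?_⟩
  · have e : ∀ x, v.1 (v⁻¹.1 x) = x := fun x => congrArg (fun A => A x) v.mul_inv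
    refine ContinuousLinearMap.ext fun x => Eq.trans ?_ (e x)
    rw [hv]
    exact map_smul H _ _
  · have e : ∀ x, v⁻¹.1 (v.1 x) = x := fun x => congrArg (fun A => A x) v.inv_mul
    refine ContinuousLinearMap.ext fun x => Eq.trans ?_ (e x)
    rw [hv]
    exact (map_smul v⁻¹.1 _ _).symm

theorem inverse_comp (hΛ : 1 ≤ Λ) {H : Vec n →L[ℝ] Vec n}
    (h : ‖ContinuousLinearMap.id ℝ (Vec n) - (1 / L) • H‖ ≤ 1 - Λ⁻¹) :
    Ring.inverse H ∘L H = ContinuousLinearMap.id ℝ (Vec n) ∧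
      H ∘L Ring.inverse H = ContinuousLinearMap.id ℝ (Vec n) :=
  ⟨Ring.inverse_mul_cancel H (isUnit_of_norm_contraction hΛ h),
    Ring.mul_inverse_cancel H (isUnit_of_norm_contraction hΛ h)⟩

/-- With `R = I - H/L` the inverse `q` satisfies `q = Rq + I/L`, and `‖R‖ ≤ 1 - Λ⁻¹` allows `‖q‖` to
be solved for. -/
theorem norm_inverse_le (hΛ : 1 ≤ Λ) (hL : 0 < L) (hL' : 1 / L ≤ Λ) {H : Vec n →L[ℝ] Vec n}
    (h : ‖ContinuousLinearMap.id ℝ (Vec n) - (1 / L) • H‖ ≤ 1 - Λ⁻¹) :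
    ‖Ring.inverse H‖ ≤ Λ ^ 2 := by
  have hΛ0 : 0 < Λ⁻¹ := by positivity
  set q := Ring.inverse H
  set R := ContinuousLinearMap.id ℝ (Vec n) - (1 / L) • H with hR
  have h1 : q = R ∘L q + (1 / L) • ContinuousLinearMap.id ℝ (Vec n) := by
    rw [← (inverse_comp hΛ h).2, hR]
    ext v; simp [q]
  have h2 : ‖q‖ ≤ (1 - Λ⁻¹) * ‖q‖ + 1 / L := by
    calc ‖q‖ = ‖R ∘L q + (1 / L) • ContinuousLinearMap.id ℝ (Vec n)‖ := by rw [← h1]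
      _ ≤ ‖R‖ * ‖q‖ + 1 / L * 1 := by
          refine (norm_add_le _ _).trans (add_le_add (ContinuousLinearMap.opNorm_comp_le _ _) ?_)
          rw [norm_smul, Real.norm_of_nonneg (by positivity)]
          gcongr
          exact ContinuousLinearMap.norm_id_le
      _ ≤ _ := by rw [mul_one]; gcongr
  have h3 : Λ⁻¹ * ‖q‖ ≤ Λ := by linarith
  rw [inv_mul_le_iff₀ (by linarith)] at h3
  linarith

/-- The resolvent identity `H⁻¹ - H'⁻¹ = H⁻¹ (H' - H) H'⁻¹`. -/
theorem norm_inverse_sub_le (hΛ : 1 ≤ Λ) (hL : 0 < L) (hL' : 1 / L ≤ Λ) {H H' : Vec n →L[ℝ] Vec n}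
    (h : ‖ContinuousLinearMap.id ℝ (Vec n) - (1 / L) • H‖ ≤ 1 - Λ⁻¹)
    (h' : ‖ContinuousLinearMap.id ℝ (Vec n) - (1 / L) • H'‖ ≤ 1 - Λ⁻¹) :
    ‖Ring.inverse H - Ring.inverse H'‖ ≤ Λ ^ 4 * ‖H - H'‖ := by
  have e : Ring.inverse H - Ring.inverse H' = Ring.inverse H ∘L (H' - H) ∘L Ring.inverse H' := by
    have h1 := (inverse_comp hΛ h).1
    have h2 := (inverse_comp hΛ h').2
    have e1 : ∀ v, Ring.inverse H (H v) = v := fun v => congrArg (fun A => A v) h1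
    have e2 : ∀ v, H' (Ring.inverse H' v) = v := fun v => congrArg (fun A => A v) h2
    refine ContinuousLinearMap.ext fun v => ?_
    simp [e1, e2]
  rw [e]
  calc _ ≤ ‖Ring.inverse H‖ * (‖H' - H‖ * ‖Ring.inverse H'‖) :=
        (ContinuousLinearMap.opNorm_comp_le _ _).trans (mul_le_mul_of_nonneg_left
          (ContinuousLinearMap.opNorm_comp_le _ _) (norm_nonneg _))
    _ ≤ Λ ^ 2 * (‖H' - H‖ * Λ ^ 2) := by
        gcongr
        · exact norm_inverse_le hΛ hL hL' h
        · exact norm_inverse_le hΛ hL hL' h'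
    _ = _ := by rw [norm_sub_rev]; ring

theorem adjoint_inverse (hΛ : 1 ≤ Λ) {H : Vec n →L[ℝ] Vec n}
    (h : ‖ContinuousLinearMap.id ℝ (Vec n) - (1 / L) • H‖ ≤ 1 - Λ⁻¹)
    (hH : ContinuousLinearMap.adjoint H = H) :
    ContinuousLinearMap.adjoint (Ring.inverse H) = Ring.inverse H := by
  obtain ⟨h1, h2⟩ := inverse_comp hΛ h
  have h3 : H ∘L ContinuousLinearMap.adjoint (Ring.inverse H) = ContinuousLinearMap.id ℝ _ := by
    have e := congrArg ContinuousLinearMap.adjoint h1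
    rw [ContinuousLinearMap.adjoint_comp, hH] at e
    rw [e]
    exact ContinuousLinearMap.adjoint_id
  calc ContinuousLinearMap.adjoint (Ring.inverse H)
      = (Ring.inverse H ∘L H) ∘L ContinuousLinearMap.adjoint (Ring.inverse H) := by
        rw [h1, ContinuousLinearMap.id_comp]
    _ = Ring.inverse H := by
        rw [ContinuousLinearMap.comp_assoc, h3, ContinuousLinearMap.comp_id]

/-- The truncated Neumann series approximates the inverse. -/
theorem norm_hessQ_sub_inverse_le (hΛ : 1 ≤ Λ) (hL : 0 < L) (hL' : 1 / L ≤ Λ) {H : Vec n →L[ℝ] Vec n}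
    (h : ‖ContinuousLinearMap.id ℝ (Vec n) - (1 / L) • H‖ ≤ 1 - Λ⁻¹) (b : ℕ) :
    ‖(1 / L) • hessQ L (fun _ => H) b - Ring.inverse H‖ ≤
      ‖ContinuousLinearMap.id ℝ (Vec n) - (1 / L) • H‖ ^ (b + 1) * Λ ^ 2 := by
  obtain ⟨h1, h2⟩ := inverse_comp hΛ h
  set R := ContinuousLinearMap.id ℝ (Vec n) - (1 / L) • H with hR
  have hi := norm_inverse_le hΛ hL hL' h
  -- The inverse is the fixed point of the recursion, so the error is multiplied by `R` in each
  -- step; already at `b = 0` it equals `-R H⁻¹`, whence the exponent `b + 1`.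
  have key : ∀ b, ‖(1 / L) • hessQ L (fun _ => H) b - Ring.inverse H‖ ≤
      ‖R‖ ^ (b + 1) * ‖Ring.inverse H‖ := by
    intro b
    induction b with
    | zero =>
      have e : (1 / L) • hessQ L (fun _ => H) 0 - Ring.inverse H = - (R ∘L Ring.inverse H) := by
        have : (1 / L) • hessQ L (fun _ => H) 0 = (1 / L) • (H ∘L Ring.inverse H) := by
          rw [h2]; rfl
        rw [this, hR]
        ext v; simp
      rw [e, norm_neg, zero_add, pow_one]
      exact ContinuousLinearMap.opNorm_comp_le _ _
    | succ b ih =>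
      have e : (1 / L) • hessQ L (fun _ => H) (b + 1) - Ring.inverse H =
          R ∘L ((1 / L) • hessQ L (fun _ => H) b - Ring.inverse H) := by
        have e1 : (1 / L) • hessQ L (fun _ => H) (b + 1) =
            (1 / L) • (H ∘L Ring.inverse H) + R ∘L ((1 / L) • hessQ L (fun _ => H) b) := by
          rw [h2, hessQ, ContinuousLinearMap.comp_smul, smul_add]
        rw [e1, hR]
        ext v; simp; ring
      rw [e, pow_succ', mul_assoc]
      exact (ContinuousLinearMap.opNorm_comp_le _ _).trans (mul_le_mul_of_nonneg_left ih (norm_nonneg _))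
  exact (key b).trans (mul_le_mul_of_nonneg_left hi (by positivity))

end Inverse

end DSMO

end

noncomputable section

namespace DSMO

open scoped ENNReal

/-! ### The best responses and the gradient of the objective -/

section BestResponse

variable {M : ℕ} {d : Fin (M + 1) → ℕ} {K : ℕ}

namespace Problem

variable (p : Problem d K)

/-- `∇₂ g_m`. -/
def gradgAvg (m : Fin M) (y' : Vec (d m.castSucc)) (y : Vec (d m.succ)) : Vec (d m.succ) :=
  avg fun k => p.gradg₂ m k y' y

/-- `∇₁₂² g_m`. -/
def mixedAvg (m : Fin M) (y' : Vec (d m.castSucc)) (y : Vec (d m.succ)) :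
    Vec (d m.succ) →L[ℝ] Vec (d m.castSucc) := avg fun k => p.hessg₁₂ m k y' y

/-- `∇₂₂² g_m`. -/
def hessAvg (m : Fin M) (y' : Vec (d m.castSucc)) (y : Vec (d m.succ)) :
    Vec (d m.succ) →L[ℝ] Vec (d m.succ) := avg fun k => p.hessg₂₂ m k y' y

/-- `∇₁₂² g_m` at the best responses. -/
def uStar (m : Fin M) (x : Vec (d 0)) : Vec (d m.succ) →L[ℝ] Vec (d m.castSucc) :=
  p.mixedAvg m (p.yStar m.castSucc x) (p.yStar m.succ x)

/-- `∇₂₂² g_m` at the best responses. -/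
def hessStar (m : Fin M) (x : Vec (d 0)) : Vec (d m.succ) →L[ℝ] Vec (d m.succ) :=
  p.hessAvg m (p.yStar m.castSucc x) (p.yStar m.succ x)

/-- The inverse of `hessStar`. -/
def qStar (m : Fin M) (x : Vec (d 0)) : Vec (d m.succ) →L[ℝ] Vec (d m.succ) :=
  Ring.inverse (p.hessStar m x)

/-- `∇₁ f` at the best response. -/
def sStar (x : Vec (d 0)) : Vec (d 0) := avg fun k => p.gradf₁ k x (p.yStar (Fin.last M) x)

/-- `∇₂ f` at the best response. -/
def hStar (x : Vec (d 0)) : Vec (d (Fin.last M)) :=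
  avg fun k => p.gradf₂ k x (p.yStar (Fin.last M) x)

/-- The hypergradient. -/
def gradF (x : Vec (d 0)) : Vec (d 0) :=
  p.sStar x + (-1 : ℝ) ^ M •
    chainTo (fun m => p.uStar m x) (fun m => p.qStar m x) (Fin.last M) (p.hStar x)

theorem yStar_zero (x : Vec (d 0)) : p.yStar 0 x = x := rfl

end Problem

variable {p : Problem d K} {Λ : ℝ} {L : Fin M → ℝ} {D : (m : Fin (M + 1)) → Set (Vec (d m))}

namespace Regular

variable (hR : Regular Λ L p D)

include hR

theorem pos : 0 < Λ := zero_lt_one.trans_le hR.one_le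

theorem differentiable_g (m : Fin M) (k : Fin K) (y' : Vec (d m.castSucc)) :
    Differentiable ℝ fun y => p.g m k y' y :=
  ((hR.contDiff m k).comp (contDiff_const.prodMk contDiff_id)).differentiable (by norm_num)

theorem hasGradientAt_gAvg (m : Fin M) (y' : Vec (d m.castSucc)) (y : Vec (d m.succ)) :
    HasGradientAt (p.gAvg m y') (p.gradgAvg m y' y) y := by
  have h1 : HasFDerivAt (fun z => ∑ k, p.g m k y' z)
      (∑ k, InnerProductSpace.toDual ℝ _ (p.gradg₂ m k y' y)) y :=
    HasFDerivAt.fun_sum fun k _ => (hR.differentiable_g m k y' y).hasGradientAt.hasFDerivAt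
  have h2 := h1.const_mul (1 / (K : ℝ))
  rw [hasGradientAt_iff_hasFDerivAt]
  refine h2.congr_fderiv ?_
  unfold Problem.gradgAvg avg
  rw [map_smulₛₗ, map_sum]
  rfl

theorem differentiable_gAvg (m : Fin M) (y' : Vec (d m.castSucc)) :
    Differentiable ℝ (p.gAvg m y') := fun y =>
  (hR.hasGradientAt_gAvg m y' y).hasFDerivAt.differentiableAt

theorem gradgAvg_yStar (m : Fin M) (x : Vec (d 0)) :
    p.gradgAvg m (p.yStar m.castSucc x) (p.yStar m.succ x) = 0 := by
  have hmin := argmin_spec (strongConvexOn_exists_forall_le (inv_pos.2 hR.pos)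
    (hR.strongConvex m (p.yStar m.castSucc x)) (hR.differentiable_gAvg m _))
  have h1 : IsLocalMin (p.gAvg m (p.yStar m.castSucc x)) (p.yStar m.succ x) :=
    Filter.Eventually.of_forall hmin
  have h2 := h1.hasFDerivAt_eq_zero (hR.hasGradientAt_gAvg m _ _).hasFDerivAt
  exact (map_eq_zero_iff _ (InnerProductSpace.toDual ℝ _).injective).1 h2

theorem inner_gradgAvg_ge (m : Fin M) (y' : Vec (d m.castSucc)) (y z : Vec (d m.succ)) :
    Λ⁻¹ * ‖y - z‖ ^ 2 ≤ inner ℝ (p.gradgAvg m y' y - p.gradgAvg m y' z) (y - z) :=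
  strongConvexOn_inner_sub_ge (hR.strongConvex m y') (hR.hasGradientAt_gAvg m y' y)
    (hR.hasGradientAt_gAvg m y' z)

theorem lip_gradgAvg (m : Fin M) (y' z' : Vec (d m.castSucc)) (y z : Vec (d m.succ)) :
    ‖p.gradgAvg m y' y - p.gradgAvg m z' z‖ ≤ Λ * (‖y' - z'‖ + ‖y - z‖) := by
  unfold Problem.gradgAvg
  rw [← avg_sub]
  have := hR.pos
  exact norm_avg_le_of_forall (by positivity) fun k => hR.lip_gradg₂ m k _ _ _ _

theorem lip_mixedAvg (m : Fin M) (y' z' : Vec (d m.castSucc)) (y z : Vec (d m.succ)) :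
    ‖p.mixedAvg m y' y - p.mixedAvg m z' z‖ ≤ Λ * (‖y' - z'‖ + ‖y - z‖) := by
  unfold Problem.mixedAvg
  rw [← avg_sub]
  have := hR.pos
  exact norm_avg_le_of_forall (by positivity) fun k => hR.lip_hessg₁₂ m k _ _ _ _

theorem lip_hessAvg (m : Fin M) (y' z' : Vec (d m.castSucc)) (y z : Vec (d m.succ)) :
    ‖p.hessAvg m y' y - p.hessAvg m z' z‖ ≤ Λ * (‖y' - z'‖ + ‖y - z‖) := by
  unfold Problem.hessAvg
  rw [← avg_sub]
  have := hR.pos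
  exact norm_avg_le_of_forall (by positivity) fun k => hR.lip_hessg₂₂ m k _ _ _ _

theorem norm_uStar_le (m : Fin M) (x : Vec (d 0)) : ‖p.uStar m x‖ ≤ Λ :=
  norm_avg_le_of_forall hR.pos.le fun k => hR.norm_hessg₁₂ m k _ _

theorem inv_le_one : Λ⁻¹ ≤ 1 := inv_le_one_of_one_le₀ hR.one_le

theorem norm_hessStar_contraction (m : Fin M) (x : Vec (d 0)) :
    ‖ContinuousLinearMap.id ℝ (Vec (d m.succ)) - (1 / L m) • p.hessStar m x‖ ≤ 1 - Λ⁻¹ := by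
  have e : ContinuousLinearMap.id ℝ (Vec (d m.succ)) - (1 / L m) • p.hessStar m x =
      avg fun k => ContinuousLinearMap.id ℝ (Vec (d m.succ)) - (1 / L m) •
        p.hessg₂₂ m k (p.yStar m.castSucc x) (p.yStar m.succ x) := by
    rw [avg_sub, avg_smul, avg_const hR.card_pos]
    rfl
  rw [e]
  exact norm_avg_le_of_forall (sub_nonneg.2 hR.inv_le_one) fun k => hR.norm_contraction m k _ _

theorem norm_qStar_le (m : Fin M) (x : Vec (d 0)) : ‖p.qStar m x‖ ≤ Λ ^ 2 :=
  norm_inverse_le hR.one_le (hR.L_pos m) (hR.inv_L_le m) (hR.norm_hessStar_contraction m x)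

theorem adjoint_qStar (m : Fin M) (x : Vec (d 0)) :
    ContinuousLinearMap.adjoint (p.qStar m x) = p.qStar m x := by
  refine adjoint_inverse hR.one_le (hR.norm_hessStar_contraction m x) ?_
  unfold Problem.hessStar Problem.hessAvg avg
  rw [map_smulₛₗ, map_sum]
  simp [p.adjoint_hessg₂₂ (hR.contDiff m _)]

/-- Both gradients vanish at their own best responses. Strong monotonicity in `y`, tested on the
difference, is balanced against the Lipschitz dependence on the parameter. -/
theorem yStar_succ_lip (m : Fin M) (x x' : Vec (d 0)) :
    ‖p.yStar m.succ x - p.yStar m.succ x'‖ ≤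
      Λ ^ 2 * ‖p.yStar m.castSucc x - p.yStar m.castSucc x'‖ := by
  set y := p.yStar m.succ x
  set y' := p.yStar m.succ x'
  set v := p.yStar m.castSucc x
  set v' := p.yStar m.castSucc x'
  have h1 := hR.inner_gradgAvg_ge m v y y'
  have h2 : p.gradgAvg m v y = 0 := hR.gradgAvg_yStar m x
  have h3 : p.gradgAvg m v' y' = 0 := hR.gradgAvg_yStar m x'
  have h4 := hR.lip_gradgAvg m v' v y' y'
  rw [h3, sub_self, norm_zero, add_zero, zero_sub, norm_neg, norm_sub_rev] at h4
  rw [h2, zero_sub] at h1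
  have h5 := h1.trans (real_inner_le_norm _ _)
  rw [norm_neg] at h5
  by_cases hy : ‖y - y'‖ = 0
  · rw [hy]; positivity
  · have hpos : 0 < ‖y - y'‖ := lt_of_le_of_ne (norm_nonneg _) (Ne.symm hy)
    have h6 : Λ⁻¹ * ‖y - y'‖ ≤ Λ * ‖v - v'‖ := by
      refine le_of_mul_le_mul_right ?_ hpos
      calc Λ⁻¹ * ‖y - y'‖ * ‖y - y'‖ = Λ⁻¹ * ‖y - y'‖ ^ 2 := by ring
        _ ≤ ‖p.gradgAvg m v y'‖ * ‖y - y'‖ := h5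
        _ ≤ _ := by gcongr
    rw [inv_mul_le_iff₀ hR.pos] at h6
    calc _ ≤ _ := h6
      _ = _ := by ring

theorem yStar_lip (m : Fin (M + 1)) (x x' : Vec (d 0)) :
    ‖p.yStar m x - p.yStar m x'‖ ≤ Λ ^ (2 * M) * ‖x - x'‖ := by
  have h : ∀ m : Fin (M + 1), ‖p.yStar m x - p.yStar m x'‖ ≤ Λ ^ (2 * (m : ℕ)) * ‖x - x'‖ := by
    intro m
    induction m using Fin.induction with
    | zero => simp [Problem.yStar_zero]
    | succ m ih =>
      have := hR.pos
      calc _ ≤ Λ ^ 2 * ‖p.yStar m.castSucc x - p.yStar m.castSucc x'‖ := hR.yStar_succ_lip m x x'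
        _ ≤ Λ ^ 2 * (Λ ^ (2 * (m.castSucc : ℕ)) * ‖x - x'‖) := by gcongr
        _ = _ := by simp only [Fin.val_castSucc, Fin.val_succ]; ring
  refine (h m).trans ?_
  gcongr
  · exact hR.one_le
  · exact Nat.lt_succ_iff.1 m.2

theorem hasFDerivAt_gradgAvg (m : Fin M) (z : Vec (d m.castSucc) × Vec (d m.succ)) :
    HasFDerivAt (fun z : Vec (d m.castSucc) × Vec (d m.succ) => p.gradgAvg m z.1 z.2)
      (ContinuousLinearMap.adjoint (p.mixedAvg m z.1 z.2) ∘L ContinuousLinearMap.fst ℝ _ _ +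
        p.hessAvg m z.1 z.2 ∘L ContinuousLinearMap.snd ℝ _ _) z := by
  have h1 := HasFDerivAt.fun_sum (u := Finset.univ) fun k _ =>
    p.hasFDerivAt_gradg₂ (hR.contDiff m k) z
  have h2 := h1.const_smul (1 / (K : ℝ))
  refine h2.congr_fderiv ?_
  unfold Problem.mixedAvg Problem.hessAvg avg
  rw [map_smulₛₗ, map_sum]
  refine ContinuousLinearMap.ext fun v => ?_
  simp [Finset.sum_add_distrib]

/-- Implicit differentiation of `∇₂ g_m = 0`, level by level; each level contributes one minus sign
and one factor `∇₂₂² g_m⁻¹ (∇₁₂² g_m)ᵀ`. The adjoint appears because the algorithm stores the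
transposed product, and the inverse Hessian is symmetric. -/
theorem hasFDerivAt_yStar (m : Fin (M + 1)) (x : Vec (d 0)) :
    HasFDerivAt (p.yStar m) (ContinuousLinearMap.adjoint ((-1 : ℝ) ^ (m : ℕ) •
      chainTo (fun m => p.uStar m x) (fun m => p.qStar m x) m)) x := by
  induction m using Fin.induction with
  | zero =>
    simp only [Fin.val_zero, pow_zero, one_smul, chainTo_zero, ContinuousLinearMap.adjoint_id]
    exact hasFDerivAt_id x
  | succ m ih =>
    have h1 := hasFDerivAt_of_implicit (G := fun z => p.gradgAvg m z.1 z.2)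
      (hR.hasFDerivAt_gradgAvg m (p.yStar m.castSucc x, p.yStar m.succ x))
      (inverse_comp hR.one_le (hR.norm_hessStar_contraction m x)).1 ih
      (fun x' => hR.yStar_lip m.succ x' x) (hR.gradgAvg_yStar m)
    refine h1.congr_fderiv ?_
    simp only [Fin.val_castSucc, Fin.val_succ, chainTo_succ, map_smulₛₗ,
      ContinuousLinearMap.adjoint_comp]
    have := hR.adjoint_qStar m x
    rw [this]
    refine ContinuousLinearMap.ext fun v => ?_
    simp [pow_succ]
    rfl

/-- Chain rule for `x ↦ f(x, y_M⋆(x))`; transposing the derivative of `y_M⋆` yields the product that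
the algorithm estimates. -/
theorem hasGradientAt_F (x : Vec (d 0)) : HasGradientAt p.F (p.gradF x) x := by
  set Y := ContinuousLinearMap.adjoint ((-1 : ℝ) ^ M •
      chainTo (fun m => p.uStar m x) (fun m => p.qStar m x) (Fin.last M)) with hY
  have hy : HasFDerivAt (p.yStar (Fin.last M)) Y x := hR.hasFDerivAt_yStar (Fin.last M) x
  set y := p.yStar (Fin.last M) x
  have hf : ∀ k, HasFDerivAt (fun z : Vec (d 0) × Vec (d (Fin.last M)) => p.f k z.1 z.2)
      (InnerProductSpace.toDual ℝ _ (p.gradf₁ k x y) ∘L ContinuousLinearMap.fst ℝ _ _ +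
        InnerProductSpace.toDual ℝ _ (p.gradf₂ k x y) ∘L ContinuousLinearMap.snd ℝ _ _) (x, y) := by
    intro k
    have h2 := (hR.differentiable k (x, y)).hasFDerivAt
    have h3 := HasFDerivAt.comp (f := fun e => (e, y)) x h2 (hasFDerivAt_prodMk_left x y)
    have h4 := HasFDerivAt.comp (f := fun e => (x, e)) y h2 (hasFDerivAt_prodMk_right x y)
    have e1 : InnerProductSpace.toDual ℝ _ (p.gradf₁ k x y) = _ :=
      h3.differentiableAt.hasGradientAt.hasFDerivAt.unique h3
    have e2 : InnerProductSpace.toDual ℝ _ (p.gradf₂ k x y) = _ :=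
      h4.differentiableAt.hasGradientAt.hasFDerivAt.unique h4
    rw [e1, e2]
    refine h2.congr_fderiv (ContinuousLinearMap.ext fun v => ?_)
    simp [← map_add]
  have h5 : ∀ k, HasFDerivAt (fun x => p.f k x (p.yStar (Fin.last M) x)) _ x := fun k =>
    HasFDerivAt.comp (f := fun x => (x, p.yStar (Fin.last M) x)) x (hf k)
      ((hasFDerivAt_id x).prodMk hy)
  have h6 := (HasFDerivAt.fun_sum (u := Finset.univ) fun k _ => h5 k).const_mul (1 / (K : ℝ))
  rw [hasGradientAt_iff_hasFDerivAt]
  refine h6.congr_fderiv ?_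
  refine ContinuousLinearMap.ext fun v => ?_
  have e : inner ℝ (p.gradF x) v = inner ℝ (p.sStar x) v + inner ℝ (p.hStar x) (Y v) := by
    rw [Problem.gradF, inner_add_left, hY, ContinuousLinearMap.adjoint_inner_right]
    rfl
  rw [InnerProductSpace.toDual_apply_apply, e]
  simp [Problem.sStar, Problem.hStar, avg, inner_smul_left, sum_inner,
    Finset.sum_add_distrib, y]

end Regular

end BestResponse

end DSMO

end

noncomputable section

namespace DSMO

open scoped ENNReal

/-! ### Bounds and Lipschitz estimates along the best responses -/

section Bounds

variable {M : ℕ} {d : Fin (M + 1) → ℕ} {K : ℕ} {p : Problem d K} {Λ : ℝ} {L : Fin M → ℝ}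
  {D : (m : Fin (M + 1)) → Set (Vec (d m))}

/-- The bound `Λ` is the fixed point of `x ↦ 1 + (1 - Λ⁻¹) x`, hence independent of the number of
terms. -/
theorem norm_hessQ_le {n : ℕ} {L : ℝ} (hΛ : 1 ≤ Λ) {v : ℕ → Vec n →L[ℝ] Vec n}
    (h : ∀ i, ‖ContinuousLinearMap.id ℝ (Vec n) - (1 / L) • v i‖ ≤ 1 - Λ⁻¹) (b : ℕ) :
    ‖hessQ L v b‖ ≤ Λ := by
  induction b with
  | zero => exact ContinuousLinearMap.norm_id_le.trans hΛ
  | succ b ih =>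
    have h0 : 0 ≤ 1 - Λ⁻¹ := (norm_nonneg _).trans (h 0)
    calc ‖hessQ L v (b + 1)‖ ≤ 1 + (1 - Λ⁻¹) * Λ :=
          (norm_add_le _ _).trans (add_le_add ContinuousLinearMap.norm_id_le
            ((ContinuousLinearMap.opNorm_comp_le _ _).trans
              (mul_le_mul (h b) ih (norm_nonneg _) h0)))
      _ = Λ := by field_simp; ring

/-- The Lipschitz constant of the objects evaluated at the best responses. -/
def lipStar (M : ℕ) (Λ : ℝ) : ℝ := 2 * Λ ^ (2 * M + 1)

/-- The sensitivity of the chain to its factors. -/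
def chainConst (M : ℕ) (Λ : ℝ) : ℝ := 2 * M * Λ ^ (3 * M) * Λ + Λ ^ (3 * M)

theorem chainConst_pos (M : ℕ) (hΛ : 1 ≤ Λ) : 0 < chainConst M Λ := by
  unfold chainConst; positivity

/-- Only the first vector `h` has to be bounded: the difference of the chains acts on `h`, and the
second chain acts on `h - h'`. Thus in `Regular.lip_gradF` only one of the two points has to lie in
`D 0`. -/
theorem norm_chain_apply_sub_le (hΛ : 1 ≤ Λ)
    {u u' : (m : Fin M) → Vec (d m.succ) →L[ℝ] Vec (d m.castSucc)}
    {q q' : (m : Fin M) → Vec (d m.succ) →L[ℝ] Vec (d m.succ)} {h h' : Vec (d (Fin.last M))}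
    (hu : ∀ m, ‖u m‖ ≤ Λ) (hq : ∀ m, ‖q m‖ ≤ Λ ^ 2)
    (hu' : ∀ m, ‖u' m‖ ≤ Λ) (hq' : ∀ m, ‖q' m‖ ≤ Λ ^ 2) (hh : ‖h‖ ≤ Λ) {s : ℝ}
    (hsu : ∀ m, ‖u m - u' m‖ ≤ s) (hsq : ∀ m, ‖q m - q' m‖ ≤ s) (hsh : ‖h - h'‖ ≤ s) :
    ‖chainTo u q (Fin.last M) h - chainTo u' q' (Fin.last M) h'‖ ≤ chainConst M Λ * s := by
  have e : chainTo u q (Fin.last M) h - chainTo u' q' (Fin.last M) h' =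
      (chainTo u q (Fin.last M) - chainTo u' q' (Fin.last M)) h +
        chainTo u' q' (Fin.last M) (h - h') := by
    simp
  have hs : 0 ≤ s := (norm_nonneg _).trans hsh
  have h1 := norm_chainTo_sub_le hΛ hu hq hu' hq' hsu hsq (Fin.last M)
  have h2 := norm_chainTo_le hΛ hu' hq' (Fin.last M)
  simp only [Fin.val_last] at h1 h2
  rw [e]
  calc _ ≤ ‖chainTo u q (Fin.last M) - chainTo u' q' (Fin.last M)‖ * ‖h‖ +
        ‖chainTo u' q' (Fin.last M)‖ * ‖h - h'‖ :=
        (norm_add_le _ _).trans (add_le_add (ContinuousLinearMap.le_opNorm _ _)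
          (ContinuousLinearMap.le_opNorm _ _))
    _ ≤ 2 * M * Λ ^ (3 * M) * s * Λ + Λ ^ (3 * M) * s := by gcongr
    _ = _ := by unfold chainConst; ring

namespace Regular

variable (hR : Regular Λ L p D)

include hR

theorem lipStar_nonneg : 0 ≤ lipStar M Λ := by
  have := hR.pos
  unfold lipStar; positivity

theorem add_yStar_le (x x' : Vec (d 0)) (m m' : Fin (M + 1)) :
    Λ * (‖p.yStar m x - p.yStar m x'‖ + ‖p.yStar m' x - p.yStar m' x'‖) ≤
      lipStar M Λ * ‖x - x'‖ := by
  have h1 := hR.yStar_lip m x x'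
  have h2 := hR.yStar_lip m' x x'
  have := hR.pos
  calc _ ≤ Λ * (Λ ^ (2 * M) * ‖x - x'‖ + Λ ^ (2 * M) * ‖x - x'‖) := by gcongr
    _ = _ := by unfold lipStar; ring

theorem yStar_lip' (m : Fin (M + 1)) (x x' : Vec (d 0)) :
    ‖p.yStar m x - p.yStar m x'‖ ≤ lipStar M Λ * ‖x - x'‖ := by
  refine (hR.yStar_lip m x x').trans ?_
  gcongr
  unfold lipStar
  have := hR.one_le
  have h1 : 0 < Λ ^ (2 * M) := by positivity
  rw [pow_succ]
  nlinarith

theorem lip_uStar (m : Fin M) (x x' : Vec (d 0)) :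
    ‖p.uStar m x - p.uStar m x'‖ ≤ lipStar M Λ * ‖x - x'‖ :=
  (hR.lip_mixedAvg m _ _ _ _).trans (hR.add_yStar_le x x' _ _)

theorem lip_hessStar (m : Fin M) (x x' : Vec (d 0)) :
    ‖p.hessStar m x - p.hessStar m x'‖ ≤ lipStar M Λ * ‖x - x'‖ :=
  (hR.lip_hessAvg m _ _ _ _).trans (hR.add_yStar_le x x' _ _)

theorem lip_sStar (x x' : Vec (d 0)) : ‖p.sStar x - p.sStar x'‖ ≤ lipStar M Λ * ‖x - x'‖ := by
  refine le_trans ?_ (hR.add_yStar_le x x' 0 (Fin.last M))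
  have := hR.pos
  unfold Problem.sStar
  rw [← avg_sub]
  exact norm_avg_le_of_forall (by positivity) fun k => hR.lip_gradf₁ k _ _ _ _

theorem lip_hStar (x x' : Vec (d 0)) : ‖p.hStar x - p.hStar x'‖ ≤ lipStar M Λ * ‖x - x'‖ := by
  refine le_trans ?_ (hR.add_yStar_le x x' 0 (Fin.last M))
  have := hR.pos
  unfold Problem.hStar
  rw [← avg_sub]
  exact norm_avg_le_of_forall (by positivity) fun k => hR.lip_gradf₂ k _ _ _ _

theorem lip_qStar (m : Fin M) (x x' : Vec (d 0)) :
    ‖p.qStar m x - p.qStar m x'‖ ≤ Λ ^ 4 * (lipStar M Λ * ‖x - x'‖) := by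
  have := hR.pos
  refine (norm_inverse_sub_le hR.one_le (hR.L_pos m) (hR.inv_L_le m)
    (hR.norm_hessStar_contraction m x) (hR.norm_hessStar_contraction m x')).trans ?_
  gcongr
  exact hR.lip_hessStar m x x'

theorem norm_sStar_le {x : Vec (d 0)} (hx : x ∈ D 0) : ‖p.sStar x‖ ≤ Λ :=
  norm_avg_le_of_forall hR.pos.le fun k => hR.norm_gradf₁ k x hx _ (hR.yStar_mem _ x hx)

theorem norm_hStar_le {x : Vec (d 0)} (hx : x ∈ D 0) : ‖p.hStar x‖ ≤ Λ :=
  norm_avg_le_of_forall hR.pos.le fun k => hR.norm_gradf₂ k x hx _ (hR.yStar_mem _ x hx)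

theorem norm_gradF_le {x : Vec (d 0)} (hx : x ∈ D 0) : ‖p.gradF x‖ ≤ Λ + Λ ^ (3 * M) * Λ := by
  unfold Problem.gradF
  refine (norm_add_le _ _).trans (add_le_add (hR.norm_sStar_le hx) ?_)
  rw [norm_smul, norm_pow, norm_neg, norm_one, one_pow, one_mul]
  refine (ContinuousLinearMap.le_opNorm _ _).trans ?_
  have h1 := norm_chainTo_le hR.one_le (fun m => hR.norm_uStar_le m x) (fun m => hR.norm_qStar_le m x)
    (Fin.last M)
  simp only [Fin.val_last] at h1
  have := hR.pos
  exact mul_le_mul h1 (hR.norm_hStar_le hx) (norm_nonneg _) (by positivity)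

theorem lip_gradF {x x' : Vec (d 0)} (hx : x ∈ D 0) :
    ‖p.gradF x - p.gradF x'‖ ≤ (1 + chainConst M Λ) * (Λ ^ 4 * lipStar M Λ) * ‖x - x'‖ := by
  have h1 : ∀ a : ℝ, 0 ≤ a → a ≤ Λ ^ 4 * a := fun a ha =>
    le_mul_of_one_le_left ha (one_le_pow₀ hR.one_le)
  have h2 : lipStar M Λ * ‖x - x'‖ ≤ Λ ^ 4 * (lipStar M Λ * ‖x - x'‖) :=
    h1 _ (mul_nonneg hR.lipStar_nonneg (norm_nonneg _))
  have h3 := norm_chain_apply_sub_le hR.one_le (fun m => hR.norm_uStar_le m x)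
    (fun m => hR.norm_qStar_le m x) (fun m => hR.norm_uStar_le m x') (fun m => hR.norm_qStar_le m x')
    (hR.norm_hStar_le hx) (fun m => (hR.lip_uStar m x x').trans h2) (fun m => hR.lip_qStar m x x')
    ((hR.lip_hStar x x').trans h2)
  have e : p.gradF x - p.gradF x' = (p.sStar x - p.sStar x') + (-1 : ℝ) ^ M •
      (chainTo (fun m => p.uStar m x) (fun m => p.qStar m x) (Fin.last M) (p.hStar x) -
      chainTo (fun m => p.uStar m x') (fun m => p.qStar m x') (Fin.last M) (p.hStar x')) := by
    unfold Problem.gradF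
    rw [smul_sub]; abel
  rw [e]
  refine (norm_add_le _ _).trans ?_
  rw [norm_smul, norm_pow, norm_neg, norm_one, one_pow, one_mul]
  refine (add_le_add ((hR.lip_sStar x x').trans h2) h3).trans (le_of_eq ?_)
  ring

/-- Mean value inequality on the segment, where the gradient differs from the one at `x` by at most
the Lipschitz constant times `‖x' - x‖`. The usual factor `1/2` is not needed. -/
theorem descent {x x' : Vec (d 0)} (hx : x ∈ D 0) (hx' : x' ∈ D 0) :
    p.F x' ≤ p.F x + inner ℝ (p.gradF x) (x' - x) +
      (1 + chainConst M Λ) * (Λ ^ 4 * lipStar M Λ) * ‖x' - x‖ ^ 2 := by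
  set C := (1 + chainConst M Λ) * (Λ ^ 4 * lipStar M Λ) with hC
  have hC0 : 0 ≤ C := by
    have := (chainConst_pos M hR.one_le).le
    have := hR.lipStar_nonneg
    have := hR.pos
    positivity
  have hseg : segment ℝ x x' ⊆ D 0 := (hR.convex 0).segment_subset hx hx'
  have h1 := Convex.norm_image_sub_le_of_norm_hasFDerivWithin_le' (f := p.F)
    (f' := fun z => InnerProductSpace.toDual ℝ _ (p.gradF z)) (C := C * ‖x' - x‖)
    (φ := InnerProductSpace.toDual ℝ _ (p.gradF x)) (s := segment ℝ x x') (x := x) (y := x')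
    (fun z _ => (hR.hasGradientAt_F z).hasFDerivAt.hasFDerivWithinAt) (fun z hz => by
      rw [← map_sub, LinearIsometryEquiv.norm_map, norm_sub_rev]
      refine (hR.lip_gradF hx).trans ?_
      gcongr
      obtain ⟨a, b, ha, hb, hab, rfl⟩ := hz
      have e : x - (a • x + b • x') = b • (x - x') := by
        have : a = 1 - b := by linarith
        rw [this]; module
      rw [e, norm_smul, Real.norm_of_nonneg hb, norm_sub_rev]
      exact mul_le_of_le_one_left (norm_nonneg _) (by linarith))
    (convex_segment _ _) (left_mem_segment _ _ _) (right_mem_segment _ _ _)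
  rw [InnerProductSpace.toDual_apply_apply] at h1
  have h2 := (abs_le.1 h1).2
  rw [sq, ← mul_assoc]
  linarith

theorem FStar_le (x : Vec (d 0)) : p.FStar ≤ p.F x := by
  obtain ⟨x₀, h0⟩ := hR.exists_min
  exact ciInf_le ⟨p.F x₀, by rintro _ ⟨z, rfl⟩; exact h0 z⟩ x

/-- PL read backwards: the bounded gradient on `D 0` bounds the gap. This keeps the initial value of
`F` out of the constants. -/
theorem gap_le {μ : ℝ} (hμ : 0 < μ) (hPL : p.PL μ) {x : Vec (d 0)} (hx : x ∈ D 0) :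
    p.F x - p.FStar ≤ (Λ + Λ ^ (3 * M) * Λ) ^ 2 / (2 * μ) := by
  have h1 := hPL x
  rw [(hR.hasGradientAt_F x).gradient] at h1
  rw [le_div_iff₀ (by positivity), mul_comm]
  exact h1.trans (pow_le_pow_left₀ (norm_nonneg _) (hR.norm_gradF_le hx) 2)

/-- One gradient step contracts towards the best response. -/
theorem gradient_step (m : Fin M) (x : Vec (d 0)) (y : Vec (d m.succ)) {γ : ℝ} (hγ : 0 ≤ γ) :
    ‖y - p.yStar m.succ x - γ • p.gradgAvg m (p.yStar m.castSucc x) y‖ ^ 2 ≤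
      (1 - 2 * γ * Λ⁻¹ + γ ^ 2 * Λ ^ 2) * ‖y - p.yStar m.succ x‖ ^ 2 := by
  have h0 := hR.gradgAvg_yStar m x
  have h1 := hR.inner_gradgAvg_ge m (p.yStar m.castSucc x) y (p.yStar m.succ x)
  have h2 := hR.lip_gradgAvg m (p.yStar m.castSucc x) (p.yStar m.castSucc x) y (p.yStar m.succ x)
  rw [h0, sub_zero] at h1 h2
  rw [sub_self, norm_zero, zero_add] at h2
  have h3 := pow_le_pow_left₀ (norm_nonneg _) h2 2
  rw [norm_sub_sq_real, inner_smul_right, norm_smul, mul_pow, Real.norm_eq_abs, sq_abs,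
    real_inner_comm]
  have h4 := mul_le_mul_of_nonneg_left h3 (sq_nonneg γ)
  have h5 := mul_le_mul_of_nonneg_left h1 hγ
  nlinarith

end Regular

end Bounds

/-! ### Regularity from the stochastic assumptions -/

section FromAssumptions

/-- Jensen's inequality, in the form `2‖a‖‖X‖ ≤ ‖a‖² + ‖X‖²`. It turns the moment assumptions into
deterministic bounds for the means, and thus for everything noiseless. -/
theorem norm_le_of_secondMoment {S V : Type*} [MeasurableSpace S] [NormedAddCommGroup V]
    [NormedSpace ℝ V] {ν : Measure S} [IsProbabilityMeasure ν] {X : S → V} {a : V} {C : ℝ}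
    (hC : 0 ≤ C) (h : Unbiased ν X a) (h' : SecondMomentLE ν X C) : ‖a‖ ≤ C := by
  have h1 : ‖a‖ ≤ ∫ s, ‖X s‖ ∂ν := by
    rw [← h.2]; exact norm_integral_le_integral_norm _
  have hi : Integrable (fun s => ‖X s‖ ^ 2) ν := h'.1.integrable_norm_pow (by norm_num)
  have h2 : ∫ s, 2 * ‖a‖ * ‖X s‖ ∂ν ≤ ∫ s, (‖a‖ ^ 2 + ‖X s‖ ^ 2) ∂ν :=
    integral_mono (h.1.norm.const_mul _) ((integrable_const _).add hi) fun s => by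
      simp only
      nlinarith [sq_nonneg (‖a‖ - ‖X s‖)]
  rw [integral_const_mul, integral_add (integrable_const _) hi] at h2
  simp only [integral_const, probReal_univ, smul_eq_mul, one_mul] at h2
  have h3 := h'.2
  have h4 := mul_le_mul_of_nonneg_left h1 (norm_nonneg a)
  exact le_of_sq_le_sq (by nlinarith) hC

theorem norm_le_frobNorm {n m : ℕ} (A : Vec n →L[ℝ] Vec m) : ‖A‖ ≤ frobNorm A := by
  refine ContinuousLinearMap.opNorm_le_bound _ (Real.sqrt_nonneg _) fun v => ?_
  have e : A v = ∑ i, v i • A (EuclideanSpace.single i 1) := by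
    conv_lhs => rw [eq_sum_inner_single v]
    simp [EuclideanSpace.inner_single_right]
  have h1 : ‖A v‖ ≤ ∑ i, |v i| * ‖A (EuclideanSpace.single i 1)‖ := by
    rw [e]
    refine (norm_sum_le _ _).trans (le_of_eq ?_)
    simp [norm_smul]
  refine h1.trans ?_
  have h2 := Real.sum_mul_le_sqrt_mul_sqrt Finset.univ (fun i => |v i|)
    (fun i => ‖A (EuclideanSpace.single i 1)‖)
  refine h2.trans (le_of_eq ?_)
  rw [mul_comm, frobNorm, EuclideanSpace.norm_eq]
  simp

variable {M : ℕ} {d : Fin (M + 1) → ℕ} {K : ℕ}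

/-- A constant that dominates all constants of the assumptions. -/
def Constants.total (c : Constants M) : ℝ :=
  1 + c.Cf + c.Lf + ∑ m, (c.Cg m + c.Lg m + c.Lt m + 1 / c.μg m + 1 / c.κ m + 1 / c.Lg m)

theorem Constants.total_spec (c : Constants M) : 1 ≤ c.total ∧ c.Cf ≤ c.total ∧ c.Lf ≤ c.total ∧
    ∀ m, c.Cg m ≤ c.total ∧ c.Lg m ≤ c.total ∧ c.Lt m ≤ c.total ∧ 1 / c.μg m ≤ c.total ∧
      1 / c.κ m ≤ c.total ∧ 1 / c.Lg m ≤ c.total := by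
  have h1 := c.Cf_pos
  have h2 := c.Lf_pos
  have hpos : ∀ m, 0 < c.Cg m ∧ 0 < c.Lg m ∧ 0 < c.Lt m ∧ 0 < 1 / c.μg m ∧ 0 < 1 / c.κ m ∧
      0 < 1 / c.Lg m := fun m =>
    ⟨c.Cg_pos m, c.Lg_pos m, c.Lt_pos m, one_div_pos.2 (c.μg_pos m), one_div_pos.2 (c.κ_pos m),
      one_div_pos.2 (c.Lg_pos m)⟩
  have hnn : ∀ m ∈ Finset.univ, 0 ≤ c.Cg m + c.Lg m + c.Lt m + 1 / c.μg m + 1 / c.κ m + 1 / c.Lg m :=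
    fun m _ => by obtain ⟨a1, a2, a3, a4, a5, a6⟩ := hpos m; linarith
  have hs := Finset.sum_nonneg hnn
  unfold Constants.total
  refine ⟨by linarith, by linarith, by linarith, fun m => ?_⟩
  have hm := Finset.single_le_sum hnn (Finset.mem_univ m)
  obtain ⟨a1, a2, a3, a4, a5, a6⟩ := hpos m
  refine ⟨?_, ?_, ?_, ?_, ?_, ?_⟩ <;> linarith

theorem Constants.inv_total_le_κ (c : Constants M) (m : Fin M) : c.total⁻¹ ≤ c.κ m := by
  obtain ⟨h1, -, -, h⟩ := c.total_spec
  obtain ⟨-, -, -, -, h5, -⟩ := h m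
  rw [one_div] at h5
  exact inv_le_of_inv_le₀ (c.κ_pos m) h5

theorem Constants.inv_total_le_μg (c : Constants M) (m : Fin M) : c.total⁻¹ ≤ c.μg m := by
  obtain ⟨h1, -, -, h⟩ := c.total_spec
  obtain ⟨-, -, -, h5, -, -⟩ := h m
  rw [one_div] at h5
  exact inv_le_of_inv_le₀ (c.μg_pos m) h5

theorem Constants.κ_le_one (c : Constants M) (m : Fin M) : c.κ m ≤ 1 := (c.κ_le m).trans (c.μg_div_le m)

theorem IsSampling.isProbabilityMeasure_outerLaw {S Ω : Type*} [MeasurableSpace S]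
    [MeasurableSpace Ω] {o : Oracle d K S} {P : Measure Ω} [IsProbabilityMeasure P]
    {ξ : Query M K → Ω → S} (h : IsSampling o P ξ) (k : Fin K) :
    IsProbabilityMeasure (o.outerLaw k) := by
  rw [← h.outer 0 k]
  exact Measure.isProbabilityMeasure_map (h.measurable _).aemeasurable

theorem IsSampling.isProbabilityMeasure_innerLaw {S Ω : Type*} [MeasurableSpace S]
    [MeasurableSpace Ω] {o : Oracle d K S} {P : Measure Ω} [IsProbabilityMeasure P]
    {ξ : Query M K → Ω → S} (h : IsSampling o P ξ) (m : Fin M) (k : Fin K) :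
    IsProbabilityMeasure (o.innerLaw m k) := by
  rw [← h.inner 0 m k]
  exact Measure.isProbabilityMeasure_map (h.measurable _).aemeasurable

theorem unbiased_contraction {S : Type*} [MeasurableSpace S] {n : ℕ} {ν : Measure S}
    [IsProbabilityMeasure ν] {X : S → Vec n →L[ℝ] Vec n} {a : Vec n →L[ℝ] Vec n}
    (h : Unbiased ν X a) (L : ℝ) :
    Unbiased ν (fun s => ContinuousLinearMap.id ℝ (Vec n) - (1 / L) • X s)
      (ContinuousLinearMap.id ℝ (Vec n) - (1 / L) • a) := by
  have hi : Integrable (fun s => (1 / L) • X s) ν := by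
    have := h.1.smul (1 / L)
    exact this
  refine ⟨(integrable_const _).sub hi, ?_⟩
  rw [integral_sub (integrable_const _) hi, integral_smul, h.2]
  simp

theorem norm_contraction_le {S Ω : Type*} [MeasurableSpace S]
    [MeasurableSpace Ω] {c : Constants M} {p : Problem d K} {o : Oracle d K S} {P : Measure Ω}
    [IsProbabilityMeasure P] {ξ : Query M K → Ω → S} {D : (m : Fin (M + 1)) → Set (Vec (d m))}
    (ho : o.IsUnbiased p) (hs : IsSampling o P ξ) (h2 : InnerAssumption c p o D) (m : Fin M)
    (k : Fin K) (y' : Vec (d m.castSucc)) (y : Vec (d m.succ)) :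
    ‖ContinuousLinearMap.id ℝ (Vec (d m.succ)) - (1 / c.Lg m) • p.hessg₂₂ m k y' y‖ ≤ 1 - c.κ m := by
  have := hs.isProbabilityMeasure_innerLaw m k
  exact norm_le_of_secondMoment (sub_nonneg.2 (c.κ_le_one m))
    (unbiased_contraction (ho.hessg₂₂ m k y' y) (c.Lg m)) (h2.moment_contraction m k y' y)

theorem regular_of_assumptions {S Ω : Type*} [MeasurableSpace S]
    [MeasurableSpace Ω] {c : Constants M} {p : Problem d K} {o : Oracle d K S} {P : Measure Ω}
    [IsProbabilityMeasure P] {ξ : Query M K → Ω → S} {D : (m : Fin (M + 1)) → Set (Vec (d m))}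
    (hK : 0 < K) (ho : o.IsUnbiased p) (hs : IsSampling o P ξ) (h1 : OuterAssumption c p o D)
    (h2 : InnerAssumption c p o D) (hconv : ∀ m, Convex ℝ (D m))
    (hmem : ∀ m, ∀ x ∈ D 0, p.yStar m x ∈ D m) : Regular c.total c.Lg p D := by
  obtain ⟨t0, tCf, tLf, tm⟩ := c.total_spec
  have h0 : 0 < c.total := by linarith
  have hp1 := hs.isProbabilityMeasure_outerLaw
  have hp2 := hs.isProbabilityMeasure_innerLaw
  refine
  { one_le := t0
    L_pos := c.Lg_pos
    L_le := fun m => (tm m).2.1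
    inv_L_le := fun m => (tm m).2.2.2.2.2
    card_pos := hK
    exists_min := h1.exists_min
    differentiable := h1.differentiable
    lip_gradf₁ := fun k x x' y y' => (h1.lip_gradf₁ k x x' y y').trans (by gcongr)
    lip_gradf₂ := fun k x x' y y' => (h1.lip_gradf₂ k x x' y y').trans (by gcongr)
    norm_gradf₁ := fun k x hx y hy => (norm_le_of_secondMoment c.Cf_pos.le (ho.gradf₁ k x y)
      (h1.moment_gradf₁ k x hx y hy)).trans tCf
    norm_gradf₂ := fun k x hx y hy => (norm_le_of_secondMoment c.Cf_pos.le (ho.gradf₂ k x y)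
      (h1.moment_gradf₂ k x hx y hy)).trans tCf
    strongConvex := fun m y' => (h2.strongConvex m y').mono (c.inv_total_le_μg m)
    contDiff := h2.contDiff
    lip_gradg₂ := fun m k y' z' y z => (h2.lip_gradg₂ m k y' z' y z).trans (by
      have := (tm m).2.1
      gcongr)
    lip_hessg₁₂ := fun m k y' z' y z => (norm_le_frobNorm _).trans
      ((h2.lip_hessg₁₂ m k y' z' y z).trans (by
        have := (tm m).2.2.1
        gcongr))
    lip_hessg₂₂ := fun m k y' z' y z => (norm_le_frobNorm _).trans
      ((h2.lip_hessg₂₂ m k y' z' y z).trans (by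
        have := (tm m).2.2.1
        gcongr))
    norm_hessg₁₂ := fun m k y' y => (norm_le_of_secondMoment (c.Lg_pos m).le
      (ho.hessg₁₂ m k y' y) (h2.moment_hessg₁₂ m k y' y)).trans (tm m).2.1
    norm_contraction := fun m k y' y => (norm_contraction_le ho hs h2 m k y' y).trans
      (by have := c.inv_total_le_κ m
          linarith)
    convex := hconv
    yStar_mem := hmem }

end FromAssumptions

end DSMO

end

noncomputable section

namespace DSMO

open scoped ENNReal

/-! ### Momentum recursions over the network -/

section Drive

variable {K : ℕ} {V : Type*} [NormedAddCommGroup V] [NormedSpace ℝ V]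

/-- The momentum recursion with gossip, driven by the inputs `m`. -/
def drive (C₁ : ℝ) (W : Matrix (Fin K) (Fin K) ℝ) (m : ℕ → Fin K → V) (g₀ : V) : ℕ → Fin K → V
  | 0 => fun _ => g₀
  | t + 1 => fun k => (1 - C₁ / (C₁ + t)) • mix W (drive C₁ W m g₀ t) k + (C₁ / (C₁ + t)) • m t k

variable {C₁ : ℝ} {W : Matrix (Fin K) (Fin K) ℝ} {ρ : ℝ} {m : ℕ → Fin K → V} {g₀ : V}

theorem drive_succ (t : ℕ) (k : Fin K) : drive C₁ W m g₀ (t + 1) k =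
    (1 - C₁ / (C₁ + t)) • mix W (drive C₁ W m g₀ t) k + (C₁ / (C₁ + t)) • m t k := rfl

theorem momentum_nonneg (hC : 0 < C₁) (t : ℕ) : 0 ≤ C₁ / (C₁ + t) ∧ 0 ≤ 1 - C₁ / (C₁ + t) := by
  have ht : (0 : ℝ) ≤ t := Nat.cast_nonneg t
  refine ⟨by positivity, ?_⟩
  rw [sub_nonneg, div_le_one (by positivity)]
  linarith

theorem norm_drive_le (hW : IsGossip W ρ) (hC₁ : 0 < C₁) {C : ℝ} (h0 : ‖g₀‖ ≤ C) {T : ℕ}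
    (hm : ∀ t < T, ∀ k, ‖m t k‖ ≤ C) : ∀ t ≤ T, ∀ k, ‖drive C₁ W m g₀ t k‖ ≤ C := by
  intro t
  induction t with
  | zero => exact fun _ _ => h0
  | succ t ih =>
    intro ht k
    obtain ⟨h1, h2⟩ := momentum_nonneg hC₁ t
    rw [drive_succ]
    refine (norm_add_le _ _).trans ?_
    rw [norm_smul, norm_smul, Real.norm_of_nonneg h1, Real.norm_of_nonneg h2]
    have h3 := hW.norm_mix_le_of_forall (ih (Nat.le_of_succ_le ht)) k
    have h4 := hm t ht k
    calc _ ≤ (1 - C₁ / (C₁ + t)) * C + C₁ / (C₁ + t) * C := by gcongr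
      _ = C := by ring

theorem avg_drive_succ (hW : IsGossip W ρ) (t : ℕ) : avg (drive C₁ W m g₀ (t + 1)) =
    (1 - C₁ / (C₁ + t)) • avg (drive C₁ W m g₀ t) + (C₁ / (C₁ + t)) • avg (m t) := by
  have : drive C₁ W m g₀ (t + 1) = fun k =>
      (1 - C₁ / (C₁ + t)) • mix W (drive C₁ W m g₀ t) k + (C₁ / (C₁ + t)) • m t k := rfl
  rw [this, avg_add, avg_smul, avg_smul, hW.avg_mix]

/-- The recursion is linear, so it can be transported to a Euclidean space, where the spectral gap
of `W` acts as a contraction. -/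
theorem map_drive {V' : Type*} [NormedAddCommGroup V'] [NormedSpace ℝ V'] (f : V →L[ℝ] V') (t : ℕ) :
    ∀ k, drive C₁ W (fun t k => f (m t k)) (f g₀) t k = f (drive C₁ W m g₀ t k) := by
  induction t with
  | zero => exact fun _ => rfl
  | succ t ih =>
    intro k
    rw [drive_succ, drive_succ, map_add, map_smul, map_smul, ← mix_map]
    congr 2
    exact congrArg (fun z => mix W z k) (funext ih)

/-- Minkowski's inequality for deviations: in `IsGossip.dev_step` the best weights are the two
bounds themselves. As they may vanish, `ε/2` is added to each and then removed in the limit. -/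
theorem IsGossip.dev_step_le (hW : IsGossip W ρ) {n : ℕ} {z N : Fin K → EuclideanSpace ℝ (Fin n)}
    {θ c r A B : ℝ} (hθ : 0 ≤ θ) (hc : 0 ≤ c) (hr : 0 ≤ r) (hρ : ρ = r ^ 2) (hA : 0 ≤ A)
    (hB : 0 ≤ B) (hz : dev z ≤ A ^ 2) (hN : msq N ≤ B ^ 2) :
    dev (fun k => θ • mix W z k + c • N k) ≤ (θ * r * A + c * B) ^ 2 := by
  have hs : ∀ ε : ℝ, 0 < ε → Real.sqrt (dev fun k => θ • mix W z k + c • N k) ≤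
      (θ * r * A + c * B) + ε := by
    intro ε hε
    have hp : 0 < θ * r * A + ε / 2 := by positivity
    have hq : 0 < c * B + ε / 2 := by positivity
    refine Real.sqrt_le_iff.2 ⟨by positivity, (hW.dev_step z N θ c hp hq).trans ?_⟩
    have h1 : θ ^ 2 * ρ * dev z / (θ * r * A + ε / 2) ≤ θ * r * A + ε / 2 := by
      rw [div_le_iff₀ hp]
      calc θ ^ 2 * ρ * dev z ≤ θ ^ 2 * ρ * A ^ 2 := by rw [hρ]; gcongr
        _ = (θ * r * A) * (θ * r * A) := by rw [hρ]; ring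
        _ ≤ _ := by gcongr <;> linarith
    have h2 : c ^ 2 * msq N / (c * B + ε / 2) ≤ c * B + ε / 2 := by
      rw [div_le_iff₀ hq]
      calc c ^ 2 * msq N ≤ c ^ 2 * B ^ 2 := by gcongr
        _ = (c * B) * (c * B) := by ring
        _ ≤ _ := by gcongr <;> linarith
    calc _ ≤ ((θ * r * A + ε / 2) + (c * B + ε / 2)) * ((θ * r * A + ε / 2) + (c * B + ε / 2)) := by
          gcongr
      _ = _ := by ring
  have h := le_of_forall_pos_le_add hs
  calc _ = Real.sqrt (dev fun k => θ • mix W z k + c • N k) ^ 2 := (Real.sq_sqrt (dev_nonneg _)).symm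
    _ ≤ _ := pow_le_pow_left₀ (Real.sqrt_nonneg _) h 2

/-- Bounded inputs may add up coherently over the rounds, so norms rather than variances are
propagated; this costs `(1-r)⁻²` in the square, against `(1-ρ)⁻¹` for independent noise. -/
theorem dev_drive_le {n : ℕ} {m : ℕ → Fin K → EuclideanSpace ℝ (Fin n)} {g₀ : EuclideanSpace ℝ (Fin n)}
    (hW : IsGossip W ρ) (hC₁ : 3 ≤ C₁) {r : ℝ} (hr : 0 ≤ r) (hr1 : r < 1) (hρ : ρ = r ^ 2) {C : ℝ}
    (hC : 0 ≤ C) {T : ℕ} (hm : ∀ t < T, ∀ k, ‖m t k‖ ≤ C) :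
    ∀ t ≤ T, dev (drive C₁ W m g₀ t) ≤ (C * (2 * C₁ / (1 - r) * (1 / (C₁ + t)))) ^ 2 := by
  have hr2 : 0 < 1 - r := by linarith
  have hC0 : 0 < C₁ := by linarith
  intro t
  induction t with
  | zero =>
    intro _
    have : dev (drive C₁ W m g₀ 0) = 0 := dev_eq_zero_of_const g₀
    rw [this]
    positivity
  | succ t ih =>
    intro ht
    obtain ⟨h1, h2⟩ := momentum_nonneg hC0 t
    have ht0 : (0 : ℝ) ≤ t := Nat.cast_nonneg t
    refine (hW.dev_step_le h2 h1 hr hρ (by positivity) hC (ih (Nat.le_of_succ_le ht))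
      (msq_le_of_forall (hm t ht))).trans ?_
    have := mul_le_mul_of_nonneg_left (consensus_mean_rec_step hC₁ hr hr1 t) hC
    refine pow_le_pow_left₀ (by positivity) ?_ 2
    linarith

theorem measurable_mix {Ω : Type*} [MeasurableSpace Ω] [FiniteDimensional ℝ V] [MeasurableSpace V]
    [BorelSpace V] {z : Ω → Fin K → V} (hz : ∀ k, Measurable fun ω => z ω k) (k : Fin K) :
    Measurable fun ω => mix W (z ω) k := by
  have : ProperSpace V := FiniteDimensional.proper ℝ V
  exact Finset.measurable_sum _ fun j _ => (hz j).const_smul (W k j)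

theorem measurable_drive {Ω : Type*} [MeasurableSpace Ω] [FiniteDimensional ℝ V] [MeasurableSpace V]
    [BorelSpace V] {m : ℕ → Fin K → Ω → V} (t : ℕ) (hm : ∀ s < t, ∀ k, Measurable (m s k)) :
    ∀ k, Measurable fun ω => drive C₁ W (fun s j => m s j ω) g₀ t k := by
  have : ProperSpace V := FiniteDimensional.proper ℝ V
  induction t with
  | zero => exact fun _ => measurable_const
  | succ t ih =>
    intro k
    simp only [drive_succ]
    exact ((measurable_mix (ih fun s hs => hm s (hs.trans (Nat.lt_succ_self t))) k).const_smul
      (1 - C₁ / (C₁ + t))).add ((hm t (Nat.lt_succ_self t) k).const_smul (C₁ / (C₁ + t)))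

end Drive

/-! ### Measurability of the iterates -/

/-- The round in which a query is made. -/
def Query.round {M K : ℕ} : Query M K → ℕ
  | .outer t _ => t
  | .inner t _ _ => t
  | .hess t _ _ _ => t

section Measurability

variable {M : ℕ} {d : Fin (M + 1) → ℕ} {K : ℕ} {S Ω : Type*} [MeasurableSpace S] [MeasurableSpace Ω]

/-- All components of a random state are measurable. -/
structure State.IsMeasurable (st : Ω → State d K) : Prop where
  y : ∀ m k, Measurable fun ω => (st ω).y m k
  s : ∀ k, Measurable fun ω => (st ω).s k
  h : ∀ k, Measurable fun ω => (st ω).h k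
  u : ∀ m k, Measurable fun ω => (st ω).u m k
  v : ∀ m i k, Measurable fun ω => (st ω).v m i k
  q : ∀ m k, Measurable fun ω => (st ω).q m k

theorem measurable_clm_apply {n m : ℕ} {A : Ω → Vec n →L[ℝ] Vec m} {v : Ω → Vec n}
    (hA : Measurable A) (hv : Measurable v) : Measurable fun ω => A ω (v ω) := by
  have : ProperSpace (Vec n →L[ℝ] Vec m) := FiniteDimensional.proper ℝ _
  have h : Continuous fun z : (Vec n →L[ℝ] Vec m) × Vec n => z.1 z.2 :=
    continuous_fst.clm_apply continuous_snd
  exact h.measurable.comp (hA.prodMk hv)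

theorem measurable_clm_comp {n m l : ℕ} {A : Ω → Vec m →L[ℝ] Vec l} {B : Ω → Vec n →L[ℝ] Vec m}
    (hA : Measurable A) (hB : Measurable B) : Measurable fun ω => A ω ∘L B ω := by
  have : ProperSpace (Vec m →L[ℝ] Vec l) := FiniteDimensional.proper ℝ _
  have : ProperSpace (Vec n →L[ℝ] Vec m) := FiniteDimensional.proper ℝ _
  have h : Continuous fun z : (Vec m →L[ℝ] Vec l) × (Vec n →L[ℝ] Vec m) => z.1 ∘L z.2 :=
    continuous_fst.clm_comp continuous_snd
  exact h.measurable.comp (hA.prodMk hB)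

theorem measurable_hessQ {n : ℕ} {L : ℝ} {v : Ω → ℕ → Vec n →L[ℝ] Vec n}
    (hv : ∀ i, Measurable fun ω => v ω i) (b : ℕ) : Measurable fun ω => hessQ L (v ω) b := by
  have : ProperSpace (Vec n →L[ℝ] Vec n) := FiniteDimensional.proper ℝ _
  induction b with
  | zero => exact measurable_const
  | succ b ih =>
    exact measurable_const.add (measurable_clm_comp
      (measurable_const.sub ((hv b).const_smul (1 / L))) ih)

theorem measurable_chainTo {u : Ω → (m : Fin M) → Vec (d m.succ) →L[ℝ] Vec (d m.castSucc)}
    {q : Ω → (m : Fin M) → Vec (d m.succ) →L[ℝ] Vec (d m.succ)}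
    (hu : ∀ m, Measurable fun ω => u ω m) (hq : ∀ m, Measurable fun ω => q ω m) (m : Fin (M + 1)) :
    Measurable fun ω => chainTo (u ω) (q ω) m := by
  induction m using Fin.induction with
  | zero => exact measurable_const
  | succ m ih =>
    exact measurable_clm_comp ih (measurable_clm_comp (hu m) (hq m))

theorem State.chain_eq (st : State d K) (k : Fin K) :
    st.chain k = chainTo (fun m => st.u m k) (fun m => st.q m k) (Fin.last M) := rfl

theorem State.IsMeasurable.z {st : Ω → State d K} (h : State.IsMeasurable st) (k : Fin K) :
    Measurable fun ω => (st ω).z k := by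
  have h1 : Measurable fun ω => (st ω).chain k ((st ω).h k) :=
    measurable_clm_apply (measurable_chainTo (fun m => h.u m k) (fun m => h.q m k) _) (h.h k)
  exact (h.s k).add (h1.const_smul ((-1 : ℝ) ^ M))

variable {a : Params M} {W : Matrix (Fin K) (Fin K) ℝ} {o : Oracle d K S} {p : Problem d K}

theorem State.IsMeasurable.step (ho : o.IsUnbiased p) {ξ : Query M K → Ω → S} {t : ℕ}
    (hξ : ∀ q : Query M K, q.round = t → Measurable (ξ q)) {st : Ω → State d K}
    (h : State.IsMeasurable st) :
    State.IsMeasurable fun ω => DSMO.step a W o (fun q => ξ q ω) t (st ω) := by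
  have hv : ∀ m i k, Measurable fun ω => nextV a W o (fun q => ξ q ω) t (st ω) m i k := by
    intro m i k
    refine ((measurable_mix (z := fun ω => (st ω).v m i) (h.v m i) k).const_smul (1 - a.β t)).add
      (Measurable.const_smul ?_ (a.β t))
    exact (ho.measurable_hessg₂₂ m k).comp ((h.y _ k).prodMk ((h.y _ k).prodMk (hξ (.hess t m k i) rfl)))
  refine ⟨fun m => ?_, fun k => ?_, fun k => ?_, fun m k => ?_, hv, fun m k => ?_⟩
  · refine Fin.cases (fun k => ?_) (fun m k => ?_) m
    · exact (measurable_mix (z := fun ω => (st ω).y 0) (h.y 0) k).sub ((h.z k).const_smul (a.α t))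
    · refine (measurable_mix (z := fun ω => (st ω).y m.succ) (h.y m.succ) k).sub
        (Measurable.const_smul ?_ (a.γ t))
      exact (ho.measurable_gradg₂ m k).comp
        ((h.y _ k).prodMk ((h.y _ k).prodMk (hξ (.inner t m k) rfl)))
  · refine ((measurable_mix (z := fun ω => (st ω).s) h.s k).const_smul (1 - a.β t)).add
      (Measurable.const_smul ?_ (a.β t))
    exact (ho.measurable_gradf₁ k).comp ((h.y _ k).prodMk ((h.y _ k).prodMk (hξ (.outer t k) rfl)))
  · refine ((measurable_mix (z := fun ω => (st ω).h) h.h k).const_smul (1 - a.β t)).add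
      (Measurable.const_smul ?_ (a.β t))
    exact (ho.measurable_gradf₂ k).comp ((h.y _ k).prodMk ((h.y _ k).prodMk (hξ (.outer t k) rfl)))
  · refine ((measurable_mix (z := fun ω => (st ω).u m) (h.u m) k).const_smul (1 - a.β t)).add
      (Measurable.const_smul ?_ (a.β t))
    exact (ho.measurable_hessg₁₂ m k).comp
      ((h.y _ k).prodMk ((h.y _ k).prodMk (hξ (.inner t m k) rfl)))
  · exact (measurable_hessQ (fun i => hv m i k) (a.b m)).const_smul (1 / a.L m)

theorem State.isMeasurable_run (ho : o.IsUnbiased p) {ξ : Query M K → Ω → S} (t : ℕ)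
    (hξ : ∀ q : Query M K, q.round < t → Measurable (ξ q)) :
    State.IsMeasurable fun ω => run a W o (fun q => ξ q ω) t := by
  induction t with
  | zero => exact ⟨fun _ _ => measurable_const, fun _ => measurable_const, fun _ => measurable_const,
      fun _ _ => measurable_const, fun _ _ _ => measurable_const, fun _ _ => measurable_const⟩
  | succ t ih =>
    exact (ih fun q hq => hξ q (hq.trans (Nat.lt_succ_self t))).step ho
      fun q hq => hξ q (hq ▸ Nat.lt_succ_self _)

end Measurability

end DSMO

end

noncomputable section

namespace DSMO

open scoped ENNReal

universe u v

/-! ### Runs of the algorithm -/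

set_option linter.checkUnivs false in
/-- A problem, an oracle and a run of `T` rounds of the algorithm, with all assumptions. -/
structure Sys {M : ℕ} (d : Fin (M + 1) → ℕ) (c : Constants M) (μ C₁ : ℝ) where
  K : ℕ
  ρ : ℝ
  W : Matrix (Fin K) (Fin K) ℝ
  S : Type u
  [mS : MeasurableSpace S]
  Ω : Type v
  [mΩ : MeasurableSpace Ω]
  P : Measure Ω
  [prob : IsProbabilityMeasure P]
  p : Problem d K
  o : Oracle d K S
  ξ : Query M K → Ω → S
  D : (m : Fin (M + 1)) → Set (Vec (d m))
  b : Fin M → ℕ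
  T : ℕ
  ρ_pos : 0 < ρ
  ρ_lt_one : ρ < 1
  unbiased : o.IsUnbiased p
  sampling : IsSampling o P ξ
  gossip : IsGossip W ρ
  outer : OuterAssumption c p o D
  inner : InnerAssumption c p o D
  pl : p.PL μ
  contraction_pow : ∀ m, (1 - c.κ m) ^ (b m + 1) ≤ 1 / T
  convex : ∀ m, Convex ℝ (D m)
  yStar_mem : ∀ m, ∀ x ∈ D 0, p.yStar m x ∈ D m
  run_mem : ∀ t ≤ T, ∀ m k,
    ∀ᵐ ω ∂P, (run (plParams c μ C₁ b) W o (fun q => ξ q ω) t).y m k ∈ D m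
  two_le : 2 ≤ T
  μ_pos : 0 < μ
  three_le : 3 ≤ C₁
  two_le_mul : 2 ≤ μ * C₁

attribute [instance] Sys.mS Sys.mΩ Sys.prob

namespace Sys

variable {M : ℕ} {d : Fin (M + 1) → ℕ} {c : Constants M} {μ C₁ : ℝ} (X : Sys.{u, v} d c μ C₁)

/-- The state after `t` rounds. -/
def st (t : ℕ) (ω : X.Ω) : State d X.K := run (plParams c μ C₁ X.b) X.W X.o (fun q => X.ξ q ω) t

/-- The variables `y` after `t` rounds. -/
def y (m : Fin (M + 1)) (t : ℕ) (ω : X.Ω) : Fin X.K → Vec (d m) := (X.st t ω).y m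

/-- The network average of the variables `y`. -/
def yBar (m : Fin (M + 1)) (t : ℕ) (ω : X.Ω) : Vec (d m) := avg (X.y m t ω)

/-- The network average of the outer variable. -/
def x (t : ℕ) (ω : X.Ω) : Vec (d 0) := X.yBar 0 t ω

theorem C₁_pos (X : Sys.{u, v} d c μ C₁) : 0 < C₁ := by
  have := X.three_le
  linarith

theorem card_pos : 0 < X.K := X.gossip.card_pos X.ρ_pos

theorem regular : Regular c.total c.Lg X.p X.D :=
  regular_of_assumptions X.card_pos X.unbiased X.sampling X.outer X.inner X.convex X.yStar_mem

theorem ae_mem : ∀ᵐ ω ∂X.P, ∀ t ≤ X.T, ∀ m k, X.y m t ω k ∈ X.D m := by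
  refine ae_all_iff.2 fun t => ?_
  by_cases ht : t ≤ X.T
  · have : ∀ᵐ ω ∂X.P, ∀ m k, X.y m t ω k ∈ X.D m :=
      ae_all_iff.2 fun m => ae_all_iff.2 fun k => X.run_mem t ht m k
    exact this.mono fun ω h _ => h
  · exact Filter.Eventually.of_forall fun ω h => absurd h ht

theorem _root_.DSMO.avg_mem_of_convex {K n : ℕ} (hK : 0 < K) {s : Set (Vec n)} (hs : Convex ℝ s)
    {z : Fin K → Vec n} (hz : ∀ k, z k ∈ s) : avg z ∈ s := by
  have hK' : (K : ℝ) ≠ 0 := by positivity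
  have := hs.sum_mem (t := Finset.univ) (w := fun _ : Fin K => 1 / (K : ℝ)) (z := z)
    (fun _ _ => by positivity) (by simp [hK']) fun k _ => hz k
  rwa [← Finset.smul_sum] at this

theorem ae_mem_yBar : ∀ᵐ ω ∂X.P, ∀ t ≤ X.T, ∀ m, X.yBar m t ω ∈ X.D m := by
  filter_upwards [X.ae_mem] with ω h t ht m
  exact avg_mem_of_convex X.card_pos (X.convex m) (h t ht m)

theorem isMeasurable_st {mΩ : MeasurableSpace X.Ω} (t : ℕ)
    (h : ∀ q : Query M X.K, q.round < t → Measurable[mΩ] (X.ξ q)) :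
    @State.IsMeasurable M d X.K X.Ω mΩ (X.st t) :=
  State.isMeasurable_run X.unbiased t h

theorem measurable_y {mΩ : MeasurableSpace X.Ω} (t : ℕ)
    (h : ∀ q : Query M X.K, q.round < t → Measurable[mΩ] (X.ξ q)) (m : Fin (M + 1)) (k : Fin X.K) :
    Measurable[mΩ] fun ω => X.y m t ω k := (X.isMeasurable_st t h).y m k

theorem measurable_yBar {mΩ : MeasurableSpace X.Ω} (t : ℕ)
    (h : ∀ q : Query M X.K, q.round < t → Measurable[mΩ] (X.ξ q)) (m : Fin (M + 1)) :
    Measurable[mΩ] fun ω => X.yBar m t ω :=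
  (Finset.measurable_sum Finset.univ fun k _ => X.measurable_y t h m k).const_smul (1 / (X.K : ℝ))

/-- A quantity estimated by a momentum recursion. -/
structure Chan (V : Type) [NormedAddCommGroup V] [NormedSpace ℝ V] [FiniteDimensional ℝ V]
    [MeasurableSpace V] [BorelSpace V] where
  a : Fin (M + 1)
  b : Fin (M + 1)
  q : ℕ → Fin X.K → Query M X.K
  n : Fin X.K → Vec (d a) → Vec (d b) → X.S → V
  mean : Fin X.K → Vec (d a) → Vec (d b) → V
  g₀ : V
  C : ℝ
  C_nonneg : 0 ≤ C
  C_le : C ≤ c.total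
  round_q : ∀ t k, (q t k).round = t
  q_ne : ∀ t j k, j ≠ k → q t j ≠ q t k
  measurable_n : ∀ k, Measurable fun z : (Vec (d a) × Vec (d b)) × X.S => n k z.1.1 z.1.2 z.2
  unbiased : ∀ t k y y', Unbiased (X.P.map (X.ξ (q t k))) (n k y y') (mean k y y')
  moment : ∀ t k, ∀ y ∈ X.D a, ∀ y' ∈ X.D b, SecondMomentLE (X.P.map (X.ξ (q t k))) (n k y y') C
  lip : ∀ k y z y' z', ‖mean k y y' - mean k z z'‖ ≤ c.total ^ 2 * (‖y - z‖ + ‖y' - z'‖)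
  norm_init : ‖g₀‖ ≤ C

namespace Chan

variable {X} {V : Type} [NormedAddCommGroup V] [NormedSpace ℝ V] [FiniteDimensional ℝ V]
    [MeasurableSpace V] [BorelSpace V] (ch : X.Chan V)

/-- The observations. -/
def N (t : ℕ) (k : Fin X.K) (ω : X.Ω) : V :=
  ch.n k (X.y ch.a t ω k) (X.y ch.b t ω k) (X.ξ (ch.q t k) ω)

/-- The conditional means of the observations. -/
def m (t : ℕ) (k : Fin X.K) (ω : X.Ω) : V := ch.mean k (X.y ch.a t ω k) (X.y ch.b t ω k)

/-- The estimates. -/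
def E (t : ℕ) (ω : X.Ω) (k : Fin X.K) : V := drive C₁ X.W (fun s j => ch.N s j ω) ch.g₀ t k

/-- The estimates without noise. -/
def G (t : ℕ) (ω : X.Ω) (k : Fin X.K) : V := drive C₁ X.W (fun s j => ch.m s j ω) ch.g₀ t k

/-- The average of the means at the best responses. -/
def star (x : Vec (d 0)) : V := avg fun k => ch.mean k (X.p.yStar ch.a x) (X.p.yStar ch.b x)

theorem norm_mean_le (k : Fin X.K) {y : Vec (d ch.a)} (hy : y ∈ X.D ch.a) {y' : Vec (d ch.b)}
    (hy' : y' ∈ X.D ch.b) : ‖ch.mean k y y'‖ ≤ ch.C := by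
  have : IsProbabilityMeasure (X.P.map (X.ξ (ch.q 0 k))) :=
    Measure.isProbabilityMeasure_map (X.sampling.measurable _).aemeasurable
  exact norm_le_of_secondMoment ch.C_nonneg (ch.unbiased 0 k y y') (ch.moment 0 k y hy y' hy')

theorem ae_norm_m_le : ∀ᵐ ω ∂X.P, ∀ t ≤ X.T, ∀ k, ‖ch.m t k ω‖ ≤ ch.C := by
  filter_upwards [X.ae_mem] with ω h t ht k
  exact ch.norm_mean_le k (h t ht _ k) (h t ht _ k)

theorem ae_norm_G_le : ∀ᵐ ω ∂X.P, ∀ t ≤ X.T, ∀ k, ‖ch.G t ω k‖ ≤ ch.C := by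
  filter_upwards [ch.ae_norm_m_le] with ω h t ht k
  exact norm_drive_le X.gossip X.C₁_pos ch.norm_init (fun s hs j => h s hs.le j) t ht k

theorem continuous_mean (k : Fin X.K) :
    Continuous fun z : Vec (d ch.a) × Vec (d ch.b) => ch.mean k z.1 z.2 := by
  have h0 : 0 ≤ c.total := by linarith [c.total_spec.1]
  refine (LipschitzWith.of_dist_le_mul (K := Real.toNNReal (c.total ^ 2 * 2)) fun z w => ?_).continuous
  rw [Real.coe_toNNReal _ (by positivity), dist_eq_norm, Prod.dist_eq, dist_eq_norm, dist_eq_norm,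
    mul_assoc]
  refine (ch.lip k _ _ _ _).trans (mul_le_mul_of_nonneg_left ?_ (by positivity))
  have h1 := le_max_left ‖z.1 - w.1‖ ‖z.2 - w.2‖
  have h2 := le_max_right ‖z.1 - w.1‖ ‖z.2 - w.2‖
  linarith

section Meas

variable {mΩ : MeasurableSpace X.Ω}

theorem measurable_m (t : ℕ) (h : ∀ q : Query M X.K, q.round < t → Measurable[mΩ] (X.ξ q))
    (k : Fin X.K) : Measurable[mΩ] (ch.m t k) :=
  (ch.continuous_mean k).measurable.comp
    ((X.measurable_y t h ch.a k).prodMk (X.measurable_y t h ch.b k))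

theorem measurable_N (t : ℕ) (k : Fin X.K)
    (h : ∀ q : Query M X.K, q.round < t → Measurable[mΩ] (X.ξ q))
    (h' : Measurable[mΩ] (X.ξ (ch.q t k))) : Measurable[mΩ] (ch.N t k) :=
  (ch.measurable_n k).comp
    (((X.measurable_y t h ch.a k).prodMk (X.measurable_y t h ch.b k)).prodMk h')

theorem measurable_G (t : ℕ) (h : ∀ q : Query M X.K, q.round < t → Measurable[mΩ] (X.ξ q))
    (k : Fin X.K) : Measurable[mΩ] fun ω => ch.G t ω k :=
  measurable_drive t (fun s hs j => ch.measurable_m s (fun q hq => h q (hq.trans hs)) j) k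

theorem measurable_E (t : ℕ) (h : ∀ q : Query M X.K, q.round < t → Measurable[mΩ] (X.ξ q))
    (k : Fin X.K) : Measurable[mΩ] fun ω => ch.E t ω k :=
  measurable_drive t (fun s hs j => ch.measurable_N s j (fun q hq => h q (hq.trans hs))
    (h _ (by rw [ch.round_q]; exact hs))) k

/-- After round `t` the estimate depends on the earlier rounds and on the answers of its own channel
only, because round `t` queries at the iterates of time `t`. This is what lets the channels be
integrated out separately. -/
theorem measurable_E_succ (t : ℕ) (h : ∀ q : Query M X.K, q.round < t → Measurable[mΩ] (X.ξ q))
    (h' : ∀ k, Measurable[mΩ] (X.ξ (ch.q t k))) (k : Fin X.K) :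
    Measurable[mΩ] fun ω => ch.E (t + 1) ω k := by
  refine measurable_drive (t + 1) (fun s hs j => ch.measurable_N s j
    (fun q hq => h q (hq.trans_le (Nat.lt_succ_iff.1 hs))) ?_) k
  rcases Nat.lt_succ_iff_lt_or_eq.1 hs with h1 | h1
  · exact h _ (by rw [ch.round_q]; exact h1)
  · exact h1 ▸ h' j

end Meas

/-- Everything but the observation of agent `k` in round `t`. -/
@[reducible] def sigma (t : ℕ) (k : Fin X.K) : MeasurableSpace X.Ω :=
  sigmaOf X.ξ {q | q.round ≤ t ∧ q ≠ ch.q t k}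

theorem measurable_sigma_of_lt {t : ℕ} {k : Fin X.K} {q : Query M X.K} (hq : q.round < t) :
    Measurable[ch.sigma t k] (X.ξ q) :=
  measurable_sigmaOf X.ξ ⟨hq.le, fun h => by rw [h, ch.round_q] at hq; exact lt_irrefl _ hq⟩

theorem measurable_sigma_of_ne {t : ℕ} {j k : Fin X.K} (h : j ≠ k) :
    Measurable[ch.sigma t k] (X.ξ (ch.q t j)) :=
  measurable_sigmaOf X.ξ ⟨(ch.round_q t j).le, ch.q_ne t j k h⟩

theorem isFresh {t : ℕ} (ht : t ≤ X.T) (k : Fin X.K) :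
    IsFresh X.P (ch.sigma t k) (ch.N t k) (ch.m t k) ch.C := by
  have hX : Measurable[ch.sigma t k] fun ω => (X.y ch.a t ω k, X.y ch.b t ω k) :=
    Measurable.prodMk (X.measurable_y t (fun q hq => ch.measurable_sigma_of_lt hq) ch.a k)
      (X.measurable_y t (fun q hq => ch.measurable_sigma_of_lt hq) ch.b k)
  refine isFresh_of_sampling (E := Vec (d ch.a) × Vec (d ch.b)) X.sampling.measurable
    X.sampling.indep (s := {q | q.round ≤ t ∧ q ≠ ch.q t k}) (q := ch.q t k)
    (fun h => h.2 rfl) (n := fun z => ch.n k z.1 z.2) (m := fun z => ch.mean k z.1 z.2) hX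
    (ch.measurable_n k) (fun z => ch.unbiased t k z.1 z.2) ?_
  filter_upwards [X.ae_mem] with ω h
  exact ch.moment t k _ (h t ht _ k) _ (h t ht _ k)

/-- One round, conditionally on everything in `𝒢₀`. -/
theorem labFun_step {𝒢₀ : MeasurableSpace X.Ω} {t : ℕ} (ht : t ≤ X.T) (h𝒢₀ : 𝒢₀ ≤ X.mΩ)
    (h𝒢 : ∀ k, 𝒢₀ ≤ ch.sigma t k)
    (hm : ∀ q : Query M X.K, q.round < t → Measurable[𝒢₀] (X.ξ q)) (l : Lab X.K) :
    ∃ (n : ℕ) (w : Fin n → ℝ≥0∞) (l' : Fin n → Lab X.K),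
      ∑ j, w j * ENNReal.ofReal (labBound V ch.C C₁ X.ρ t (l' j)) ≤
        ENNReal.ofReal (labBound V ch.C C₁ X.ρ (t + 1) l) ∧
      ∀ A : X.Ω → ℝ≥0∞, Measurable[𝒢₀] A →
        ∫⁻ ω, A ω * ENNReal.ofReal (labFun (fun k ω => ch.E (t + 1) ω k)
          (fun k ω => ch.G (t + 1) ω k) l ω) ∂X.P ≤
        ∫⁻ ω, A ω * ∑ j, w j * ENNReal.ofReal (labFun (fun k ω => ch.E t ω k)
          (fun k ω => ch.G t ω k) (l' j) ω) ∂X.P :=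
  DSMO.labFun_step (mΩ := X.mΩ) (𝒢₀ := 𝒢₀) (𝒢 := ch.sigma t) X.gossip X.ρ_pos.le X.C₁_pos (fun _ _ => rfl) (fun _ _ => rfl)
    h𝒢₀ h𝒢 (ch.isFresh ht)
    (fun j _ hjk => ch.measurable_N t j (fun _ => ch.measurable_sigma_of_lt)
      (ch.measurable_sigma_of_ne hjk))
    (fun j _ _ => ch.measurable_m t (fun _ hq => ch.measurable_sigma_of_lt hq) j)
    (fun k => ch.measurable_E t hm k) (fun k => ch.measurable_G t hm k) l

theorem labFun_zero_le (l : Lab X.K) (ω : X.Ω) : labFun (fun k ω => ch.E 0 ω k)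
    (fun k ω => ch.G 0 ω k) l ω ≤ labBound V ch.C C₁ X.ρ 0 l := by
  cases l with
  | one => exact le_rfl
  | size => exact pow_le_pow_left₀ (norm_nonneg _) ch.norm_init 2
  | noise a => simp [labFun, labBound, E, G, drive, pSeq, qSeq]

end Chan

end Sys

end DSMO

end

noncomputable section

namespace DSMO

open scoped ENNReal

universe u v

/-! ### Upper bounds for expectations -/

section EB

variable {Ω : Type*} [MeasurableSpace Ω] {P : Measure Ω} {Y Z : Ω → ℝ} {d e : ℝ}

/-- `Y` has a measurable nonnegative majorant with expectation at most `e`. -/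
def EB (P : Measure Ω) (Y : Ω → ℝ) (e : ℝ) : Prop :=
  ∃ Y' : Ω → ℝ, Measurable Y' ∧ (∀ ω, 0 ≤ Y' ω) ∧ (∀ᵐ ω ∂P, Y ω ≤ Y' ω) ∧
    ∫⁻ ω, ENNReal.ofReal (Y' ω) ∂P ≤ ENNReal.ofReal e

theorem EB.of_lintegral (hY : Measurable Y) (h0 : ∀ ω, 0 ≤ Y ω)
    (h : ∫⁻ ω, ENNReal.ofReal (Y ω) ∂P ≤ ENNReal.ofReal e) : EB P Y e :=
  ⟨Y, hY, h0, Filter.Eventually.of_forall fun _ => le_rfl, h⟩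

theorem EB.mono (h : EB P Y d) (hZ : ∀ᵐ ω ∂P, Z ω ≤ Y ω) (hd : d ≤ e) : EB P Z e := by
  obtain ⟨Y', h1, h2, h3, h4⟩ := h
  exact ⟨Y', h1, h2, by filter_upwards [h3, hZ] with ω a b using b.trans a,
    h4.trans (ENNReal.ofReal_le_ofReal hd)⟩

theorem EB.mono_right (h : EB P Y d) (hd : d ≤ e) : EB P Y e :=
  h.mono (Filter.Eventually.of_forall fun _ => le_rfl) hd

theorem EB.add (h : EB P Y d) (h' : EB P Z e) (hd : 0 ≤ d) (he : 0 ≤ e) :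
    EB P (fun ω => Y ω + Z ω) (d + e) := by
  obtain ⟨Y', h1, h2, h3, h4⟩ := h
  obtain ⟨Z', k1, k2, k3, k4⟩ := h'
  refine ⟨fun ω => Y' ω + Z' ω, h1.add k1, fun ω => add_nonneg (h2 ω) (k2 ω), by
    filter_upwards [h3, k3] with ω a b using add_le_add a b, ?_⟩
  simp_rw [ENNReal.ofReal_add (h2 _) (k2 _)]
  rw [lintegral_add_left h1.ennreal_ofReal, ENNReal.ofReal_add hd he]
  exact add_le_add h4 k4

theorem EB.const_mul (h : EB P Y d) {a : ℝ} (ha : 0 ≤ a) : EB P (fun ω => a * Y ω) (a * d) := by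
  obtain ⟨Y', h1, h2, h3, h4⟩ := h
  refine ⟨fun ω => a * Y' ω, h1.const_mul a, fun ω => mul_nonneg ha (h2 ω), by
    filter_upwards [h3] with ω b using mul_le_mul_of_nonneg_left b ha, ?_⟩
  simp_rw [ENNReal.ofReal_mul ha]
  rw [lintegral_const_mul' _ _ ENNReal.ofReal_ne_top]
  exact mul_le_mul_right h4 _

theorem EB.const [IsProbabilityMeasure P] (he : 0 ≤ e) : EB P (fun _ => e) e :=
  ⟨fun _ => e, measurable_const, fun _ => he, Filter.Eventually.of_forall fun _ => le_rfl, by simp⟩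

theorem EB.of_ae_le [IsProbabilityMeasure P] (he : 0 ≤ e) (h : ∀ᵐ ω ∂P, Y ω ≤ e) : EB P Y e :=
  (EB.const he).mono h le_rfl

theorem EB.sum {ι : Type*} (s : Finset ι) {Y : ι → Ω → ℝ} {d : ι → ℝ}
    (h : ∀ i ∈ s, EB P (Y i) (d i)) (hd : ∀ i ∈ s, 0 ≤ d i) :
    EB P (fun ω => ∑ i ∈ s, Y i ω) (∑ i ∈ s, d i) := by
  classical
  induction s using Finset.induction_on with
  | empty => exact ⟨fun _ => 0, measurable_const, fun _ => le_rfl, by simp, by simp⟩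
  | insert i s hi ih =>
    simp_rw [Finset.sum_insert hi]
    exact (h i (Finset.mem_insert_self i s)).add
      (ih (fun j hj => h j (Finset.mem_insert_of_mem hj)) fun j hj => hd j (Finset.mem_insert_of_mem hj))
      (hd i (Finset.mem_insert_self i s))
      (Finset.sum_nonneg fun j hj => hd j (Finset.mem_insert_of_mem hj))

theorem EB.integral_le (h : EB P Y e) (he : 0 ≤ e) (hY : AEStronglyMeasurable Y P)
    (h0 : ∀ᵐ ω ∂P, 0 ≤ Y ω) : Integrable Y P ∧ ∫ ω, Y ω ∂P ≤ e := by
  obtain ⟨Y', h1, h2, h3, h4⟩ := h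
  have hi : Integrable Y' P := by
    refine ⟨h1.aestronglyMeasurable, ?_⟩
    rw [hasFiniteIntegral_iff_ofReal (Filter.Eventually.of_forall h2)]
    exact h4.trans_lt ENNReal.ofReal_lt_top
  have hiY : Integrable Y P := hi.mono' hY (by
    filter_upwards [h0, h3] with ω a b
    rwa [Real.norm_of_nonneg a])
  refine ⟨hiY, (integral_mono_ae hiY hi h3).trans ?_⟩
  rw [integral_eq_lintegral_of_nonneg_ae (Filter.Eventually.of_forall h2) h1.aestronglyMeasurable]
  exact ENNReal.toReal_le_of_le_ofReal he h4

theorem EB.msq {K : ℕ} {V : Type*} [NormedAddCommGroup V] (hK : 0 < K) {z : Ω → Fin K → V}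
    (he : 0 ≤ e) (h : ∀ k, EB P (fun ω => ‖z ω k‖ ^ 2) e) : EB P (fun ω => DSMO.msq (z ω)) e := by
  have hK' : (K : ℝ) ≠ 0 := by positivity
  refine ((EB.sum Finset.univ (fun k _ => h k) fun _ _ => he).const_mul
    (a := 1 / (K : ℝ)) (by positivity)).mono_right ?_
  simp
  field_simp
  exact le_rfl

theorem Bdd.eb {ι : Type*} [Fintype ι] {K : ℕ} {Φ : ι → Lab K → Ω → ℝ} {D : ι → Lab K → ℝ}
    {I : Set ι} (h1Φ : ∀ i ω, Φ i .one ω = 1) (h1D : ∀ i, D i .one = 1)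
    (h : Bdd P Φ D I Y d) : EB P Y d := by
  obtain ⟨Y', h1, h2, h3, h4⟩ := h
  have := h4 (fun _ => .one) fun _ _ => rfl
  simp only [h1Φ, h1D, ENNReal.ofReal_one, Finset.prod_const_one, mul_one] at this
  exact ⟨Y', h1, h2, h3, this⟩

end EB

/-! ### Noise of a single channel -/

section NoiseConst

variable (V : Type*) [NormedAddCommGroup V] [NormedSpace ℝ V] [FiniteDimensional ℝ V]

/-- The squared distortion of the identification with a Euclidean space. -/
def distortion : ℝ := (‖(toEuclidean : V ≃L[ℝ] _).symm.toContinuousLinearMap‖ *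
  ‖(toEuclidean : V ≃L[ℝ] _).toContinuousLinearMap‖) ^ 2

theorem distortion_nonneg : 0 ≤ distortion V := sq_nonneg _

variable {V} {Ω : Type*} {K : ℕ}

theorem norm_sq_le_toEuclidean (w : V) : ‖w‖ ^ 2 ≤
    ‖(toEuclidean : V ≃L[ℝ] _).symm.toContinuousLinearMap‖ ^ 2 * ‖toEuclidean w‖ ^ 2 := by
  rw [← mul_pow]
  refine pow_le_pow_left₀ (norm_nonneg _) ?_ 2
  have := (toEuclidean : V ≃L[ℝ] _).symm.toContinuousLinearMap.le_opNorm (toEuclidean w)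
  simpa using this

/-- The noise of one agent is the functional with a unit coefficient vector, up to the change to the
Euclidean norm. -/
theorem norm_sub_sq_le_labFun (X G : Fin K → Ω → V) (k : Fin K) (ω : Ω) :
    ‖X k ω - G k ω‖ ^ 2 ≤ ‖(toEuclidean : V ≃L[ℝ] _).symm.toContinuousLinearMap‖ ^ 2 *
      labFun X G (.noise (Pi.single k 1)) ω := by
  have : ∑ j, (Pi.single k 1 : Fin K → ℝ) j • toEuclidean (X j ω - G j ω) =
      toEuclidean (X k ω - G k ω) := by
    simp [Pi.single_apply]
  simp only [labFun, this]
  exact norm_sq_le_toEuclidean _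

/-- A unit vector has sum `1` and deviation at most `1`. Hence even a single agent has variance
`p_t/K + q_t`: gossip averages the noise. -/
theorem labBound_single_le {C C₁ ρ : ℝ} (hρ : 0 ≤ ρ) (t : ℕ) (k : Fin K) :
    ‖(toEuclidean : V ≃L[ℝ] _).symm.toContinuousLinearMap‖ ^ 2 *
      labBound V C C₁ ρ t (.noise (Pi.single k 1)) ≤
      distortion V * C ^ 2 * (pSeq C₁ t / K + qSeq C₁ ρ t) := by
  have h1 : ∑ j, (Pi.single k 1 : Fin K → ℝ) j = 1 := by simp
  have h2 := sum_sq_eq_add_dev (Pi.single k 1 : Fin K → ℝ)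
  have h3 : ∑ j, (Pi.single k 1 : Fin K → ℝ) j ^ 2 = 1 := by simp [Pi.single_apply]
  have h4 : ∑ j, ((Pi.single k 1 : Fin K → ℝ) j - avg (Pi.single k 1 : Fin K → ℝ)) ^ 2 ≤ 1 := by
    have : 0 ≤ (∑ j, (Pi.single k 1 : Fin K → ℝ) j) ^ 2 / K := by positivity
    linarith
  simp only [labBound, h1, distortion, mul_pow]
  have hq := qSeq_nonneg C₁ hρ t
  have h5 : qSeq C₁ ρ t * ∑ j, ((Pi.single k 1 : Fin K → ℝ) j - avg (Pi.single k 1 : Fin K → ℝ)) ^ 2 ≤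
    qSeq C₁ ρ t * 1 := by gcongr
  have h6 : pSeq C₁ t * (1 ^ 2 / K) + qSeq C₁ ρ t * ∑ j, ((Pi.single k 1 : Fin K → ℝ) j -
      avg (Pi.single k 1 : Fin K → ℝ)) ^ 2 ≤ pSeq C₁ t / K + qSeq C₁ ρ t := by
    have e : pSeq C₁ t * (1 ^ 2 / K) = pSeq C₁ t / K := by ring
    linarith
  have h7 := mul_le_mul_of_nonneg_left h6 (show 0 ≤
    ‖(toEuclidean : V ≃L[ℝ] _).symm.toContinuousLinearMap‖ ^ 2 *
      (‖(toEuclidean : V ≃L[ℝ] _).toContinuousLinearMap‖ ^ 2 * C ^ 2) from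
        mul_nonneg (sq_nonneg _) (mul_nonneg (sq_nonneg _) (sq_nonneg _)))
  linarith

theorem dev_le_toEuclidean (z : Fin K → V) : dev z ≤
    ‖(toEuclidean : V ≃L[ℝ] _).symm.toContinuousLinearMap‖ ^ 2 *
      dev fun k => toEuclidean (z k) := by
  have h : ∀ k, ‖z k - avg z‖ ^ 2 ≤ ‖(toEuclidean : V ≃L[ℝ] _).symm.toContinuousLinearMap‖ ^ 2 *
      ‖toEuclidean (z k) - avg (fun j => toEuclidean (z j))‖ ^ 2 := fun k => by
    have e : avg (fun j => toEuclidean (z j)) = toEuclidean (avg z) :=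
      avg_map (toEuclidean : V ≃L[ℝ] _).toContinuousLinearMap z
    rw [e, ← map_sub]
    exact norm_sq_le_toEuclidean _
  unfold dev msq
  rw [mul_left_comm]
  refine mul_le_mul_of_nonneg_left ?_ (by positivity)
  rw [Finset.mul_sum]
  exact Finset.sum_le_sum fun k _ => h k

end NoiseConst

namespace Sys

variable {M : ℕ} {d : Fin (M + 1) → ℕ} {c : Constants M} {μ C₁ : ℝ} (X : Sys.{u, v} d c μ C₁)

/-- The order of the variance of the momentum estimates. -/
def eps (t : ℕ) : ℝ := pSeq C₁ t / X.K + qSeq C₁ X.ρ t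

/-- The order of the deviation of the noiseless estimates from their network average. -/
def delta (t : ℕ) : ℝ := 2 * C₁ / (1 - Real.sqrt X.ρ) * (1 / (C₁ + t))

theorem eps_nonneg (t : ℕ) : 0 ≤ X.eps t := by
  have := pSeq_nonneg C₁ t
  have := qSeq_nonneg C₁ X.ρ_pos.le t
  unfold eps
  positivity

theorem sqrt_ρ_pos : 0 < Real.sqrt X.ρ := Real.sqrt_pos.2 X.ρ_pos

theorem sqrt_ρ_lt_one : Real.sqrt X.ρ < 1 := by
  rw [Real.sqrt_lt' one_pos]
  simpa using X.ρ_lt_one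

theorem sq_sqrt_ρ : X.ρ = Real.sqrt X.ρ ^ 2 := (Real.sq_sqrt X.ρ_pos.le).symm

theorem one_le_total (X : Sys.{u, v} d c μ C₁) : 1 ≤ c.total := X.regular.one_le

/-- The squared errors of the averaged inner variables. -/
def Y (m : Fin (M + 1)) (t : ℕ) (ω : X.Ω) : ℝ := ‖X.yBar m t ω - X.p.yStar m (X.x t ω)‖ ^ 2

/-- The truncated consensus error. -/
def cons (t : ℕ) (ω : X.Ω) : ℝ := min 1 (∑ m, dev (X.y m t ω))

/-- The averaged search direction. -/
def zBar (t : ℕ) (ω : X.Ω) : Vec (d 0) := avg fun k => (X.st t ω).z k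

/-- The step size of the outer variable. -/
def α (_ : Sys.{u, v} d c μ C₁) (t : ℕ) : ℝ := 2 / (μ * (C₁ + t))

/-- The step size of the estimates. -/
def β (_ : Sys.{u, v} d c μ C₁) (t : ℕ) : ℝ := C₁ / (C₁ + t)

theorem α_pos (t : ℕ) : 0 < X.α t := by
  have := X.μ_pos
  have := X.C₁_pos
  unfold α
  positivity

theorem β_pos (t : ℕ) : 0 < X.β t := by
  have := X.C₁_pos
  unfold β
  positivity

theorem β_le_one (t : ℕ) : X.β t ≤ 1 := sub_nonneg.1 (momentum_nonneg X.C₁_pos t).2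

theorem α_eq (t : ℕ) : X.α t = 2 / (μ * C₁) * X.β t := by
  have := X.μ_pos
  have := X.C₁_pos
  unfold α β
  have : C₁ + t ≠ 0 := by positivity
  field_simp

theorem α_le_β (t : ℕ) : X.α t ≤ X.β t := by
  have h1 := X.μ_pos
  have h2 := X.C₁_pos
  rw [X.α_eq]
  have h3 : 2 / (μ * C₁) ≤ 1 := by
    rw [div_le_one (by positivity)]
    exact X.two_le_mul
  have := mul_le_mul_of_nonneg_right h3 (X.β_pos t).le
  linarith

theorem x_succ (t : ℕ) (ω : X.Ω) : X.x (t + 1) ω = X.x t ω - X.α t • X.zBar t ω := by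
  have : X.y 0 (t + 1) ω = fun k => mix X.W (X.y 0 t ω) k - X.α t • (X.st t ω).z k := rfl
  simp only [x, yBar, this, zBar]
  rw [avg_sub, X.gossip.avg_mix, avg_smul]

/-! ### Noise, deviation and tracking error of a single momentum estimate. -/

namespace Chan

variable {X} {V : Type} [NormedAddCommGroup V] [NormedSpace ℝ V] [FiniteDimensional ℝ V]
    [MeasurableSpace V] [BorelSpace V] (ch : X.Chan V)

theorem eb_norm_N (t : ℕ) (ht : t ≤ X.T) (k : Fin X.K) :
    EB X.P (fun ω => ‖ch.N t k ω‖ ^ 2) (ch.C ^ 2) := by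
  have hp : ProperSpace V := FiniteDimensional.proper ℝ V
  refine EB.of_lintegral ((ch.measurable_N t k (fun q _ => X.sampling.measurable q)
    (X.sampling.measurable _)).norm.pow_const 2) (fun _ => sq_nonneg _) ?_
  have := (ch.isFresh ht k).moment (fun _ => 1) measurable_const
  simpa using this

/-- The product bound with a single channel. It also covers the channels that share their samples
with a factor of the product, such as the estimates of `∇₁ f`. -/
theorem eb_lab (t : ℕ) (ht : t ≤ X.T) (l : Lab X.K) :
    EB X.P (labFun (fun k ω => ch.E t ω k) (fun k ω => ch.G t ω k) l) (labBound V ch.C C₁ X.ρ t l) := by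
  have hall : ∀ q : Query M X.K, Measurable (X.ξ q) := X.sampling.measurable
  have hlt : ∀ t, ∀ q : Query M X.K, q.round < t →
      Measurable[sigmaOf X.ξ {q | q.round < t}] (X.ξ q) := fun t q hq => measurable_sigmaOf X.ξ hq
  have key := lintegral_prod_le_prod (P := X.P) (ι := Unit) (Λ := fun _ => Lab X.K)
    (Φ := fun _ t l ω => ENNReal.ofReal (labFun (fun k ω => ch.E t ω k) (fun k ω => ch.G t ω k) l ω))
    (D := fun _ t l => ENNReal.ofReal (labBound V ch.C C₁ X.ρ t l)) (T := X.T)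
    (fun _ t => sigmaOf X.ξ {q | q.round < t}) (fun _ t => sigmaOf_le hall _)
    (fun _ l ω => ENNReal.ofReal_le_ofReal (ch.labFun_zero_le l ω))
    (fun _ t ht l => ch.labFun_step ht.le (sigmaOf_le hall _)
      (fun k => sigmaOf_mono X.ξ fun q (hq : q.round < t) => ⟨le_of_lt hq, fun h => by
        rw [h, ch.round_q] at hq
        exact lt_irrefl _ hq⟩) (hlt t) l)
    (fun _ _ t _ l => (measurable_labFun (m := sigmaOf X.ξ {q | q.round < t})
      (ch.measurable_E t (hlt t)) (ch.measurable_G t (hlt t)) l).ennreal_ofReal)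
    (fun i j hij => absurd (Subsingleton.elim i j) hij) t ht
    (fun _ => l)
  simp only [Finset.univ_unique, Finset.prod_singleton] at key
  exact EB.of_lintegral (measurable_labFun (ch.measurable_E t fun q _ => hall q)
    (ch.measurable_G t fun q _ => hall q) _) (fun ω => labFun_nonneg _ _ _ ω) key

theorem eb_norm_E (t : ℕ) (ht : t ≤ X.T) (k : Fin X.K) :
    EB X.P (fun ω => ‖ch.E t ω k‖ ^ 2) (ch.C ^ 2) := ch.eb_lab t ht (.size k)

theorem eb_noise (t : ℕ) (ht : t ≤ X.T) (k : Fin X.K) :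
    EB X.P (fun ω => ‖ch.E t ω k - ch.G t ω k‖ ^ 2) (distortion V * ch.C ^ 2 * X.eps t) :=
  ((ch.eb_lab t ht (.noise (Pi.single k 1))).const_mul
    (sq_nonneg ‖(toEuclidean : V ≃L[ℝ] _).symm.toContinuousLinearMap‖)).mono
    (Filter.Eventually.of_forall fun ω =>
      norm_sub_sq_le_labFun (fun k ω => ch.E t ω k) (fun k ω => ch.G t ω k) k ω)
    (labBound_single_le X.ρ_pos.le t k)

theorem ae_dev_G_le : ∀ᵐ ω ∂X.P, ∀ t ≤ X.T,
    dev (ch.G t ω) ≤ distortion V * ch.C ^ 2 * X.delta t ^ 2 := by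
  filter_upwards [ch.ae_norm_m_le] with ω h t ht
  refine (dev_le_toEuclidean _).trans ?_
  set f := (toEuclidean : V ≃L[ℝ] _).toContinuousLinearMap with hf
  have e : (fun k => toEuclidean (ch.G t ω k)) =
      drive C₁ X.W (fun s j => f (ch.m s j ω)) (f ch.g₀) t := by
    funext k
    exact (map_drive f t k).symm
  rw [e]
  have := dev_drive_le (g₀ := f ch.g₀) X.gossip X.three_le X.sqrt_ρ_pos.le X.sqrt_ρ_lt_one X.sq_sqrt_ρ
    (m := fun s j => f (ch.m s j ω)) (C := ‖f‖ * ch.C) (mul_nonneg (norm_nonneg _) ch.C_nonneg)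
    (fun s hs k => (f.le_opNorm _).trans (by gcongr; exact h s hs.le k)) t ht
  refine (mul_le_mul_of_nonneg_left this (sq_nonneg _)).trans_eq ?_
  rw [distortion, delta]
  ring

/-- The squared error of the averaged noiseless estimate. -/
def err (t : ℕ) (ω : X.Ω) : ℝ := ‖avg (ch.G t ω) - ch.star (X.x t ω)‖ ^ 2

theorem norm_star_sub_le (x x' : Vec (d 0)) :
    ‖ch.star x - ch.star x'‖ ≤ 2 * c.total ^ (2 * M + 2) * ‖x - x'‖ := by
  have h0 := X.one_le_total
  rw [star, star, ← avg_sub]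
  refine norm_avg_le_of_forall (by positivity) fun k => (ch.lip k _ _ _ _).trans ?_
  calc _ ≤ c.total ^ 2 * (c.total ^ (2 * M) * ‖x - x'‖ + c.total ^ (2 * M) * ‖x - x'‖) := by
        gcongr
        · exact X.regular.yStar_lip _ _ _
        · exact X.regular.yStar_lip _ _ _
    _ = _ := by ring

theorem _root_.DSMO.add_le_two_mul_sum {n : ℕ} {f : Fin n → ℝ} (a b : Fin n) (hf : ∀ m, 0 ≤ f m) :
    f a + f b ≤ 2 * ∑ m, f m := by
  have h1 := Finset.single_le_sum (f := f) (fun m _ => hf m) (Finset.mem_univ a)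
  have h2 := Finset.single_le_sum (f := f) (fun m _ => hf m) (Finset.mem_univ b)
  linarith

/-- Two bounds are available: the Lipschitz bound by the deviations, and the trivial one from
boundedness of the means. Their minimum is why only the truncated consensus error `cons` enters the
analysis. -/
theorem ae_norm_avg_m_sub_sq_le : ∀ᵐ ω ∂X.P, ∀ t ≤ X.T,
    ‖avg (fun k => ch.m t k ω) - avg (fun k => ch.mean k (X.yBar ch.a t ω) (X.yBar ch.b t ω))‖ ^ 2 ≤
      4 * c.total ^ 4 * X.cons t ω := by
  filter_upwards [X.ae_mem, X.ae_mem_yBar] with ω h h' t ht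
  have h0 := X.one_le_total
  have hK := X.card_pos
  rw [← avg_sub]
  set z : Fin X.K → V := fun k => ch.m t k ω - ch.mean k (X.yBar ch.a t ω) (X.yBar ch.b t ω) with hz
  have h11 : ‖avg z‖ ≤ 2 * c.total := norm_avg_le_of_forall (by positivity) fun k => by
    have i1 := ch.norm_mean_le k (h t ht ch.a k) (h t ht ch.b k)
    have i2 := ch.norm_mean_le k (h' t ht ch.a) (h' t ht ch.b)
    have := ch.C_le
    calc ‖z k‖ ≤ _ := norm_sub_le _ _
      _ ≤ ch.C + ch.C := add_le_add i1 i2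
      _ ≤ _ := by linarith
  have h12 : ‖avg z‖ ^ 2 ≤ 4 * c.total ^ 4 * ∑ m, dev (X.y m t ω) := by
    refine (norm_avg_sq_le z).trans ?_
    have i : msq z ≤ (1 + 1) * c.total ^ 4 * (dev (X.y ch.a t ω) + dev (X.y ch.b t ω)) := by
      have hk : ∀ k, ‖z k‖ ^ 2 ≤ 2 * c.total ^ 4 *
          (‖X.y ch.a t ω k - avg (X.y ch.a t ω)‖ ^ 2 + ‖X.y ch.b t ω k - avg (X.y ch.b t ω)‖ ^ 2) := by
        intro k
        refine (pow_le_pow_left₀ (norm_nonneg _) (ch.lip k _ _ _ _) 2).trans ?_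
        rw [mul_pow, ← pow_mul]
        have := mul_le_mul_of_nonneg_left (add_sq_le (a := ‖X.y ch.a t ω k - X.yBar ch.a t ω‖)
          (b := ‖X.y ch.b t ω k - X.yBar ch.b t ω‖)) (show 0 ≤ c.total ^ 4 by positivity)
        simp only [yBar] at this ⊢
        norm_num at this ⊢
        linarith
      unfold dev msq
      rw [← mul_add, ← Finset.sum_add_distrib, mul_left_comm]
      refine mul_le_mul_of_nonneg_left ?_ (by positivity)
      rw [Finset.mul_sum]
      refine Finset.sum_le_sum fun k _ => ?_
      have := hk k
      norm_num at this ⊢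
      linarith
    have := add_le_two_mul_sum ch.a ch.b (f := fun m => dev (X.y m t ω)) fun m => dev_nonneg _
    have := mul_le_mul_of_nonneg_left this (show 0 ≤ 2 * c.total ^ 4 by positivity)
    norm_num at i
    linarith
  have h13 : ‖avg z‖ ^ 2 ≤ 4 * c.total ^ 4 * 1 := by
    refine (pow_le_pow_left₀ (norm_nonneg _) h11 2).trans ?_
    have : c.total ^ 2 ≤ c.total ^ 4 := pow_le_pow_right₀ h0 (by norm_num)
    nlinarith
  rw [cons]
  rcases min_choice 1 (∑ m, dev (X.y m t ω)) with h | h <;> rw [h]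
  · exact h13
  · exact h12

theorem ae_norm_avg_m_sub_star_sq_le : ∀ᵐ ω ∂X.P, ∀ t ≤ X.T,
    ‖avg (fun k => ch.m t k ω) - ch.star (X.x t ω)‖ ^ 2 ≤
      8 * c.total ^ 4 * (X.cons t ω + ∑ m, X.Y m t ω) := by
  filter_upwards [ch.ae_norm_avg_m_sub_sq_le] with ω h t ht
  have h0 := X.one_le_total
  have h1 := h t ht
  set w : Fin X.K → V := fun k => ch.mean k (X.yBar ch.a t ω) (X.yBar ch.b t ω) -
    ch.mean k (X.p.yStar ch.a (X.x t ω)) (X.p.yStar ch.b (X.x t ω)) with hw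
  have e : avg (fun k => ch.m t k ω) - ch.star (X.x t ω) = (avg (fun k => ch.m t k ω) -
      avg (fun k => ch.mean k (X.yBar ch.a t ω) (X.yBar ch.b t ω))) + avg w := by
    rw [star, hw, avg_sub]
    abel
  have h2 : ‖avg w‖ ^ 2 ≤ 4 * c.total ^ 4 * ∑ m, X.Y m t ω := by
    have h21 : ‖avg w‖ ≤ c.total ^ 2 * (‖X.yBar ch.a t ω - X.p.yStar ch.a (X.x t ω)‖ +
        ‖X.yBar ch.b t ω - X.p.yStar ch.b (X.x t ω)‖) :=
      norm_avg_le_of_forall (by positivity) fun k => ch.lip k _ _ _ _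
    refine (pow_le_pow_left₀ (norm_nonneg _) h21 2).trans ?_
    rw [mul_pow, ← pow_mul]
    have i := mul_le_mul_of_nonneg_left (add_sq_le (a := ‖X.yBar ch.a t ω - X.p.yStar ch.a (X.x t ω)‖)
      (b := ‖X.yBar ch.b t ω - X.p.yStar ch.b (X.x t ω)‖)) (show 0 ≤ c.total ^ 4 by positivity)
    have := add_le_two_mul_sum ch.a ch.b (f := fun m => X.Y m t ω) fun m => sq_nonneg _
    have := mul_le_mul_of_nonneg_left this (show 0 ≤ 2 * c.total ^ 4 by positivity)
    simp only [Y] at this i ⊢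
    norm_num at this i ⊢
    linarith
  rw [e]
  have h3 := (pow_le_pow_left₀ (norm_nonneg _) (norm_add_le (avg (fun k => ch.m t k ω) -
    avg (fun k => ch.mean k (X.yBar ch.a t ω) (X.yBar ch.b t ω))) (avg w)) 2).trans add_sq_le
  linarith

/-- Convexity of the squared norm. -/
theorem _root_.DSMO.norm_convex_sq_le {V : Type*} [NormedAddCommGroup V] [NormedSpace ℝ V] {θ : ℝ}
    (h0 : 0 < θ) (h1 : θ ≤ 1) (a b w : V) :
    ‖(1 - θ) • a + θ • b + w‖ ^ 2 ≤ (1 - θ) * ‖a‖ ^ 2 + 2 * θ * ‖b‖ ^ 2 + 2 / θ * ‖w‖ ^ 2 := by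
  have e : (1 - θ) • a + θ • b + w = (1 - θ) • a + θ • (b + θ⁻¹ • w) := by
    rw [smul_add, smul_smul, mul_inv_cancel₀ h0.ne', one_smul, add_assoc]
  have h2 : ‖(1 - θ) • a + θ • (b + θ⁻¹ • w)‖ ≤ (1 - θ) * ‖a‖ + θ * ‖b + θ⁻¹ • w‖ := by
    refine (norm_add_le _ _).trans_eq ?_
    rw [norm_smul, norm_smul, Real.norm_of_nonneg h0.le, Real.norm_of_nonneg (sub_nonneg.2 h1)]
  have h3 : ‖b + θ⁻¹ • w‖ ^ 2 ≤ 2 * (‖b‖ ^ 2 + (θ⁻¹ * ‖w‖) ^ 2) := by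
    refine (pow_le_pow_left₀ (norm_nonneg _) (norm_add_le _ _) 2).trans ?_
    rw [norm_smul, Real.norm_of_nonneg (inv_nonneg.2 h0.le)]
    exact add_sq_le
  rw [e]
  calc _ ≤ ((1 - θ) * ‖a‖ + θ * ‖b + θ⁻¹ • w‖) ^ 2 := pow_le_pow_left₀ (norm_nonneg _) h2 2
    _ ≤ (1 - θ) * ‖a‖ ^ 2 + θ * ‖b + θ⁻¹ • w‖ ^ 2 := by
        nlinarith [mul_nonneg (mul_nonneg h0.le (sub_nonneg.2 h1))
          (sq_nonneg (‖a‖ - ‖b + θ⁻¹ • w‖))]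
    _ ≤ (1 - θ) * ‖a‖ ^ 2 + θ * (2 * (‖b‖ ^ 2 + (θ⁻¹ * ‖w‖) ^ 2)) := by gcongr
    _ = _ := by field_simp; ring

/-- The new error is a convex combination of the old error and the current bias of the means, plus
the drift of the target. The drift is divided by `β_t` in `norm_convex_sq_le`, and `α_t/β_t =
2/(μC₁)` turns it into a small multiple of `α_t ‖z̄‖²`. -/
theorem ae_err_succ_le : ∀ᵐ ω ∂X.P, ∀ t < X.T,
    ch.err (t + 1) ω ≤ (1 - X.β t) * ch.err t ω +
      16 * c.total ^ 4 * X.β t * (X.cons t ω + ∑ m, X.Y m t ω) +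
      16 * c.total ^ (4 * M + 4) / (μ * C₁) * (X.α t * ‖X.zBar t ω‖ ^ 2) := by
  filter_upwards [ch.ae_norm_avg_m_sub_star_sq_le] with ω h t ht
  have h0 := X.one_le_total
  have hμ := X.μ_pos
  have hC := X.C₁_pos
  have e : avg (ch.G (t + 1) ω) - ch.star (X.x (t + 1) ω) =
      (1 - X.β t) • (avg (ch.G t ω) - ch.star (X.x t ω)) +
        X.β t • (avg (fun k => ch.m t k ω) - ch.star (X.x t ω)) +
        (ch.star (X.x t ω) - ch.star (X.x (t + 1) ω)) := by
    have : avg (ch.G (t + 1) ω) = (1 - X.β t) • avg (ch.G t ω) +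
        X.β t • avg (fun k => ch.m t k ω) := avg_drive_succ X.gossip t
    rw [this]
    module
  have h1 := ch.norm_star_sub_le (X.x t ω) (X.x (t + 1) ω)
  have h2 : X.x t ω - X.x (t + 1) ω = X.α t • X.zBar t ω := by rw [x_succ]; abel
  rw [h2, norm_smul, Real.norm_of_nonneg (X.α_pos t).le] at h1
  have h3 := norm_convex_sq_le (X.β_pos t) (X.β_le_one t) (avg (ch.G t ω) - ch.star (X.x t ω))
    (avg (fun k => ch.m t k ω) - ch.star (X.x t ω)) (ch.star (X.x t ω) - ch.star (X.x (t + 1) ω))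
  rw [← e] at h3
  have h4 := h t ht.le
  have hb := X.β_pos t
  have h5 : 2 / X.β t * ‖ch.star (X.x t ω) - ch.star (X.x (t + 1) ω)‖ ^ 2 ≤
      16 * c.total ^ (4 * M + 4) / (μ * C₁) * (X.α t * ‖X.zBar t ω‖ ^ 2) := by
    calc _ ≤ 2 / X.β t * (2 * c.total ^ (2 * M + 2) * (X.α t * ‖X.zBar t ω‖)) ^ 2 := by gcongr
      _ = 8 * c.total ^ (4 * M + 4) * ((X.α t / X.β t) * (X.α t * ‖X.zBar t ω‖ ^ 2)) := by
          field_simp; ring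
      _ = _ := by
          have : X.α t / X.β t = 2 / (μ * C₁) := by rw [X.α_eq]; field_simp
          rw [this]; ring
  have h6 : 2 * X.β t * ‖avg (fun k => ch.m t k ω) - ch.star (X.x t ω)‖ ^ 2 ≤
      2 * X.β t * (8 * c.total ^ 4 * (X.cons t ω + ∑ m, X.Y m t ω)) := by gcongr
  simp only [err]
  linarith

end Chan

end Sys

end DSMO

end

noncomputable section

namespace DSMO

open scoped ENNReal

universe u v

/-! ### Products of estimated operators -/

/-- `Q_0 = I` and `Q_{i+1} = I + R_i Q_i`. -/
def neumann {n : ℕ} (R : ℕ → Vec n →L[ℝ] Vec n) : ℕ → Vec n →L[ℝ] Vec n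
  | 0 => ContinuousLinearMap.id ℝ (Vec n)
  | i + 1 => ContinuousLinearMap.id ℝ (Vec n) + R i ∘L neumann R i

theorem hessQ_eq_neumann {n : ℕ} (L : ℝ) (v : ℕ → Vec n →L[ℝ] Vec n) (b : ℕ) :
    hessQ L v b = neumann (fun i => ContinuousLinearMap.id ℝ (Vec n) - (1 / L) • v i) b := by
  induction b with
  | zero => rfl
  | succ b ih => rw [hessQ, neumann, ih]

section Ctrl

variable {Ω ι : Type*} [MeasurableSpace Ω] [Fintype ι] {K : ℕ}

/-- Control of a random vector `w` and its deviation from a bounded vector `wG`, conditionally on the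
channels outside `I`. -/
structure Ctrl {E : Type*} [NormedAddCommGroup E] (P : Measure Ω) (Φ : ι → Lab K → Ω → ℝ)
    (D : ι → Lab K → ℝ) (I : Set ι) (w wG : Ω → E) (a e : ℝ) : Prop where
  size : Bdd P Φ D I (fun ω => ‖w ω‖ ^ 2) a
  mean : ∀ᵐ ω ∂P, ‖wG ω‖ ^ 2 ≤ a
  err : Bdd P Φ D I (fun ω => ‖w ω - wG ω‖ ^ 2) e

/-- Control of the random variable `A` estimated by channel `i`, and of its noise. -/
structure CtrlOp {E : Type*} [NormedAddCommGroup E] (P : Measure Ω) (Φ : ι → Lab K → Ω → ℝ)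
    (D : ι → Lab K → ℝ) (i : ι) (A AG : Ω → E) (C ν : ℝ) : Prop where
  size : ∀ (I J : Set ι) (Y : Ω → ℝ) (d : ℝ), Bdd P Φ D I Y d → i ∉ I → insert i I ⊆ J →
    Bdd P Φ D J (fun ω => ‖A ω‖ ^ 2 * Y ω) (C ^ 2 * d)
  mean : ∀ᵐ ω ∂P, ‖AG ω‖ ≤ C
  noise : ∀ (J : Set ι) (a : ℝ), i ∈ J → 0 ≤ a →
    Bdd P Φ D J (fun ω => ‖A ω - AG ω‖ ^ 2 * a) (ν * a)

variable {P : Measure Ω} {Φ : ι → Lab K → Ω → ℝ} {D : ι → Lab K → ℝ} {I J : Set ι}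

theorem Ctrl.mono {E : Type*} [NormedAddCommGroup E] {w wG : Ω → E} {a e a' e' : ℝ}
    (h : Ctrl P Φ D I w wG a e) (hI : I ⊆ J) (ha : a ≤ a') (he : e ≤ e') :
    Ctrl P Φ D J w wG a' e' :=
  ⟨(h.size.mono_set hI).mono (Filter.Eventually.of_forall fun _ => le_rfl) ha,
    h.mean.mono fun _ h => h.trans ha,
    (h.err.mono_set hI).mono (Filter.Eventually.of_forall fun _ => le_rfl) he⟩

theorem Ctrl.smul {E : Type*} [NormedAddCommGroup E] [NormedSpace ℝ E] {w wG : Ω → E} {a e : ℝ}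
    (h : Ctrl P Φ D I w wG a e) (r : ℝ) :
    Ctrl P Φ D I (fun ω => r • w ω) (fun ω => r • wG ω) (r ^ 2 * a) (r ^ 2 * e) := by
  have hr : ∀ v : E, ‖r • v‖ ^ 2 = r ^ 2 * ‖v‖ ^ 2 := fun v => by
    rw [norm_smul, mul_pow, Real.norm_eq_abs, sq_abs]
  refine ⟨?_, ?_, ?_⟩
  · simp_rw [hr]
    exact h.size.const_mul (sq_nonneg r)
  · filter_upwards [h.mean] with ω hω
    rw [hr]
    exact mul_le_mul_of_nonneg_left hω (sq_nonneg r)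
  · simp_rw [← smul_sub, hr]
    exact h.err.const_mul (sq_nonneg r)

theorem norm_add_sq_le_weighted {E : Type*} [SeminormedAddCommGroup E] {Λ : ℝ} (hΛ : 0 < Λ) (v w : E) :
    ‖v + w‖ ^ 2 ≤ (1 + Λ) * ‖v‖ ^ 2 + (1 + Λ⁻¹) * ‖w‖ ^ 2 := by
  have h1 : ‖v + w‖ ^ 2 ≤ (‖v‖ + ‖w‖) ^ 2 := pow_le_pow_left₀ (norm_nonneg _) (norm_add_le _ _) 2
  have h2 : 0 ≤ Λ⁻¹ * (Λ * ‖v‖ - ‖w‖) ^ 2 := by positivity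
  have h3 : Λ⁻¹ * (Λ * ‖v‖ - ‖w‖) ^ 2 = Λ * ‖v‖ ^ 2 - 2 * (‖v‖ * ‖w‖) + Λ⁻¹ * ‖w‖ ^ 2 := by
    field_simp
    ring
  nlinarith

variable (hΦ : ∀ i l, Measurable (Φ i l))

include hΦ

/-- The splitting `A w - A_G w_G = A (w - w_G) + (A - A_G) w_G` is essential. In the first term the
unbounded `A` multiplies an error that does not use channel `i`; in the second the noise of channel
`i` multiplies an almost surely bounded vector. -/
theorem Ctrl.apply {E F : Type*} [NormedAddCommGroup E] [NormedSpace ℝ E] [NormedAddCommGroup F]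
    [NormedSpace ℝ F] {w wG : Ω → E} {a e C ν : ℝ} (ha : 0 ≤ a) (he : 0 ≤ e) (hν : 0 ≤ ν)
    (h : Ctrl P Φ D I w wG a e) {i : ι} {A AG : Ω → E →L[ℝ] F} (hA : CtrlOp P Φ D i A AG C ν)
    (hi : i ∉ I) (hJ : insert i I ⊆ J) :
    Ctrl P Φ D J (fun ω => A ω (w ω)) (fun ω => AG ω (wG ω)) (C ^ 2 * a) (2 * (C ^ 2 * e + ν * a)) := by
  refine ⟨?_, ?_, ?_⟩
  · refine (hA.size I J _ _ h.size hi hJ).mono (Filter.Eventually.of_forall fun ω => ?_) le_rfl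
    rw [← mul_pow]
    exact pow_le_pow_left₀ (norm_nonneg _) ((A ω).le_opNorm _) 2
  · filter_upwards [h.mean, hA.mean] with ω h1 h2
    calc ‖AG ω (wG ω)‖ ^ 2 ≤ (‖AG ω‖ * ‖wG ω‖) ^ 2 :=
          pow_le_pow_left₀ (norm_nonneg _) ((AG ω).le_opNorm _) 2
      _ = ‖AG ω‖ ^ 2 * ‖wG ω‖ ^ 2 := mul_pow _ _ _
      _ ≤ _ := by gcongr
  · refine (((hA.size I J _ _ h.err hi hJ).add hΦ
      (hA.noise J a (hJ (Set.mem_insert i I)) ha) (by positivity) (by positivity)).const_mul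
      (show (0 : ℝ) ≤ 2 by norm_num)).mono ?_ le_rfl
    filter_upwards [h.mean] with ω h1
    have e1 : A ω (w ω) - AG ω (wG ω) = A ω (w ω - wG ω) + (A ω - AG ω) (wG ω) := by simp
    rw [e1]
    have h2 : ‖A ω (w ω - wG ω)‖ ^ 2 ≤ ‖A ω‖ ^ 2 * ‖w ω - wG ω‖ ^ 2 := by
      rw [← mul_pow]
      exact pow_le_pow_left₀ (norm_nonneg _) ((A ω).le_opNorm _) 2
    have h3 : ‖(A ω - AG ω) (wG ω)‖ ^ 2 ≤ ‖A ω - AG ω‖ ^ 2 * a := by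
      calc _ ≤ (‖A ω - AG ω‖ * ‖wG ω‖) ^ 2 :=
            pow_le_pow_left₀ (norm_nonneg _) ((A ω - AG ω).le_opNorm _) 2
        _ = ‖A ω - AG ω‖ ^ 2 * ‖wG ω‖ ^ 2 := mul_pow _ _ _
        _ ≤ _ := by gcongr
    calc _ ≤ (‖A ω (w ω - wG ω)‖ + ‖(A ω - AG ω) (wG ω)‖) ^ 2 :=
          pow_le_pow_left₀ (norm_nonneg _) (norm_add_le _ _) 2
      _ ≤ 2 * (‖A ω (w ω - wG ω)‖ ^ 2 + ‖(A ω - AG ω) (wG ω)‖ ^ 2) := add_sq_le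
      _ ≤ _ := by gcongr

/-- Each new term brings an independent contraction, so sizes and errors obey recursions whose
supersolutions `S` and `T` do not involve `b`. This uniformity is needed since `b` grows like `log
T`. -/
theorem Ctrl.neumann {n : ℕ} {w wG : Ω → Vec n} {a e ν Λ : ℝ} (hΛ : 1 ≤ Λ) (ha : 0 ≤ a) (he : 0 ≤ e)
    (hν : 0 ≤ ν) (h : Ctrl P Φ D I w wG a e) {b : ℕ} {f : Fin b → ι} (hf : Function.Injective f)
    (hfI : ∀ i, f i ∉ I) {R RG : ℕ → Ω → Vec n →L[ℝ] Vec n}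
    (hR : ∀ i : Fin b, CtrlOp P Φ D (f i) (R i) (RG i) (1 - Λ⁻¹) ν) :
    Ctrl P Φ D (I ∪ Set.range f) (fun ω => DSMO.neumann (fun i => R i ω) b (w ω))
      (fun ω => DSMO.neumann (fun i => RG i ω) b (wG ω)) (Λ * (1 + Λ) * a)
      (2 * Λ * (1 + Λ) * (e + ν * (Λ * (1 + Λ) * a))) := by
  have hΛ0 : 0 < Λ := by linarith
  set κ := Λ⁻¹ with hκ
  have hκ0 : 0 < κ := by positivity
  have hκ1 : κ ≤ 1 := inv_le_one_of_one_le₀ hΛ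
  have hΛκ : Λ * κ = 1 := mul_inv_cancel₀ hΛ0.ne'
  set S := Λ * (1 + Λ) * a with hS
  set T := 2 * Λ * (1 + Λ) * (e + ν * S) with hT
  have hS0 : 0 ≤ S := by positivity
  have hT0 : 0 ≤ T := by positivity
  have haS : a ≤ S := by
    have : 1 * a ≤ Λ * (1 + Λ) * a := mul_le_mul_of_nonneg_right (by nlinarith) ha
    linarith
  have heT : e ≤ T := by
    have h1 : 1 * (e + ν * S) ≤ 2 * Λ * (1 + Λ) * (e + ν * S) :=
      mul_le_mul_of_nonneg_right (by nlinarith) (by positivity)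
    have : 0 ≤ ν * S := by positivity
    linarith
  -- Squaring the contraction factor leaves room for the factor `1 + κ` of Young's inequality with
  -- weight `Λ = κ⁻¹`, and a contraction by `1 - κ` survives. The constants `S` and `T` are chosen
  -- so that `κ` times each equals the forcing.
  have hθ : (1 + κ) * (1 - κ) ^ 2 ≤ 1 - κ := by nlinarith [mul_nonneg (sq_nonneg κ) (sub_nonneg.2 hκ1)]
  have hrecS : (1 + Λ) * a + (1 + κ) * ((1 - κ) ^ 2 * S) ≤ S := by
    have h1 := mul_le_mul_of_nonneg_right hθ hS0
    have h2 : κ * S = (1 + Λ) * a := by rw [hS]; linear_combination (1 + Λ) * a * hΛκ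
    linarith
  have hrecT : (1 + Λ) * (2 * (e + ν * S)) + (1 + κ) * ((1 - κ) ^ 2 * T) ≤ T := by
    have h1 := mul_le_mul_of_nonneg_right hθ hT0
    have h2 : κ * T = (1 + Λ) * (2 * (e + ν * S)) := by
      rw [hT]; linear_combination 2 * (1 + Λ) * (e + ν * S) * hΛκ
    linarith
  have key : ∀ j ≤ b, Ctrl P Φ D (I ∪ f '' {i | (i : ℕ) < j})
      (fun ω => DSMO.neumann (fun i => R i ω) j (w ω))
      (fun ω => DSMO.neumann (fun i => RG i ω) j (wG ω)) S T := by
    intro j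
    induction j with
    | zero => exact fun _ => h.mono Set.subset_union_left haS heT
    | succ j ih =>
      intro hj
      have hjb : j < b := hj
      have hIH := ih hjb.le
      have hRj := hR ⟨j, hjb⟩
      set J := I ∪ f '' {i : Fin b | (i : ℕ) < j + 1} with hJ
      -- The next Hessian channel is new, by injectivity; without this its operator could not be
      -- multiplied in.
      have hnot : f ⟨j, hjb⟩ ∉ I ∪ f '' {i : Fin b | (i : ℕ) < j} := by
        rintro (h1 | ⟨i, h1, h2⟩)
        · exact hfI _ h1
        · have h1' : (i : ℕ) < j := h1
          rw [hf h2] at h1'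
          exact lt_irrefl _ h1'
      have hins : insert (f ⟨j, hjb⟩) (I ∪ f '' {i : Fin b | (i : ℕ) < j}) ⊆ J := by
        rintro x (rfl | h1 | ⟨i, h1, rfl⟩)
        · exact Or.inr ⟨⟨j, hjb⟩, Nat.lt_succ_self j, rfl⟩
        · exact Or.inl h1
        · exact Or.inr ⟨i, Nat.lt_succ_of_lt h1, rfl⟩
      have hIJ : I ⊆ J := Set.subset_union_left
      have hjJ : f ⟨j, hjb⟩ ∈ J := hins (Set.mem_insert _ _)
      have eN : ∀ (R : ℕ → Ω → Vec n →L[ℝ] Vec n) (w : Ω → Vec n) ω,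
          DSMO.neumann (fun i => R i ω) (j + 1) (w ω) =
          w ω + R j ω (DSMO.neumann (fun i => R i ω) j (w ω)) := fun R w ω => rfl
      have hop : ∀ (A : Vec n →L[ℝ] Vec n) v, ‖A v‖ ^ 2 ≤ ‖A‖ ^ 2 * ‖v‖ ^ 2 := fun A v => by
        rw [← mul_pow]
        exact pow_le_pow_left₀ (norm_nonneg _) (A.le_opNorm _) 2
      refine ⟨?_, ?_, ?_⟩
      · refine (((h.size.mono_set hIJ).const_mul (show 0 ≤ 1 + Λ by positivity)).add hΦ
          ((hRj.size _ J _ _ hIH.size hnot hins).const_mul (show 0 ≤ 1 + κ by positivity))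
          (by positivity) (by positivity)).mono (Filter.Eventually.of_forall fun ω => ?_) hrecS
        rw [eN]
        refine (norm_add_sq_le_weighted hΛ0 _ _).trans ?_
        have := hop (R j ω) (DSMO.neumann (fun i => R i ω) j (w ω))
        gcongr
      · filter_upwards [h.mean, hIH.mean, hRj.mean] with ω h1 h2 h3
        rw [eN]
        refine (norm_add_sq_le_weighted hΛ0 _ _).trans (le_trans ?_ hrecS)
        have h4 := hop (RG j ω) (DSMO.neumann (fun i => RG i ω) j (wG ω))
        have h5 : ‖RG j ω‖ ^ 2 * ‖DSMO.neumann (fun i => RG i ω) j (wG ω)‖ ^ 2 ≤ (1 - κ) ^ 2 * S := by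
          have h3' : ‖RG j ω‖ ≤ 1 - κ := h3
          gcongr
        have h6 := h4.trans h5
        gcongr
      · refine ((((h.err.mono_set hIJ).add hΦ (hRj.noise J S hjJ hS0) he (by positivity)).const_mul
          (show 0 ≤ (1 + Λ) * 2 by positivity)).add hΦ
          ((hRj.size _ J _ _ hIH.err hnot hins).const_mul (show 0 ≤ 1 + κ by positivity))
          (by positivity) (by positivity)).mono ?_ ((by ring :
            (1 + Λ) * 2 * (e + ν * S) + (1 + κ) * ((1 - κ) ^ 2 * T) =
            (1 + Λ) * (2 * (e + ν * S)) + (1 + κ) * ((1 - κ) ^ 2 * T)).trans_le hrecT)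
        filter_upwards [hIH.mean] with ω h1
        rw [eN, eN]
        set Q := DSMO.neumann (fun i => R i ω) j (w ω)
        set QG := DSMO.neumann (fun i => RG i ω) j (wG ω)
        have e1 : w ω + R j ω Q - (wG ω + RG j ω QG) =
            ((w ω - wG ω) + (R j ω - RG j ω) QG) + R j ω (Q - QG) := by
          simp
          abel
        rw [e1]
        refine (norm_add_sq_le_weighted hΛ0 _ _).trans ?_
        have h2 := hop (R j ω) (Q - QG)
        have h3 : ‖(w ω - wG ω) + (R j ω - RG j ω) QG‖ ^ 2 ≤
            2 * (‖w ω - wG ω‖ ^ 2 + ‖R j ω - RG j ω‖ ^ 2 * S) := by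
          have h4 : ‖(R j ω - RG j ω) QG‖ ^ 2 ≤ ‖R j ω - RG j ω‖ ^ 2 * S :=
            (hop _ _).trans (by gcongr)
          calc _ ≤ (‖w ω - wG ω‖ + ‖(R j ω - RG j ω) QG‖) ^ 2 :=
                pow_le_pow_left₀ (norm_nonneg _) (norm_add_le _ _) 2
            _ ≤ 2 * (‖w ω - wG ω‖ ^ 2 + ‖(R j ω - RG j ω) QG‖ ^ 2) := add_sq_le
            _ ≤ _ := by gcongr
        rw [mul_assoc (1 + Λ) 2]
        gcongr
  refine (key b le_rfl).mono ?_ le_rfl le_rfl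
  rintro x (h1 | ⟨i, -, rfl⟩)
  · exact Or.inl h1
  · exact Or.inr ⟨i, rfl⟩

omit hΦ

variable {M : ℕ} {b : Fin M → ℕ}

/-- The channels: mixed Hessians, contractions, outer gradients. -/
abbrev ChanIdx (b : Fin M → ℕ) := Fin M ⊕ (Σ m, Fin (b m)) ⊕ Unit

/-- The level of a channel. -/
def ChanIdx.level : ChanIdx b → ℕ
  | .inl m => m
  | .inr (.inl x) => x.1
  | .inr (.inr _) => M

/-- The chain is applied from the innermost vector outwards: a vector at level `m` has used only
channels of level at least `m`, so the factors of the next level are new. A level costs `20Λ⁸`; its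
fresh noise `ν a` doubles this to `40Λ⁸` in the error. -/
theorem Ctrl.chainTo {d : Fin (M + 1) → ℕ} {Φ : ChanIdx b → Lab K → Ω → ℝ}
    {D : ChanIdx b → Lab K → ℝ} (hΦ : ∀ i l, Measurable (Φ i l)) {L : Fin M → ℝ} {Λ ν : ℝ} (hΛ : 1 ≤ Λ)
    (hν : 0 ≤ ν) (hL : ∀ m, |1 / L m| ≤ Λ)
    {u uG : (m : Fin M) → Ω → Vec (d m.succ) →L[ℝ] Vec (d m.castSucc)}
    {R RG : (m : Fin M) → ℕ → Ω → Vec (d m.succ) →L[ℝ] Vec (d m.succ)}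
    (hu : ∀ m, CtrlOp P Φ D (.inl m) (u m) (uG m) Λ ν)
    (hR : ∀ m (i : Fin (b m)), CtrlOp P Φ D (.inr (.inl ⟨m, i⟩)) (R m i) (RG m i) (1 - Λ⁻¹) ν)
    (m : Fin (M + 1)) : ∀ {w wG : Ω → Vec (d m)} {a e : ℝ}, 0 ≤ a → 0 ≤ e →
    Ctrl P Φ D {i | (m : ℕ) ≤ i.level} w wG a e →
    Ctrl P Φ D Set.univ
      (fun ω => DSMO.chainTo (fun m => u m ω)
        (fun m => (1 / L m) • DSMO.neumann (fun i => R m i ω) (b m)) m (w ω))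
      (fun ω => DSMO.chainTo (fun m => uG m ω)
        (fun m => (1 / L m) • DSMO.neumann (fun i => RG m i ω) (b m)) m (wG ω))
      ((40 * Λ ^ 8) ^ (m : ℕ) * a) ((40 * Λ ^ 8) ^ (m : ℕ) * (e + ν * a)) := by
  have hΛ0 : 0 < Λ := by linarith
  induction m using Fin.induction with
  | zero =>
    intro w wG a e ha he h
    refine h.mono (Set.subset_univ _) (by simp) ?_
    have : 0 ≤ ν * a := by positivity
    simp
    linarith
  | succ m ih =>
    intro w wG a e ha he h
    have h1 := Ctrl.neumann hΦ hΛ ha he hν h (f := fun i : Fin (b m) => .inr (.inl ⟨m, i⟩))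
      (fun i j hij => by simpa using hij) (fun i hi => by simp [ChanIdx.level] at hi)
      (hR m)
    have h2 := h1.smul (1 / L m)
    have hl2 : (1 / L m) ^ 2 ≤ Λ ^ 2 := by
      rw [← sq_abs]
      exact pow_le_pow_left₀ (abs_nonneg _) (hL m) 2
    have hνa : 0 ≤ ν * a := by positivity
    have p1 : 1 ≤ Λ ^ 2 := one_le_pow₀ hΛ
    have p3 : Λ * (1 + Λ) ≤ 2 * Λ ^ 2 := by nlinarith
    have hA : (1 / L m) ^ 2 * (Λ * (1 + Λ) * a) ≤ 2 * Λ ^ 4 * a := by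
      calc _ ≤ Λ ^ 2 * (2 * Λ ^ 2 * a) := by gcongr
        _ = _ := by ring
    have hE : (1 / L m) ^ 2 * (2 * Λ * (1 + Λ) * (e + ν * (Λ * (1 + Λ) * a))) ≤
        8 * Λ ^ 6 * (e + ν * a) := by
      calc _ = (1 / L m) ^ 2 * (2 * (Λ * (1 + Λ)) * (e + ν * (Λ * (1 + Λ) * a))) := by ring
        _ ≤ Λ ^ 2 * (2 * (2 * Λ ^ 2) * (2 * Λ ^ 2 * e + ν * (2 * Λ ^ 2 * a))) := by
            gcongr
            nlinarith
        _ = _ := by ring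
    have h3 := h2.mono (le_refl _) hA hE
    have h4 := h3.apply hΦ (by positivity) (by positivity) hν (hu m)
      (J := {i : ChanIdx b | ((m.castSucc : Fin (M + 1)) : ℕ) ≤ i.level})
      (by rintro (h | ⟨i, h⟩)
          · simp [ChanIdx.level] at h
          · simp at h)
      (by rintro x (rfl | h | ⟨i, rfl⟩)
          · simp [ChanIdx.level]
          · simp at h ⊢
            omega
          · simp [ChanIdx.level])
    have h5 := h4.mono (le_refl _) (a' := 20 * Λ ^ 8 * a) (e' := 20 * Λ ^ 8 * (e + ν * a))
      (by have : Λ ^ 6 * a ≤ Λ ^ 8 * a := by gcongr; norm_num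
          have : 0 ≤ Λ ^ 8 * a := by positivity
          linarith)
      (by have e1 : Λ ^ 4 * (ν * a) ≤ Λ ^ 8 * (e + ν * a) := by
            have : Λ ^ 4 ≤ Λ ^ 8 := pow_le_pow_right₀ hΛ (by norm_num)
            have : ν * a ≤ e + ν * a := by linarith
            gcongr
          have : 0 ≤ Λ ^ 8 * (e + ν * a) := by positivity
          linarith)
    have h6 := ih (by positivity) (by positivity) h5
    refine h6.mono le_rfl ?_ ?_
    · have : (0 : ℝ) ≤ (40 * Λ ^ 8) ^ (m : ℕ) := by positivity
      simp only [Fin.val_castSucc, Fin.val_succ, pow_succ (40 * Λ ^ 8) (m : ℕ)]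
      have : 20 * Λ ^ 8 * a ≤ 40 * Λ ^ 8 * a := by gcongr; norm_num
      have := mul_le_mul_of_nonneg_left this ‹(0 : ℝ) ≤ (40 * Λ ^ 8) ^ (m : ℕ)›
      linarith
    · have h0 : (0 : ℝ) ≤ (40 * Λ ^ 8) ^ (m : ℕ) := by positivity
      simp only [Fin.val_castSucc, Fin.val_succ, pow_succ (40 * Λ ^ 8) (m : ℕ)]
      have : 20 * Λ ^ 8 * (e + ν * a) + ν * (20 * Λ ^ 8 * a) ≤ 40 * Λ ^ 8 * (e + ν * a) := by
        have : 0 ≤ Λ ^ 8 * e := by positivity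
        linarith
      have := mul_le_mul_of_nonneg_left this h0
      linarith

end Ctrl

end DSMO

end

noncomputable section

namespace DSMO

open scoped ENNReal

universe u v

namespace Sys

variable {M : ℕ} {d : Fin (M + 1) → ℕ} {c : Constants M} {μ C₁ : ℝ} (X : Sys.{u, v} d c μ C₁)

/-! ### The estimates of the algorithm -/

/-- The estimates of `∇₁ f`. -/
def chS : X.Chan (Vec (d 0)) where
  a := 0
  b := Fin.last M
  q := .outer
  n := X.o.gradf₁
  mean := X.p.gradf₁
  g₀ := 0
  C := c.Cf
  C_nonneg := c.Cf_pos.le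
  C_le := c.total_spec.2.1
  round_q _ _ := rfl
  q_ne t j k h e := h (by injection e)
  measurable_n k := (X.unbiased.measurable_gradf₁ k).comp
    (measurable_fst.fst.prodMk (measurable_fst.snd.prodMk measurable_snd))
  unbiased t k y y' := by
    rw [X.sampling.outer]
    exact X.unbiased.gradf₁ k y y'
  moment t k y hy y' hy' := by
    rw [X.sampling.outer]
    exact X.outer.moment_gradf₁ k y hy y' hy'
  lip k y z y' z' := (X.regular.lip_gradf₁ k y z y' z').trans (by
    have := X.one_le_total
    have : c.total ≤ c.total ^ 2 := by nlinarith
    gcongr)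
  norm_init := by simpa using c.Cf_pos.le

/-- The estimates of `∇₂ f`. -/
def chH : X.Chan (Vec (d (Fin.last M))) where
  a := 0
  b := Fin.last M
  q := .outer
  n := X.o.gradf₂
  mean := X.p.gradf₂
  g₀ := 0
  C := c.Cf
  C_nonneg := c.Cf_pos.le
  C_le := c.total_spec.2.1
  round_q _ _ := rfl
  q_ne t j k h e := h (by injection e)
  measurable_n k := (X.unbiased.measurable_gradf₂ k).comp
    (measurable_fst.fst.prodMk (measurable_fst.snd.prodMk measurable_snd))
  unbiased t k y y' := by
    rw [X.sampling.outer]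
    exact X.unbiased.gradf₂ k y y'
  moment t k y hy y' hy' := by
    rw [X.sampling.outer]
    exact X.outer.moment_gradf₂ k y hy y' hy'
  lip k y z y' z' := (X.regular.lip_gradf₂ k y z y' z').trans (by
    have := X.one_le_total
    have : c.total ≤ c.total ^ 2 := by nlinarith
    gcongr)
  norm_init := by simpa using c.Cf_pos.le

/-- Momentum estimates of `∇₂ g_m`; only their observations are used. -/
def chY (m : Fin M) : X.Chan (Vec (d m.succ)) where
  a := m.castSucc
  b := m.succ
  q t := .inner t m
  n := X.o.gradg₂ m
  mean := X.p.gradg₂ m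
  g₀ := 0
  C := c.Cg m
  C_nonneg := (c.Cg_pos m).le
  C_le := (c.total_spec.2.2.2 m).1
  round_q _ _ := rfl
  q_ne t j k h e := h (by injection e)
  measurable_n k := (X.unbiased.measurable_gradg₂ m k).comp
    (measurable_fst.fst.prodMk (measurable_fst.snd.prodMk measurable_snd))
  unbiased t k y y' := by
    rw [X.sampling.inner]
    exact X.unbiased.gradg₂ m k y y'
  moment t k y hy y' hy' := by
    rw [X.sampling.inner]
    exact X.inner.moment_gradg₂ m k y hy y' hy'
  lip k y z y' z' := (X.regular.lip_gradg₂ m k y z y' z').trans (by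
    have := X.one_le_total
    have : c.total ≤ c.total ^ 2 := by nlinarith
    gcongr)
  norm_init := by simpa using (c.Cg_pos m).le

/-- The estimates of `∇₁₂² g_m`. -/
def chU (m : Fin M) : X.Chan (Vec (d m.succ) →L[ℝ] Vec (d m.castSucc)) where
  a := m.castSucc
  b := m.succ
  q t := .inner t m
  n := X.o.hessg₁₂ m
  mean := X.p.hessg₁₂ m
  g₀ := 0
  C := c.Lg m
  C_nonneg := (c.Lg_pos m).le
  C_le := (c.total_spec.2.2.2 m).2.1
  round_q _ _ := rfl
  q_ne t j k h e := h (by injection e)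
  measurable_n k := (X.unbiased.measurable_hessg₁₂ m k).comp
    (measurable_fst.fst.prodMk (measurable_fst.snd.prodMk measurable_snd))
  unbiased t k y y' := by
    rw [X.sampling.inner]
    exact X.unbiased.hessg₁₂ m k y y'
  moment t k y hy y' hy' := by
    rw [X.sampling.inner]
    exact X.inner.moment_hessg₁₂ m k y y'
  lip k y z y' z' := (X.regular.lip_hessg₁₂ m k y z y' z').trans (by
    have := X.one_le_total
    have : c.total ≤ c.total ^ 2 := by nlinarith
    gcongr)
  norm_init := by simpa using (c.Lg_pos m).le

/-- The estimates of `I - ∇₂₂² g_m / L_m`. -/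
def chR (m : Fin M) (i : ℕ) : X.Chan (Vec (d m.succ) →L[ℝ] Vec (d m.succ)) where
  a := m.castSucc
  b := m.succ
  q t k := .hess t m k i
  n k y y' s := ContinuousLinearMap.id ℝ _ - (1 / c.Lg m) • X.o.hessg₂₂ m k y y' s
  mean k y y' := ContinuousLinearMap.id ℝ _ - (1 / c.Lg m) • X.p.hessg₂₂ m k y y'
  g₀ := ContinuousLinearMap.id ℝ _ - (1 / c.Lg m) • (c.μg m • ContinuousLinearMap.id ℝ _)
  C := 1 - c.κ m
  C_nonneg := sub_nonneg.2 (c.κ_le_one m)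
  C_le := by
    have := c.κ_pos m
    have := X.one_le_total
    linarith
  round_q _ _ := rfl
  q_ne t j k h e := h (by injection e)
  measurable_n k := by
    have : ProperSpace (Vec (d m.succ) →L[ℝ] Vec (d m.succ)) := FiniteDimensional.proper ℝ _
    exact measurable_const.sub (((X.unbiased.measurable_hessg₂₂ m k).comp
      (measurable_fst.fst.prodMk (measurable_fst.snd.prodMk measurable_snd))).const_smul (1 / c.Lg m))
  unbiased t k y y' := by
    rw [X.sampling.hess]
    have := X.sampling.isProbabilityMeasure_innerLaw m k
    exact unbiased_contraction (X.unbiased.hessg₂₂ m k y y') _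
  moment t k y hy y' hy' := by
    rw [X.sampling.hess]
    exact X.inner.moment_contraction m k y y'
  lip k y z y' z' := by
    have h0 := X.one_le_total
    have h1 : 0 ≤ 1 / c.Lg m := one_div_nonneg.2 (c.Lg_pos m).le
    have e : ContinuousLinearMap.id ℝ _ - (1 / c.Lg m) • X.p.hessg₂₂ m k y y' -
        (ContinuousLinearMap.id ℝ _ - (1 / c.Lg m) • X.p.hessg₂₂ m k z z') =
        -((1 / c.Lg m) • (X.p.hessg₂₂ m k y y' - X.p.hessg₂₂ m k z z')) := by module
    rw [e, norm_neg, norm_smul, Real.norm_of_nonneg h1]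
    calc _ ≤ c.total * (c.total * (‖y - z‖ + ‖y' - z'‖)) := by
          gcongr
          · exact X.regular.inv_L_le m
          · exact X.regular.lip_hessg₂₂ m k y z y' z'
      _ = _ := by ring
  norm_init := by
    have e : ContinuousLinearMap.id ℝ (Vec (d m.succ)) -
        (1 / c.Lg m) • (c.μg m • ContinuousLinearMap.id ℝ _) =
        (1 - c.μg m / c.Lg m) • ContinuousLinearMap.id ℝ _ := by module
    rw [e, norm_smul, Real.norm_of_nonneg (sub_nonneg.2 (c.μg_div_le m))]
    have h1 := c.κ_le m
    have h2 := c.μg_div_le m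
    calc _ ≤ (1 - c.μg m / c.Lg m) * 1 :=
          mul_le_mul_of_nonneg_left ContinuousLinearMap.norm_id_le (by linarith)
      _ ≤ _ := by linarith

theorem s_eq (t : ℕ) (ω : X.Ω) : (X.st t ω).s = X.chS.E t ω := by
  induction t with
  | zero => rfl
  | succ t ih =>
    funext k
    change (1 - C₁ / (C₁ + t)) • mix X.W (X.st t ω).s k + _ = _
    rw [ih]
    rfl

theorem h_eq (t : ℕ) (ω : X.Ω) : (X.st t ω).h = X.chH.E t ω := by
  induction t with
  | zero => rfl
  | succ t ih =>
    funext k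
    change (1 - C₁ / (C₁ + t)) • mix X.W (X.st t ω).h k + _ = _
    rw [ih]
    rfl

theorem u_eq (m : Fin M) (t : ℕ) (ω : X.Ω) : (X.st t ω).u m = (X.chU m).E t ω := by
  induction t with
  | zero => rfl
  | succ t ih =>
    funext k
    change (1 - C₁ / (C₁ + t)) • mix X.W ((X.st t ω).u m) k + _ = _
    rw [ih]
    rfl

/-- The affine map `v ↦ I - v/L` commutes with the momentum recursion, because mixing fixes the
identity and the weights add up to `1`. The contraction assumption then concerns the channel
directly. -/
theorem v_eq (m : Fin M) (i : ℕ) (t : ℕ) (ω : X.Ω) (k : Fin X.K) :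
    ContinuousLinearMap.id ℝ _ - (1 / c.Lg m) • (X.st t ω).v m i k = (X.chR m i).E t ω k := by
  induction t generalizing k with
  | zero => rfl
  | succ t ih =>
    have h1 : (X.chR m i).E (t + 1) ω k = (1 - C₁ / (C₁ + t)) • mix X.W ((X.chR m i).E t ω) k +
        (C₁ / (C₁ + t)) • (X.chR m i).N t k ω := rfl
    have h2 : (X.st (t + 1) ω).v m i k = (1 - C₁ / (C₁ + t)) • mix X.W ((X.st t ω).v m i) k +
        (C₁ / (C₁ + t)) • X.o.hessg₂₂ m k (X.y m.castSucc t ω k) (X.y m.succ t ω k)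
          (X.ξ (.hess t m k i) ω) := rfl
    have h3 : (X.chR m i).N t k ω = ContinuousLinearMap.id ℝ _ - (1 / c.Lg m) •
        X.o.hessg₂₂ m k (X.y m.castSucc t ω k) (X.y m.succ t ω k) (X.ξ (.hess t m k i) ω) := rfl
    have h4 : mix X.W ((X.chR m i).E t ω) k =
        ContinuousLinearMap.id ℝ _ - (1 / c.Lg m) • mix X.W ((X.st t ω).v m i) k := by
      have : (X.chR m i).E t ω = fun j => (fun _ => ContinuousLinearMap.id ℝ _) j -
          (fun j => (1 / c.Lg m) • (X.st t ω).v m i j) j := funext fun j => (ih j).symm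
      rw [this, mix_sub, X.gossip.mix_const]
      congr 1
      simp only [mix, Finset.smul_sum]
      exact Finset.sum_congr rfl fun j _ => smul_comm _ _ _
    rw [h1, h2, h3, h4]
    module

/-- The estimates of the inverse Hessians. -/
def QE (m : Fin M) (t : ℕ) (ω : X.Ω) (k : Fin X.K) : Vec (d m.succ) →L[ℝ] Vec (d m.succ) :=
  (1 / c.Lg m) • neumann (fun i => (X.chR m i).E t ω k) (X.b m)

/-- The noiseless estimates of the inverse Hessians. -/
def QG (m : Fin M) (t : ℕ) (ω : X.Ω) (k : Fin X.K) : Vec (d m.succ) →L[ℝ] Vec (d m.succ) :=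
  (1 / c.Lg m) • neumann (fun i => (X.chR m i).G t ω k) (X.b m)

/-- The second part of the search direction. -/
def chainE (t : ℕ) (ω : X.Ω) (k : Fin X.K) : Vec (d 0) :=
  chainTo (fun m => (X.chU m).E t ω k) (fun m => X.QE m t ω k) (Fin.last M) (X.chH.E t ω k)

/-- The second part of the noiseless search direction. -/
def chainG (t : ℕ) (ω : X.Ω) (k : Fin X.K) : Vec (d 0) :=
  chainTo (fun m => (X.chU m).G t ω k) (fun m => X.QG m t ω k) (Fin.last M) (X.chH.G t ω k)

theorem z_eq (t : ℕ) (ω : X.Ω) (k : Fin X.K) :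
    (X.st t ω).z k = X.chS.E t ω k + (-1 : ℝ) ^ M • X.chainE t ω k := by
  rw [State.z, State.chain_eq, s_eq, h_eq]
  congr 2
  cases t with
  -- Initially `q = 0`, which differs from the Neumann product, but `h = 0` makes both chains
  -- vanish.
  | zero =>
    have : X.chH.E 0 ω k = 0 := rfl
    rw [chainE, this, map_zero, map_zero]
  | succ t =>
    rw [chainE]
    congr 2
    · funext m
      rw [u_eq]
    · funext m
      have : (X.st (t + 1) ω).q m k =
        (1 / c.Lg m) • hessQ (c.Lg m) (fun i => (X.st (t + 1) ω).v m i k) (X.b m) := rfl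
      rw [this, hessQ_eq_neumann, QE]
      simp_rw [v_eq]

/-! ### The product structure -/

/-- The functionals of the channels. -/
def lab (t : ℕ) : ChanIdx X.b → Lab X.K → X.Ω → ℝ
  | .inl m => labFun (fun k ω => (X.chU m).E t ω k) (fun k ω => (X.chU m).G t ω k)
  | .inr (.inl ⟨m, i⟩) => labFun (fun k ω => (X.chR m i).E t ω k) (fun k ω => (X.chR m i).G t ω k)
  | .inr (.inr _) => labFun (fun k ω => X.chH.E t ω k) (fun k ω => X.chH.G t ω k)

/-- Their bounds. -/
def labB (t : ℕ) : ChanIdx X.b → Lab X.K → ℝ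
  | .inl m => labBound (Vec (d m.succ) →L[ℝ] Vec (d m.castSucc)) (X.chU m).C C₁ X.ρ t
  | .inr (.inl ⟨m, i⟩) => labBound (Vec (d m.succ) →L[ℝ] Vec (d m.succ)) (X.chR m i).C C₁ X.ρ t
  | .inr (.inr _) => labBound (Vec (d (Fin.last M))) X.chH.C C₁ X.ρ t

/-- Their queries. -/
def labQ : ChanIdx X.b → ℕ → Fin X.K → Query M X.K
  | .inl m => (X.chU m).q
  | .inr (.inl ⟨m, i⟩) => (X.chR m i).q
  | .inr (.inr _) => X.chH.q

theorem labQ_round (i : ChanIdx X.b) (t : ℕ) (k : Fin X.K) : (X.labQ i t k).round = t := by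
  rcases i with m | ⟨m, i⟩ | i <;> rfl

/-- The channels of the product never share a sample. The estimates of `∇₁ f` and the observations
of `∇₂ g_m` do share samples with channels of the product and are therefore left out of it. -/
theorem labQ_ne {i j : ChanIdx X.b} (h : i ≠ j) (t : ℕ) (k k' : Fin X.K) :
    X.labQ i t k ≠ X.labQ j t k' := by
  intro e
  apply h
  rcases i with m | ⟨m, i⟩ | i <;> rcases j with m' | ⟨m', i'⟩ | i' <;>
    simp only [labQ, chU, chR, chH, Query.inner.injEq, Query.hess.injEq, reduceCtorEq] at e
  · obtain ⟨-, rfl, -⟩ := e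
    rfl
  · obtain ⟨-, rfl, -, h⟩ := e
    obtain rfl := Fin.ext h
    rfl
  · rfl

theorem measurable_lab {mΩ : MeasurableSpace X.Ω} (t : ℕ)
    (h : ∀ q : Query M X.K, q.round < t → Measurable[mΩ] (X.ξ q)) (i : ChanIdx X.b) (l : Lab X.K) :
    Measurable[mΩ] (X.lab t i l) := by
  rcases i with m | ⟨m, i⟩ | i
  · exact measurable_labFun ((X.chU m).measurable_E t h) ((X.chU m).measurable_G t h) l
  · exact measurable_labFun ((X.chR m i).measurable_E t h) ((X.chR m i).measurable_G t h) l
  · exact measurable_labFun (X.chH.measurable_E t h) (X.chH.measurable_G t h) l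

theorem Chan.measurable_G_succ {V : Type} [NormedAddCommGroup V] [NormedSpace ℝ V]
    [FiniteDimensional ℝ V] [MeasurableSpace V] [BorelSpace V] {X : Sys.{u, v} d c μ C₁} (ch : X.Chan V)
    {mΩ : MeasurableSpace X.Ω} (t : ℕ)
    (h : ∀ q : Query M X.K, q.round < t → Measurable[mΩ] (X.ξ q)) (k : Fin X.K) :
    Measurable[mΩ] fun ω => ch.G (t + 1) ω k :=
  measurable_drive (t + 1) (fun s hs j =>
    ch.measurable_m s (fun q hq => h q (hq.trans_le (Nat.lt_succ_iff.1 hs))) j) k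

theorem measurable_lab_succ {mΩ : MeasurableSpace X.Ω} (t : ℕ) (i : ChanIdx X.b)
    (h : ∀ q : Query M X.K, q.round < t → Measurable[mΩ] (X.ξ q))
    (h' : ∀ k, Measurable[mΩ] (X.ξ (X.labQ i t k))) (l : Lab X.K) :
    Measurable[mΩ] (X.lab (t + 1) i l) := by
  rcases i with m | ⟨m, i⟩ | i
  · exact measurable_labFun ((X.chU m).measurable_E_succ t h h') ((X.chU m).measurable_G_succ t h) l
  · exact measurable_labFun ((X.chR m i).measurable_E_succ t h h')
      ((X.chR m i).measurable_G_succ t h) l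
  · exact measurable_labFun (X.chH.measurable_E_succ t h h') (X.chH.measurable_G_succ t h) l

/-- Everything known before round `t`, and the observations of the other channels in round `t`. -/
@[reducible] def sigma (i : ChanIdx X.b) (t : ℕ) : MeasurableSpace X.Ω :=
  sigmaOf X.ξ {q | q.round < t ∨ ∃ j, j ≠ i ∧ ∃ k, q = X.labQ j t k}

theorem lintegral_prod_lab_le {t : ℕ} (ht : t ≤ X.T) (l : ChanIdx X.b → Lab X.K) :
    ∫⁻ ω, ∏ i, ENNReal.ofReal (X.lab t i (l i) ω) ∂X.P ≤
      ∏ i, ENNReal.ofReal (X.labB t i (l i)) := by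
  have hall : ∀ q : Query M X.K, Measurable (X.ξ q) := X.sampling.measurable
  have hlt : ∀ i t, ∀ q : Query M X.K, q.round < t → Measurable[X.sigma i t] (X.ξ q) :=
    fun i t q hq => measurable_sigmaOf X.ξ (Or.inl hq)
  have hsub : ∀ i t k, {q | q.round < t ∨ ∃ j, j ≠ i ∧ ∃ k, q = X.labQ j t k} ⊆
      {q | q.round ≤ t ∧ q ≠ X.labQ i t k} := by
    rintro i t k q (hq | ⟨j, hj, k', rfl⟩)
    · exact ⟨le_of_lt hq, fun h => by
        rw [h, labQ_round] at hq
        exact lt_irrefl _ hq⟩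
    · exact ⟨(X.labQ_round _ _ _).le, X.labQ_ne hj t k' k⟩
  refine lintegral_prod_le_prod (P := X.P) (T := X.T) (Λ := fun _ => Lab X.K)
    (Φ := fun i t l ω => ENNReal.ofReal (X.lab t i l ω))
    (D := fun i t l => ENNReal.ofReal (X.labB t i l)) X.sigma (fun i t => sigmaOf_le hall _)
    ?_ ?_ (fun i j t _ l => (X.measurable_lab t (hlt i t) j l).ennreal_ofReal)
    (fun i j hij t _ l => (X.measurable_lab_succ t j (hlt i t) (fun k => measurable_sigmaOf X.ξ
      (Or.inr ⟨j, hij.symm, k, rfl⟩)) l).ennreal_ofReal) t ht l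
  · intro i l ω
    refine ENNReal.ofReal_le_ofReal ?_
    rcases i with m | ⟨m, i⟩ | i
    · exact (X.chU m).labFun_zero_le l ω
    · exact (X.chR m i).labFun_zero_le l ω
    · exact X.chH.labFun_zero_le l ω
  · intro i t ht l
    rcases i with m | ⟨m, i⟩ | i
    · exact (X.chU m).labFun_step ht.le (sigmaOf_le hall _)
        (fun k => sigmaOf_mono X.ξ (hsub _ t k)) (hlt _ t) l
    · exact (X.chR m i).labFun_step ht.le (sigmaOf_le hall _)
        (fun k => sigmaOf_mono X.ξ (hsub _ t k)) (hlt _ t) l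
    · exact X.chH.labFun_step ht.le (sigmaOf_le hall _)
        (fun k => sigmaOf_mono X.ξ (hsub _ t k)) (hlt _ t) l

theorem lab_nonneg (t : ℕ) (i : ChanIdx X.b) (l : Lab X.K) (ω : X.Ω) : 0 ≤ X.lab t i l ω := by
  rcases i with m | ⟨m, i⟩ | i <;> exact labFun_nonneg _ _ l ω

theorem labB_nonneg (t : ℕ) (i : ChanIdx X.b) (l : Lab X.K) : 0 ≤ X.labB t i l := by
  rcases i with m | ⟨m, i⟩ | i <;> exact labBound_nonneg X.ρ_pos.le t l

theorem lab_one (t : ℕ) (i : ChanIdx X.b) (ω : X.Ω) : X.lab t i .one ω = 1 := by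
  rcases i with m | ⟨m, i⟩ | i <;> rfl

theorem labB_one (t : ℕ) (i : ChanIdx X.b) : X.labB t i .one = 1 := by
  rcases i with m | ⟨m, i⟩ | i <;> rfl

theorem bdd_const {t : ℕ} (ht : t ≤ X.T) (I : Set (ChanIdx X.b)) {a : ℝ} (ha : 0 ≤ a) :
    Bdd X.P (X.lab t) (X.labB t) I (fun _ => a) a :=
  (Bdd.of_prod fun l => X.lintegral_prod_lab_le ht l).const ha

theorem bdd_mul {t : ℕ} {I J : Set (ChanIdx X.b)} {Y : X.Ω → ℝ} {e : ℝ}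
    (h : Bdd X.P (X.lab t) (X.labB t) I Y e) {i : ChanIdx X.b} (hi : i ∉ I) (l : Lab X.K)
    (hJ : insert i I ⊆ J) :
    Bdd X.P (X.lab t) (X.labB t) J (fun ω => X.lab t i l ω * Y ω) (X.labB t i l * e) :=
  Bdd.mul_channel (X.measurable_lab t fun q _ => X.sampling.measurable q) (X.lab_nonneg t)
    (X.labB_nonneg t) (X.lab_one t) (X.labB_one t) h hi l hJ

/-- A channel of the product controls its estimate. -/
theorem ctrlOp {V : Type} [NormedAddCommGroup V] [NormedSpace ℝ V]
    [FiniteDimensional ℝ V] [MeasurableSpace V] [BorelSpace V] (ch : X.Chan V) {t : ℕ} (ht : t ≤ X.T)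
    {i : ChanIdx X.b}
    (h : X.lab t i = labFun (fun k ω => ch.E t ω k) (fun k ω => ch.G t ω k))
    (h' : X.labB t i = labBound V ch.C C₁ X.ρ t) (k : Fin X.K) {C ν : ℝ} (hC : ch.C ≤ C)
    (hν : distortion V * ch.C ^ 2 * X.eps t ≤ ν) :
    CtrlOp X.P (X.lab t) (X.labB t) i (fun ω => ch.E t ω k) (fun ω => ch.G t ω k) C ν := by
  have hC0 := ch.C_nonneg
  refine ⟨fun I J Y e hY hi hJ => ?_, ?_, fun J a hi ha => ?_⟩
  · have := X.bdd_mul (J := J) hY hi (.size k) hJ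
    rw [h, h'] at this
    obtain ⟨Y', k1, k2, k3, k4⟩ := this
    refine ⟨Y', k1, k2, k3, fun l hl => (k4 l hl).trans (mul_le_mul_left ?_ _)⟩
    -- `Bdd` does not force the sign of its constant; for a negative one, `ENNReal.ofReal` makes the
    -- bound zero.
    by_cases he : 0 ≤ e
    · refine ENNReal.ofReal_le_ofReal ?_
      simp only [labBound]
      gcongr
    · rw [ENNReal.ofReal_of_nonpos]
      · exact bot_le
      · exact mul_nonpos_of_nonneg_of_nonpos (sq_nonneg ch.C) (not_le.1 he).le
  · filter_upwards [ch.ae_norm_G_le] with ω hω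
    exact (hω t ht k).trans hC
  · have h1 := X.bdd_mul (J := J) (X.bdd_const ht ∅ ha) (Set.notMem_empty i) (.noise (Pi.single k 1))
      (by rintro x (rfl | hx)
          · exact hi
          · exact absurd hx (Set.notMem_empty x))
    rw [h, h'] at h1
    refine (h1.const_mul
      (sq_nonneg ‖(toEuclidean : V ≃L[ℝ] _).symm.toContinuousLinearMap‖)).mono
      (Filter.Eventually.of_forall fun ω => ?_) ?_
    · have := mul_le_mul_of_nonneg_right
        (norm_sub_sq_le_labFun (fun k ω => ch.E t ω k) (fun k ω => ch.G t ω k) k ω) ha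
      linarith
    · have := mul_le_mul_of_nonneg_right
        ((labBound_single_le (V := V) (C := ch.C) (C₁ := C₁) X.ρ_pos.le t k).trans hν) ha
      linarith

end Sys

/-- A bound for the noise of all channels. -/
def noiseConst {M : ℕ} (d : Fin (M + 1) → ℕ) (c : Constants M) : ℝ :=
  (∑ m : Fin M, (distortion (Vec (d m.succ) →L[ℝ] Vec (d m.castSucc)) +
    distortion (Vec (d m.succ) →L[ℝ] Vec (d m.succ))) + distortion (Vec (d (Fin.last M))) +
    distortion (Vec (d 0))) * c.total ^ 2

theorem le_sum_add_mul {n : ℕ} {f g : Fin n → ℝ} {a b r : ℝ} (hf : ∀ m, 0 ≤ f m) (hg : ∀ m, 0 ≤ g m)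
    (ha : 0 ≤ a) (hb : 0 ≤ b) (hr : 0 ≤ r) :
    (∀ m, f m * r ≤ (∑ m, (f m + g m) + a + b) * r ∧ g m * r ≤ (∑ m, (f m + g m) + a + b) * r) ∧
    a * r ≤ (∑ m, (f m + g m) + a + b) * r ∧ b * r ≤ (∑ m, (f m + g m) + a + b) * r ∧
    0 ≤ (∑ m, (f m + g m) + a + b) * r := by
  have h0 : ∀ m, 0 ≤ f m + g m := fun m => add_nonneg (hf m) (hg m)
  have h3 := Finset.sum_nonneg fun m (_ : m ∈ Finset.univ) => h0 m
  refine ⟨fun m => ?_, ?_, ?_, by positivity⟩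
  · have h4 := Finset.single_le_sum (fun m _ => h0 m) (Finset.mem_univ m)
    have h5 := hf m
    have h6 := hg m
    constructor <;> refine mul_le_mul_of_nonneg_right ?_ hr <;> linarith
  · refine mul_le_mul_of_nonneg_right ?_ hr
    linarith
  · refine mul_le_mul_of_nonneg_right ?_ hr
    linarith

theorem distortion_le_noiseConst {M : ℕ} (d : Fin (M + 1) → ℕ) (c : Constants M) :
    (∀ m : Fin M, distortion (Vec (d m.succ) →L[ℝ] Vec (d m.castSucc)) * c.total ^ 2 ≤ noiseConst d c ∧
    distortion (Vec (d m.succ) →L[ℝ] Vec (d m.succ)) * c.total ^ 2 ≤ noiseConst d c) ∧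
    distortion (Vec (d (Fin.last M))) * c.total ^ 2 ≤ noiseConst d c ∧
    distortion (Vec (d 0)) * c.total ^ 2 ≤ noiseConst d c ∧ 0 ≤ noiseConst d c :=
  le_sum_add_mul (fun _ => distortion_nonneg _) (fun _ => distortion_nonneg _) (distortion_nonneg _)
    (distortion_nonneg _) (sq_nonneg _)

namespace Sys

variable {M : ℕ} {d : Fin (M + 1) → ℕ} {c : Constants M} {μ C₁ : ℝ} (X : Sys.{u, v} d c μ C₁)

theorem Chan.distortion_mul_le {V : Type} [NormedAddCommGroup V] [NormedSpace ℝ V]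
    [FiniteDimensional ℝ V] [MeasurableSpace V] [BorelSpace V] {X : Sys.{u, v} d c μ C₁} (ch : X.Chan V)
    (h : distortion V * c.total ^ 2 ≤ noiseConst d c) (t : ℕ) :
    distortion V * ch.C ^ 2 * X.eps t ≤ noiseConst d c * X.eps t := by
  have h1 := ch.C_nonneg
  have h2 := ch.C_le
  have h3 := distortion_nonneg V
  refine mul_le_mul_of_nonneg_right (le_trans ?_ h) (X.eps_nonneg t)
  gcongr

/-- The products of the estimates are bounded and close to the products of the noiseless ones. -/
theorem ctrl_chain {t : ℕ} (ht : t ≤ X.T) (k : Fin X.K) :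
    EB X.P (fun ω => ‖X.chainE t ω k‖ ^ 2) ((40 * c.total ^ 8) ^ M * c.total ^ 2) ∧
    EB X.P (fun ω => ‖X.chainE t ω k - X.chainG t ω k‖ ^ 2)
      ((40 * c.total ^ 8) ^ M * (2 * c.total ^ 2 * noiseConst d c * X.eps t)) := by
  obtain ⟨n1, n2, n3, n4⟩ := distortion_le_noiseConst d c
  have h0 := X.one_le_total
  have he := X.eps_nonneg t
  have hν : 0 ≤ noiseConst d c * X.eps t := mul_nonneg n4 he
  have hh := X.ctrlOp X.chH ht (i := .inr (.inr ())) rfl rfl k X.chH.C_le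
    (X.chH.distortion_mul_le n2 t)
  have hw : Ctrl X.P (X.lab t) (X.labB t) {i | ((Fin.last M : Fin (M + 1)) : ℕ) ≤ i.level}
      (fun ω => X.chH.E t ω k) (fun ω => X.chH.G t ω k) (c.total ^ 2) (noiseConst d c * X.eps t) := by
    refine ⟨?_, ?_, ?_⟩
    · have := hh.size ∅ {i | ((Fin.last M : Fin (M + 1)) : ℕ) ≤ i.level} (fun _ => 1) 1
        (X.bdd_const ht ∅ zero_le_one) (Set.notMem_empty _) (by
          rintro x (rfl | hx)
          · simp [ChanIdx.level]
          · exact absurd hx (Set.notMem_empty x))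
      simpa using this
    · filter_upwards [hh.mean] with ω h
      exact pow_le_pow_left₀ (norm_nonneg _) h 2
    · have := hh.noise {i | ((Fin.last M : Fin (M + 1)) : ℕ) ≤ i.level} 1
        (by simp [ChanIdx.level]) zero_le_one
      simpa using this
  have := Ctrl.chainTo (X.measurable_lab t fun q _ => X.sampling.measurable q) (L := c.Lg) h0 hν
    (fun m => by
      rw [abs_of_nonneg (one_div_nonneg.2 (c.Lg_pos m).le)]
      exact X.regular.inv_L_le m)
    (u := fun m ω => (X.chU m).E t ω k) (uG := fun m ω => (X.chU m).G t ω k)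
    (R := fun m i ω => (X.chR m i).E t ω k) (RG := fun m i ω => (X.chR m i).G t ω k)
    (fun m => X.ctrlOp (X.chU m) ht (i := .inl m) rfl rfl k (X.chU m).C_le
      ((X.chU m).distortion_mul_le (n1 m).1 t))
    (fun m i => X.ctrlOp (X.chR m i) ht (i := .inr (.inl ⟨m, i⟩)) rfl rfl k
      (sub_le_sub_left (c.inv_total_le_κ m) 1) ((X.chR m i).distortion_mul_le (n1 m).2 t))
    (Fin.last M) (by positivity) hν hw
  refine ⟨this.size.eb (X.lab_one t) (X.labB_one t),
    (this.err.eb (X.lab_one t) (X.labB_one t)).mono_right ?_⟩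
  simp only [Fin.val_last]
  refine mul_le_mul_of_nonneg_left ?_ (by positivity)
  have : 1 * (noiseConst d c * X.eps t) ≤ c.total ^ 2 * (noiseConst d c * X.eps t) :=
    mul_le_mul_of_nonneg_right (one_le_pow₀ h0) hν
  linarith

end Sys

end DSMO

end

noncomputable section

namespace DSMO

open scoped ENNReal

universe u v

/-- The order of the second moment of the search direction. -/
def dirConst {M : ℕ} (c : Constants M) : ℝ := 4 * ((40 * c.total ^ 8) ^ M * c.total ^ 2)

/-- The order of the noise of the search direction. -/
def dirNoiseConst {M : ℕ} (d : Fin (M + 1) → ℕ) (c : Constants M) : ℝ :=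
  6 * ((40 * c.total ^ 8) ^ M * c.total ^ 2) * noiseConst d c

namespace Sys

variable {M : ℕ} {d : Fin (M + 1) → ℕ} {c : Constants M} {μ C₁ : ℝ} (X : Sys.{u, v} d c μ C₁)

/-! ### The search direction and its noise -/

/-- The noiseless search direction. -/
def zG (t : ℕ) (ω : X.Ω) (k : Fin X.K) : Vec (d 0) := X.chS.G t ω k + (-1 : ℝ) ^ M • X.chainG t ω k

theorem _root_.DSMO.norm_add_sign_smul_sq_le {E : Type*} [NormedAddCommGroup E] [NormedSpace ℝ E]
    (n : ℕ) (v w : E) : ‖v + (-1 : ℝ) ^ n • w‖ ^ 2 ≤ 2 * (‖v‖ ^ 2 + ‖w‖ ^ 2) := by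
  refine (pow_le_pow_left₀ (norm_nonneg _) (norm_add_le _ _) 2).trans ?_
  rw [norm_smul, norm_pow, norm_neg, norm_one, one_pow, one_mul]
  exact add_sq_le

theorem one_le_chain (X : Sys.{u, v} d c μ C₁) : 1 ≤ (40 * c.total ^ 8) ^ M := by
  have h0 := X.one_le_total
  refine one_le_pow₀ ?_
  have : 1 ≤ c.total ^ 8 := one_le_pow₀ h0
  linarith

theorem dirConst_nonneg (X : Sys.{u, v} d c μ C₁) : 0 ≤ dirConst c := by
  have h0 := X.one_le_total
  unfold dirConst
  positivity

theorem eb_norm_z {t : ℕ} (ht : t ≤ X.T) (k : Fin X.K) :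
    EB X.P (fun ω => ‖(X.st t ω).z k‖ ^ 2) (dirConst c) := by
  have h0 := X.one_le_total
  have h1 := X.one_le_chain
  have hC : X.chS.C ^ 2 ≤ c.total ^ 2 := pow_le_pow_left₀ X.chS.C_nonneg X.chS.C_le 2
  refine (((X.chS.eb_norm_E t ht k).add (X.ctrl_chain ht k).1 (sq_nonneg _)
    (by positivity)).const_mul (show (0 : ℝ) ≤ 2 by norm_num)).mono
    (Filter.Eventually.of_forall fun ω => ?_) ?_
  · rw [z_eq]
    exact norm_add_sign_smul_sq_le _ _ _
  · have : 1 * c.total ^ 2 ≤ (40 * c.total ^ 8) ^ M * c.total ^ 2 :=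
      mul_le_mul_of_nonneg_right h1 (by positivity)
    unfold dirConst
    linarith

/-- The two parts of the direction use the same outer samples, so they are combined by the triangle
inequality, not by independence. -/
theorem eb_norm_z_sub {t : ℕ} (ht : t ≤ X.T) (k : Fin X.K) :
    EB X.P (fun ω => ‖(X.st t ω).z k - X.zG t ω k‖ ^ 2) (dirNoiseConst d c * X.eps t) := by
  have h0 := X.one_le_total
  have h1 := X.one_le_chain
  obtain ⟨-, -, n3, n4⟩ := distortion_le_noiseConst d c
  have he := X.eps_nonneg t
  have hν : 0 ≤ noiseConst d c * X.eps t := mul_nonneg n4 he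
  have hS := (X.chS.eb_noise t ht k).mono_right (X.chS.distortion_mul_le n3 t)
  refine ((hS.add (X.ctrl_chain ht k).2 hν (by positivity)).const_mul
    (show (0 : ℝ) ≤ 2 by norm_num)).mono (Filter.Eventually.of_forall fun ω => ?_) ?_
  · have e : (X.st t ω).z k - X.zG t ω k = (X.chS.E t ω k - X.chS.G t ω k) +
        (-1 : ℝ) ^ M • (X.chainE t ω k - X.chainG t ω k) := by
      rw [z_eq, zG]
      module
    rw [e]
    exact norm_add_sign_smul_sq_le _ _ _
  · have h2 : 1 * 1 ≤ (40 * c.total ^ 8) ^ M * c.total ^ 2 :=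
      mul_le_mul h1 (one_le_pow₀ h0) zero_le_one (by positivity)
    have h3 := mul_le_mul_of_nonneg_right h2 hν
    unfold dirNoiseConst
    linarith

/-! ### Consensus -/

/-- In `IsGossip.dev_step` the deterministic weights `r η_t` and `β_t` close the recursion: their
sum is `η_{t+1}`, and `(r η_t + β_t)(r η_t B + β_t B) = B η_{t+1}²`. The outer variable is included
because `α_t ≤ β_t`. -/
theorem eb_dev {n : ℕ} {w N : ℕ → X.Ω → Fin X.K → Vec n} {s : ℕ → ℝ} {v₀ : Vec n} {B : ℝ} (hB : 0 ≤ B)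
    (h0 : ∀ ω, w 0 ω = fun _ => v₀)
    (hw : ∀ t ω, w (t + 1) ω = fun k => mix X.W (w t ω) k - s t • N t ω k)
    (hs0 : ∀ t, 0 ≤ s t) (hs : ∀ t, s t ≤ X.β t)
    (hN : ∀ t < X.T, EB X.P (fun ω => msq (N t ω)) B) :
    ∀ t ≤ X.T, EB X.P (fun ω => dev (w t ω)) (B * etaSeq C₁ (Real.sqrt X.ρ) t ^ 2) := by
  set r := Real.sqrt X.ρ with hr
  have hr0 : 0 < r := X.sqrt_ρ_pos
  have hη : ∀ t, 0 < etaSeq C₁ r t := etaSeq_pos (by linarith [X.three_le]) hr0.le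
  intro t
  induction t with
  | zero =>
    intro _
    refine EB.of_ae_le (by positivity) (Filter.Eventually.of_forall fun ω => ?_)
    rw [h0, dev_eq_zero_of_const]
    positivity
  | succ t ih =>
    intro ht
    have h1 := ih (Nat.le_of_succ_le ht)
    have h2 := hN t ht
    have hβ := X.β_pos t
    have hηt := hη t
    have hp : 0 < r * etaSeq C₁ r t := by positivity
    refine (((h1.const_mul (show 0 ≤ r / etaSeq C₁ r t by positivity)).add (h2.const_mul hβ.le)
      (by positivity) (by positivity)).const_mul
      (show 0 ≤ r * etaSeq C₁ r t + X.β t by positivity)).mono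
      (Filter.Eventually.of_forall fun ω => ?_) (le_of_eq ?_)
    · have h3 := X.gossip.dev_step (w t ω) (N t ω) 1 (-s t) hp hβ
      have e : w (t + 1) ω = fun k => (1 : ℝ) • mix X.W (w t ω) k + (-s t) • N t ω k := by
        rw [hw]
        funext k
        rw [one_smul, neg_smul, sub_eq_add_neg]
      rw [e]
      refine h3.trans (mul_le_mul_of_nonneg_left (add_le_add (le_of_eq ?_) ?_) (by positivity))
      · rw [X.sq_sqrt_ρ, ← hr]
        field_simp
      · rw [div_le_iff₀ hβ, neg_sq]
        have h4 : s t ^ 2 ≤ X.β t ^ 2 := pow_le_pow_left₀ (hs0 t) (hs t) 2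
        have := mul_le_mul_of_nonneg_right h4 (msq_nonneg (N t ω))
        linarith
    · have : etaSeq C₁ r (t + 1) = r * etaSeq C₁ r t + X.β t := rfl
      rw [this]
      field_simp

theorem y_succ_succ (m : Fin M) (t : ℕ) (ω : X.Ω) : X.y m.succ (t + 1) ω = fun k =>
    mix X.W (X.y m.succ t ω) k - X.β t • (X.chY m).N t k ω := rfl

theorem eb_cons {t : ℕ} (ht : t ≤ X.T) : EB X.P (X.cons t)
    ((1 + dirConst c + M * c.total ^ 2) * min 1 (etaSeq C₁ (Real.sqrt X.ρ) t ^ 2)) := by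
  have h0 := X.one_le_total
  have hd := X.dirConst_nonneg
  have hx : ∀ t ≤ X.T, EB X.P (fun ω => dev (X.y 0 t ω))
      (dirConst c * etaSeq C₁ (Real.sqrt X.ρ) t ^ 2) :=
    X.eb_dev (w := fun t ω => X.y 0 t ω) (N := fun t ω k => (X.st t ω).z k) hd (fun ω => rfl)
      (fun t ω => rfl) (fun t => (X.α_pos t).le) X.α_le_β
      fun t ht => EB.msq X.card_pos hd fun k => X.eb_norm_z ht.le k
  have hy : ∀ m : Fin M, ∀ t ≤ X.T, EB X.P (fun ω => dev (X.y m.succ t ω))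
      (c.total ^ 2 * etaSeq C₁ (Real.sqrt X.ρ) t ^ 2) := fun m =>
    X.eb_dev (w := fun t ω => X.y m.succ t ω) (N := fun t ω k => (X.chY m).N t k ω) (sq_nonneg _)
      (fun ω => rfl) (X.y_succ_succ m) (fun t => (X.β_pos t).le) (fun t => le_rfl)
      fun t ht => EB.msq X.card_pos (sq_nonneg _) fun k => ((X.chY m).eb_norm_N t ht.le k).mono_right
        (pow_le_pow_left₀ (X.chY m).C_nonneg (X.chY m).C_le 2)
  set η := etaSeq C₁ (Real.sqrt X.ρ) t
  have h1 := (hx t ht).add (EB.sum Finset.univ (fun m _ => hy m t ht) fun _ _ => by positivity)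
    (by positivity) (by positivity)
  rcases min_choice 1 (η ^ 2) with h | h <;> rw [h]
  · refine EB.of_ae_le (by positivity) (Filter.Eventually.of_forall fun ω => (min_le_left _ _).trans ?_)
    have : 0 ≤ dirConst c + M * c.total ^ 2 := by positivity
    linarith
  · refine h1.mono (Filter.Eventually.of_forall fun ω => (min_le_right _ _).trans ?_) ?_
    · rw [Fin.sum_univ_succ]
    · simp
      nlinarith [sq_nonneg η]

/-! ### The error of the noiseless search direction -/

/-- The sum of the squared errors of the averaged noiseless estimates. -/
def errSum (t : ℕ) (ω : X.Ω) : ℝ :=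
  X.chS.err t ω + X.chH.err t ω + ∑ m, ((X.chU m).err t ω + (X.chR m 0).err t ω)

theorem chR_star (m : Fin M) (i : ℕ) (x : Vec (d 0)) : (X.chR m i).star x =
    ContinuousLinearMap.id ℝ _ - (1 / c.Lg m) • X.p.hessStar m x := by
  have : (X.chR m i).star x = avg fun k => (fun _ => ContinuousLinearMap.id ℝ _) k -
      (1 / c.Lg m) • X.p.hessg₂₂ m k (X.p.yStar m.castSucc x) (X.p.yStar m.succ x) := rfl
  rw [this, avg_sub, avg_const X.card_pos, avg_smul]
  rfl

/-- All Hessian channels of a level have the same means and initial value, hence the same noiseless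
estimate. So `QG` is a genuine truncated Neumann series of one operator `H`: the truncation costs
`1/T`, and the rest is the Lipschitz bound for inversion. -/
theorem ae_norm_QG_sub_le (m : Fin M) : ∀ᵐ ω ∂X.P, ∀ t ≤ X.T, ∀ k,
    ‖X.QG m t ω k‖ ≤ c.total ^ 2 ∧ ‖X.QG m t ω k - X.p.qStar m (X.x t ω)‖ ≤
      c.total ^ 2 * (1 / X.T) + c.total ^ 5 * ‖(X.chR m 0).G t ω k - (X.chR m 0).star (X.x t ω)‖ := by
  filter_upwards [(X.chR m 0).ae_norm_G_le] with ω h t ht k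
  have h0 := X.one_le_total
  have hL := c.Lg_pos m
  have hL' := X.regular.inv_L_le m
  set R := (X.chR m 0).G t ω k with hR
  -- The operator whose contraction `I - H/L` is the noiseless estimate `R`.
  set H : Vec (d m.succ) →L[ℝ] Vec (d m.succ) := c.Lg m • (ContinuousLinearMap.id ℝ _ - R) with hH
  have eR : ContinuousLinearMap.id ℝ _ - (1 / c.Lg m) • H = R := by
    rw [hH, smul_smul, one_div, inv_mul_cancel₀ hL.ne', one_smul, sub_sub_cancel]
  have hRn : ‖R‖ ≤ 1 - c.κ m := h t ht k
  have hRn' : ‖ContinuousLinearMap.id ℝ _ - (1 / c.Lg m) • H‖ ≤ 1 - c.total⁻¹ := by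
    rw [eR]
    have := c.inv_total_le_κ m
    linarith
  have eQ : X.QG m t ω k = (1 / c.Lg m) • hessQ (c.Lg m) (fun _ => H) (X.b m) := by
    rw [hessQ_eq_neumann, QG, eR]
    rfl
  have hLn : ‖(1 / c.Lg m : ℝ)‖ ≤ c.total := by
    rw [Real.norm_of_nonneg (by positivity)]
    exact hL'
  refine ⟨?_, ?_⟩
  · rw [eQ, norm_smul, sq]
    have := norm_hessQ_le h0 (v := fun _ => H) (L := c.Lg m) (fun _ => hRn') (X.b m)
    gcongr
  · have h1 := norm_hessQ_sub_inverse_le h0 hL hL' hRn' (X.b m)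
    have h2 := norm_inverse_sub_le h0 hL hL' hRn' (X.regular.norm_hessStar_contraction m (X.x t ω))
    have h3 : H - X.p.hessStar m (X.x t ω) = -(c.Lg m • (R - (X.chR m 0).star (X.x t ω))) := by
      rw [chR_star, hH]
      have : X.p.hessStar m (X.x t ω) = c.Lg m • ((1 / c.Lg m) • X.p.hessStar m (X.x t ω)) := by
        rw [smul_smul, mul_one_div_cancel hL.ne', one_smul]
      nth_rewrite 1 [this]
      module
    rw [h3, norm_neg, norm_smul, Real.norm_of_nonneg hL.le] at h2
    rw [eR] at h1
    have h4 : ‖R‖ ^ (X.b m + 1) ≤ 1 / X.T :=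
      (pow_le_pow_left₀ (norm_nonneg _) hRn _).trans (X.contraction_pow m)
    have e : X.QG m t ω k - X.p.qStar m (X.x t ω) =
        (X.QG m t ω k - Ring.inverse H) + (Ring.inverse H - X.p.qStar m (X.x t ω)) := by abel
    rw [e]
    refine (norm_add_le _ _).trans (add_le_add ?_ (h2.trans ?_))
    · rw [eQ]
      refine h1.trans ?_
      rw [mul_comm]
      gcongr
    · have := X.regular.L_le m
      calc _ ≤ c.total ^ 4 * (c.total * ‖R - (X.chR m 0).star (X.x t ω)‖) := by gcongr
        _ = _ := by ring

theorem Chan.msq_G_sub_star_le {V : Type} [NormedAddCommGroup V] [NormedSpace ℝ V]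
    [FiniteDimensional ℝ V] [MeasurableSpace V] [BorelSpace V] {X : Sys.{u, v} d c μ C₁} (ch : X.Chan V)
    (h : distortion V * c.total ^ 2 ≤ noiseConst d c) : ∀ᵐ ω ∂X.P, ∀ t ≤ X.T,
    msq (fun k => ch.G t ω k - ch.star (X.x t ω)) ≤
      2 * (noiseConst d c * X.delta t ^ 2 + ch.err t ω) := by
  filter_upwards [ch.ae_dev_G_le] with ω hω t ht
  have h1 := hω t ht
  have h2 : distortion V * ch.C ^ 2 * X.delta t ^ 2 ≤ noiseConst d c * X.delta t ^ 2 := by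
    have h3 := ch.C_nonneg
    have h4 := ch.C_le
    have h5 := distortion_nonneg V
    refine mul_le_mul_of_nonneg_right (le_trans ?_ h) (sq_nonneg _)
    gcongr
  have h3 := msq_add_le (z := fun k => ch.G t ω k - avg (ch.G t ω))
    (z' := fun _ => avg (ch.G t ω) - ch.star (X.x t ω)) one_pos one_pos
  have e : (fun k => ch.G t ω k - avg (ch.G t ω) + (avg (ch.G t ω) - ch.star (X.x t ω))) =
      fun k => ch.G t ω k - ch.star (X.x t ω) := by
    funext k
    abel
  have h4 : msq (fun _ : Fin X.K => avg (ch.G t ω) - ch.star (X.x t ω)) ≤ ch.err t ω :=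
    msq_le_of_forall fun _ => le_rfl
  have h5 : msq (fun k => ch.G t ω k - avg (ch.G t ω)) = dev (ch.G t ω) := rfl
  rw [e, h5] at h3
  norm_num at h3
  linarith

end Sys

/-- The sensitivity of the search direction. -/
def gradConst {M : ℕ} (d : Fin (M + 1) → ℕ) (c : Constants M) : ℝ :=
  ((1 + chainConst M c.total) * c.total ^ 5) ^ 2 * (4 * M + 4) *
    ((4 * M + 4) * noiseConst d c + 2 + M)

namespace Sys

variable {M : ℕ} {d : Fin (M + 1) → ℕ} {c : Constants M} {μ C₁ : ℝ} (X : Sys.{u, v} d c μ C₁)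

theorem ae_norm_zG_sub_le : ∀ᵐ ω ∂X.P, ∀ t ≤ X.T, ∀ k,
    ‖X.zG t ω k - X.p.gradF (X.x t ω)‖ ≤ (1 + chainConst M c.total) * c.total ^ 5 *
      (‖X.chS.G t ω k - X.chS.star (X.x t ω)‖ + ‖X.chH.G t ω k - X.chH.star (X.x t ω)‖ +
        ∑ m, (‖(X.chU m).G t ω k - (X.chU m).star (X.x t ω)‖ +
          ‖(X.chR m 0).G t ω k - (X.chR m 0).star (X.x t ω)‖) + M * (1 / X.T)) := by
  have hU : ∀ᵐ ω ∂X.P, ∀ m, ∀ t ≤ X.T, ∀ k, ‖(X.chU m).G t ω k‖ ≤ (X.chU m).C :=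
    ae_all_iff.2 fun m => (X.chU m).ae_norm_G_le
  filter_upwards [X.chH.ae_norm_G_le, hU, ae_all_iff.2 X.ae_norm_QG_sub_le] with ω hH hU hQ t ht k
  have h0 := X.one_le_total
  set aS := ‖X.chS.G t ω k - X.chS.star (X.x t ω)‖
  set aH := ‖X.chH.G t ω k - X.chH.star (X.x t ω)‖
  set aU : Fin M → ℝ := fun m => ‖(X.chU m).G t ω k - (X.chU m).star (X.x t ω)‖ with haU
  set aR : Fin M → ℝ := fun m => ‖(X.chR m 0).G t ω k - (X.chR m 0).star (X.x t ω)‖ with haR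
  have hT : (0 : ℝ) ≤ 1 / X.T := by positivity
  set s := c.total ^ 5 * (aH + ∑ m, (aU m + aR m) + M * (1 / X.T)) with hs
  have p5 : 1 ≤ c.total ^ 5 := one_le_pow₀ h0
  have p25 : c.total ^ 2 ≤ c.total ^ 5 := pow_le_pow_right₀ h0 (by norm_num)
  have hm : ∀ m : Fin M, aU m + aR m + 1 / X.T ≤ ∑ m, (aU m + aR m) + M * (1 / X.T) := fun m => by
    have := Finset.single_le_sum (f := fun m => aU m + aR m + 1 / (X.T : ℝ))
      (fun m _ => by positivity) (Finset.mem_univ m)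
    simpa [Finset.sum_add_distrib] using this
  have haH : 0 ≤ aH := norm_nonneg _
  have hU0 : ∀ m, 0 ≤ aU m := fun m => norm_nonneg _
  have hR0 : ∀ m, 0 ≤ aR m := fun m => norm_nonneg _
  have hsum : 0 ≤ ∑ m, (aU m + aR m) := Finset.sum_nonneg fun m _ => add_nonneg (hU0 m) (hR0 m)
  have h1 : ‖X.chainG t ω k - chainTo (fun m => X.p.uStar m (X.x t ω)) (fun m => X.p.qStar m (X.x t ω))
      (Fin.last M) (X.p.hStar (X.x t ω))‖ ≤ chainConst M c.total * s := by
    refine norm_chain_apply_sub_le h0 (fun m => (hU m t ht k).trans (X.chU m).C_le)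
      (fun m => (hQ m t ht k).1) (fun m => X.regular.norm_uStar_le m _)
      (fun m => X.regular.norm_qStar_le m _) ((hH t ht k).trans X.chH.C_le) (fun m => ?_) (fun m => ?_) ?_
    · have h2 : 1 * aU m ≤ s := by
        refine mul_le_mul p5 ?_ (hU0 m) (by positivity)
        linarith [hm m, hR0 m]
      rw [one_mul] at h2
      exact h2
    · refine (hQ m t ht k).2.trans ?_
      calc _ ≤ c.total ^ 5 * (1 / X.T) + c.total ^ 5 * aR m := by gcongr
        _ ≤ s := by
          rw [← mul_add]
          refine mul_le_mul_of_nonneg_left ?_ (by positivity)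
          linarith [hm m, hU0 m]
    · have h2 : 1 * aH ≤ s := by
        have : (0 : ℝ) ≤ M * (1 / X.T) := by positivity
        exact mul_le_mul p5 (by linarith) haH (by positivity)
      rw [one_mul] at h2
      exact h2
  have h2 : X.zG t ω k - X.p.gradF (X.x t ω) = (X.chS.G t ω k - X.chS.star (X.x t ω)) +
      (-1 : ℝ) ^ M • (X.chainG t ω k - chainTo (fun m => X.p.uStar m (X.x t ω))
        (fun m => X.p.qStar m (X.x t ω)) (Fin.last M) (X.p.hStar (X.x t ω))) := by
    have : X.chS.star (X.x t ω) = X.p.sStar (X.x t ω) := rfl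
    rw [zG, Problem.gradF, this]
    module
  rw [h2]
  refine (norm_add_le _ _).trans ?_
  rw [norm_smul, norm_pow, norm_neg, norm_one, one_pow, one_mul]
  refine (add_le_add_right h1 _).trans ?_
  have hc := chainConst_pos M h0
  have haS : 0 ≤ aS := norm_nonneg _
  have h3 : 1 * aS ≤ c.total ^ 5 * aS := mul_le_mul_of_nonneg_right p5 haS
  have h4 : 0 ≤ chainConst M c.total * (c.total ^ 5 * aS) := by positivity
  have h5 : 0 ≤ s := by positivity
  calc aS + chainConst M c.total * s ≤ (1 + chainConst M c.total) * (c.total ^ 5 * aS + s) := by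
        linarith
    _ = _ := by rw [hs]; ring

theorem ae_msq_zG_sub_le : ∀ᵐ ω ∂X.P, ∀ t ≤ X.T,
    msq (fun k => X.zG t ω k - X.p.gradF (X.x t ω)) ≤
      gradConst d c * (X.delta t ^ 2 + X.errSum t ω + (1 / X.T) ^ 2) := by
  obtain ⟨n1, n2, n3, n4⟩ := distortion_le_noiseConst d c
  filter_upwards [X.ae_norm_zG_sub_le, X.chS.msq_G_sub_star_le n3, X.chH.msq_G_sub_star_le n2,
    ae_all_iff.2 fun m => (X.chU m).msq_G_sub_star_le (n1 m).1,
    ae_all_iff.2 fun m => (X.chR m 0).msq_G_sub_star_le (n1 m).2] with ω h hS hH hU hR t ht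
  have h0 := X.one_le_total
  have hc := chainConst_pos M h0
  have hK : (X.K : ℝ) ≠ 0 := by
    have := X.card_pos
    positivity
  set B := (1 + chainConst M c.total) * c.total ^ 5 with hB
  set aS : Fin X.K → ℝ := fun k => ‖X.chS.G t ω k - X.chS.star (X.x t ω)‖ with haS
  set aH : Fin X.K → ℝ := fun k => ‖X.chH.G t ω k - X.chH.star (X.x t ω)‖ with haH
  set aU : Fin M → Fin X.K → ℝ := fun m k => ‖(X.chU m).G t ω k - (X.chU m).star (X.x t ω)‖ with haU
  set aR : Fin M → Fin X.K → ℝ :=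
    fun m k => ‖(X.chR m 0).G t ω k - (X.chR m 0).star (X.x t ω)‖ with haR
  set τ : ℝ := 1 / X.T with hτ
  have hsq : ∀ k, (aS k + aH k + ∑ m, (aU m k + aR m k) + M * τ) ^ 2 ≤
      (4 * M + 4) * (aS k ^ 2 + aH k ^ 2 + ∑ m, (aU m k ^ 2 + aR m k ^ 2) + M * τ ^ 2) := by
    intro k
    -- Cauchy–Schwarz over the `2M + 2` tracking errors. The truncation term is added afterwards,
    -- which doubles the factor to `4M + 4`.
    have cs := Finset.sum_mul_sq_le_sq_mul_sq (Finset.univ : Finset (Fin M ⊕ Fin M ⊕ Unit ⊕ Unit))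
      (fun _ => (1 : ℝ)) (fun i => i.elim (aU · k) fun i => i.elim (aR · k) fun i =>
        i.elim (fun _ => aS k) fun _ => aH k)
    simp [Fintype.sum_sum_type] at cs
    have h1 : aS k + aH k + ∑ m, (aU m k + aR m k) + M * τ =
        (∑ m, aU m k + (∑ m, aR m k + (aS k + aH k))) + M * τ := by
      rw [Finset.sum_add_distrib]
      ring
    have h2 : ∑ m, (aU m k ^ 2 + aR m k ^ 2) = ∑ m, aU m k ^ 2 + ∑ m, aR m k ^ 2 :=
      Finset.sum_add_distrib
    rw [h1, h2]
    set A := ∑ m, aU m k + (∑ m, aR m k + (aS k + aH k))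
    set Q := ∑ m, aU m k ^ 2 + (∑ m, aR m k ^ 2 + (aS k ^ 2 + aH k ^ 2)) with hQ
    have hQ0 : 0 ≤ Q := by positivity
    have cs' : A ^ 2 ≤ (2 * M + 2) * Q := by
      refine cs.trans (le_of_eq ?_)
      ring
    have e : ∑ m, aU m k ^ 2 + ∑ m, aR m k ^ 2 = Q - (aS k ^ 2 + aH k ^ 2) := by rw [hQ]; ring
    rw [e]
    have h3 : (A + M * τ) ^ 2 ≤ 2 * (A ^ 2 + (M * τ) ^ 2) := add_sq_le
    have hM : (0 : ℝ) ≤ M := Nat.cast_nonneg M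
    have h4 : (0 : ℝ) ≤ M * τ ^ 2 * (2 * M + 4) := by positivity
    linarith
  have hpt : ∀ k, ‖X.zG t ω k - X.p.gradF (X.x t ω)‖ ^ 2 ≤ B ^ 2 * (4 * M + 4) *
      (aS k ^ 2 + aH k ^ 2 + ∑ m, (aU m k ^ 2 + aR m k ^ 2) + M * τ ^ 2) := fun k => by
    refine (pow_le_pow_left₀ (norm_nonneg _) (h t ht k) 2).trans ?_
    rw [mul_pow, mul_assoc (B ^ 2)]
    exact mul_le_mul_of_nonneg_left (hsq k) (sq_nonneg B)
  have hmsq : msq (fun k => X.zG t ω k - X.p.gradF (X.x t ω)) ≤ B ^ 2 * (4 * M + 4) *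
      (msq (fun k => X.chS.G t ω k - X.chS.star (X.x t ω)) +
        msq (fun k => X.chH.G t ω k - X.chH.star (X.x t ω)) +
        ∑ m, (msq (fun k => (X.chU m).G t ω k - (X.chU m).star (X.x t ω)) +
          msq (fun k => (X.chR m 0).G t ω k - (X.chR m 0).star (X.x t ω))) + M * τ ^ 2) := by
    have h1 : msq (fun k => X.zG t ω k - X.p.gradF (X.x t ω)) ≤ (1 / (X.K : ℝ)) *
        ∑ k, B ^ 2 * (4 * M + 4) *
          (aS k ^ 2 + aH k ^ 2 + ∑ m, (aU m k ^ 2 + aR m k ^ 2) + M * τ ^ 2) :=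
      mul_le_mul_of_nonneg_left (Finset.sum_le_sum fun k _ => hpt k) (by positivity)
    refine h1.trans (le_of_eq ?_)
    rw [← Finset.mul_sum, Finset.sum_add_distrib, Finset.sum_add_distrib, Finset.sum_add_distrib,
      Finset.sum_comm]
    have h2 : ∀ m, msq (fun k => (X.chU m).G t ω k - (X.chU m).star (X.x t ω)) +
        msq (fun k => (X.chR m 0).G t ω k - (X.chR m 0).star (X.x t ω)) =
        (1 / (X.K : ℝ)) * ∑ k, (aU m k ^ 2 + aR m k ^ 2) := fun m => by
      rw [Finset.sum_add_distrib, mul_add]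
      rfl
    have h3 : ∑ m, (msq (fun k => (X.chU m).G t ω k - (X.chU m).star (X.x t ω)) +
        msq (fun k => (X.chR m 0).G t ω k - (X.chR m 0).star (X.x t ω))) =
        (1 / (X.K : ℝ)) * ∑ m, ∑ k, (aU m k ^ 2 + aR m k ^ 2) := by
      rw [Finset.mul_sum]
      exact Finset.sum_congr rfl fun m _ => h2 m
    rw [h3]
    have h4 : msq (fun k => X.chS.G t ω k - X.chS.star (X.x t ω)) =
      (1 / (X.K : ℝ)) * ∑ k, aS k ^ 2 := rfl
    have h5 : msq (fun k => X.chH.G t ω k - X.chH.star (X.x t ω)) =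
      (1 / (X.K : ℝ)) * ∑ k, aH k ^ 2 := rfl
    rw [h4, h5, Finset.sum_const, Finset.card_univ, Fintype.card_fin, nsmul_eq_mul]
    field_simp
  refine hmsq.trans ?_
  have hs : ∑ m, (msq (fun k => (X.chU m).G t ω k - (X.chU m).star (X.x t ω)) +
      msq (fun k => (X.chR m 0).G t ω k - (X.chR m 0).star (X.x t ω))) ≤
      ∑ m, (4 * (noiseConst d c * X.delta t ^ 2) +
        2 * ((X.chU m).err t ω + (X.chR m 0).err t ω)) :=
    Finset.sum_le_sum fun m _ => by linarith [hU m t ht, hR m t ht]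
  have hs' : ∑ m, (4 * (noiseConst d c * X.delta t ^ 2) +
        2 * ((X.chU m).err t ω + (X.chR m 0).err t ω)) =
      M * (4 * (noiseConst d c * X.delta t ^ 2)) +
        2 * ∑ m, ((X.chU m).err t ω + (X.chR m 0).err t ω) := by
    rw [Finset.sum_add_distrib, Finset.sum_const, Finset.card_univ, Fintype.card_fin,
      nsmul_eq_mul, Finset.mul_sum]
  rw [hs'] at hs
  have h1 := hS t ht
  have h2 := hH t ht
  have hE : 0 ≤ X.errSum t ω := by
    unfold errSum
    have e1 : ∀ {V : Type} [NormedAddCommGroup V] [NormedSpace ℝ V] [FiniteDimensional ℝ V]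
      [MeasurableSpace V] [BorelSpace V] (ch : X.Chan V), 0 ≤ ch.err t ω := fun ch => sq_nonneg _
    exact add_nonneg (add_nonneg (e1 _) (e1 _))
      (Finset.sum_nonneg fun m _ => add_nonneg (e1 _) (e1 _))
  rw [gradConst, mul_assoc (B ^ 2 * (4 * M + 4))]
  refine mul_le_mul_of_nonneg_left ?_ (by positivity)
  have hM : (0 : ℝ) ≤ M := Nat.cast_nonneg M
  have e : msq (fun k => X.chS.G t ω k - X.chS.star (X.x t ω)) +
        msq (fun k => X.chH.G t ω k - X.chH.star (X.x t ω)) +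
        ∑ m, (msq (fun k => (X.chU m).G t ω k - (X.chU m).star (X.x t ω)) +
          msq (fun k => (X.chR m 0).G t ω k - (X.chR m 0).star (X.x t ω))) + M * τ ^ 2 ≤
      (4 * M + 4) * noiseConst d c * X.delta t ^ 2 + 2 * X.errSum t ω + M * τ ^ 2 := by
    unfold errSum
    linarith
  refine e.trans ?_
  have p1 : 0 ≤ (4 * M + 4) * noiseConst d c := by positivity
  have p2 : 0 ≤ (4 * M + 4) * noiseConst d c * (X.errSum t ω + τ ^ 2) := by positivity
  have p3 : 0 ≤ X.delta t ^ 2 := sq_nonneg _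
  have p4 : 0 ≤ M * (X.delta t ^ 2 + X.errSum t ω) + 2 * (X.delta t ^ 2 + τ ^ 2) := by positivity
  linarith

end Sys

end DSMO

end

noncomputable section

namespace DSMO

open scoped ENNReal

universe u v

/-! ### Auxiliary inequalities for one round. -/

theorem EB.add_sum_of_lintegral_le {Ω : Type*} [MeasurableSpace Ω] {P : Measure Ω} {ι : Type*}
    (s : Finset ι) {Q : Ω → ℝ} {B Y : ι → Ω → ℝ} {a r : ι → ℝ} {e : ℝ}
    (hQ : Measurable Q) (hQ0 : ∀ ω, 0 ≤ Q ω) (hB : ∀ i, Measurable (B i)) (hB0 : ∀ i ω, 0 ≤ B i ω)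
    (hY : ∀ i, Measurable (Y i)) (hY0 : ∀ i ω, 0 ≤ Y i ω) (ha : ∀ i, 0 ≤ a i) (hr : ∀ i, 0 ≤ r i)
    (he : 0 ≤ e) (h : EB P (fun ω => Q ω + ∑ i ∈ s, a i * B i ω) e)
    (hl : ∀ i, ∫⁻ ω, ENNReal.ofReal (Y i ω) ∂P ≤
      ∫⁻ ω, ENNReal.ofReal (B i ω) ∂P + ENNReal.ofReal (r i)) :
    EB P (fun ω => Q ω + ∑ i ∈ s, a i * Y i ω) (e + ∑ i ∈ s, a i * r i) := by
  have hsplit : ∀ Z : ι → Ω → ℝ, (∀ i, Measurable (Z i)) → (∀ i ω, 0 ≤ Z i ω) →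
      ∫⁻ ω, ENNReal.ofReal (Q ω + ∑ i ∈ s, a i * Z i ω) ∂P =
        ∫⁻ ω, ENNReal.ofReal (Q ω) ∂P +
          ∑ i ∈ s, ENNReal.ofReal (a i) * ∫⁻ ω, ENNReal.ofReal (Z i ω) ∂P := fun Z hZ hZ0 => by
    have e1 : ∀ ω, ENNReal.ofReal (Q ω + ∑ i ∈ s, a i * Z i ω) = ENNReal.ofReal (Q ω) +
        ∑ i ∈ s, ENNReal.ofReal (a i) * ENNReal.ofReal (Z i ω) := fun ω => by
      rw [ENNReal.ofReal_add (hQ0 ω) (Finset.sum_nonneg fun i _ => mul_nonneg (ha i) (hZ0 i ω)),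
        ENNReal.ofReal_sum_of_nonneg fun i _ => mul_nonneg (ha i) (hZ0 i ω)]
      simp_rw [ENNReal.ofReal_mul (ha _)]
    simp_rw [e1]
    rw [lintegral_add_left hQ.ennreal_ofReal, lintegral_finsetSum _ fun i _ =>
      (hZ i).ennreal_ofReal.const_mul _]
    simp_rw [lintegral_const_mul' _ _ ENNReal.ofReal_ne_top]
  obtain ⟨Y', -, -, h3, h4⟩ := h
  have h5 : ∫⁻ ω, ENNReal.ofReal (Q ω + ∑ i ∈ s, a i * B i ω) ∂P ≤ ENNReal.ofReal e :=
    (lintegral_mono_ae (h3.mono fun ω h => ENNReal.ofReal_le_ofReal h)).trans h4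
  rw [hsplit B hB hB0] at h5
  refine EB.of_lintegral (hQ.add (Finset.measurable_sum _ fun i _ => (hY i).const_mul _))
    (fun ω => add_nonneg (hQ0 ω) (Finset.sum_nonneg fun i _ => mul_nonneg (ha i) (hY0 i ω))) ?_
  rw [hsplit Y hY hY0, ENNReal.ofReal_add he (Finset.sum_nonneg fun i _ => mul_nonneg (ha i) (hr i)),
    ENNReal.ofReal_sum_of_nonneg fun i _ => mul_nonneg (ha i) (hr i)]
  simp_rw [ENNReal.ofReal_mul (ha _)]
  refine le_trans ?_ (add_le_add_left h5 _)
  rw [add_assoc, ← Finset.sum_add_distrib]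
  refine add_le_add_right (Finset.sum_le_sum fun i _ => ?_) _
  rw [← mul_add]
  exact mul_le_mul_right (hl i) _

/-- Shifting the level by one gains a factor `r`. This is how geometric weights absorb the influence
of a level on the next; level `0` carries no error. -/
theorem sum_pow_mul_castSucc_le {M : ℕ} {f : Fin (M + 1) → ℝ} (h0 : f 0 = 0) (hf : ∀ m, 0 ≤ f m) {r : ℝ}
    (hr : 0 ≤ r) : ∑ m : Fin M, r ^ (m : ℕ) * f m.castSucc ≤ r * ∑ m : Fin M, r ^ (m : ℕ) * f m.succ := by
  have h1 := Fin.sum_univ_castSucc fun m : Fin (M + 1) => r ^ (m : ℕ) * f m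
  have h2 := Fin.sum_univ_succ fun m : Fin (M + 1) => r ^ (m : ℕ) * f m
  rw [h1] at h2
  simp only [Fin.val_castSucc, Fin.val_last, h0, mul_zero, zero_add, Fin.val_succ] at h2
  have h3 : 0 ≤ r ^ M * f (Fin.last M) := mul_nonneg (pow_nonneg hr _) (hf _)
  have h4 : r * ∑ m : Fin M, r ^ (m : ℕ) * f m.succ = ∑ m : Fin M, r ^ ((m : ℕ) + 1) * f m.succ := by
    rw [Finset.mul_sum]
    exact Finset.sum_congr rfl fun m _ => by ring
  linarith

theorem norm_add_add_sq_le {E : Type*} [SeminormedAddCommGroup E] (u v w : E) :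
    ‖u + v + w‖ ^ 2 ≤ 3 * (‖u‖ ^ 2 + ‖v‖ ^ 2 + ‖w‖ ^ 2) := by
  have h1 : ‖u + v + w‖ ≤ ‖u‖ + ‖v‖ + ‖w‖ := norm_add₃_le
  have h2 := pow_le_pow_left₀ (norm_nonneg _) h1 2
  nlinarith [sq_nonneg (‖u‖ - ‖v‖), sq_nonneg (‖v‖ - ‖w‖), sq_nonneg (‖u‖ - ‖w‖)]

/-- The smoothness constant of `F`. -/
def smoothConst {M : ℕ} (c : Constants M) : ℝ :=
  (1 + chainConst M c.total) * (c.total ^ 4 * lipStar M c.total)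

namespace Sys

variable {M : ℕ} {d : Fin (M + 1) → ℕ} {c : Constants M} {μ C₁ : ℝ} (X : Sys.{u, v} d c μ C₁)

/-! ### One round of the algorithm -/

/-- The optimality gap. -/
def gap (t : ℕ) (ω : X.Ω) : ℝ := X.p.F (X.x t ω) - X.p.FStar

theorem gap_nonneg (t : ℕ) (ω : X.Ω) : 0 ≤ X.gap t ω := sub_nonneg.2 (X.regular.FStar_le _)

theorem continuous_F : Continuous X.p.F :=
  continuous_iff_continuousAt.2 fun x => (X.regular.hasGradientAt_F x).hasFDerivAt.continuousAt

theorem continuous_yStar (m : Fin (M + 1)) : Continuous (X.p.yStar m) :=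
  continuous_iff_continuousAt.2 fun x => (X.regular.hasFDerivAt_yStar m x).continuousAt

theorem measurable_gap (t : ℕ) : Measurable (X.gap t) :=
  (X.continuous_F.measurable.comp (X.measurable_yBar t (fun q _ => X.sampling.measurable q) 0)).sub_const _

theorem errSum_nonneg (t : ℕ) (ω : X.Ω) : 0 ≤ X.errSum t ω := by
  have e : ∀ {V : Type} [NormedAddCommGroup V] [NormedSpace ℝ V] [FiniteDimensional ℝ V]
    [MeasurableSpace V] [BorelSpace V] (ch : X.Chan V), 0 ≤ ch.err t ω := fun ch => sq_nonneg _
  exact add_nonneg (add_nonneg (e _) (e _)) (Finset.sum_nonneg fun m _ => add_nonneg (e _) (e _))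

/-- Polarization writes `-α⟨g, z̄⟩` as `(α/2)(‖z̄-g‖² - ‖z̄‖² - ‖g‖²)`. PL uses the last term. Of
the middle one, half pays for the quadratic term of the descent inequality, and the other half is
kept for the drift of the targets. -/
theorem ae_gap_succ_le (hC : 8 * smoothConst c ≤ μ * C₁) : ∀ᵐ ω ∂X.P, ∀ t < X.T,
    X.gap (t + 1) ω ≤ (1 - μ * X.α t) * X.gap t ω - X.α t / 4 * ‖X.zBar t ω‖ ^ 2 +
      X.α t * msq (fun k => (X.st t ω).z k - X.zG t ω k) +
      X.α t * (gradConst d c * (X.delta t ^ 2 + X.errSum t ω + (1 / X.T) ^ 2)) := by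
  filter_upwards [X.ae_mem_yBar, X.ae_msq_zG_sub_le] with ω hD hG t ht
  have hα := X.α_pos t
  set g := X.p.gradF (X.x t ω)
  set z := X.zBar t ω with hz
  have h1 := X.regular.descent (hD t ht.le 0) (hD (t + 1) ht 0)
  change X.p.F (X.x (t + 1) ω) ≤ X.p.F (X.x t ω) + Inner.inner ℝ g (X.x (t + 1) ω - X.x t ω) +
    smoothConst c * ‖X.x (t + 1) ω - X.x t ω‖ ^ 2 at h1
  have h2 : X.x (t + 1) ω - X.x t ω = -(X.α t • z) := by rw [x_succ]; abel
  rw [h2, inner_neg_right, inner_smul_right, norm_neg, norm_smul, Real.norm_of_nonneg hα.le,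
    mul_pow] at h1
  have h3 : ‖z - g‖ ^ 2 = ‖z‖ ^ 2 - 2 * Inner.inner ℝ g z + ‖g‖ ^ 2 := by
    rw [norm_sub_sq_real, real_inner_comm]
  have h4 := X.pl (X.x t ω)
  rw [(X.regular.hasGradientAt_F (X.x t ω)).gradient] at h4
  change 2 * μ * X.gap t ω ≤ ‖g‖ ^ 2 at h4
  have h5 : smoothConst c * X.α t ≤ 1 / 4 := by
    have hn : (0 : ℝ) ≤ t := Nat.cast_nonneg t
    have hμ := X.μ_pos
    have hC0 := X.C₁_pos
    unfold α
    rw [mul_div_assoc', div_le_iff₀ (by positivity)]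
    have : 0 ≤ μ * t := by positivity
    linarith
  have h6 : ‖z - g‖ ^ 2 ≤ 2 * msq (fun k => (X.st t ω).z k - X.zG t ω k) +
      2 * msq (fun k => X.zG t ω k - g) := by
    have e : z - g = avg fun k => ((X.st t ω).z k - X.zG t ω k) + (X.zG t ω k - g) := by
      have : (fun k => ((X.st t ω).z k - X.zG t ω k) + (X.zG t ω k - g)) =
          fun k => (X.st t ω).z k - g := by
        funext k
        abel
      rw [this, avg_sub, avg_const X.card_pos]
      rfl
    rw [e]
    refine (norm_avg_sq_le _).trans ((msq_add_le one_pos one_pos).trans_eq ?_)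
    ring
  have h7 := hG t ht.le
  have h8 : X.α t / 2 * ‖z - g‖ ^ 2 ≤ X.α t * msq (fun k => (X.st t ω).z k - X.zG t ω k) +
      X.α t * (gradConst d c * (X.delta t ^ 2 + X.errSum t ω + (1 / X.T) ^ 2)) := by
    have := mul_le_mul_of_nonneg_left h6 (show 0 ≤ X.α t / 2 by positivity)
    have := mul_le_mul_of_nonneg_left h7 hα.le
    linarith
  have h9 : X.α t / 2 * (2 * μ * X.gap t ω) ≤ X.α t / 2 * ‖g‖ ^ 2 :=
    mul_le_mul_of_nonneg_left h4 (by positivity)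
  have h10 : smoothConst c * X.α t * (X.α t * ‖z‖ ^ 2) ≤ 1 / 4 * (X.α t * ‖z‖ ^ 2) :=
    mul_le_mul_of_nonneg_right h5 (by positivity)
  have h11 : X.gap (t + 1) ω = X.p.F (X.x (t + 1) ω) - X.p.FStar := rfl
  have h12 : X.gap t ω = X.p.F (X.x t ω) - X.p.FStar := rfl
  rw [h3] at h8
  rw [h11]
  rw [h12] at h9 ⊢
  linarith

theorem ae_errSum_succ_le : ∀ᵐ ω ∂X.P, ∀ t < X.T,
    X.errSum (t + 1) ω ≤ (1 - X.β t) * X.errSum t ω +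
      (2 * M + 2) * (16 * c.total ^ 4) * X.β t * (X.cons t ω + ∑ m, X.Y m t ω) +
      (2 * M + 2) * (16 * c.total ^ (4 * M + 4)) / (μ * C₁) * (X.α t * ‖X.zBar t ω‖ ^ 2) := by
  filter_upwards [X.chS.ae_err_succ_le, X.chH.ae_err_succ_le,
    ae_all_iff.2 fun m => (X.chU m).ae_err_succ_le,
    ae_all_iff.2 fun m => (X.chR m 0).ae_err_succ_le] with ω hS hH hU hR t ht
  have h1 := hS t ht
  have h2 := hH t ht
  set P := 16 * c.total ^ 4 * X.β t * (X.cons t ω + ∑ m, X.Y m t ω)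
  set R := 16 * c.total ^ (4 * M + 4) / (μ * C₁) * (X.α t * ‖X.zBar t ω‖ ^ 2)
  have h3 : ∑ m, ((X.chU m).err (t + 1) ω + (X.chR m 0).err (t + 1) ω) ≤
      (1 - X.β t) * ∑ m, ((X.chU m).err t ω + (X.chR m 0).err t ω) + M * (2 * P + 2 * R) := by
    calc _ ≤ ∑ m : Fin M, ((1 - X.β t) * ((X.chU m).err t ω + (X.chR m 0).err t ω) +
          (2 * P + 2 * R)) := Finset.sum_le_sum fun m _ => by linarith [hU m t ht, hR m t ht]
      _ = _ := by
        rw [Finset.sum_add_distrib, ← Finset.mul_sum, Finset.sum_const, Finset.card_univ,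
          Fintype.card_fin, nsmul_eq_mul]
  have e1 : (2 * M + 2) * (16 * c.total ^ 4) * X.β t * (X.cons t ω + ∑ m, X.Y m t ω) =
      (2 * M + 2) * P := by ring
  have e2 : (2 * M + 2) * (16 * c.total ^ (4 * M + 4)) / (μ * C₁) * (X.α t * ‖X.zBar t ω‖ ^ 2) =
      (2 * M + 2) * R := by ring
  rw [e1, e2]
  unfold errSum
  linarith

/-- The error of the inner variable after a round without noise. -/
def pred (m : Fin M) (t : ℕ) (ω : X.Ω) : Vec (d m.succ) :=
  X.yBar m.succ t ω - X.β t • avg (fun k => (X.chY m).m t k ω) - X.p.yStar m.succ (X.x (t + 1) ω)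

/-- The new target depends on `x_{t+1}`, hence only on samples before round `t`, so `pred` is known
before the gradients of round `t` are sampled. Their independent noises then add only `β²/K`. -/
theorem lintegral_Y_succ_le (m : Fin M) {t : ℕ} (ht : t ≤ X.T) :
    ∫⁻ ω, ENNReal.ofReal (X.Y m.succ (t + 1) ω) ∂X.P ≤
      ∫⁻ ω, ENNReal.ofReal (‖X.pred m t ω‖ ^ 2) ∂X.P +
        ENNReal.ofReal (X.β t ^ 2 * c.total ^ 2 / X.K) := by
  have hK : (X.K : ℝ) ≠ 0 := by
    have := X.card_pos
    positivity
  have hpred : ∀ k, Measurable[(X.chY m).sigma t k] (X.pred m t) := fun k => by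
    have hlt : ∀ q : Query M X.K, q.round < t → Measurable[(X.chY m).sigma t k] (X.ξ q) :=
      fun q hq => (X.chY m).measurable_sigma_of_lt hq
    have hz : ∀ j, Measurable[(X.chY m).sigma t k] fun ω => (X.st t ω).z j :=
      @State.IsMeasurable.z _ _ _ _ ((X.chY m).sigma t k) _ (X.isMeasurable_st t hlt)
    have hx : Measurable[(X.chY m).sigma t k] fun ω => X.x (t + 1) ω := by
      simp_rw [x_succ]
      exact (X.measurable_yBar t hlt 0).sub (((Finset.measurable_sum Finset.univ fun j _ =>
        hz j).const_smul (1 / (X.K : ℝ))).const_smul (X.α t))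
    refine ((X.measurable_yBar t hlt m.succ).sub (((Finset.measurable_sum Finset.univ fun j _ =>
      (X.chY m).measurable_m t hlt j).const_smul (1 / (X.K : ℝ))).const_smul (X.β t))).sub ?_
    exact (X.continuous_yStar m.succ).measurable.comp hx
  have key := IsFresh.lintegral_sum_le ((X.chY m).isFresh ht)
    (fun j k hjk => (X.chY m).measurable_N t j (fun _ => (X.chY m).measurable_sigma_of_lt)
      ((X.chY m).measurable_sigma_of_ne hjk))
    (fun j k _ => (X.chY m).measurable_m t (fun _ hq => (X.chY m).measurable_sigma_of_lt hq) j)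
    (ContinuousLinearMap.id ℝ (Vec (d m.succ))) (A := fun _ => 1) measurable_const
    (fun _ => measurable_const) hpred (fun _ => -(X.β t / X.K))
  simp only [one_mul, ContinuousLinearMap.id_apply] at key
  have e : ∀ ω, X.yBar m.succ (t + 1) ω - X.p.yStar m.succ (X.x (t + 1) ω) = X.pred m t ω +
      ∑ k, -(X.β t / X.K) • ((X.chY m).N t k ω - (X.chY m).m t k ω) := fun ω => by
    have h1 : X.yBar m.succ (t + 1) ω = X.yBar m.succ t ω -
        X.β t • avg (fun k => (X.chY m).N t k ω) := by
      rw [yBar, y_succ_succ, avg_sub, X.gossip.avg_mix, avg_smul]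
      rfl
    have h2 : ∑ k, -(X.β t / X.K) • ((X.chY m).N t k ω - (X.chY m).m t k ω) =
        -(X.β t • (avg (fun k => (X.chY m).N t k ω) - avg (fun k => (X.chY m).m t k ω))) := by
      rw [← avg_sub, ← Finset.smul_sum, avg, smul_smul, neg_smul, mul_one_div]
    rw [h1, h2, pred]
    module
  simp only [Y, e]
  refine key.trans ?_
  rw [lintegral_add_right _ measurable_const, lintegral_const, measure_univ, mul_one]
  refine add_le_add_right (ENNReal.ofReal_le_ofReal ?_) _
  have h3 : (‖ContinuousLinearMap.id ℝ (Vec (d m.succ))‖ * (X.chY m).C) ^ 2 ≤ c.total ^ 2 := by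
    refine pow_le_pow_left₀ (mul_nonneg (norm_nonneg _) (X.chY m).C_nonneg) ?_ 2
    exact (mul_le_of_le_one_left (X.chY m).C_nonneg ContinuousLinearMap.norm_id_le).trans
      (X.chY m).C_le
  rw [Finset.sum_const, Finset.card_univ, Fintype.card_fin, nsmul_eq_mul]
  calc _ ≤ (X.K : ℝ) * (-(X.β t / X.K)) ^ 2 * c.total ^ 2 := by gcongr
    _ = _ := by field_simp

/-- An exact gradient step towards the best response, perturbed by the error of the level before, by
the disagreement of the agents and by the motion of the target. -/
theorem ae_pred_le (m : Fin M) : ∀ᵐ ω ∂X.P, ∀ t < X.T, ‖X.pred m t ω‖ ^ 2 ≤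
    (1 - X.β t / c.total + 2 * c.total ^ 2 * X.β t ^ 2) * X.Y m.succ t ω +
      24 * c.total ^ 5 * X.β t * X.cons t ω + 6 * c.total ^ 3 * X.β t * X.Y m.castSucc t ω +
      12 * c.total * lipStar M c.total ^ 2 / (μ * C₁) * (X.α t * ‖X.zBar t ω‖ ^ 2) := by
  filter_upwards [(X.chY m).ae_norm_avg_m_sub_sq_le] with ω h t ht
  have h0 := X.one_le_total
  set Λ := c.total
  have hΛ : 0 < Λ := by linarith
  have hβ := X.β_pos t
  have hβ1 := X.β_le_one t
  have hα := X.α_pos t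
  set a := X.yBar m.succ t ω - X.p.yStar m.succ (X.x t ω) -
    X.β t • X.p.gradgAvg m (X.p.yStar m.castSucc (X.x t ω)) (X.yBar m.succ t ω) with ha
  set b₁ := X.p.gradgAvg m (X.p.yStar m.castSucc (X.x t ω)) (X.yBar m.succ t ω) -
    X.p.gradgAvg m (X.yBar m.castSucc t ω) (X.yBar m.succ t ω) with hb₁
  set b₂ := X.p.gradgAvg m (X.yBar m.castSucc t ω) (X.yBar m.succ t ω) -
    avg (fun k => (X.chY m).m t k ω) with hb₂
  set e := X.p.yStar m.succ (X.x t ω) - X.p.yStar m.succ (X.x (t + 1) ω) with he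
  have hsplit : X.pred m t ω = a + (X.β t • b₁ + X.β t • b₂ + e) := by
    rw [pred, ha, hb₁, hb₂, he]
    module
  have h1 : ‖a‖ ^ 2 ≤ (1 - 2 * X.β t * Λ⁻¹ + X.β t ^ 2 * Λ ^ 2) * X.Y m.succ t ω :=
    X.regular.gradient_step m (X.x t ω) (X.yBar m.succ t ω) hβ.le
  have h2 : ‖b₁‖ ^ 2 ≤ Λ ^ 2 * X.Y m.castSucc t ω := by
    have := X.regular.lip_gradgAvg m (X.p.yStar m.castSucc (X.x t ω)) (X.yBar m.castSucc t ω)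
      (X.yBar m.succ t ω) (X.yBar m.succ t ω)
    rw [sub_self, norm_zero, add_zero, norm_sub_rev (X.p.yStar m.castSucc (X.x t ω))] at this
    refine (pow_le_pow_left₀ (norm_nonneg _) this 2).trans_eq ?_
    rw [mul_pow]
    rfl
  have h3 : ‖b₂‖ ^ 2 ≤ 4 * Λ ^ 4 * X.cons t ω := by
    rw [hb₂, norm_sub_rev]
    exact h t ht.le
  have h4 : ‖e‖ ^ 2 ≤ lipStar M Λ ^ 2 * (X.α t ^ 2 * ‖X.zBar t ω‖ ^ 2) := by
    have := X.regular.yStar_lip' m.succ (X.x t ω) (X.x (t + 1) ω)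
    have e2 : X.x t ω - X.x (t + 1) ω = X.α t • X.zBar t ω := by rw [x_succ]; abel
    rw [e2, norm_smul, Real.norm_of_nonneg hα.le] at this
    refine (pow_le_pow_left₀ (norm_nonneg _) this 2).trans_eq ?_
    ring
  have h5 : ‖X.β t • b₁ + X.β t • b₂ + e‖ ^ 2 ≤
      3 * (X.β t ^ 2 * ‖b₁‖ ^ 2 + X.β t ^ 2 * ‖b₂‖ ^ 2 + ‖e‖ ^ 2) := by
    refine (norm_add_add_sq_le _ _ _).trans_eq ?_
    rw [norm_smul, norm_smul, Real.norm_of_nonneg hβ.le, mul_pow, mul_pow]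
  -- The weight in Young's inequality: it spends half of the contraction `2β/Λ`, so the
  -- perturbations are multiplied only by about `Λ/β`.
  have hτ : 0 < X.β t / Λ := by positivity
  have h6 := norm_add_sq_le_weighted hτ a (X.β t • b₁ + X.β t • b₂ + e)
  rw [← hsplit] at h6
  have h7 : (1 + (X.β t / Λ)⁻¹) * ‖X.β t • b₁ + X.β t • b₂ + e‖ ^ 2 ≤
      2 * Λ / X.β t * (3 * (X.β t ^ 2 * (Λ ^ 2 * X.Y m.castSucc t ω) +
        X.β t ^ 2 * (4 * Λ ^ 4 * X.cons t ω) +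
        lipStar M Λ ^ 2 * (X.α t ^ 2 * ‖X.zBar t ω‖ ^ 2))) := by
    have i1 : 1 + (X.β t / Λ)⁻¹ ≤ 2 * Λ / X.β t := by
      rw [inv_div]
      have : 1 ≤ Λ / X.β t := by rw [le_div_iff₀ hβ]; linarith
      have e3 : 2 * Λ / X.β t = Λ / X.β t + Λ / X.β t := by ring
      linarith
    refine mul_le_mul i1 (h5.trans ?_) (sq_nonneg _) (by positivity)
    gcongr
  have h8 : (1 + X.β t / Λ) * ‖a‖ ^ 2 ≤ (1 - X.β t / Λ + 2 * Λ ^ 2 * X.β t ^ 2) * X.Y m.succ t ω := by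
    have hY : 0 ≤ X.Y m.succ t ω := sq_nonneg _
    refine (mul_le_mul_of_nonneg_left h1 (by positivity)).trans ?_
    rw [← mul_assoc]
    refine mul_le_mul_of_nonneg_right ?_ hY
    have i1 : (1 + X.β t / Λ) * (1 - 2 * X.β t * Λ⁻¹ + X.β t ^ 2 * Λ ^ 2) =
        1 - X.β t / Λ + Λ ^ 2 * X.β t ^ 2 + X.β t ^ 2 * (X.β t * Λ) - 2 * (X.β t / Λ) ^ 2 := by
      field_simp
      ring
    have i2 : X.β t * Λ ≤ Λ ^ 2 := by nlinarith
    have i3 := mul_le_mul_of_nonneg_left i2 (sq_nonneg (X.β t))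
    have i4 := sq_nonneg (X.β t / Λ)
    rw [i1]
    linarith
  have h9 : 2 * Λ / X.β t * (3 * (X.β t ^ 2 * (Λ ^ 2 * X.Y m.castSucc t ω) +
        X.β t ^ 2 * (4 * Λ ^ 4 * X.cons t ω) +
        lipStar M Λ ^ 2 * (X.α t ^ 2 * ‖X.zBar t ω‖ ^ 2))) =
      24 * Λ ^ 5 * X.β t * X.cons t ω + 6 * Λ ^ 3 * X.β t * X.Y m.castSucc t ω +
      12 * Λ * lipStar M Λ ^ 2 / (μ * C₁) * (X.α t * ‖X.zBar t ω‖ ^ 2) := by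
    have e4 : X.α t / X.β t = 2 / (μ * C₁) := by rw [X.α_eq]; field_simp
    have e5 : 12 * Λ * lipStar M Λ ^ 2 / (μ * C₁) = 6 * Λ * lipStar M Λ ^ 2 * (X.α t / X.β t) := by
      rw [e4]; ring
    rw [e5]
    field_simp
    ring
  linarith

end Sys

end DSMO

end

noncomputable section

namespace DSMO

open scoped ENNReal

universe u v

/-! ### The Lyapunov function -/

section Constants

variable {M : ℕ} (d : Fin (M + 1) → ℕ) (c : Constants M)

/-- The ratio of the weights of consecutive levels. -/
def levelRatio : ℝ := 1 / (24 * c.total ^ 4)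

/-- The influence of the inner variables on the errors of the estimates. -/
def errRate : ℝ := (2 * M + 2) * (16 * c.total ^ 4)

/-- The weight of the inner variables. -/
def innerWeight : ℝ := 4 * c.total * errRate c / levelRatio c ^ M

/-- The influence of the search direction on the errors. -/
def driftConst : ℝ := (2 * M + 2) * (16 * c.total ^ (4 * M + 4)) +
  innerWeight c * (M * (12 * c.total * lipStar M c.total ^ 2))

/-- The influence of the consensus error. -/
def consRate : ℝ := errRate c + innerWeight c * (M * (24 * c.total ^ 5))

/-- The size of the perturbations of the Lyapunov recursion. -/
def lyapNoise : ℝ := dirNoiseConst d c + gradConst d c +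
  consRate c * (1 + dirConst c + M * c.total ^ 2) + M * (innerWeight c * c.total ^ 2)

/-- The initial size of the Lyapunov function. -/
def lyapInit (μ : ℝ) : ℝ := (c.total + c.total ^ (3 * M) * c.total) ^ 2 / (2 * μ) +
  (2 * M + 2) * (4 * c.total ^ 2) + M * (innerWeight c * c.total ^ 4)

/-- The requirements on `C₁`. -/
structure Large (μ C₁ : ℝ) : Prop where
  smooth : 8 * smoothConst c ≤ μ * C₁
  grad : 4 * gradConst d c ≤ μ * C₁
  rate : 4 * c.total ≤ C₁
  drift : 4 * driftConst c ≤ μ * C₁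

end Constants

namespace Sys

variable {M : ℕ} {d : Fin (M + 1) → ℕ} {c : Constants M} {μ C₁ : ℝ} (X : Sys.{u, v} d c μ C₁)

theorem levelRatio_pos (X : Sys.{u, v} d c μ C₁) : 0 < levelRatio c := by
  have := X.one_le_total
  unfold levelRatio
  positivity

theorem levelRatio_le_one (X : Sys.{u, v} d c μ C₁) : levelRatio c ≤ 1 := by
  have h := X.one_le_total
  unfold levelRatio
  rw [div_le_one (by positivity)]
  have : 1 ≤ c.total ^ 4 := one_le_pow₀ h
  linarith

theorem errRate_nonneg (X : Sys.{u, v} d c μ C₁) : 0 ≤ errRate c := by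
  have := X.one_le_total
  unfold errRate
  positivity

theorem innerWeight_nonneg (X : Sys.{u, v} d c μ C₁) : 0 ≤ innerWeight c := by
  have := X.one_le_total
  have := X.levelRatio_pos
  have := X.errRate_nonneg
  unfold innerWeight
  positivity

theorem gradConst_nonneg (X : Sys.{u, v} d c μ C₁) : 0 ≤ gradConst d c := by
  have := (distortion_le_noiseConst d c).2.2.2
  have := X.one_le_total
  unfold gradConst
  positivity

theorem dirNoiseConst_nonneg (X : Sys.{u, v} d c μ C₁) : 0 ≤ dirNoiseConst d c := by
  have := (distortion_le_noiseConst d c).2.2.2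
  have := X.one_le_total
  unfold dirNoiseConst
  positivity

theorem consRate_nonneg (X : Sys.{u, v} d c μ C₁) : 0 ≤ consRate c := by
  have := X.one_le_total
  have := X.errRate_nonneg
  have := X.innerWeight_nonneg
  unfold consRate
  positivity

/-- The Lyapunov function. -/
def lyap (t : ℕ) (ω : X.Ω) : ℝ := (X.gap t ω + X.errSum t ω) +
  ∑ m : Fin M, innerWeight c * levelRatio c ^ (m : ℕ) * X.Y m.succ t ω

/-- The contraction `β/Λ` of the inner errors is spent as `1/2 + 1/4 + 1/4`: on the target rate, on
the influence upon the tracking errors, and on the influence upon the next level. That of the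
tracking errors is shared between the target rate and the gradient error. -/
theorem ae_lyap_pred_le (hC : Large d c μ C₁) : ∀ᵐ ω ∂X.P, ∀ t < X.T,
    (X.gap (t + 1) ω + X.errSum (t + 1) ω) +
      ∑ m : Fin M, innerWeight c * levelRatio c ^ (m : ℕ) * ‖X.pred m t ω‖ ^ 2 ≤
    (1 - 2 / (C₁ + t) + 2 * c.total ^ 2 * X.β t ^ 2) * X.lyap t ω +
      X.β t * (msq (fun k => (X.st t ω).z k - X.zG t ω k) +
        gradConst d c * (X.delta t ^ 2 + (1 / X.T) ^ 2) + consRate c * X.cons t ω) := by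
  filter_upwards [X.ae_gap_succ_le hC.smooth, X.ae_errSum_succ_le,
    ae_all_iff.2 fun m => X.ae_pred_le m] with ω hgap herr hpred t ht
  have h0 := X.one_le_total
  have hμ := X.μ_pos
  have hC0 := X.C₁_pos
  have hβ := X.β_pos t
  have hα := X.α_pos t
  have hr := X.levelRatio_pos
  have hr1 := X.levelRatio_le_one
  have hP := X.errRate_nonneg
  have hA := X.innerWeight_nonneg
  have hG := X.gradConst_nonneg
  have g1 := hgap t ht
  have g2 := herr t ht
  have hE := X.errSum_nonneg t ω
  have hg := X.gap_nonneg t ω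
  have hY : ∀ m, 0 ≤ X.Y m t ω := fun m => sq_nonneg _
  have hY0 : X.Y 0 t ω = 0 := by
    have : X.yBar 0 t ω - X.p.yStar 0 (X.x t ω) = 0 := sub_self _
    rw [Y, this]
    simp
  have hcons : 0 ≤ X.cons t ω := le_min zero_le_one (Finset.sum_nonneg fun m _ => dev_nonneg _)
  have hn : (0 : ℝ) ≤ t := Nat.cast_nonneg t
  set Λ := c.total with hΛ
  set r := levelRatio c with hr_def
  set A := innerWeight c with hA_def
  set S₁ := ∑ m : Fin M, r ^ (m : ℕ) * X.Y m.succ t ω with hS₁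
  set S₀ := ∑ m : Fin M, r ^ (m : ℕ) * X.Y m.castSucc t ω with hS₀
  set q := X.α t * ‖X.zBar t ω‖ ^ 2 with hq
  have hq0 : 0 ≤ q := by positivity
  have hS₁0 : 0 ≤ S₁ := Finset.sum_nonneg fun m _ => mul_nonneg (pow_nonneg hr.le _) (hY _)
  have hS₀1 : S₀ ≤ r * S₁ := sum_pow_mul_castSucc_le (f := fun m => X.Y m t ω) hY0 hY hr.le
  have hS : r ^ M * ∑ m, X.Y m t ω ≤ S₁ := by
    rw [Fin.sum_univ_succ, hY0, zero_add, Finset.mul_sum]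
    refine Finset.sum_le_sum fun m _ => mul_le_mul_of_nonneg_right ?_ (hY _)
    exact pow_le_pow_of_le_one hr.le hr1 m.2.le
  have hB : ∑ m : Fin M, A * r ^ (m : ℕ) * ‖X.pred m t ω‖ ^ 2 ≤
      A * ((1 - X.β t / Λ + 2 * Λ ^ 2 * X.β t ^ 2) * S₁ + 6 * Λ ^ 3 * X.β t * S₀ +
        M * (24 * Λ ^ 5 * X.β t * X.cons t ω + 12 * Λ * lipStar M Λ ^ 2 / (μ * C₁) * q)) := by
    have hU : 0 ≤ 24 * Λ ^ 5 * X.β t * X.cons t ω + 12 * Λ * lipStar M Λ ^ 2 / (μ * C₁) * q := by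
      positivity
    set U := 24 * Λ ^ 5 * X.β t * X.cons t ω + 12 * Λ * lipStar M Λ ^ 2 / (μ * C₁) * q
    have h1 : ∀ m : Fin M, A * r ^ (m : ℕ) * ‖X.pred m t ω‖ ^ 2 ≤
        A * ((1 - X.β t / Λ + 2 * Λ ^ 2 * X.β t ^ 2) * (r ^ (m : ℕ) * X.Y m.succ t ω) +
          6 * Λ ^ 3 * X.β t * (r ^ (m : ℕ) * X.Y m.castSucc t ω) + U) := fun m => by
      rw [mul_assoc]
      refine mul_le_mul_of_nonneg_left ?_ hA
      have h2 : r ^ (m : ℕ) * U ≤ 1 * U := mul_le_mul_of_nonneg_right (pow_le_one₀ hr.le hr1) hU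
      have h3 := mul_le_mul_of_nonneg_left (hpred m t ht) (pow_nonneg hr.le (m : ℕ))
      have h4 : r ^ (m : ℕ) * U = r ^ (m : ℕ) * (24 * Λ ^ 5 * X.β t * X.cons t ω) +
        r ^ (m : ℕ) * (12 * Λ * lipStar M Λ ^ 2 / (μ * C₁) * q) := mul_add _ _ _
      linarith
    refine (Finset.sum_le_sum fun m _ => h1 m).trans_eq ?_
    rw [← Finset.mul_sum, Finset.sum_add_distrib, Finset.sum_add_distrib, ← Finset.mul_sum,
      ← Finset.mul_sum, Finset.sum_const, Finset.card_univ, Fintype.card_fin, nsmul_eq_mul]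
  have hlyap : X.lyap t ω = X.gap t ω + X.errSum t ω + A * S₁ := by
    rw [lyap, hS₁, Finset.mul_sum]
    congr 1
    exact Finset.sum_congr rfl fun m _ => mul_assoc _ _ _
  have e1 : μ * X.α t = 2 / (C₁ + t) := by
    unfold α
    field_simp
  have e2 : 2 / (C₁ + t) ≤ X.β t / 2 := by
    unfold β
    rw [div_div, div_le_div_iff₀ (by positivity) (by positivity)]
    have : 4 * 1 ≤ C₁ := by linarith [hC.rate]
    nlinarith
  have e3 : 2 / (C₁ + t) ≤ X.β t / (2 * Λ) := by
    unfold β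
    rw [div_div, div_le_div_iff₀ (by positivity) (by positivity)]
    have := mul_le_mul_of_nonneg_right hC.rate (show 0 ≤ C₁ + t by positivity)
    linarith
  have e4 : X.α t * gradConst d c ≤ X.β t / 2 := by
    rw [X.α_eq]
    have h1 : 2 / (μ * C₁) * gradConst d c ≤ 1 / 2 := by
      rw [div_mul_eq_mul_div, div_le_iff₀ (by positivity)]
      linarith [hC.grad]
    have := mul_le_mul_of_nonneg_right h1 hβ.le
    linarith
  -- This dictates `innerWeight`: `errRate = A rᴹ/(4Λ)`, with `rᴹ` a lower bound for the weights of
  -- all levels.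
  have e5 : errRate c * X.β t * ∑ m, X.Y m t ω ≤ A * (X.β t / (4 * Λ)) * S₁ := by
    have h1 : errRate c = A * r ^ M / (4 * Λ) := by
      rw [hA_def, innerWeight, ← hΛ, ← hr_def]
      field_simp
    have h2 := mul_le_mul_of_nonneg_left hS (show 0 ≤ A * (X.β t / (4 * Λ)) by positivity)
    rw [h1]
    refine le_trans (le_of_eq ?_) h2
    ring
  -- This dictates `levelRatio`: `6Λ³ r = 1/(4Λ)`.
  have e6 : A * (6 * Λ ^ 3 * X.β t * S₀) ≤ A * (X.β t / (4 * Λ)) * S₁ := by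
    have h1 := mul_le_mul_of_nonneg_left hS₀1 (show 0 ≤ A * (6 * Λ ^ 3 * X.β t) by positivity)
    have h2 : A * (6 * Λ ^ 3 * X.β t) * (r * S₁) = A * (X.β t / (4 * Λ)) * S₁ := by
      rw [hr_def, levelRatio, ← hΛ]
      field_simp
      ring
    linarith
  -- All drift terms together fit into the `-q/4` left over from the descent inequality, since `μC₁
  -- ≥ 4 driftConst`.
  have e7 : (2 * M + 2) * (16 * Λ ^ (4 * M + 4)) / (μ * C₁) * q +
      A * (M * (12 * Λ * lipStar M Λ ^ 2 / (μ * C₁) * q)) ≤ q / 4 := by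
    have h1 : (2 * M + 2) * (16 * Λ ^ (4 * M + 4)) / (μ * C₁) * q +
      A * (M * (12 * Λ * lipStar M Λ ^ 2 / (μ * C₁) * q)) = driftConst c / (μ * C₁) * q := by
      rw [driftConst]
      ring
    have h2 : driftConst c / (μ * C₁) ≤ 1 / 4 := by
      rw [div_le_iff₀ (by positivity)]
      linarith [hC.drift]
    rw [h1]
    have := mul_le_mul_of_nonneg_right h2 hq0
    linarith
  have e8 : A * (M * (24 * Λ ^ 5 * X.β t * X.cons t ω)) + errRate c * X.β t * X.cons t ω =
      X.β t * (consRate c * X.cons t ω) := by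
    rw [consRate]
    ring
  have hN : 0 ≤ msq (fun k => (X.st t ω).z k - X.zG t ω k) := msq_nonneg _
  set N := msq (fun k => (X.st t ω).z k - X.zG t ω k)
  have hαβ := X.α_le_β t
  have e9 : X.α t * N ≤ X.β t * N := mul_le_mul_of_nonneg_right hαβ hN
  set δ := X.delta t ^ 2 + (1 / X.T : ℝ) ^ 2 with hδ
  have hδ0 : 0 ≤ δ := by positivity
  have e10 : X.α t * (gradConst d c * δ) ≤ X.β t * (gradConst d c * δ) :=
    mul_le_mul_of_nonneg_right hαβ (mul_nonneg hG hδ0)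
  have e11 : X.α t * gradConst d c * X.errSum t ω ≤ X.β t / 2 * X.errSum t ω :=
    mul_le_mul_of_nonneg_right e4 hE
  have e12 : 2 / (C₁ + t) * X.errSum t ω ≤ X.β t / 2 * X.errSum t ω :=
    mul_le_mul_of_nonneg_right e2 hE
  have e13 : 2 / (C₁ + t) * (A * S₁) ≤ X.β t / (2 * Λ) * (A * S₁) :=
    mul_le_mul_of_nonneg_right e3 (mul_nonneg hA hS₁0)
  have e14 : X.β t / (2 * Λ) * (A * S₁) + A * (X.β t / (4 * Λ)) * S₁ + A * (X.β t / (4 * Λ)) * S₁ =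
      A * (X.β t / Λ * S₁) := by
    field_simp
    ring
  have e15 : 0 ≤ 2 * Λ ^ 2 * X.β t ^ 2 * (X.gap t ω + X.errSum t ω) := by positivity
  rw [e1] at g1
  have g1' : X.gap (t + 1) ω ≤ (1 - 2 / (C₁ + t)) * X.gap t ω - q / 4 + X.α t * N +
      X.α t * (gradConst d c * δ) + X.α t * gradConst d c * X.errSum t ω := by
    rw [hδ, hq]
    linarith
  have g2' : X.errSum (t + 1) ω ≤ (1 - X.β t) * X.errSum t ω + errRate c * X.β t * X.cons t ω +
      errRate c * X.β t * ∑ m, X.Y m t ω +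
      (2 * M + 2) * (16 * Λ ^ (4 * M + 4)) / (μ * C₁) * q := by
    rw [errRate]
    linarith
  rw [hlyap]
  linarith

/-- The pathwise inequality contains the predictions instead of the new inner errors, because the
gradient noise averages out only in expectation. `EB.add_sum_of_lintegral_le` makes the exchange
inside the weighted sum. -/
theorem eb_lyap_succ (hC : Large d c μ C₁) {t : ℕ} (ht : t < X.T) {v : ℝ} (hv : 0 ≤ v)
    (h : EB X.P (X.lyap t) v) : EB X.P (X.lyap (t + 1))
      ((1 - 2 / (C₁ + t) + 2 * c.total ^ 2 * X.β t ^ 2) * v + lyapNoise d c *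
        (X.β t * (X.eps t + X.delta t ^ 2 + (1 / X.T) ^ 2 +
          min 1 (etaSeq C₁ (Real.sqrt X.ρ) t ^ 2)) + X.β t ^ 2 / X.K)) := by
  have h0 := X.one_le_total
  have hβ := X.β_pos t
  have hC0 := X.C₁_pos
  have hr := X.levelRatio_pos
  have hr1 := X.levelRatio_le_one
  have hA := X.innerWeight_nonneg
  have hG := X.gradConst_nonneg
  have hD := X.dirNoiseConst_nonneg
  have hcr := X.consRate_nonneg
  have hdc := X.dirConst_nonneg
  have heps := X.eps_nonneg t
  have hn : (0 : ℝ) ≤ t := Nat.cast_nonneg t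
  set η := min 1 (etaSeq C₁ (Real.sqrt X.ρ) t ^ 2) with hη
  have hη0 : 0 ≤ η := le_min zero_le_one (sq_nonneg _)
  set θ := 1 - 2 / (C₁ + t) + 2 * c.total ^ 2 * X.β t ^ 2 with hθ
  have hθ0 : 0 ≤ θ := by
    have : 2 / (C₁ + t) ≤ 1 := by
      rw [div_le_one (by positivity)]
      linarith [X.three_le]
    have : 0 ≤ 2 * c.total ^ 2 * X.β t ^ 2 := by positivity
    linarith
  set δ := X.delta t ^ 2 + (1 / X.T : ℝ) ^ 2 with hδ
  have hδ0 : 0 ≤ δ := by positivity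
  have k1 := EB.msq X.card_pos (mul_nonneg hD heps) fun k => X.eb_norm_z_sub ht.le k
  have k2 : EB X.P (fun _ => gradConst d c * δ) (gradConst d c * δ) := EB.const (mul_nonneg hG hδ0)
  have k3 := (X.eb_cons ht.le).const_mul hcr
  have hcc : 0 ≤ (1 + dirConst c + M * c.total ^ 2) * η := by positivity
  have k4 := (h.const_mul hθ0).add (((k1.add k2 (mul_nonneg hD heps) (mul_nonneg hG hδ0)).add k3
    (add_nonneg (mul_nonneg hD heps) (mul_nonneg hG hδ0)) (mul_nonneg hcr hcc)).const_mul hβ.le)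
    (mul_nonneg hθ0 hv) (by positivity)
  set e := θ * v + X.β t * (dirNoiseConst d c * X.eps t + gradConst d c * δ +
    consRate c * ((1 + dirConst c + M * c.total ^ 2) * η)) with he
  have he0 : 0 ≤ e := by positivity
  have hall : ∀ t, ∀ q : Query M X.K, q.round < t → Measurable (X.ξ q) :=
    fun _ q _ => X.sampling.measurable q
  have hmerr : Measurable (X.errSum (t + 1)) := by
    have hch : ∀ {V : Type} [NormedAddCommGroup V] [NormedSpace ℝ V] [FiniteDimensional ℝ V]
        [MeasurableSpace V] [BorelSpace V] (ch : X.Chan V), Measurable (ch.err (t + 1)) := by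
      intro V _ _ _ _ _ ch
      have hp : ProperSpace V := FiniteDimensional.proper ℝ V
      have hs : Continuous ch.star := by
        refine (LipschitzWith.of_dist_le_mul (K := Real.toNNReal (2 * c.total ^ (2 * M + 2)))
          fun x x' => ?_).continuous
        rw [Real.coe_toNNReal _ (by positivity), dist_eq_norm, dist_eq_norm]
        exact ch.norm_star_sub_le x x'
      exact ((((Finset.measurable_sum Finset.univ fun k _ => ch.measurable_G (t + 1) (hall _) k).const_smul
        (1 / (X.K : ℝ))).sub (hs.measurable.comp (X.measurable_yBar (t + 1) (hall _) 0))).norm).pow_const 2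
    exact ((hch _).add (hch _)).add (Finset.measurable_sum _ fun m _ => (hch _).add (hch _))
  have hmY : ∀ m : Fin M, Measurable fun ω => X.Y m.succ (t + 1) ω := fun m =>
    (((X.measurable_yBar (t + 1) (hall _) m.succ).sub ((X.continuous_yStar m.succ).measurable.comp
      (X.measurable_yBar (t + 1) (hall _) 0))).norm).pow_const 2
  have hmB : ∀ m : Fin M, Measurable fun ω => ‖X.pred m t ω‖ ^ 2 := fun m =>
    ((((X.measurable_yBar t (hall _) m.succ).sub (((Finset.measurable_sum Finset.univ fun j _ =>
      (X.chY m).measurable_m t (hall _) j).const_smul (1 / (X.K : ℝ))).const_smul (X.β t))).sub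
      ((X.continuous_yStar m.succ).measurable.comp
        (X.measurable_yBar (t + 1) (hall _) 0))).norm).pow_const 2
  have k5 := EB.add_sum_of_lintegral_le (P := X.P) Finset.univ
    (Q := fun ω => X.gap (t + 1) ω + X.errSum (t + 1) ω) (B := fun m ω => ‖X.pred m t ω‖ ^ 2)
    (Y := fun m ω => X.Y m.succ (t + 1) ω) (a := fun m : Fin M => innerWeight c * levelRatio c ^ (m : ℕ))
    (r := fun _ => X.β t ^ 2 * c.total ^ 2 / X.K) (e := e) ((X.measurable_gap (t + 1)).add hmerr)
    (fun ω => add_nonneg (X.gap_nonneg _ ω) (X.errSum_nonneg _ ω)) hmB (fun _ _ => sq_nonneg _) hmY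
    (fun _ _ => sq_nonneg _) (fun m => mul_nonneg hA (pow_nonneg hr.le _)) (fun _ => by positivity) he0
    (k4.mono ((X.ae_lyap_pred_le hC).mono fun ω h => h t ht) le_rfl)
    (fun m => X.lintegral_Y_succ_le m ht.le)
  refine k5.mono_right ?_
  have s1 : ∑ m : Fin M, innerWeight c * levelRatio c ^ (m : ℕ) * (X.β t ^ 2 * c.total ^ 2 / X.K) ≤
      M * (innerWeight c * c.total ^ 2) * (X.β t ^ 2 / X.K) := by
    calc _ ≤ ∑ _m : Fin M, innerWeight c * 1 * (X.β t ^ 2 * c.total ^ 2 / X.K) := by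
          gcongr
          exact pow_le_one₀ hr.le hr1
      _ = _ := by
          rw [Finset.sum_const, Finset.card_univ, Fintype.card_fin, nsmul_eq_mul]
          ring
  refine (add_le_add_right s1 e).trans ?_
  set a₁ := dirNoiseConst d c
  set a₂ := gradConst d c
  set a₃ := consRate c * (1 + dirConst c + M * c.total ^ 2) with ha₃
  set a₄ := M * (innerWeight c * c.total ^ 2) with ha₄
  have ha₃0 : 0 ≤ a₃ := by positivity
  have ha₄0 : 0 ≤ a₄ := by positivity
  have hL : lyapNoise d c = a₁ + a₂ + a₃ + a₄ := rfl
  have s2 : e = θ * v + X.β t * (a₁ * X.eps t + a₂ * δ + a₃ * η) := by rw [he, ha₃]; ring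
  have s3 : a₁ * X.eps t + a₂ * δ + a₃ * η ≤ (a₁ + a₂ + a₃ + a₄) * (X.eps t + δ + η) := by
    have : 0 ≤ a₁ * (δ + η) + a₂ * (X.eps t + η) + a₃ * (X.eps t + δ) + a₄ * (X.eps t + δ + η) := by
      positivity
    linarith
  have s4 : a₄ * (X.β t ^ 2 / X.K) ≤ (a₁ + a₂ + a₃ + a₄) * (X.β t ^ 2 / X.K) := by
    gcongr
    linarith
  have s5 := mul_le_mul_of_nonneg_left s3 hβ.le
  rw [hL, s2]
  have s6 : X.eps t + X.delta t ^ 2 + (1 / X.T : ℝ) ^ 2 + η = X.eps t + δ + η := by rw [hδ]; ring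
  rw [s6]
  linarith

/-- In the confinement sets the inner gradient is bounded by `Λ`, while by strong monotonicity it is
at least `Λ⁻¹` times the distance to the best response. -/
theorem ae_Y_succ_le (m : Fin M) : ∀ᵐ ω ∂X.P, ∀ t ≤ X.T, X.Y m.succ t ω ≤ c.total ^ 4 := by
  filter_upwards [X.ae_mem_yBar] with ω hD t ht
  have h0 := X.one_le_total
  have hx := hD t ht 0
  set y := X.yBar m.succ t ω
  set y' := X.p.yStar m.succ (X.x t ω)
  have h1 := X.regular.inner_gradgAvg_ge m (X.p.yStar m.castSucc (X.x t ω)) y y'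
  rw [X.regular.gradgAvg_yStar, sub_zero] at h1
  have h2 : ‖X.p.gradgAvg m (X.p.yStar m.castSucc (X.x t ω)) y‖ ≤ c.total :=
    norm_avg_le_of_forall (by linarith) fun k => ((X.chY m).norm_mean_le k
      (X.yStar_mem m.castSucc _ hx) (hD t ht m.succ)).trans (X.chY m).C_le
  have h3 := h1.trans ((real_inner_le_norm _ _).trans
    (mul_le_mul_of_nonneg_right h2 (norm_nonneg (y - y'))))
  have h4 : ‖y - y'‖ ≤ c.total ^ 2 := by
    by_contra! hlt
    have h5 : 0 < ‖y - y'‖ := lt_of_le_of_lt (by positivity) hlt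
    rw [sq, ← mul_assoc] at h3
    have h6 := le_of_mul_le_mul_right h3 h5
    rw [inv_mul_le_iff₀ (by linarith)] at h6
    nlinarith
  have h5 := pow_le_pow_left₀ (norm_nonneg _) h4 2
  rw [← pow_mul] at h5
  exact h5

theorem Chan.ae_err_le {V : Type} [NormedAddCommGroup V] [NormedSpace ℝ V]
    [FiniteDimensional ℝ V] [MeasurableSpace V] [BorelSpace V] {X : Sys.{u, v} d c μ C₁} (ch : X.Chan V) :
    ∀ᵐ ω ∂X.P, ∀ t ≤ X.T, ch.err t ω ≤ 4 * c.total ^ 2 := by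
  filter_upwards [ch.ae_norm_G_le, X.ae_mem_yBar] with ω hG hD t ht
  have h0 := X.one_le_total
  have h1 : ‖avg (ch.G t ω)‖ ≤ c.total :=
    norm_avg_le_of_forall (by linarith) fun k => (hG t ht k).trans ch.C_le
  have h2 : ‖ch.star (X.x t ω)‖ ≤ c.total := norm_avg_le_of_forall (by linarith) fun k =>
    (ch.norm_mean_le k (X.yStar_mem _ _ (hD t ht 0)) (X.yStar_mem _ _ (hD t ht 0))).trans ch.C_le
  have h3 := pow_le_pow_left₀ (norm_nonneg _)
    ((norm_sub_le (avg (ch.G t ω)) (ch.star (X.x t ω))).trans (add_le_add h1 h2)) 2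
  refine h3.trans_eq ?_
  ring

theorem lyapInit_nonneg (X : Sys.{u, v} d c μ C₁) : 0 ≤ lyapInit c μ := by
  have := X.one_le_total
  have := X.innerWeight_nonneg
  have := X.μ_pos
  unfold lyapInit
  positivity

theorem eb_lyap_zero : EB X.P (X.lyap 0) (lyapInit c μ) := by
  refine EB.of_ae_le X.lyapInit_nonneg ?_
  filter_upwards [X.ae_mem_yBar, ae_all_iff.2 fun m => X.ae_Y_succ_le m, X.chS.ae_err_le,
    X.chH.ae_err_le, ae_all_iff.2 fun m => (X.chU m).ae_err_le,
    ae_all_iff.2 fun m => (X.chR m 0).ae_err_le] with ω hD hY hS hH hU hR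
  have h0 := X.one_le_total
  have hA := X.innerWeight_nonneg
  have hr := X.levelRatio_pos
  have h1 := X.regular.gap_le X.μ_pos X.pl (hD 0 (Nat.zero_le _) 0)
  have h2 : ∑ m, ((X.chU m).err 0 ω + (X.chR m 0).err 0 ω) ≤ M * (8 * c.total ^ 2) := by
    calc _ ≤ ∑ _m : Fin M, 8 * c.total ^ 2 := Finset.sum_le_sum fun m _ => by
          linarith [hU m 0 (Nat.zero_le _), hR m 0 (Nat.zero_le _)]
      _ = _ := by simp
  have h3 : ∑ m : Fin M, innerWeight c * levelRatio c ^ (m : ℕ) * X.Y m.succ 0 ω ≤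
      M * (innerWeight c * c.total ^ 4) := by
    calc _ ≤ ∑ _m : Fin M, innerWeight c * 1 * c.total ^ 4 := by
          gcongr with m _
          · exact sq_nonneg _
          · exact pow_le_one₀ hr.le X.levelRatio_le_one
          · exact hY m 0 (Nat.zero_le _)
      _ = _ := by
          rw [Finset.sum_const, Finset.card_univ, Fintype.card_fin, nsmul_eq_mul]
          ring
  have h4 := hS 0 (Nat.zero_le _)
  have h5 := hH 0 (Nat.zero_le _)
  have h6 : X.gap 0 ω ≤ (c.total + c.total ^ (3 * M) * c.total) ^ 2 / (2 * μ) := h1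
  unfold lyap errSum lyapInit
  linarith

end Sys

end DSMO

end

noncomputable section

namespace DSMO

open scoped ENNReal

universe u v

/-! ### Summation of the Lyapunov recursion -/

/-- With `n = C₁ + t`, the weight `(n-1)(n-2)` is an exact integrating factor for `1 - 2/n`. The
summable terms `a C₁²/n²` cost only a bounded exponential factor `g`, whose exponent telescopes. -/
theorem weighted_rec_le {C₁ a : ℝ} (hC : 3 ≤ C₁) (ha : 0 ≤ a) {v r : ℕ → ℝ} (hv : ∀ t, 0 ≤ v t)
    (hr : ∀ t, 0 ≤ r t)
    (h : ∀ t : ℕ, v (t + 1) ≤ (1 - 2 / (C₁ + t) + a * (C₁ / (C₁ + t)) ^ 2) * v t + r t) (T : ℕ) :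
    (T : ℝ) ^ 2 * v T ≤ Real.exp (3 * a * C₁ ^ 2) *
      (C₁ ^ 2 * v 0 + ∑ t ∈ Finset.range T, (C₁ + t) ^ 2 * r t) := by
  set g : ℕ → ℝ := fun t => Real.exp (3 * a * C₁ ^ 2 * (1 / (C₁ - 1) - 1 / (C₁ + t - 1))) with hg
  have hg1 : ∀ t, 1 ≤ g t := fun t => by
    have ht : (0 : ℝ) ≤ t := Nat.cast_nonneg t
    refine Real.one_le_exp (mul_nonneg (by positivity) (sub_nonneg.2 ?_))
    exact one_div_le_one_div_of_le (by linarith) (by linarith)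
  have key : ∀ t : ℕ, (C₁ + t - 1) * (C₁ + t - 2) * v t ≤ g t *
      (C₁ ^ 2 * v 0 + ∑ s ∈ Finset.range t, (C₁ + s) ^ 2 * r s) := by
    intro t
    induction t with
    | zero =>
      have e : g 0 = 1 := by simp [hg]
      rw [e]
      simp only [Nat.cast_zero, add_zero, Finset.range_zero, Finset.sum_empty, one_mul]
      refine mul_le_mul_of_nonneg_right ?_ (hv 0)
      nlinarith
    | succ t ih =>
      have ht : (0 : ℝ) ≤ t := Nat.cast_nonneg t
      have hgt := hg1 t
      set n := C₁ + (t : ℝ) with hn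
      have hn3 : 3 ≤ n := by linarith
      set R := C₁ ^ 2 * v 0 + ∑ s ∈ Finset.range t, (C₁ + s) ^ 2 * r s with hR
      have hR0 : 0 ≤ R := add_nonneg (mul_nonneg (sq_nonneg _) (hv 0))
        (Finset.sum_nonneg fun s _ => mul_nonneg (sq_nonneg _) (hr s))
      have h1 := mul_le_mul_of_nonneg_left (h t) (show 0 ≤ n * (n - 1) by nlinarith)
      -- The main part equals `(n-1)(n-2)`; the perturbation is compared with it by `n ≤ 3(n-2)`,
      -- which is where `C₁ ≥ 3` enters.
      have h2 : n * (n - 1) * (1 - 2 / n + a * (C₁ / n) ^ 2) ≤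
          (1 + 3 * a * C₁ ^ 2 * (1 / n ^ 2)) * ((n - 1) * (n - 2)) := by
        have e : n * (n - 1) * (1 - 2 / n + a * (C₁ / n) ^ 2) =
            (n - 1) * (n - 2) + a * C₁ ^ 2 * (1 / n ^ 2) * (n - 1) * n := by
          field_simp
        have h3 : 0 ≤ a * C₁ ^ 2 * (1 / n ^ 2) * (n - 1) :=
          mul_nonneg (by positivity) (by linarith)
        have h4 := mul_le_mul_of_nonneg_left (show n ≤ 3 * (n - 2) by linarith) h3
        rw [e]
        linarith
      have h3 : g t * (1 + 3 * a * C₁ ^ 2 * (1 / n ^ 2)) ≤ g (t + 1) := by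
        have e : g (t + 1) = g t * Real.exp (3 * a * C₁ ^ 2 * (1 / (n - 1) - 1 / n)) := by
          simp only [hg]
          rw [← Real.exp_add]
          push_cast
          rw [← add_assoc, ← hn, add_sub_cancel_right]
          congr 1
          ring
        rw [e]
        refine mul_le_mul_of_nonneg_left ?_ (by linarith)
        have h5 := Real.add_one_le_exp (3 * a * C₁ ^ 2 * (1 / (n - 1) - 1 / n))
        have h6 : 1 / n ^ 2 ≤ 1 / (n - 1) - 1 / n := by
          rw [div_sub_div _ _ (by linarith) (by linarith), div_le_div_iff₀ (by positivity) (by nlinarith)]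
          nlinarith
        have h7 := mul_le_mul_of_nonneg_left h6 (show 0 ≤ 3 * a * C₁ ^ 2 by positivity)
        linarith
      have hx : 0 ≤ 3 * a * C₁ ^ 2 * (1 / n ^ 2) := by positivity
      have h4 : n * (n - 1) * v (t + 1) ≤ (1 + 3 * a * C₁ ^ 2 * (1 / n ^ 2)) * (g t * R) + n ^ 2 * r t := by
        have h5 := mul_le_mul_of_nonneg_right h2 (hv t)
        have h6 := mul_le_mul_of_nonneg_left ih
          (show 0 ≤ 1 + 3 * a * C₁ ^ 2 * (1 / n ^ 2) by positivity)
        have h7 : n * (n - 1) * r t ≤ n ^ 2 * r t :=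
          mul_le_mul_of_nonneg_right (by nlinarith) (hr t)
        linarith
      have h5 := mul_le_mul_of_nonneg_right h3 hR0
      have h6 : n ^ 2 * r t ≤ g (t + 1) * (n ^ 2 * r t) :=
        le_mul_of_one_le_left (mul_nonneg (sq_nonneg _) (hr t)) (hg1 _)
      rw [Finset.sum_range_succ, ← add_assoc, ← hR, ← hn]
      push_cast
      have e1 : C₁ + ((t : ℝ) + 1) - 1 = n := by rw [hn]; ring
      have e2 : C₁ + ((t : ℝ) + 1) - 2 = n - 1 := by rw [hn]; ring
      rw [e1, e2, mul_add]
      linarith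
  have hT : (0 : ℝ) ≤ T := Nat.cast_nonneg T
  have h1 : (T : ℝ) ^ 2 * v T ≤ (C₁ + T - 1) * (C₁ + T - 2) * v T :=
    mul_le_mul_of_nonneg_right (by nlinarith) (hv T)
  refine h1.trans ((key T).trans (mul_le_mul_of_nonneg_right ?_ ?_))
  · refine Real.exp_le_exp.2 (mul_le_of_le_one_right (by positivity) ?_)
    have h2 : 1 / (C₁ - 1) ≤ 1 := by rw [div_le_one (by linarith)]; linarith
    have h3 : 0 ≤ 1 / (C₁ + T - 1) := div_nonneg zero_le_one (by linarith)
    linarith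
  · exact add_nonneg (mul_nonneg (sq_nonneg _) (hv 0))
      (Finset.sum_nonneg fun s _ => mul_nonneg (sq_nonneg _) (hr s))

/-- The constant of the convergence rate. -/
def rateConst {M : ℕ} (d : Fin (M + 1) → ℕ) (c : Constants M) (μ C₁ : ℝ) : ℝ :=
  Real.exp (3 * (2 * c.total ^ 2) * C₁ ^ 2) * (3 * lyapNoise d c * C₁ ^ 2 +
    (2 * C₁ ^ 2 * lyapInit c μ + lyapNoise d c * C₁ * (472 * C₁ ^ 2 + 2 * (C₁ + 1))))

namespace Sys

variable {M : ℕ} {d : Fin (M + 1) → ℕ} {c : Constants M} {μ C₁ : ℝ} (X : Sys.{u, v} d c μ C₁)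

/-- The perturbations of the Lyapunov recursion. -/
def pert (t : ℕ) : ℝ := lyapNoise d c *
  (X.β t * (X.eps t + X.delta t ^ 2 + (1 / X.T) ^ 2 + min 1 (etaSeq C₁ (Real.sqrt X.ρ) t ^ 2)) +
    X.β t ^ 2 / X.K)

theorem lyapNoise_nonneg (X : Sys.{u, v} d c μ C₁) : 0 ≤ lyapNoise d c := by
  have := X.one_le_total
  have := X.dirNoiseConst_nonneg
  have := X.gradConst_nonneg
  have := X.consRate_nonneg
  have := X.innerWeight_nonneg
  have := X.dirConst_nonneg
  unfold lyapNoise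
  positivity

theorem pert_nonneg (t : ℕ) : 0 ≤ X.pert t := by
  have := X.lyapNoise_nonneg
  have := X.β_pos t
  have := X.eps_nonneg t
  have : 0 ≤ min 1 (etaSeq C₁ (Real.sqrt X.ρ) t ^ 2) := le_min zero_le_one (sq_nonneg _)
  unfold pert
  positivity

/-- The bounds for the expectations of the Lyapunov function. -/
def lyapBound : ℕ → ℝ
  | 0 => lyapInit c μ
  | t + 1 => (1 - 2 / (C₁ + t) + 2 * c.total ^ 2 * (C₁ / (C₁ + t)) ^ 2) * lyapBound t + X.pert t

theorem lyapBound_nonneg (t : ℕ) : 0 ≤ X.lyapBound t := by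
  induction t with
  | zero => exact X.lyapInit_nonneg
  | succ t ih =>
    have hn : (0 : ℝ) ≤ t := Nat.cast_nonneg t
    have hC := X.three_le
    have h1 : 2 / (C₁ + t) ≤ 1 := by
      rw [div_le_one (by linarith)]
      linarith
    have h2 : 0 ≤ 2 * c.total ^ 2 * (C₁ / (C₁ + t)) ^ 2 := by positivity
    exact add_nonneg (mul_nonneg (by linarith) ih) (X.pert_nonneg t)

theorem eb_lyap (hC : Large d c μ C₁) : ∀ t ≤ X.T, EB X.P (X.lyap t) (X.lyapBound t) := by
  intro t
  induction t with
  | zero => exact fun _ => X.eb_lyap_zero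
  | succ t ih => exact fun ht => X.eb_lyap_succ hC ht (X.lyapBound_nonneg t) (ih (Nat.le_of_succ_le ht))

/-- Only `p_t/K` and `β²/K` are of first order, and they give `3C₁² T/K`. The weighted terms with
`q_t` and `delta²` decay like `1/(C₁+t)` and sum to logarithms, the Neumann bias `1/T²` sums to a
constant, and the truncated consensus error is `sum_min_etaSeq_le`. -/
theorem sum_sq_mul_pert_le : ∑ t ∈ Finset.range X.T, (C₁ + t) ^ 2 * X.pert t ≤
    lyapNoise d c * (3 * C₁ ^ 2 * (X.T / X.K) +
      C₁ * (472 * C₁ ^ 2 + 2 * (C₁ + 1)) * (Real.log X.T / (1 - X.ρ) ^ 2)) := by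
  have hC := X.three_le
  have hC0 := X.C₁_pos
  have hK : (0 : ℝ) < X.K := by exact_mod_cast X.card_pos
  have hT : (2 : ℝ) ≤ X.T := by exact_mod_cast X.two_le
  have hρ0 := X.ρ_pos
  have hρ1 := X.ρ_lt_one
  have hr0 := X.sqrt_ρ_pos
  have hr1 := X.sqrt_ρ_lt_one
  have hρr := X.sq_sqrt_ρ
  set r := Real.sqrt X.ρ with hr
  have hlog : 1 / 2 ≤ Real.log X.T :=
    (by linarith [Real.log_two_gt_d9] : (1 : ℝ) / 2 ≤ Real.log 2).trans
      (Real.log_le_log (by norm_num) hT)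
  set H := 1 / (1 - r) ^ 2 with hH
  have h1r : 0 < 1 - r := by linarith
  have h1ρ : 0 < 1 - X.ρ := by linarith
  have hH0 : 0 < H := by positivity
  have hH1 : 1 / (1 - X.ρ) ≤ H := by
    rw [hH]
    refine one_div_le_one_div_of_le (by positivity) ?_
    rw [hρr]
    nlinarith
  -- Passage from `r = √ρ` back to `ρ`: `1 - ρ = (1-r)(1+r)` and `(1+r)² ≤ 4`.
  have hH2 : H ≤ 4 * (1 / (1 - X.ρ) ^ 2) := by
    rw [hH, mul_one_div, div_le_div_iff₀ (by positivity) (by positivity), one_mul]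
    have e : 1 - X.ρ = (1 - r) * (1 + r) := by
      rw [hρr]
      ring
    rw [e, mul_pow]
    nlinarith [sq_nonneg (1 - r)]
  set ℓ := Real.log X.T / (1 - X.ρ) ^ 2 with hℓ
  have hℓ1 : 1 ≤ 2 * ℓ := by
    have h1 : (1 - X.ρ) ^ 2 ≤ 1 := pow_le_one₀ h1ρ.le (by linarith)
    rw [hℓ, mul_div_assoc', le_div_iff₀ (by positivity)]
    linarith
  have hHℓ : H * Real.log X.T ≤ 4 * ℓ := by
    have := mul_le_mul_of_nonneg_right hH2 (show 0 ≤ Real.log X.T by linarith)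
    refine this.trans_eq ?_
    rw [hℓ]
    ring
  have hterm : ∀ t ∈ Finset.range X.T, (C₁ + t) ^ 2 * X.pert t ≤ lyapNoise d c *
      (3 * C₁ ^ 2 * (1 / X.K) + 6 * C₁ ^ 3 * H * (1 / (C₁ + t)) + C₁ * ((C₁ + X.T) / X.T ^ 2) +
        C₁ * ((C₁ + t) * min 1 (etaSeq C₁ r t ^ 2))) := by
    intro t ht
    have htT : (t : ℝ) ≤ X.T := by exact_mod_cast (Finset.mem_range.1 ht).le
    have hn : (0 : ℝ) ≤ t := Nat.cast_nonneg t
    rw [pert, mul_left_comm]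
    refine mul_le_mul_of_nonneg_left ?_ X.lyapNoise_nonneg
    set m := min 1 (etaSeq C₁ r t ^ 2)
    set n := C₁ + (t : ℝ) with hn'
    have hn0 : 0 < n := by linarith
    have e1 : n ^ 2 * (X.β t * (X.eps t + X.delta t ^ 2 + (1 / X.T) ^ 2 + m) + X.β t ^ 2 / X.K) =
        C₁ * (n * X.eps t) + C₁ * (n * X.delta t ^ 2) + C₁ * (n / X.T ^ 2) + C₁ * (n * m) +
          C₁ ^ 2 * (1 / X.K) := by
      have : X.β t = C₁ / n := rfl
      rw [this]
      field_simp
    have e2 : n * X.eps t ≤ 2 * C₁ * (1 / X.K) + 2 * C₁ ^ 2 * H * (1 / n) := by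
      have p1 : pSeq C₁ t ≤ 2 * C₁ / n :=
        variance_rec_le (by linarith) (by simp [pSeq]) (fun _ => le_rfl) t
      have p2 : qSeq C₁ X.ρ t ≤ 2 * C₁ ^ 2 / (1 - X.ρ) * (1 / n ^ 2) :=
        consensus_variance_rec_le hC hρ0.le hρ1 (by simp [qSeq]) (fun _ => le_rfl) t
      calc n * X.eps t ≤ n * (2 * C₁ / n / X.K + 2 * C₁ ^ 2 / (1 - X.ρ) * (1 / n ^ 2)) := by
            unfold eps
            gcongr
        _ = 2 * C₁ * (1 / X.K) + 2 * C₁ ^ 2 * (1 / (1 - X.ρ)) * (1 / n) := by field_simp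
        _ ≤ _ := by gcongr
    have e3 : n * X.delta t ^ 2 = 4 * C₁ ^ 2 * H * (1 / n) := by
      have : X.delta t = 2 * C₁ / (1 - r) * (1 / n) := rfl
      rw [this, hH]
      field_simp
      ring
    have e4 : n / X.T ^ 2 ≤ (C₁ + X.T) / X.T ^ 2 :=
      div_le_div_of_nonneg_right (by linarith) (by positivity)
    have e5 := mul_le_mul_of_nonneg_left e2 hC0.le
    have e6 := mul_le_mul_of_nonneg_left e4 hC0.le
    rw [e1, e3]
    linarith
  refine (Finset.sum_le_sum hterm).trans ?_
  rw [← Finset.mul_sum]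
  refine mul_le_mul_of_nonneg_left ?_ X.lyapNoise_nonneg
  rw [Finset.sum_add_distrib, Finset.sum_add_distrib, Finset.sum_add_distrib, Finset.sum_const,
    Finset.sum_const, Finset.card_range, nsmul_eq_mul, nsmul_eq_mul, ← Finset.mul_sum, ← Finset.mul_sum]
  have s1 := mul_le_mul_of_nonneg_left (sum_inv_le_log (C₁ := C₁) (by linarith) X.T)
    (show 0 ≤ 6 * C₁ ^ 3 * H by positivity)
  have s2 := mul_le_mul_of_nonneg_left (sum_min_etaSeq_le hC hr0.le hr1 X.two_le) hC0.le
  have s3 : (X.T : ℝ) * (C₁ * ((C₁ + X.T) / X.T ^ 2)) ≤ C₁ * (C₁ + 1) := by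
    have : (X.T : ℝ) * (C₁ * ((C₁ + X.T) / X.T ^ 2)) = C₁ * (C₁ / X.T + 1) := by field_simp
    rw [this]
    refine mul_le_mul_of_nonneg_left (add_le_add_left ?_ _) hC0.le
    exact div_le_self hC0.le (by linarith)
  have s4 : 6 * C₁ ^ 3 * H * (1 + Real.log X.T) ≤ 6 * C₁ ^ 3 * (12 * ℓ) := by
    have h1 : H * (1 + Real.log X.T) ≤ 12 * ℓ := by
      have : H * (1 + Real.log X.T) ≤ H * (3 * Real.log X.T) :=
        mul_le_mul_of_nonneg_left (by linarith) hH0.le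
      linarith
    have := mul_le_mul_of_nonneg_left h1 (show 0 ≤ 6 * C₁ ^ 3 by positivity)
    linarith
  have s5 : C₁ * (100 * C₁ ^ 2 * (Real.log X.T / (1 - r) ^ 2)) ≤ 100 * C₁ ^ 3 * (4 * ℓ) := by
    have e : Real.log X.T / (1 - r) ^ 2 = H * Real.log X.T := by
      rw [hH]
      ring
    rw [e]
    have := mul_le_mul_of_nonneg_left hHℓ (show 0 ≤ 100 * C₁ ^ 3 by positivity)
    linarith
  have s6 := mul_le_mul_of_nonneg_left hℓ1 (show 0 ≤ C₁ * (C₁ + 1) by positivity)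
  have s7 : (X.T : ℝ) * (3 * C₁ ^ 2 * (1 / X.K)) = 3 * C₁ ^ 2 * (X.T / X.K) := by ring
  rw [s7]
  linarith

theorem lyapBound_le : X.lyapBound X.T ≤ rateConst d c μ C₁ * (1 / (X.K * X.T)) +
    rateConst d c μ C₁ * (Real.log X.T / (X.T ^ 2 * (1 - X.ρ) ^ 2)) := by
  have hC0 := X.C₁_pos
  have hK : (0 : ℝ) < X.K := by exact_mod_cast X.card_pos
  have hT : (2 : ℝ) ≤ X.T := by exact_mod_cast X.two_le
  have hρ1 := X.ρ_lt_one
  have hL := X.lyapNoise_nonneg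
  have hI := X.lyapInit_nonneg
  have h1ρ : 0 < 1 - X.ρ := by linarith
  have h := weighted_rec_le X.three_le (show 0 ≤ 2 * c.total ^ 2 by positivity) X.lyapBound_nonneg
    X.pert_nonneg (fun t => le_rfl) X.T
  have hs := X.sum_sq_mul_pert_le
  set ℓ := Real.log X.T / (1 - X.ρ) ^ 2 with hℓ
  have hlog : 1 / 2 ≤ Real.log X.T :=
    (by linarith [Real.log_two_gt_d9] : (1 : ℝ) / 2 ≤ Real.log 2).trans
      (Real.log_le_log (by norm_num) hT)
  have hℓ1 : 1 ≤ 2 * ℓ := by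
    have h1 : (1 - X.ρ) ^ 2 ≤ 1 := pow_le_one₀ h1ρ.le (by linarith [X.ρ_pos])
    rw [hℓ, mul_div_assoc', le_div_iff₀ (by positivity)]
    linarith
  have h0 : X.lyapBound 0 = lyapInit c μ := rfl
  rw [h0] at h
  set E := Real.exp (3 * (2 * c.total ^ 2) * C₁ ^ 2)
  set a := 3 * lyapNoise d c * C₁ ^ 2 with ha
  set b := 2 * C₁ ^ 2 * lyapInit c μ + lyapNoise d c * C₁ * (472 * C₁ ^ 2 + 2 * (C₁ + 1)) with hb
  have ha0 : 0 ≤ a := by positivity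
  have hb0 : 0 ≤ b := by positivity
  have hE : 0 < E := Real.exp_pos _
  have hA : rateConst d c μ C₁ = E * (a + b) := rfl
  have h1 : C₁ ^ 2 * lyapInit c μ + ∑ t ∈ Finset.range X.T, (C₁ + t) ^ 2 * X.pert t ≤
      (a + b) * (X.T / X.K + ℓ) := by
    have h2 := mul_le_mul_of_nonneg_left hℓ1 (show 0 ≤ C₁ ^ 2 * lyapInit c μ by positivity)
    have h3 : 0 ≤ a * ℓ + b * (X.T / X.K) := by
      have : 0 ≤ ℓ := by linarith
      positivity
    have h4 : a * (X.T / X.K) + b * ℓ = lyapNoise d c * (3 * C₁ ^ 2 * (X.T / X.K) +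
      C₁ * (472 * C₁ ^ 2 + 2 * (C₁ + 1)) * ℓ) + C₁ ^ 2 * lyapInit c μ * (2 * ℓ) := by
      rw [ha, hb]
      ring
    linarith
  have h2 := h.trans (mul_le_mul_of_nonneg_left h1 hE.le)
  have h3 : X.lyapBound X.T ≤ E * ((a + b) * (X.T / X.K + ℓ)) / X.T ^ 2 := by
    rw [le_div_iff₀ (by positivity)]
    linarith
  refine h3.trans_eq ?_
  rw [hA, hℓ]
  field_simp

theorem integral_F_le (hC : Large d c μ C₁) : Integrable (fun ω => X.p.F (X.x X.T ω)) X.P ∧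
    ∫ ω, X.p.F (X.x X.T ω) ∂X.P - X.p.FStar ≤ rateConst d c μ C₁ * (1 / (X.K * X.T)) +
      rateConst d c μ C₁ * (Real.log X.T / (X.T ^ 2 * (1 - X.ρ) ^ 2)) := by
  have h1 : EB X.P (X.gap X.T) (X.lyapBound X.T) := by
    refine (X.eb_lyap hC X.T le_rfl).mono (Filter.Eventually.of_forall fun ω => ?_) le_rfl
    have h2 := X.errSum_nonneg X.T ω
    have h3 : 0 ≤ ∑ m : Fin M, innerWeight c * levelRatio c ^ (m : ℕ) * X.Y m.succ X.T ω :=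
      Finset.sum_nonneg fun m _ => mul_nonneg (mul_nonneg X.innerWeight_nonneg
        (pow_nonneg X.levelRatio_pos.le _)) (sq_nonneg _)
    unfold lyap
    linarith
  obtain ⟨h2, h3⟩ := h1.integral_le (X.lyapBound_nonneg _) (X.measurable_gap _).aestronglyMeasurable
    (Filter.Eventually.of_forall fun ω => X.gap_nonneg _ ω)
  have e : (fun ω => X.p.F (X.x X.T ω)) = fun ω => X.gap X.T ω + X.p.FStar := by
    funext ω
    rw [gap, sub_add_cancel]
  rw [e]
  refine ⟨h2.add (integrable_const _), ?_⟩
  rw [integral_add h2 (integrable_const _)]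
  simp only [integral_const, probReal_univ, one_smul, add_sub_cancel_right]
  exact h3.trans X.lyapBound_le

end Sys

end DSMO

end

noncomputable section

namespace DSMO

universe u v

/-! ### From the rate to the iteration and sample complexities. -/

theorem pow_succ_le_one_div_of_logb_le {q : ℝ} (hq0 : 0 ≤ q) (hq1 : q < 1) {T b : ℕ} (hT : 2 ≤ T)
    (hb : 3 * Real.logb (1 / q) T ≤ b) : q ^ (b + 1) ≤ 1 / T := by
  have hT' : (0 : ℝ) < T := by positivity
  rcases hq0.eq_or_lt with rfl | hq
  · rw [zero_pow (Nat.succ_ne_zero b)]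
    positivity
  · have hlog : 0 < Real.log (1 / q) := Real.log_pos (by rw [lt_div_iff₀ hq]; linarith)
    have hlogT : 0 ≤ Real.log T := Real.log_nonneg (by exact_mod_cast (by omega : 1 ≤ T))
    rw [Real.logb, mul_div_assoc', div_le_iff₀ hlog] at hb
    rw [← Real.log_le_log_iff (by positivity) (by positivity), Real.log_pow, one_div, Real.log_inv]
    rw [one_div, Real.log_inv] at hb hlog
    push_cast
    nlinarith

theorem integral_F_xBar_le {M : ℕ} {d : Fin (M + 1) → ℕ} {c : Constants M} {μ C₁ B : ℝ} (hμ : 0 < μ)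
    (h3 : 3 ≤ C₁) (h2 : 2 ≤ μ * C₁) (hC : Large d c μ C₁) {K : ℕ} {ρ : ℝ} (hρ0 : 0 < ρ) (hρ1 : ρ < 1)
    {W : Matrix (Fin K) (Fin K) ℝ} {S : Type u} [MeasurableSpace S] {Ω : Type v} [MeasurableSpace Ω]
    {P : Measure Ω} [IsProbabilityMeasure P] {p : Problem d K} {o : Oracle d K S}
    {ξ : Query M K → Ω → S} {D : (m : Fin (M + 1)) → Set (Vec (d m))} {b : ℕ → Fin M → ℕ}
    (ho : o.IsUnbiased p) (hξ : IsSampling o P ξ) (hW : IsGossip W ρ) (hout : OuterAssumption c p o D)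
    (hin : InnerAssumption c p o D) (hPL : p.PL μ) (hb : LogSampling c B b)
    (hD : Confined p o W P ξ (fun T => plParams c μ C₁ (b T)) D) {T : ℕ} (hT : 2 ≤ T) :
    Integrable (fun ω => p.F (run (plParams c μ C₁ (b T)) W o (fun q => ξ q ω) T).xBar) P ∧
    ∫ ω, p.F (run (plParams c μ C₁ (b T)) W o (fun q => ξ q ω) T).xBar ∂P - p.FStar ≤
      rateConst d c μ C₁ * (1 / (K * T)) +
        rateConst d c μ C₁ * (Real.log T / (T ^ 2 * (1 - ρ) ^ 2)) := by
  let X : Sys.{u, v} d c μ C₁ :=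
    { K := K, ρ := ρ, W := W, S := S, Ω := Ω, P := P, p := p, o := o, ξ := ξ, D := D, b := b T, T := T
      ρ_pos := hρ0
      ρ_lt_one := hρ1
      unbiased := ho
      sampling := hξ
      gossip := hW
      outer := hout
      inner := hin
      pl := hPL
      contraction_pow := fun m => pow_succ_le_one_div_of_logb_le
        (sub_nonneg.2 ((c.κ_le m).trans (c.μg_div_le m))) (by linarith [c.κ_pos m]) hT (hb T hT m).1
      convex := hD.convex
      yStar_mem := hD.yStar_mem
      run_mem := hD.run_mem T hT
      two_le := hT
      μ_pos := hμ
      three_le := h3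
      two_le_mul := h2 }
  exact X.integral_F_le hC

/-- The threshold for `C₁`. -/
def threshold {M : ℕ} (d : Fin (M + 1) → ℕ) (c : Constants M) (μ : ℝ) : ℝ :=
  3 + 4 * c.total + (2 + 8 * |smoothConst c| + 4 * |gradConst d c| + 4 * |driftConst c|) / μ

theorem threshold_spec {M : ℕ} (d : Fin (M + 1) → ℕ) (c : Constants M) {μ C₁ : ℝ} (hμ : 0 < μ)
    (h : threshold d c μ ≤ C₁) : 3 ≤ C₁ ∧ 2 ≤ μ * C₁ ∧ Large d c μ C₁ := by
  have h0 : 1 ≤ c.total := c.total_spec.1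
  unfold threshold at h
  have s := abs_nonneg (smoothConst c)
  have g := abs_nonneg (gradConst d c)
  have e := abs_nonneg (driftConst c)
  set N := 2 + 8 * |smoothConst c| + 4 * |gradConst d c| + 4 * |driftConst c| with hN
  have hN0 : 0 ≤ N / μ := by positivity
  have h1 : N ≤ μ * C₁ := by
    rw [← div_le_iff₀' hμ]
    linarith
  have s' := le_abs_self (smoothConst c)
  have g' := le_abs_self (gradConst d c)
  have e' := le_abs_self (driftConst c)
  exact ⟨by linarith, by linarith, ⟨by linarith, by linarith, by linarith, by linarith⟩⟩

/-- The iteration complexity that corresponds to the rate. -/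
theorem rate_le_of_le {A ρ ε : ℝ} {K T : ℕ} (hA : 0 < A) (hK : 0 < K) (hρ : ρ < 1) (hε : 0 < ε)
    (hε' : ε * (2 * (K + 1) ^ 3) ≤ A * (1 - ρ) ^ 4) (hT : 2 ≤ T) (h : 2 * A / (K * ε) ≤ T) :
    A * (1 / (K * T)) + A * (Real.log T / (T ^ 2 * (1 - ρ) ^ 2)) ≤ ε := by
  have hK' : (1 : ℝ) ≤ K := by exact_mod_cast hK
  have hT' : (2 : ℝ) ≤ T := by exact_mod_cast hT
  have hr : 0 < 1 - ρ := by linarith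
  have h1 : 2 * A ≤ K * T * ε := by
    rw [div_le_iff₀ (by positivity)] at h
    linarith
  have h2 : A * (1 / (K * T)) ≤ ε / 2 := by
    rw [mul_one_div, div_le_iff₀ (by positivity)]
    linarith
  -- Small `ε` forces `T` to be large compared with the network constants. Together with `log T ≤
  -- 2√T` this yields `K log T ≤ T(1-ρ)²`, so the network term is at most `A/(KT)`.
  have h3 : 4 * (K : ℝ) ^ 2 ≤ T * (1 - ρ) ^ 4 := by
    have h4 : (K : ℝ) ^ 3 ≤ (K + 1) ^ 3 := pow_le_pow_left₀ (by positivity) (by linarith) 3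
    have h5 : 2 * A * (2 * K ^ 2) ≤ 2 * A * (T * (1 - ρ) ^ 4 / 2) := by
      have h6 := mul_le_mul_of_nonneg_right h1 (show 0 ≤ 2 * (K : ℝ) ^ 2 by positivity)
      have h7 : ε * (2 * (K : ℝ) ^ 3) ≤ A * (1 - ρ) ^ 4 := by
        refine le_trans ?_ hε'
        gcongr
      have h8 := mul_le_mul_of_nonneg_left h7 (show 0 ≤ (T : ℝ) by positivity)
      linarith
    have := le_of_mul_le_mul_left h5 (by positivity)
    linarith
  have h4 : Real.log T ≤ 2 * Real.sqrt T := by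
    have h5 := Real.log_le_sub_one_of_pos (show 0 < Real.sqrt T by positivity)
    have h6 : Real.log (Real.sqrt T) = Real.log T / 2 := Real.log_sqrt (by positivity)
    linarith
  have h5 : 2 * (K : ℝ) ≤ Real.sqrt T * (1 - ρ) ^ 2 := by
    refine le_of_sq_le_sq ?_ (by positivity)
    rw [mul_pow, mul_pow, Real.sq_sqrt (by positivity), ← pow_mul]
    norm_num
    exact h3
  have h6 : A * (Real.log T / (T ^ 2 * (1 - ρ) ^ 2)) ≤ ε / 2 := by
    rw [mul_div_assoc', div_le_iff₀ (by positivity)]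
    have h7 : K * Real.log T ≤ T * (1 - ρ) ^ 2 := by
      calc K * Real.log T ≤ K * (2 * Real.sqrt T) := by gcongr
        _ = (2 * K) * Real.sqrt T := by ring
        _ ≤ (Real.sqrt T * (1 - ρ) ^ 2) * Real.sqrt T := by gcongr
        _ = (Real.sqrt T * Real.sqrt T) * (1 - ρ) ^ 2 := by ring
        _ = _ := by rw [Real.mul_self_sqrt (by positivity)]
    have h8 := mul_le_mul_of_nonneg_right h1 (show 0 ≤ Real.log T from Real.log_nonneg (by linarith))
    have h9 := mul_le_mul_of_nonneg_left h7 (show 0 ≤ T * ε by positivity)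
    linarith
  linarith

/-- The sample complexity that corresponds to the rate. -/
theorem samplesPerAgent_le {M : ℕ} {a : Params M} {A B ε : ℝ} {K T : ℕ} (hA : 0 < A) (hB : 0 < B)
    (hK : 0 < K) (hε : 0 < ε) (hε1 : ε ≤ 1 / 2) (h2 : 2 ≤ 2 * A / (K * ε))
    (hT : T = ⌈2 * A / (K * ε)⌉₊) (hb : ∀ m, (a.b m : ℝ) ≤ B * Real.log T) :
    (samplesPerAgent a T : ℝ) ≤
      4 * A * (2 * (1 + M) + M * B * (2 * |Real.log (4 * A)| + 1)) / (K * ε) * Real.log (1 / ε) := by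
  have hK' : (1 : ℝ) ≤ K := by exact_mod_cast hK
  have h3 : (T : ℝ) ≤ 4 * A / (K * ε) := by
    have := (Nat.ceil_lt_add_one (show 0 ≤ 2 * A / (K * ε) by positivity)).le
    rw [← hT] at this
    have e : 4 * A / (K * ε) = 2 * A / (K * ε) + 2 * A / (K * ε) := by ring
    linarith
  have h4 : (2 : ℝ) ≤ T := h2.trans (hT ▸ Nat.le_ceil _)
  have hl : 1 / 2 ≤ Real.log (1 / ε) := by
    have h5 : (2 : ℝ) ≤ 1 / ε := by
      rw [le_div_iff₀ hε]
      linarith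
    exact (by linarith [Real.log_two_gt_d9] : (1 : ℝ) / 2 ≤ Real.log 2).trans
      (Real.log_le_log (by norm_num) h5)
  set l := Real.log (1 / ε) with hl_def
  -- Since `T ≤ 4A/ε`, the logarithm of `T` exceeds `log(1/ε)` only by `log(4A)`, which is absorbed
  -- because `log(1/ε) ≥ 1/2`.
  have h5 : Real.log T ≤ (2 * |Real.log (4 * A)| + 1) * l := by
    have h6 : (T : ℝ) ≤ 4 * A * (1 / ε) := by
      refine h3.trans ?_
      rw [mul_one_div]
      refine div_le_div_of_nonneg_left (by positivity) hε ?_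
      nlinarith
    have h7 := Real.log_le_log (by linarith) h6
    rw [Real.log_mul (by positivity) (by positivity)] at h7
    have h8 := le_abs_self (Real.log (4 * A))
    have h9 := mul_le_mul_of_nonneg_left hl (abs_nonneg (Real.log (4 * A)))
    linarith
  have h6 : ∑ m, (1 + (a.b m : ℝ)) ≤ M * (1 + B * Real.log T) := by
    calc _ ≤ ∑ _m : Fin M, (1 + B * Real.log T) := Finset.sum_le_sum fun m _ => by linarith [hb m]
      _ = _ := by
          simp
          ring
  have h7 : 1 + ∑ m, (1 + (a.b m : ℝ)) ≤
      (2 * (1 + M) + M * B * (2 * |Real.log (4 * A)| + 1)) * l := by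
    have h8 := mul_le_mul_of_nonneg_left h5 (show 0 ≤ M * B by positivity)
    have h9 := mul_le_mul_of_nonneg_left hl (show (0 : ℝ) ≤ 2 * (1 + M) by positivity)
    linarith
  unfold samplesPerAgent
  push_cast
  have h8 : 0 ≤ 1 + ∑ m, (1 + (a.b m : ℝ)) := by positivity
  refine (mul_le_mul h3 h7 h8 (by positivity)).trans_eq ?_
  ring

end DSMO

end

theorem theorem2 {M : ℕ} (hM : 1 ≤ M) (d : Fin (M + 1) → ℕ) (c : Constants M)
    (μ : ℝ) (hμ : 0 < μ) (B : ℝ) (hB : 0 < B) :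
    ∃ C₁₀ : ℝ, 0 < C₁₀ ∧ ∀ C₁ : ℝ, C₁₀ ≤ C₁ →
      ∃ A A' A'' : ℝ, 0 < A ∧ 0 < A' ∧ 0 < A'' ∧
      ∀ (K : ℕ) (ρ : ℝ), 0 < ρ → ρ < 1 → ∃ ε₀ : ℝ, 0 < ε₀ ∧ ε₀ < 1 ∧
        ∀ (W : Matrix (Fin K) (Fin K) ℝ) (S : Type*) [MeasurableSpace S]
          (Ω : Type*) [MeasurableSpace Ω] (P : MeasureTheory.Measure Ω)
          [MeasureTheory.IsProbabilityMeasure P]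
          (p : Problem d K) (o : Oracle d K S) (ξ : Query M K → Ω → S)
          (D : (m : Fin (M + 1)) → Set (Vec (d m))) (b : ℕ → Fin M → ℕ),
          o.IsUnbiased p → IsSampling o P ξ → IsGossip W ρ →
          OuterAssumption c p o D → InnerAssumption c p o D → p.PL μ →
          LogSampling c B b → Confined p o W P ξ (fun T => plParams c μ C₁ (b T)) D →
          let xBar : ℕ → Ω → Vec (d 0) := fun T ω =>
            (run (plParams c μ C₁ (b T)) W o (fun q => ξ q ω) T).xBar
          (∀ T : ℕ, 2 ≤ T →
            MeasureTheory.Integrable (fun ω => p.F (xBar T ω)) P ∧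
            ∫ ω, p.F (xBar T ω) ∂P - p.FStar ≤
              A * (1 / (K * T)) + A * (Real.log T / (T ^ 2 * (1 - ρ) ^ 2))) ∧
          (∀ ε : ℝ, 0 < ε → ε ≤ ε₀ →
            (∀ T : ℕ, A' / (K * ε) ≤ T →
              MeasureTheory.Integrable (fun ω => p.F (xBar T ω)) P ∧
              ∫ ω, p.F (xBar T ω) ∂P - p.FStar ≤ ε) ∧
            (∀ T : ℕ, T = ⌈A' / (K * ε)⌉₊ →
              (samplesPerAgent (plParams c μ C₁ (b T)) T : ℝ) ≤
                A'' / (K * ε) * Real.log (1 / ε))) := by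
  refine ⟨threshold d c μ, ?_, fun C₁ hC₁ => ?_⟩
  · have h0 : 1 ≤ c.total := c.total_spec.1
    unfold threshold
    positivity
  obtain ⟨h3, h2, hL⟩ := threshold_spec d c hμ hC₁
  -- The maximum makes positivity of the constant immediate, before any problem instance is given.
  set A := max (rateConst d c μ C₁) 1 with hA_def
  have hA : 0 < A := lt_max_of_lt_right one_pos
  refine ⟨A, 2 * A, 4 * A * (2 * (1 + M) + M * B * (2 * |Real.log (4 * A)| + 1)), hA, by positivity,
    by positivity, fun K ρ hρ0 hρ1 => ?_⟩
  have hr : 0 < 1 - ρ := by linarith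
  -- The bound `1/2` keeps `log(1/ε)` away from zero; the other one makes the network term
  -- negligible. The denominator has `K + 1` because `K > 0` follows only from the gossip matrix,
  -- which is introduced later.
  refine ⟨min (1 / 2) (A * (1 - ρ) ^ 4 / (2 * (K + 1) ^ 3)), by positivity,
    (min_le_left _ _).trans_lt (by norm_num), ?_⟩
  intro W S _ Ω _ P _ p o ξ D b ho hξ hW hout hin hPL hb hD xBar
  have hK : 0 < K := hW.card_pos hρ0
  have hK' : (1 : ℝ) ≤ K := by exact_mod_cast hK
  have hrate : ∀ T : ℕ, 2 ≤ T → MeasureTheory.Integrable (fun ω => p.F (xBar T ω)) P ∧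
      ∫ ω, p.F (xBar T ω) ∂P - p.FStar ≤
        A * (1 / (K * T)) + A * (Real.log T / (T ^ 2 * (1 - ρ) ^ 2)) := by
    intro T hT
    obtain ⟨i1, i2⟩ := integral_F_xBar_le hμ h3 h2 hL hρ0 hρ1 ho hξ hW hout hin hPL hb hD hT
    refine ⟨i1, i2.trans ?_⟩
    have hlog : 0 ≤ Real.log T := Real.log_nonneg (by exact_mod_cast (by omega : 1 ≤ T))
    gcongr
    · exact le_max_left _ _
    · exact le_max_left _ _
  refine ⟨hrate, fun ε hε hε₀ => ?_⟩
  have hε1 : ε ≤ 1 / 2 := hε₀.trans (min_le_left _ _)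
  have hε2 : ε * (2 * (K + 1) ^ 3) ≤ A * (1 - ρ) ^ 4 :=
    (le_div_iff₀ (by positivity)).1 (hε₀.trans (min_le_right _ _))
  -- The rate is available only for `T ≥ 2`; the choice of `ε₀` guarantees this for every admissible
  -- horizon.
  have hT2 : 2 ≤ 2 * A / (K * ε) := by
    rw [le_div_iff₀ (by positivity)]
    have h4 : A * (1 - ρ) ^ 4 ≤ A * 1 :=
      mul_le_mul_of_nonneg_left (pow_le_one₀ hr.le (by linarith)) hA.le
    have h5 : (K : ℝ) ≤ 2 * (K + 1) ^ 3 := by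
      have : (1 : ℝ) ≤ ((K : ℝ) + 1) ^ 2 := one_le_pow₀ (by linarith)
      nlinarith
    have h6 := mul_le_mul_of_nonneg_left h5 hε.le
    linarith
  have hT : ∀ T : ℕ, 2 * A / (K * ε) ≤ T → 2 ≤ T := fun T h => by exact_mod_cast hT2.trans h
  refine ⟨fun T h => ⟨(hrate T (hT T h)).1, (hrate T (hT T h)).2.trans
    (rate_le_of_le hA hK hρ1 hε hε2 (hT T h) h)⟩, fun T h => ?_⟩
  have h4 : 2 ≤ T := hT T (h ▸ Nat.le_ceil _)
  exact samplesPerAgent_le hA hB hK hε hε1 hT2 h fun m => (hb T h4 m).2
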